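/- Let $X$ be a Hausdorff reduced complex space, $0\in X$, and let $f,g$ be holomorphic functions on $X$ with $f(0)=g(0)=0$ such that $\{f\neq 0\}$ is dense in $X$ and is a complex manifold of dimension $3$, $V(g)$ is a smooth surface outside $0$, and at every point of $V(f)\cap V(g)\setminus\{0\}$ there are local coordinates $(h_0,h_1,h_2)$ of $X$ (smooth of dimension $3$ there) with $V(f)=\{h_0=0\}$, $V(g)=\{h_1=0\}$. Let $r\colon Y\to X$ be a modification by a Hausdorff reduced complex space ($r$ is holomorphic and proper, $\{f\circ r\ne 0\}$ is dense in $Y$) which is an isomorphism over a neighbourhood of every point of $X$ outside $(V(f)\setminus V(g))\cup\{0\}$. Let $\mathbb D=r^{-1}(V(fg))$ be the total transform. An irreducible component $D$ of $\mathbb D$ is of kind $\mathbb D_0$ if $r(D)=\{0\}$; otherwise it is of kind $\mathbb D_f$ if $f\circ r=0$ on $D$ and of kind $\mathbb D_g$ if $g\circ r=0$ on $D$. Let $\widetilde{\mathcal C}$ be the union of the intersections $D\cap D'$ with $D$ of kind $\mathbb D_f$ and $D'$ of kind $\mathbb D_0$ or $\mathbb D_g$, and $\mathcal C$ the union of its compact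 irreducible components. Assume that $\mathbb D$ is a simple normal crossings divisor of the $3$-manifold $Y$ at every point of $\widetilde{\mathcal C}$. For a component $D$ of $\mathbb D$ let $m_D,n_D$ be the multiplicities of $f\circ r$, $g\circ r$ along $D$. Let $k>0$ be an even integer such that $kn_D>m_D$ for all $D$ of kind $\mathbb D_0$ and $kn_D/m_{D'}$ is an even integer whenever $D$ of kind $\mathbb D_0$ meets $D'$ of kind $\mathbb D_f$. Let $\widetilde S$ be the closure of $r^{-1}(\{f=|g|^k\}\setminus\{0\})$ in $Y$. *Local complexification.* An adapted chart at a point $p\in\mathcal C$ consists of local holomorphic coordinates $(u,v,w)$ of $Y$ on an open set $U\ni p$, with $u(p)=v(p)=0$, in which $f\circ r=u^{a_1}v^{a_2}w^{a_3}$ and $g\circ r=u^{b_1}w^{b_3}$, $b_1,a_2>0$. The chart is generic if $a_3=b_3=0$; otherwise $w(p)=0$ is required, $p$ is a double point, and the chart is of type $\ominus$ if $b_3=0$ (then $a_1>0$ is required) and of type $\oplus$ if $b_3>0$. In generic charts and charts of type $\oplus$ put $x=u$, $y=v^{-1}|u|^{kb_1/a_2}|w|^{kb_3/a_2}$, $z=w$;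 this identifies $\widetilde S\cap U$, off $\mathbb D$, with a part of the complex surface $y^{a_2}=x^{a_1}z^{a_3}$. In charts of type $\ominus$ put $x=u$, $y=v^{-1}|v|^{e}$, $z=w^{-1}|w|^{e}$, $e=kb_1/(kb_1-a_1)$, with the complex surface $x^{a_1}=y^{a_2}z^{a_3}$. Suppose that $\mathcal C$ is covered by adapted charts, no two of which are centered at the same double point. The local complexification $S^K$ is obtained by gluing the normalizations of these local complex models. As a space over $\widetilde S$, its points over $q$ are the local irreducible components (branches) at $q$. The preimage of $\mathcal C$ in $S^K$ is oriented by the complex structure of the local model in generic charts and charts of type $\oplus$, and by the opposite orientation in charts of type $\ominus$. For $q\in\mathcal C$ not a double point, the branches at $q$ are cyclically ordered: in a generic chart, with $d=\gcd(a_1,a_2)$, the branch in $x^{a_1/d}=e^{2i\pi(j+1)/d}y^{a_2/d}$ follows the branch in $x^{a_1/d}=e^{2i\pi j/d}y^{a_2/d}$. **Theorem.** Let $C\subset D_1\cap D_2$ be a compact irreducible component of $\widetilde{\mathcal C}$, with $D_1$ of kind $\mathbb D_f$ and $D_2$ of kind $\mathbb D_0$ or $\mathbb D_g$, and let $g_C$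 be its genus. Then the components $D_3,\dots,D_{s+t}$ of $\mathbb D$ other than $D_1,D_2$ that meet $C$ are finite in number, and $\mu_i:=\#(D_i\cap C)$ is finite for each $i\geq 3$. Write $m_i=m_{D_i}$. Let $\alpha_1,\dots,\alpha_{2g_C}$ be loops in $C\setminus\bigcup_{i\ge 3}D_i$ with a common base point, whose classes generate $\pi_1(C)$. Let $\delta_j$ be the switch of $\alpha_j$: following the branches along $\alpha_j$ sends each branch at the base point to the one which is $\delta_j$ further in the cyclic order. Put $$n_C=\gcd(m_1,\dots,m_{s+t},\delta_1,\dots,\delta_{2g_C})>0 .$$ Then the preimage $C^K$ of $C$ in $S^K$ is an oriented real analytic surface, the disjoint union of exactly $n_C$ connected components. The set of these components has a cyclic order induced by that of the branches: it can be indexed by $\mathbb Z/n_C\mathbb Z$ so that, over every point $q\in C\setminus\bigcup_{i\ge3}D_i$, if a branch at $q$ lies in the component of index $j$, then the following branch at $q$ lies in the component of index $j+1$. All these components have the same Euler characteristic $\chi$, and $$n_C\cdot\chi=\Bigl(2-2g_C-\sum_{i=3}^{s+t}\mu_i\Bigr)\gcd(m_1,m_2)+\sum_{i=3}^{s+t}\gcd(m_1,m_2,m_i)\,\mu_i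 .$$ -/

import Mathlib

open Set Filter Topology

noncomputable section

namespace MilnorBoundary

/-! ### Reduced complex spaces

A reduced complex space is a topological space together with the relation `hol x F`, read
"the germ at `x` of the complex valued function `F` is holomorphic", which is locally isomorphic to
an analytic subset of an open set of `ℂⁿ` with the restrictions of holomorphic functions. -/

/-- `h` identifies the part in `U` of the subset `A` of a space with structure relation `hol`
(`A` carries the restrictions of the holomorphic germs of the ambient space) with an open set of
`ℂᵈ` and its holomorphic functions: it is a holomorphic chart of `A`. -/
structure IsChartOn {X : Type*} [TopologicalSpace X] (hol : X → (X → ℂ) → Prop)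
    (A U : Set X) {d : ℕ} (h : X → Fin d → ℂ) : Prop where
  isOpen : IsOpen U
  hol_coord : ∀ i, ∀ x ∈ A ∩ U, hol x (fun y => h y i)
  isOpenEmbedding : IsOpenEmbedding ((A ∩ U).domRestrict h)
  factor : ∀ x ∈ A ∩ U, ∀ F : X → ℂ, hol x F →
    ∃ G : (Fin d → ℂ) → ℂ, AnalyticAt ℂ G (h x) ∧ F =ᶠ[𝓝[A] x] G ∘ h

/-- `A` is an analytic subset of the open set `Ω` of `ℂⁿ`. -/
def IsAnalyticSubset {n : ℕ} (Ω A : Set (Fin n → ℂ)) : Prop :=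
  IsOpen Ω ∧ A ⊆ Ω ∧ ∀ z ∈ Ω, ∃ W : Set (Fin n → ℂ), IsOpen W ∧ z ∈ W ∧ W ⊆ Ω ∧
    ∃ (l : ℕ) (F : Fin l → (Fin n → ℂ) → ℂ), (∀ j, AnalyticOnNhd ℂ (F j) W) ∧
      A ∩ W = {x ∈ W | ∀ j, F j x = 0}

/-- A reduced complex space structure on a topological space. -/
structure ComplexSpace (X : Type*) [TopologicalSpace X] where
  hol : X → (X → ℂ) → Prop
  local_model : ∀ x : X, ∃ (n : ℕ) (U : Set X) (φ : X → Fin n → ℂ) (Ω : Set (Fin n → ℂ)),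
    x ∈ U ∧ IsOpen U ∧ IsEmbedding (U.domRestrict φ) ∧ IsAnalyticSubset Ω (φ '' U) ∧
    ∀ y ∈ U, ∀ F : X → ℂ,
      hol y F ↔ ∃ G : (Fin n → ℂ) → ℂ, AnalyticAt ℂ G (φ y) ∧ F =ᶠ[𝓝 y] G ∘ φ

/-- The subset `A` is a complex manifold of dimension `d` near `x`. -/
def IsSmoothAt {X : Type*} [TopologicalSpace X] (hol : X → (X → ℂ) → Prop)
    (A : Set X) (d : ℕ) (x : X) : Prop :=
  ∃ (U : Set X) (h : X → Fin d → ℂ), x ∈ U ∧ IsChartOn hol A U h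

/-- The regular points of `A`. -/
def regularLocus {X : Type*} [TopologicalSpace X] (hol : X → (X → ℂ) → Prop)
    (A : Set X) : Set X :=
  {x ∈ A | ∃ d, IsSmoothAt hol A d x}

/-- The irreducible components of an analytic subset `A`: the closures of the connected components
of its regular locus. -/
def irreducibleComponentsOf {X : Type*} [TopologicalSpace X] (hol : X → (X → ℂ) → Prop)
    (A : Set X) : Set (Set X) :=
  {D | ∃ x ∈ regularLocus hol A, D = closure (connectedComponentIn (regularLocus hol A) x)}

/-! ### The germ, the two functions and the modification -/

/-- (A representative of) a germ `(X, o)` of complex variety of dimension `3`, a function `f` not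
vanishing on any irreducible component whose zero locus contains the singular locus of `X`, and a
second function `g`, a companion of `f`: `V(g)` is a smooth surface outside `o`, and outside `o`
the sets `V(f)` and `V(g)` are smooth surfaces intersecting transversally at their common points. -/
structure SmoothingGerm (X : Type*) [TopologicalSpace X] where
  space : ComplexSpace X
  o : X
  f : X → ℂ
  g : X → ℂ
  f_hol : ∀ x, space.hol x f
  g_hol : ∀ x, space.hol x g
  f_o : f o = 0
  g_o : g o = 0
  dense_f_ne_zero : Dense {x | f x ≠ 0}
  smooth_of_f_ne_zero : ∀ x, f x ≠ 0 → IsSmoothAt space.hol univ 3 x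
  smooth_zeroLocus_g : ∀ x, x ≠ o → g x = 0 → IsSmoothAt space.hol {y | g y = 0} 2 x
  transverse : ∀ x, x ≠ o → f x = 0 → g x = 0 →
    ∃ (U : Set X) (h : X → Fin 3 → ℂ), x ∈ U ∧ IsChartOn space.hol univ U h ∧
      {y ∈ U | f y = 0} = {y ∈ U | h y 0 = 0} ∧ {y ∈ U | g y = 0} = {y ∈ U | h y 1 = 0}

/-- A modification `r : Y → X` (proper, holomorphic, bimeromorphic) which is an isomorphism over a
neighbourhood of every point outside `(V(f) \ V(g)) ∪ {o}`. As `f` is not zero on a dense subset of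
`X` and `f ∘ r` on a dense subset of `Y`, it is bimeromorphic. -/
structure Modification {X : Type*} [TopologicalSpace X] (P : SmoothingGerm X)
    (Y : Type*) [TopologicalSpace Y] where
  space : ComplexSpace Y
  r : Y → X
  isProperMap : IsProperMap r
  hol_comp : ∀ (y : Y) (F : X → ℂ), P.space.hol (r y) F → space.hol y (F ∘ r)
  dense_f_ne_zero : Dense {y | P.f (r y) ≠ 0}
  iso_over : ∀ x, x ∉ ({x | P.f x = 0} \ {x | P.g x = 0}) ∪ {P.o} →
    ∃ W : Set X, IsOpen W ∧ x ∈ W ∧ BijOn r (r ⁻¹' W) W ∧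
      ∀ y ∈ r ⁻¹' W, ∀ F : Y → ℂ, space.hol y F →
        ∃ G : X → ℂ, P.space.hol (r y) G ∧ F =ᶠ[𝓝 y] G ∘ r

namespace Modification

variable {X : Type*} [TopologicalSpace X] {P : SmoothingGerm X} {Y : Type*} [TopologicalSpace Y]
  (M : Modification P Y)

/-- The pullback of `f`. -/
def pullF (y : Y) : ℂ := P.f (M.r y)

/-- The pullback of `g`. -/
def pullG (y : Y) : ℂ := P.g (M.r y)

/-- The total transform of `V(f g)`. -/
def divisor : Set Y := {y | M.pullF y * M.pullG y = 0}

/-- The irreducible components of the total transform. -/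
def components : Set (Set Y) := irreducibleComponentsOf M.space.hol M.divisor

/-- The components sent to the origin. -/
def compO : Set (Set Y) := {D ∈ M.components | M.r '' D ⊆ {P.o}}

/-- The other components over `V(f)`: those of the strict transform of `V(f)` and those sent
onto curves in `V(f)`. -/
def compF : Set (Set Y) :=
  {D ∈ M.components | ¬ M.r '' D ⊆ {P.o} ∧ ∀ y ∈ D, M.pullF y = 0}

/-- The other components over `V(g)`: those of the strict transform of `V(g)`. -/
def compG : Set (Set Y) :=
  {D ∈ M.components | ¬ M.r '' D ⊆ {P.o} ∧ ∀ y ∈ D, M.pullG y = 0}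

/-- The total transform is a simple normal crossings divisor at `y`. -/
def IsSNCAt (y : Y) : Prop :=
  ∃ (U : Set Y) (h : Y → Fin 3 → ℂ), y ∈ U ∧ IsChartOn M.space.hol univ U h ∧ h y = 0 ∧
    ∃ J : Set (Fin 3), M.divisor ∩ U = {x ∈ U | ∃ i ∈ J, h x i = 0} ∧
      ∀ i ∈ J, ∃ D ∈ M.components, D ∩ U = {x ∈ U | h x i = 0}

/-- The full curve configuration, non compact curves included. -/
def fullConfiguration : Set Y :=
  ⋃ D ∈ M.compF, ⋃ D' ∈ M.compO ∪ M.compG, D ∩ D'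

/-- `C` is a compact irreducible component of the full curve configuration, contained in `D ∩ D'`.
(For an adapted modification `D ∩ D'` is a smooth curve: its irreducible components are its
connected components.) -/
def IsCompactCurve (D D' C : Set Y) : Prop :=
  D ∈ M.compF ∧ D' ∈ M.compO ∪ M.compG ∧ IsCompact C ∧
    ∃ p ∈ D ∩ D', C = connectedComponentIn (D ∩ D') p

/-- The curve configuration: the union of the compact components of the full one. -/
def configuration : Set Y := {y | ∃ D D' C, M.IsCompactCurve D D' C ∧ y ∈ C}

/-- `F` vanishes to the order `m` along the component `D`: at every point of `D` where the ambient
space and the total transform are smooth, it is a unit times the `m`-th power of a local equation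
of the total transform. -/
def IsMultiplicity (F : Y → ℂ) (D : Set Y) (m : ℕ) : Prop :=
  ∀ p ∈ D, ∀ (U : Set Y) (h : Y → Fin 3 → ℂ), p ∈ U → IsChartOn M.space.hol univ U h →
    M.divisor ∩ U = {y ∈ U | h y 0 = 0} →
      ∃ I : Y → ℂ, M.space.hol p I ∧ I p ≠ 0 ∧ ∀ᶠ y in 𝓝 p, F y = I y * h y 0 ^ m

/-- The strict transform of `{f = |g|^k}`. -/
def strictTransform (k : ℕ) : Set Y :=
  closure (M.r ⁻¹' ({x | P.f x = ((‖P.g x‖ ^ k : ℝ) : ℂ)} \ {P.o}))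

/-- The part of the strict transform off the total transform. -/
def openPart (k : ℕ) : Set Y := M.strictTransform k \ M.divisor

/-- The components of the total transform, other than the two given ones, which meet the
curve `C`; their points on `C` are the double points of the configuration on `C`. -/
def thirdComponents (D D' C : Set Y) : Set (Set Y) :=
  {D'' ∈ M.components | D'' ≠ D ∧ D'' ≠ D' ∧ (D'' ∩ C).Nonempty}

end Modification

/-- A modification adapted to `(f, g)`: the total transform is a simple normal crossings divisor
at every point of the full curve configuration. -/
structure AdaptedModification {X : Type*} [TopologicalSpace X] (P : SmoothingGerm X)
    (Y : Type*) [TopologicalSpace Y] extends Modification P Y where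
  isSNCAt : ∀ y ∈ toModification.fullConfiguration, toModification.IsSNCAt y

/-- The conditions on the exponent `k`, in terms of the multiplicities `m` of `f` and `n` of `g`:
`k > 0` is even, `k n_D > m_D` for the components `D` over the origin, and `k n_D / m_D'` is an even
integer whenever such a `D` meets a component `D'` of the other kind over `V(f)`. -/
structure IsAdmissibleExponent {X : Type*} [TopologicalSpace X] {P : SmoothingGerm X}
    {Y : Type*} [TopologicalSpace Y] (M : Modification P Y) (m n : Set Y → ℕ) (k : ℕ) : Prop where
  pos : 0 < k
  even : Even k
  lt : ∀ D ∈ M.compO, m D < k * n D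
  dvd : ∀ D ∈ M.compO, ∀ D' ∈ M.compF, (D ∩ D').Nonempty → 2 * m D' ∣ k * n D

/-! ### Normalization, as a space

The points of the normalization over `q` are the local irreducible components at `q`, that is the
coherent choices, for all neighbourhoods `N` of `q`, of a connected component of the part in `N` of
the (dense, open) locus `S` which is not modified. -/

/-- A point together with a local branch of `S` at this point. -/
structure BranchPoint {Y : Type*} [TopologicalSpace Y] (S : Set Y) where
  pt : Y
  branch : TopologicalSpace.OpenNhdsOf pt → Set Y
  isComponent : ∀ N : TopologicalSpace.OpenNhdsOf pt,
    ∃ y ∈ (N : Set Y) ∩ S, branch N = connectedComponentIn ((N : Set Y) ∩ S) y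
  mono : ∀ N N' : TopologicalSpace.OpenNhdsOf pt, (N : Set Y) ⊆ N' → branch N ⊆ branch N'

/-- A basic open set consists of the branches, at the points of an open set `U`, contained in
a given connected component `W` of `U ∩ S`. -/
instance {Y : Type*} [TopologicalSpace Y] (S : Set Y) : TopologicalSpace (BranchPoint S) :=
  TopologicalSpace.generateFrom
    {A | ∃ U W : Set Y,
      A = {s | ∃ N : TopologicalSpace.OpenNhdsOf s.pt, (N : Set Y) = U ∧ s.branch N = W}}

/-! ### Local complex models -/

section Charts

variable {X : Type*} [TopologicalSpace X] {P : SmoothingGerm X} {Y : Type*} [TopologicalSpace Y]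

/-- Local holomorphic coordinates `(u, v, w)` at a point of the curve configuration in which
`f = u^m₁ v^m₂ w^m₃` and `g = u^n₁ w^n₃`, with `n₁, m₂ > 0`. The total transform is locally `u v = 0`
if `m₃ = n₃ = 0` (generic points), and `u v w = 0` otherwise (double points, at which `w = 0`). If
`n₃ = 0 ≠ m₃` (double points of type `⊖`) then the component `u = 0` lies over the origin. -/
structure AdaptedChart (M : Modification P Y) where
  center : Y
  U : Set Y
  coord : Y → Fin 3 → ℂ
  isChartOn : IsChartOn M.space.hol univ U coord
  center_mem : center ∈ U
  center_mem_configuration : center ∈ M.configuration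
  m₁ : ℕ
  m₂ : ℕ
  m₃ : ℕ
  n₁ : ℕ
  n₃ : ℕ
  n₁_pos : 0 < n₁
  m₂_pos : 0 < m₂
  pullF_eq : ∀ y ∈ U, M.pullF y = coord y 0 ^ m₁ * coord y 1 ^ m₂ * coord y 2 ^ m₃
  pullG_eq : ∀ y ∈ U, M.pullG y = coord y 0 ^ n₁ * coord y 2 ^ n₃
  coord_zero : coord center 0 = 0
  coord_one : coord center 1 = 0
  coord_two : (m₃ ≠ 0 ∨ n₃ ≠ 0) → coord center 2 = 0
  minus_origin : n₃ = 0 → m₃ ≠ 0 → 0 < m₁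

namespace AdaptedChart

variable {M : Modification P Y} (c : AdaptedChart M)

/-- The chart is centered at a double point. -/
def IsDouble : Prop := c.m₃ ≠ 0 ∨ c.n₃ ≠ 0

/-- The chart is centered at a double point of type `⊖`. -/
def IsMinus : Prop := c.n₃ = 0 ∧ c.m₃ ≠ 0

open Classical in
/-- The coordinates `(x, y, z)` of the local complex model, as functions on the strict transform of
`{f = |g|^k}`. At generic points and double points of type `⊕`,
`x = u`, `y = v⁻¹ |u|^(k n₁ / m₂) |w|^(k n₃ / m₂)`, `z = w`, and the model is the complex surface
`y^m₂ = x^m₁ z^m₃`. At double points of type `⊖`, `x = u`, `y = v⁻¹ |v|^(k n₁ / (k n₁ - m₁))`,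
`z = w⁻¹ |w|^(k n₁ / (k n₁ - m₁))`, and the model is the complex surface `x^m₁ = y^m₂ z^m₃`. -/
def model (k : ℕ) (y : Y) : Fin 3 → ℂ :=
  if c.IsMinus then
    ![c.coord y 0,
      (c.coord y 1)⁻¹ * ((‖c.coord y 1‖ ^ ((k * c.n₁ : ℝ) / (k * c.n₁ - c.m₁)) : ℝ) : ℂ),
      (c.coord y 2)⁻¹ * ((‖c.coord y 2‖ ^ ((k * c.n₁ : ℝ) / (k * c.n₁ - c.m₁)) : ℝ) : ℂ)]
  else
    ![c.coord y 0,
      (c.coord y 1)⁻¹ * ((‖c.coord y 0‖ ^ ((k * c.n₁ : ℝ) / c.m₂) *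
        ‖c.coord y 2‖ ^ ((k * c.n₃ : ℝ) / c.m₂) : ℝ) : ℂ),
      c.coord y 2]

/-- The holomorphic functions of the normalization of the local complex model, transported to the
normalization of the strict transform: the continuous functions which, off the total transform,
are locally holomorphic functions of the coordinates of the model. -/
def modelHol (k : ℕ) (s : BranchPoint (M.openPart k)) (F : BranchPoint (M.openPart k) → ℂ) : Prop :=
  ∃ V : Set (BranchPoint (M.openPart k)), IsOpen V ∧ s ∈ V ∧ (∀ t ∈ V, t.pt ∈ c.U) ∧
    ContinuousOn F V ∧ ∀ t ∈ V, t.pt ∈ M.openPart k →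
      ∃ G : (Fin 3 → ℂ) → ℂ, AnalyticAt ℂ G (c.model k t.pt) ∧
        F =ᶠ[𝓝 t] fun t' => G (c.model k t'.pt)

/-- In a chart at a generic point, the branch `s` lies in the component
`x^(m₁/d) = exp(2iπj/d) y^(m₂/d)`, `d = gcd(m₁, m₂)`, of the local complex model. -/
def HasIndex (k : ℕ) (s : BranchPoint (M.openPart k)) (j : ℤ) : Prop :=
  ∃ N : TopologicalSpace.OpenNhdsOf s.pt, ∀ y ∈ s.branch N, y ∈ c.U ∧
    c.model k y 0 ^ (c.m₁ / c.m₁.gcd c.m₂) =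
      Complex.exp (2 * Real.pi * Complex.I * j / (c.m₁.gcd c.m₂ : ℕ)) *
        c.model k y 1 ^ (c.m₂ / c.m₁.gcd c.m₂)

end AdaptedChart

/-- A covering of the curve configuration by adapted charts, with no more than one chart centered
at each double point. -/
structure AdaptedCover (M : Modification P Y) (ι : Type*) where
  chart : ι → AdaptedChart M
  covers : ∀ y ∈ M.configuration, ∃ i, y ∈ (chart i).U
  double_injective : ∀ i j, (chart i).IsDouble → (chart j).IsDouble →
    (chart i).center = (chart j).center → i = j

namespace Modification

variable (M : Modification P Y)

/-- The preimage of a curve in the local complexification. The latter, as a space, is the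
normalization of the strict transform of `{f = |g|^k}`; its local complex structures are those
given by `AdaptedChart.modelHol`. -/
def curvePreimage (k : ℕ) (C : Set Y) : Set (BranchPoint (M.openPart k)) := {s | s.pt ∈ C}

/-- The oriented charts of the preimage of a curve: the holomorphic charts given by the local
complex models, composed with the complex conjugation at the double points of type `⊖` (where the
orientation is the opposite of the one given by the local complex structure). -/
def orientedCharts {ι : Type*} (k : ℕ) (𝒰 : AdaptedCover M ι) (C : Set Y) :
    Set (Set (BranchPoint (M.openPart k)) × (BranchPoint (M.openPart k) → ℂ)) :=
  {c | ∃ (i : ι) (φ : BranchPoint (M.openPart k) → ℂ),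
    IsChartOn ((𝒰.chart i).modelHol k) (M.curvePreimage k C) c.1 (fun s (_ : Fin 1) => φ s) ∧
    ((¬ (𝒰.chart i).IsMinus ∧ c.2 = φ) ∨
      ((𝒰.chart i).IsMinus ∧ c.2 = fun s => (starRingEnd ℂ) (φ s)))}

/-- At a generic point of the configuration, `t` is the branch which comes `a` further than `s` in
the cyclic order of the branches at this point: it has index `j + a` if `s` has index `j`. -/
def Shift (k : ℕ) (a : ℤ) (s t : BranchPoint (M.openPart k)) : Prop :=
  s.pt = t.pt ∧ ∃ (c : AdaptedChart M) (j : ℤ), ¬ c.IsDouble ∧ s.pt ∈ c.U ∧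
    c.HasIndex k s j ∧ c.HasIndex k t (j + a)

/-- `a` is a switch of the loop `γ` (a loop of generic points of `C`): following a branch
along `γ` leads to the branch which comes `a` further in the cyclic order. -/
def IsSwitch (k : ℕ) {C : Set Y} {p : C} (γ : Path p p) (a : ℤ) : Prop :=
  ∀ s : BranchPoint (M.openPart k), s.pt = p →
    ∃ Γ : C(unitInterval, BranchPoint (M.openPart k)),
      Γ 0 = s ∧ (∀ t, (Γ t).pt = γ t) ∧ M.Shift k a s (Γ 1)

end Modification

end Charts

/-! ### Surfaces -/

/-- With the given charts, the subspace `A` is an oriented real analytic surface (a manifold of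
real dimension `2`). -/
structure IsOrientedAnalyticSurface {S : Type*} [TopologicalSpace S] (A : Set S)
    (charts : Set (Set S × (S → ℂ))) : Prop where
  t2Space : T2Space A
  secondCountable : SecondCountableTopology A
  covers : ∀ s ∈ A, ∃ c ∈ charts, s ∈ c.1
  isOpen : ∀ c ∈ charts, IsOpen c.1
  isOpenEmbedding : ∀ c ∈ charts, IsOpenEmbedding ((A ∩ c.1).domRestrict c.2)
  compatible : ∀ c ∈ charts, ∀ c' ∈ charts, ∀ s ∈ A ∩ (c.1 ∩ c'.1),
    ∃ T : ℂ → ℂ, AnalyticAt ℝ T (c.2 s) ∧ 0 < (fderiv ℝ T (c.2 s)).det ∧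
      c'.2 =ᶠ[𝓝[A] s] T ∘ c.2

/-- The Euler characteristic of the compact surface `S` is `χ`: it has a finite cell decomposition
with `χ = #vertices - #edges + #faces`. -/
def HasEulerCharacteristic (S : Type*) [TopologicalSpace S] (χ : ℤ) : Prop :=
  ∃ K : CWComplex (univ : Set S), (∀ n, Finite (K.cell n)) ∧ (∀ n, 3 ≤ n → IsEmpty (K.cell n)) ∧
    χ = Nat.card (K.cell 0) - Nat.card (K.cell 1) + Nat.card (K.cell 2)

end MilnorBoundary

end

/-! Near a point of `C`, write the three coordinates of an adapted chart, permuted so that `C` is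
the locus where the first two vanish, as `exp z₁`, `exp z₂` and `ω t`, where `ω` is `exp` or the
identity. If `f` is the monomial with exponents `a₁, a₂, a₃`, the equation `f = |g|^k` off the total
transform says two things: a real linear relation holds between `Re z₁`, `Re z₂`, `Re t`, and `a₁ Im
z₁ + a₂ Im z₂ + a₃ Im t` is `2πj` for some integer `j`. For fixed `j` the solutions form a convex
set, so its image is connected, and the branches are exactly these images. Two integers give the
same branch when they differ by a change of the logarithms, that is by a multiple of `gcd(a₁, a₂)`
at a generic point, and of `gcd(a₁, a₂, a₃)` at a double point, where the third coordinate may wind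
around `0` too (`LogForm.isGoodNhd`). The index `j` is read off from the argument of a root of `f`,
which lets labels at neighbouring points be compared (`IsRootAt.compare`).

The preimage of `C` is therefore a ramified cyclic cover (`BranchSystem.isCyclicCover`): passing to
the following branch is a homeomorphism `T` whose orbits are the fibers, and the fiber over `q` has
`d q` points, with `d q = gcd(m₁, m₂)` or `gcd(m₁, m₂, m_i)`. The powers of `T` preserving a
component form a subgroup of `ℤ` which is the same for all components. It contains every `d q` and
every switch `δ_i`, hence also `n_C`. Conversely the quotient of the cover by `T ^ n_C` is an
unramified covering of `C`, on which the generators of `π₁(C)` act trivially; a path from `s` to `T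
^ a s` then forces `n_C ∣ a` (`IsCyclicCover.mk_zpow_eq_iff`). So there are `n_C` components,
permuted cyclically by `T`, and each of them is a ramified cover of `C` of degree `gcd(m₁, m₂) /
n_C`. The Riemann–Hurwitz formula gives the Euler characteristic; it is proved by making the
ramification points vertices of a cell decomposition and lifting the cells
(`HasEulerCharacteristic.of_ramified`).

For the analytic structure, a holomorphic function on a local model is restricted to discs of the
branch parallel to the curve; its values on the curve are a locally uniform limit of these
restrictions, hence holomorphic (`MonomialForm.OnSheet.factor`). At a generic point the third model
coordinate is a chart. At a double point a monomial in the model coordinates, found by a Bézout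
relation, is a root of the third one and a chart, by removal of the singularity at the center
(`MonomialForm.exists_chart_double`). At points of type `⊖` the model replaces `w` by `w⁻¹ |w|^e`,
which reverses the orientation. After conjugation it differs from `w` by a map `r exp(iθ) ↦ r^α
exp(iθ)`, real analytic with positive Jacobian off `0`. Transitions between different adapted charts
never occur at a double point, because no two charts are centered at the same one
(`isOrientedAnalyticSurface`).

The link with the multiplicities is `exists_isLocalForm`: simple normal crossings identify the
coordinate hyperplanes through a point of `C` with distinct components of the total transform, and
the exponents with their multiplicities. -/

namespace MilnorBoundary

open Metric

/-! ### Finite cell decompositions -/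

/-- A family of cells partitioning `X`, in the sense of CW complexes. -/
structure Cells.{u} (X : Type u) [TopologicalSpace X] where
  cell : ℕ → Type u
  map : ∀ n, cell n → (Fin n → ℝ) → X
  cont : ∀ n i, ContinuousOn (map n i) (closedBall 0 1)
  inj : ∀ {n m : ℕ} {i : cell n} {j : cell m} {x : Fin n → ℝ} {y : Fin m → ℝ},
    x ∈ ball 0 1 → y ∈ ball 0 1 → map n i x = map m j y →
      (⟨n, i, x⟩ : Σ n, cell n × (Fin n → ℝ)) = ⟨m, j, y⟩
  bd : ∀ n i, ∀ x ∈ sphere 0 1, ∃ m < n, ∃ j, ∃ y ∈ ball 0 1, map n i x = map m j y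
  cover : ∀ p, ∃ n i, ∃ x ∈ ball 0 1, map n i x = p

namespace Cells

variable {X : Type*} [TopologicalSpace X]

lemma injOn (K : Cells X) (n : ℕ) (i : K.cell n) : InjOn (K.map n i) (ball 0 1) := by
  intro x hx y hy h
  have := K.inj hx hy h
  simpa using this

/-- A closed part of the closed ball has compact, hence closed, image. Such an image meets the open
cell only in images of interior points, because the boundary of the ball goes to cells of smaller
dimension. -/
lemma continuousOn_symm [T2Space X] (K : Cells X) (n : ℕ) (i : K.cell n) :
    ContinuousOn ((K.injOn n i).toPartialEquiv).symm (K.map n i '' ball 0 1) := by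
  rw [continuousOn_iff_isClosed]
  intro t ht
  refine ⟨K.map n i '' (t ∩ closedBall 0 1), ?_, ?_⟩
  · refine IsCompact.isClosed (((isCompact_closedBall _ _).inter_left ht).image_of_continuousOn
      ((K.cont n i).mono inter_subset_right))
  · ext p
    constructor
    · rintro ⟨hp, y, hy, rfl⟩
      have h1 : ((K.injOn n i).toPartialEquiv).symm (K.map n i y) = y :=
        ((K.injOn n i).toPartialEquiv).left_inv hy
      rw [mem_preimage, h1] at hp
      exact ⟨⟨y, ⟨hp, ball_subset_closedBall hy⟩, rfl⟩, y, hy, rfl⟩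
    · rintro ⟨⟨x, ⟨hxt, hx⟩, hxy⟩, y, hy, rfl⟩
      have hxb : x ∈ ball (0 : Fin n → ℝ) 1 := by
        by_contra hxb
        have hs : x ∈ sphere (0 : Fin n → ℝ) 1 :=
          mem_sphere.2 (le_antisymm hx (not_lt.1 hxb))
        obtain ⟨m, hm, j, z, hz, h⟩ := K.bd n i x hs
        have := K.inj hy hz (hxy.symm.trans h)
        have := congrArg Sigma.fst this
        simp at this
        omega
      obtain rfl := K.injOn n i hxb hy hxy
      have h1 : ((K.injOn n i).toPartialEquiv).symm (K.map n i x) = x :=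
        ((K.injOn n i).toPartialEquiv).left_inv hxb
      exact ⟨by rw [mem_preimage, h1]; exact hxt, x, hxb, rfl⟩

/-- The CW complex with the given cells. -/
@[reducible]
noncomputable def toCWComplex [T2Space X] (K : Cells X) (hfin : ∀ n, Finite (K.cell n))
    (hemp : ∀ n, 3 ≤ n → IsEmpty (K.cell n)) : CWComplex (univ : Set X) :=
  CWComplex.mkFinite univ K.cell (fun n i => (K.injOn n i).toPartialEquiv)
    (by filter_upwards [eventually_ge_atTop 3] with n hn using hemp n hn)
    hfin (fun n i => rfl) (fun n i => K.cont n i) (fun n i => K.continuousOn_symm n i)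
    (by
      rintro ⟨n, i⟩ - ⟨m, j⟩ - hne
      rw [Function.onFun, Set.disjoint_left]
      rintro _ ⟨x, hx, rfl⟩ ⟨y, hy, hxy⟩
      have := K.inj hy hx hxy
      apply hne
      simp only [Sigma.mk.injEq] at this ⊢
      obtain ⟨rfl, h⟩ := this
      simp at h
      simp [h.1])
    (by
      intro n i x hx
      obtain ⟨m, hm, j, y, hy, h⟩ := K.bd n i x hx
      simp only [mem_iUnion]
      exact ⟨m, hm, j, y, ball_subset_closedBall hy, h.symm⟩)
    (by
      refine eq_univ_of_forall fun p => ?_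
      obtain ⟨n, i, x, hx, h⟩ := K.cover p
      simp only [mem_iUnion]
      exact ⟨n, i, x, ball_subset_closedBall hx, h⟩)

lemma hasEulerCharacteristic [T2Space X] (K : Cells X) (hfin : ∀ n, Finite (K.cell n))
    (hemp : ∀ n, 3 ≤ n → IsEmpty (K.cell n)) :
    HasEulerCharacteristic X
      (Nat.card (K.cell 0) - Nat.card (K.cell 1) + Nat.card (K.cell 2)) :=
  ⟨K.toCWComplex hfin hemp, hfin, hemp, rfl⟩

end Cells

/-! ### Lifting cells -/

section Lift

variable {C F : Type*} [TopologicalSpace C] [TopologicalSpace F] [T2Space F] [CompactSpace F]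
  [T2Space C] {ρ : F → C} {s : Set C}

/-- The boundary of a cell may pass through ramification points, where covering theory says nothing.
Closedness of `ρ` confines the lift near `x` to disjoint neighbourhoods of the finitely many points
of the fiber. The trace on the ball of a small ball around `x` is convex, so the lift stays in only
one of them and converges to its point. -/
lemma exists_tendsto_lift (hρ : Continuous ρ) (hfin : ∀ q, (ρ ⁻¹' {q}).Finite)
    {W : Type*} [NormedAddCommGroup W] [NormedSpace ℝ W] {φ : W → C} {ψ : W → F}
    (hφ : ContinuousOn φ (closedBall 0 1)) (hψ : ContinuousOn ψ (ball 0 1))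
    (h : ∀ x ∈ ball (0 : W) 1, ρ (ψ x) = φ x) {x : W} (hx : x ∈ closedBall (0 : W) 1) :
    ∃ y, Tendsto ψ (𝓝[ball 0 1] x) (𝓝 y) := by
  have hcl : IsClosedMap ρ := hρ.isClosedMap
  have hcomap := isClosedMap_iff_comap_nhds_le.mp hcl (y := φ x)
  obtain ⟨V, hV, disj⟩ := (hfin (φ x)).t2_separation
  have hφx : Tendsto φ (𝓝[ball 0 1] x) (𝓝 (φ x)) :=
    (hφ x hx).mono_left (nhdsWithin_mono _ ball_subset_closedBall)
  have hne : (𝓝[ball (0 : W) 1] x).NeBot := by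
    rw [← mem_closure_iff_nhdsWithin_neBot, closure_ball _ one_ne_zero]; exact hx
  -- the lift stays in a neighbourhood of the fiber
  have key : ∀ U : Set F, IsOpen U → ρ ⁻¹' {φ x} ⊆ U → ∀ᶠ z in 𝓝[ball 0 1] x, ψ z ∈ U := by
    intro U hU hsub
    have : U ∈ 𝓝ˢ (ρ ⁻¹' {φ x}) := hU.mem_nhdsSet.2 hsub
    obtain ⟨N, hN, hNU⟩ := hcomap this
    filter_upwards [hφx hN, self_mem_nhdsWithin] with z hz hzb
    exact hNU (by rw [mem_preimage, h z hzb]; exact hz)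
  have hUV : ρ ⁻¹' {φ x} ⊆ ⋃ e ∈ ρ ⁻¹' {φ x}, V e := fun e he =>
    mem_iUnion₂.2 ⟨e, he, (hV e).1⟩
  have h1 := key _ (isOpen_biUnion fun e _ => (hV e).2) hUV
  obtain ⟨δ, hδ, hball⟩ := Metric.mem_nhdsWithin_iff.1 h1
  have hconv : IsPreconnected (ball x δ ∩ ball (0 : W) 1) :=
    ((convex_ball x δ).inter (convex_ball 0 1)).isPreconnected
  have hmem : ball x δ ∩ ball (0 : W) 1 ∈ 𝓝[ball 0 1] x :=
    inter_mem (mem_nhdsWithin_of_mem_nhds (ball_mem_nhds x hδ)) self_mem_nhdsWithin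
  obtain ⟨z0, hz0⟩ := hne.nonempty_of_mem hmem
  obtain ⟨e, he, hze⟩ := mem_iUnion₂.1 (hball hz0)
  refine ⟨e, ?_⟩
  have hother : IsOpen (⋃ e' ∈ (ρ ⁻¹' {φ x}) \ {e}, V e') := isOpen_biUnion fun e' _ => (hV e').2
  have himg : IsPreconnected (ψ '' (ball x δ ∩ ball (0 : W) 1)) :=
    hconv.image _ (hψ.mono inter_subset_right)
  have hsubV : ψ '' (ball x δ ∩ ball (0 : W) 1) ⊆ V e := by
    refine himg.subset_left_of_subset_union (hV e).2 hother ?_ ?_ ⟨_, ⟨z0, hz0, rfl⟩, hze⟩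
    · rw [Set.disjoint_iUnion₂_right]
      intro e' he'
      exact disj he he'.1 (fun h => he'.2 h.symm)
    · rintro _ ⟨z, hz, rfl⟩
      obtain ⟨e', he', hz'⟩ := mem_iUnion₂.1 (hball hz)
      by_cases hee : e' = e
      · left; rwa [← hee]
      · right; exact mem_iUnion₂.2 ⟨e', ⟨he', hee⟩, hz'⟩
  refine tendsto_nhds.2 fun U hU heU => ?_
  -- Only the neighbourhood of `e` is shrunk: the union still contains the whole fiber, and the
  -- lift, being in `V e`, must enter `U`.
  have h2 := key (U ∩ V e ∪ ⋃ e' ∈ (ρ ⁻¹' {φ x}) \ {e}, V e')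
    ((hU.inter (hV e).2).union hother) (by
      intro e' he'
      by_cases hee : e' = e
      · left; rw [hee]; exact ⟨heU, (hV e).1⟩
      · right; exact mem_iUnion₂.2 ⟨e', ⟨he', hee⟩, (hV e').1⟩)
  filter_upwards [h2, hmem] with z hz hzm
  rcases hz with hz | hz
  · exact hz.1
  · obtain ⟨e', he', hz'⟩ := mem_iUnion₂.1 hz
    exact ((disj he he'.1 (fun h => he'.2 h.symm)).le_bot
      ⟨hsubV ⟨z, hzm, rfl⟩, hz'⟩).elim

section
variable {W : Type*} [NormedAddCommGroup W] [NormedSpace ℝ W]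

instance : SimplyConnectedSpace (ball (0 : W) 1) := by
  have := (convex_ball (0 : W) 1).contractibleSpace ⟨0, by simp⟩
  infer_instance

instance : LocallyPathConnectedSpace (ball (0 : W) 1) :=
  isOpen_ball.locallyPathConnectedSpace

/-- The open ball is simply connected, so the lift exists there by the covering property. It is
extended to the sphere by its limits. -/
lemma exists_lift_closedBall (hρ : Continuous ρ) (hfin : ∀ q, (ρ ⁻¹' {q}).Finite)
    (cov : IsCoveringMapOn ρ s) {φ : W → C}
    (hφ : ContinuousOn φ (closedBall 0 1)) (hs : ∀ x ∈ ball (0 : W) 1, φ x ∈ s)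
    {x₀ : W} (hx₀ : x₀ ∈ ball (0 : W) 1) {y₀ : F} (hy₀ : ρ y₀ = φ x₀) :
    ∃ ψ : W → F, ContinuousOn ψ (closedBall 0 1) ∧ (∀ x ∈ closedBall (0 : W) 1, ρ (ψ x) = φ x) ∧
      ψ x₀ = y₀ := by
  let f : C(ball (0 : W) 1, C) :=
    ⟨fun x => φ x, (hφ.mono ball_subset_closedBall).domRestrict⟩
  obtain ⟨G, ⟨hG0, hG⟩, -⟩ := cov.existsUnique_continuousMap_lifts f (a₀ := ⟨x₀, hx₀⟩) hy₀
    (fun a => hs a a.2)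
  classical
  let ψ₀ : W → F := fun x => if hx : x ∈ ball (0 : W) 1 then G ⟨x, hx⟩ else y₀
  have hψG : (ball (0 : W) 1).domRestrict ψ₀ = G := by
    ext x; exact dif_pos x.2
  have hψ₀ : ContinuousOn ψ₀ (ball 0 1) := by
    rw [continuousOn_iff_continuous_domRestrict, hψG]; exact G.continuous
  have hρψ : ∀ x ∈ ball (0 : W) 1, ρ (ψ₀ x) = φ x := by
    intro x hx
    have := congrFun hG ⟨x, hx⟩
    simp only [ψ₀, dif_pos hx]; exact this
  have hlim : ∀ x ∈ closedBall (0 : W) 1, ∃ y, Tendsto ψ₀ (𝓝[ball 0 1] x) (𝓝 y) :=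
    fun x hx => exists_tendsto_lift hρ hfin hφ hψ₀ hρψ hx
  have hcl : closedBall (0 : W) 1 ⊆ closure (ball 0 1) := by rw [closure_ball _ one_ne_zero]
  have hext : ∀ x ∈ ball (0 : W) 1, extendFrom (ball 0 1) ψ₀ x = ψ₀ x := fun x hx =>
    extendFrom_eq (subset_closure hx) (hψ₀ x hx)
  refine ⟨extendFrom (ball 0 1) ψ₀, continuousOn_extendFrom hcl hlim, fun x hx => ?_, ?_⟩
  · have hne : (𝓝[ball (0 : W) 1] x).NeBot := by
      rw [← mem_closure_iff_nhdsWithin_neBot]; exact hcl hx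
    have h1 := tendsto_extendFrom (hlim x hx)
    have h2 : Tendsto (fun z => ρ (ψ₀ z)) (𝓝[ball 0 1] x) (𝓝 (φ x)) :=
      ((hφ x hx).mono_left (nhdsWithin_mono _ ball_subset_closedBall)).congr'
        (by filter_upwards [self_mem_nhdsWithin] with z hz using (hρψ z hz).symm)
    exact tendsto_nhds_unique ((hρ.tendsto _).comp h1) h2
  · rw [hext _ hx₀]; simp only [ψ₀, dif_pos hx₀]; exact hG0

omit [T2Space F] [CompactSpace F] [T2Space C] in
lemma eqOn_ball_of_lifts (cov : IsCoveringMapOn ρ s) {φ : W → C} {ψ ψ' : W → F}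
    (hφ : ContinuousOn φ (ball 0 1)) (hs : ∀ x ∈ ball (0 : W) 1, φ x ∈ s)
    (hψ : ContinuousOn ψ (ball 0 1)) (hψ' : ContinuousOn ψ' (ball 0 1))
    (h : ∀ x ∈ ball (0 : W) 1, ρ (ψ x) = φ x) (h' : ∀ x ∈ ball (0 : W) 1, ρ (ψ' x) = φ x)
    {x₀ : W} (hx₀ : x₀ ∈ ball (0 : W) 1) (h0 : ψ x₀ = ψ' x₀) : EqOn ψ ψ' (ball 0 1) := by
  have hu := cov.existsUnique_continuousMap_lifts
    (⟨fun x => φ x, hφ.domRestrict⟩ : C(ball (0 : W) 1, C)) (a₀ := ⟨x₀, hx₀⟩) (h x₀ hx₀)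
    (fun a => hs a a.2)
  have := hu.unique (y₁ := ⟨fun x => ψ x, hψ.domRestrict⟩) (y₂ := ⟨fun x => ψ' x, hψ'.domRestrict⟩)
    ⟨rfl, funext fun x => h x x.2⟩ ⟨h0.symm, funext fun x => h' x x.2⟩
  intro x hx
  exact congrArg (fun G : C(ball (0 : W) 1, F) => G ⟨x, hx⟩) this

end

/-- Cells of dimension `0` are treated apart: they may be ramification points, and their lifts are
constant maps. -/
lemma Cells.exists_lift (K : Cells C) (hρ : Continuous ρ) (hfin : ∀ q, (ρ ⁻¹' {q}).Finite)
    (cov : IsCoveringMapOn ρ s) (hs : ∀ n, n ≠ 0 → ∀ i, ∀ x ∈ ball 0 1, K.map n i x ∈ s)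
    (n : ℕ) (i : K.cell n) {x₀ : Fin n → ℝ} (hx₀ : x₀ ∈ ball 0 1) {y₀ : F}
    (hy₀ : ρ y₀ = K.map n i x₀) :
    ∃ ψ : (Fin n → ℝ) → F, ContinuousOn ψ (closedBall 0 1) ∧
      (∀ x ∈ closedBall 0 1, ρ (ψ x) = K.map n i x) ∧ ψ x₀ = y₀ := by
  rcases eq_or_ne n 0 with rfl | hn
  · exact ⟨fun _ => y₀, continuousOn_const, fun x _ => by rw [hy₀, Subsingleton.elim x x₀], rfl⟩
  · exact exists_lift_closedBall hρ hfin cov (K.cont n i) (hs n hn i) hx₀ hy₀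

omit [T2Space F] [CompactSpace F] [T2Space C] in
lemma Cells.eqOn_of_lifts (K : Cells C) (cov : IsCoveringMapOn ρ s)
    (hs : ∀ n, n ≠ 0 → ∀ i, ∀ x ∈ ball 0 1, K.map n i x ∈ s)
    (n : ℕ) (i : K.cell n) {ψ ψ' : (Fin n → ℝ) → F}
    (hψ : ContinuousOn ψ (closedBall 0 1)) (hψ' : ContinuousOn ψ' (closedBall 0 1))
    (h : ∀ x ∈ closedBall 0 1, ρ (ψ x) = K.map n i x)
    (h' : ∀ x ∈ closedBall 0 1, ρ (ψ' x) = K.map n i x)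
    {x₀ : Fin n → ℝ} (hx₀ : x₀ ∈ ball 0 1) (h0 : ψ x₀ = ψ' x₀) : EqOn ψ ψ' (ball 0 1) := by
  rcases eq_or_ne n 0 with rfl | hn
  · intro x _
    rw [Subsingleton.elim x x₀, h0]
  · exact eqOn_ball_of_lifts cov ((K.cont n i).mono ball_subset_closedBall) (hs n hn i)
      (hψ.mono ball_subset_closedBall) (hψ'.mono ball_subset_closedBall)
      (fun x hx => h x (ball_subset_closedBall hx)) (fun x hx => h' x (ball_subset_closedBall hx))
      hx₀ h0

/-- Cells lift through a covering ramified over `0`-cells. -/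
lemma Cells.exists_lifted.{u} {C F : Type u} [TopologicalSpace C] [TopologicalSpace F] [T2Space F]
    [CompactSpace F] [T2Space C] {ρ : F → C} {s : Set C} (K : Cells C) (hρ : Continuous ρ)
    (hfin : ∀ q, (ρ ⁻¹' {q}).Finite)
    (cov : IsCoveringMapOn ρ s) (hs : ∀ n, n ≠ 0 → ∀ i, ∀ x ∈ ball 0 1, K.map n i x ∈ s) :
    ∃ L : Cells F, ∀ n, L.cell n = Σ i : K.cell n, ρ ⁻¹' {K.map n i 0} := by
  have h0 : ∀ n, (0 : Fin n → ℝ) ∈ ball 0 1 := fun n => by simp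
  choose ψ hψc hψρ hψ0 using fun (n : ℕ) (j : Σ i : K.cell n, ρ ⁻¹' {K.map n i 0}) =>
    K.exists_lift hρ hfin cov hs n j.1 (h0 n) (y₀ := j.2.1) j.2.2
  -- A lift of a cell is determined by its value at the center, so the lifts of a cell are indexed
  -- by the fiber over its center, and they fill the preimage of the open cell.
  have hthrough : ∀ n (i : K.cell n) (z : Fin n → ℝ), z ∈ ball 0 1 → ∀ p : F,
      ρ p = K.map n i z → ∃ y : ρ ⁻¹' {K.map n i 0}, ψ n ⟨i, y⟩ z = p := by
    intro n i z hz p hp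
    obtain ⟨ψ', h1, h2, h3⟩ := K.exists_lift hρ hfin cov hs n i hz hp
    refine ⟨⟨ψ' 0, h2 0 (by simp)⟩, ?_⟩
    rw [← h3]
    exact K.eqOn_of_lifts cov hs n i (hψc n _) h1 (hψρ n _) h2 (h0 n) (hψ0 n _) hz
  refine ⟨⟨fun n => Σ i : K.cell n, ρ ⁻¹' {K.map n i 0}, ψ, hψc, ?_, ?_, ?_⟩, fun n => rfl⟩
  · rintro n m ⟨i, a⟩ ⟨j, b⟩ x y hx hy hxy
    have h1 := congrArg ρ hxy
    rw [hψρ n _ x (ball_subset_closedBall hx), hψρ m _ y (ball_subset_closedBall hy)] at h1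
    have h2 := K.inj hx hy h1
    simp only [Sigma.mk.injEq] at h2
    obtain ⟨rfl, h2⟩ := h2
    simp only [heq_eq_eq, Prod.mk.injEq] at h2
    obtain ⟨rfl, rfl⟩ := h2
    have h3 := K.eqOn_of_lifts cov hs n i (hψc n ⟨i, a⟩) (hψc n ⟨i, b⟩) (hψρ n _) (hψρ n _) hx hxy
      (h0 n)
    rw [hψ0, hψ0] at h3
    obtain rfl : a = b := Subtype.ext h3
    rfl
  · rintro n ⟨i, a⟩ x hx
    obtain ⟨m, hm, j, y, hy, h⟩ := K.bd n i x hx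
    obtain ⟨b, hb⟩ := hthrough m j y hy (ψ n ⟨i, a⟩ x)
      (by rw [hψρ n _ x (sphere_subset_closedBall hx), h])
    exact ⟨m, hm, ⟨j, b⟩, y, hy, hb.symm⟩
  · intro p
    obtain ⟨n, i, x, hx, h⟩ := K.cover (ρ p)
    obtain ⟨b, hb⟩ := hthrough n i x hx p h.symm
    exact ⟨n, ⟨i, b⟩, x, hx, hb⟩

end Lift

end MilnorBoundary


namespace MilnorBoundary

open Metric

/-! ### Subdivision -/

lemma mem_ball_fin_one {x : Fin 1 → ℝ} : x ∈ ball (0 : Fin 1 → ℝ) 1 ↔ -1 < x 0 ∧ x 0 < 1 := by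
  rw [mem_ball_zero_iff, pi_norm_lt_iff one_pos]
  simp [Real.norm_eq_abs, abs_lt]

lemma mem_closedBall_fin_one {x : Fin 1 → ℝ} :
    x ∈ closedBall (0 : Fin 1 → ℝ) 1 ↔ -1 ≤ x 0 ∧ x 0 ≤ 1 := by
  rw [mem_closedBall_zero_iff, pi_norm_le_iff_of_nonneg zero_le_one]
  simp [Real.norm_eq_abs, abs_le]

lemma mem_sphere_fin_one {x : Fin 1 → ℝ} :
    x ∈ sphere (0 : Fin 1 → ℝ) 1 ↔ x 0 = -1 ∨ x 0 = 1 := by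
  rw [← closedBall_sdiff_ball, Set.mem_sdiff, mem_ball_fin_one, mem_closedBall_fin_one]
  constructor
  · rintro ⟨⟨h1, h2⟩, h3⟩
    by_contra! h
    exact h3 ⟨lt_of_le_of_ne h1 (Ne.symm h.1), lt_of_le_of_ne h2 h.2⟩
  · rintro (h | h) <;> constructor <;> simp [h]

lemma mem_ball_fin_two {x : Fin 2 → ℝ} :
    x ∈ ball (0 : Fin 2 → ℝ) 1 ↔ (-1 < x 0 ∧ x 0 < 1) ∧ -1 < x 1 ∧ x 1 < 1 := by
  rw [mem_ball_zero_iff, pi_norm_lt_iff one_pos]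
  simp [Fin.forall_fin_two, Real.norm_eq_abs, abs_lt]

lemma mem_closedBall_fin_two {x : Fin 2 → ℝ} :
    x ∈ closedBall (0 : Fin 2 → ℝ) 1 ↔ (-1 ≤ x 0 ∧ x 0 ≤ 1) ∧ -1 ≤ x 1 ∧ x 1 ≤ 1 := by
  rw [mem_closedBall_zero_iff, pi_norm_le_iff_of_nonneg zero_le_one]
  simp [Fin.forall_fin_two, Real.norm_eq_abs, abs_le]

/-- The affine map of the interval `[-1, 1]` onto `[a, b]`. -/
noncomputable def reparam (a b : ℝ) (x : Fin 1 → ℝ) : Fin 1 → ℝ := fun _ => a + (b - a) * (x 0 + 1) / 2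

lemma continuous_reparam (a b : ℝ) : Continuous (reparam a b) := by
  unfold reparam; fun_prop

lemma reparam_inj {a b : ℝ} (hab : a < b) {x y : Fin 1 → ℝ} (h : reparam a b x = reparam a b y) :
    x = y := by
  have h0 := congrFun h 0
  simp only [reparam] at h0
  have h1 : (b - a) * (x 0 - y 0) = 0 := by linarith
  have h2 : x 0 = y 0 := by
    rcases mul_eq_zero.1 h1 with h | h <;> linarith
  ext i; rw [Subsingleton.elim i 0, h2]

lemma reparam_lt {a b : ℝ} (hab : a < b) {x : Fin 1 → ℝ} (hx : x ∈ ball (0 : Fin 1 → ℝ) 1) :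
    a < reparam a b x 0 ∧ reparam a b x 0 < b := by
  rw [mem_ball_fin_one] at hx
  simp only [reparam]
  constructor <;> nlinarith

lemma exists_reparam {a b : ℝ} {y : Fin 1 → ℝ} (h1 : a < y 0) (h2 : y 0 < b) :
    ∃ x ∈ ball (0 : Fin 1 → ℝ) 1, reparam a b x = y := by
  have hab : 0 < b - a := by linarith
  refine ⟨fun _ => 2 * (y 0 - a) / (b - a) - 1, ?_, ?_⟩
  · rw [mem_ball_fin_one]
    constructor
    · have : 0 < 2 * (y 0 - a) / (b - a) := by apply div_pos <;> linarith
      linarith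
    · have : 2 * (y 0 - a) / (b - a) < 2 := by rw [div_lt_iff₀ hab]; linarith
      linarith
  · ext i
    rw [Subsingleton.elim i 0]
    simp only [reparam]
    field_simp
    ring

lemma reparam_mem_closedBall {a b : ℝ} (hab : a ≤ b) (ha : -1 ≤ a) (hb : b ≤ 1) {x : Fin 1 → ℝ}
    (hx : x ∈ closedBall (0 : Fin 1 → ℝ) 1) : reparam a b x ∈ closedBall (0 : Fin 1 → ℝ) 1 := by
  rw [mem_closedBall_fin_one] at hx ⊢
  simp only [reparam]
  constructor <;> nlinarith

/-- A finite cell decomposition with cells of dimension `0`, `1` and `2`. -/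
structure CellDec.{u} (X : Type u) [TopologicalSpace X] where
  V : Type u
  E : Type u
  F : Type u
  finV : Finite V
  finE : Finite E
  finF : Finite F
  v : V → X
  e : E → (Fin 1 → ℝ) → X
  f : F → (Fin 2 → ℝ) → X
  e_cont : ∀ i, ContinuousOn (e i) (closedBall 0 1)
  f_cont : ∀ i, ContinuousOn (f i) (closedBall 0 1)
  v_inj : ∀ i j, v i = v j → i = j
  e_inj : ∀ i j, ∀ x ∈ ball 0 1, ∀ y ∈ ball 0 1, e i x = e j y → i = j ∧ x = y
  f_inj : ∀ i j, ∀ x ∈ ball 0 1, ∀ y ∈ ball 0 1, f i x = f j y → i = j ∧ x = y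
  v_e : ∀ i j, ∀ x ∈ ball 0 1, v i ≠ e j x
  v_f : ∀ i j, ∀ x ∈ ball 0 1, v i ≠ f j x
  e_f : ∀ i j, ∀ x ∈ ball 0 1, ∀ y ∈ ball 0 1, e i x ≠ f j y
  e_bd : ∀ i, ∀ x ∈ sphere 0 1, ∃ j, e i x = v j
  f_bd : ∀ i, ∀ x ∈ sphere 0 1, (∃ j, f i x = v j) ∨ ∃ j, ∃ y ∈ ball 0 1, f i x = e j y
  cover : ∀ p, (∃ j, p = v j) ∨ (∃ j, ∃ y ∈ ball 0 1, p = e j y) ∨ ∃ j, ∃ y ∈ ball 0 1, p = f j y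

namespace CellDec

variable {X : Type*} [TopologicalSpace X] (K : CellDec X)

/-- The Euler characteristic of a cell decomposition. -/
noncomputable def chi : ℤ := Nat.card K.V - Nat.card K.E + Nat.card K.F

open Classical in
/-- The edges of the decomposition in which the edge `i` has been divided at the parameter `t`. -/
noncomputable def splitEdgeMap (i : K.E) (t : ℝ) : Option K.E → (Fin 1 → ℝ) → X
  | none => K.e i ∘ reparam t 1
  | some j => if j = i then K.e i ∘ reparam (-1) t else K.e j

/-- Every edge, new or old, is an old edge restricted to an interval `[a, b]`, so that the axioms of
a decomposition reduce to comparisons of intervals. The half beyond `t` gets the new index `none`,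
the other half keeps the index of the divided edge. -/
lemma exists_splitEdgeMap {i : K.E} {t : ℝ} (ht : -1 < t ∧ t < 1) (o : Option K.E) :
    ∃ (j : K.E) (a b : ℝ), K.splitEdgeMap i t o = K.e j ∘ reparam a b ∧ a < b ∧ -1 ≤ a ∧ b ≤ 1 ∧
      ((j = i ∧ a = t ∧ b = 1 ∧ o = none) ∨ (j = i ∧ a = -1 ∧ b = t ∧ o = some i) ∨
        (j ≠ i ∧ a = -1 ∧ b = 1 ∧ o = some j)) := by
  rcases o with _ | j
  · exact ⟨i, t, 1, rfl, ht.2, ht.1.le, le_rfl, Or.inl ⟨rfl, rfl, rfl, rfl⟩⟩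
  · by_cases hj : j = i
    · subst hj
      exact ⟨j, -1, t, by simp [splitEdgeMap], ht.1, le_rfl, ht.2.le, Or.inr (Or.inl ⟨rfl, rfl, rfl, rfl⟩)⟩
    · refine ⟨j, -1, 1, ?_, by norm_num, le_rfl, le_rfl, Or.inr (Or.inr ⟨hj, rfl, rfl, rfl⟩)⟩
      have : reparam (-1) 1 = id := by
        ext x k
        rw [Subsingleton.elim k 0]
        simp only [reparam, id]
        ring
      simp [splitEdgeMap, hj, this]

/-- Division of an edge by a new vertex. -/
noncomputable def splitEdge (i : K.E) (t : Fin 1 → ℝ) (ht : t ∈ ball (0 : Fin 1 → ℝ) 1) :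
    CellDec X where
  V := Option K.V
  E := Option K.E
  F := K.F
  finV := have := K.finV; inferInstance
  finE := have := K.finE; inferInstance
  finF := K.finF
  v := fun o => o.elim (K.e i t) K.v
  e := K.splitEdgeMap i (t 0)
  f := K.f
  e_cont := by
    intro o
    obtain ⟨j, a, b, h, hab, ha, hb, -⟩ := K.exists_splitEdgeMap (i := i) (mem_ball_fin_one.1 ht) o
    rw [h]
    exact (K.e_cont j).comp (continuous_reparam a b).continuousOn
      fun x hx => reparam_mem_closedBall hab.le ha hb hx
  f_cont := K.f_cont
  v_inj := by
    rintro (_ | j) (_ | j') h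
    · rfl
    · exact absurd h.symm (K.v_e _ _ _ ht)
    · exact absurd h (K.v_e _ _ _ ht)
    · exact congrArg some (K.v_inj _ _ h)
  e_inj := by
    intro o o' x hx y hy h
    obtain ⟨j, a, b, h1, hab, ha, hb, hcase⟩ := K.exists_splitEdgeMap (i := i) (mem_ball_fin_one.1 ht) o
    obtain ⟨j', a', b', h1', hab', ha', hb', hcase'⟩ :=
      K.exists_splitEdgeMap (i := i) (mem_ball_fin_one.1 ht) o'
    have hx' := reparam_lt hab hx
    have hy' := reparam_lt hab' hy
    rw [h1, h1'] at h
    obtain ⟨rfl, h2⟩ := K.e_inj _ _ _ (mem_ball_fin_one.2 ⟨by linarith, by linarith⟩) _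
      (mem_ball_fin_one.2 ⟨by linarith, by linarith⟩) h
    have h3 := congrFun h2 0
    -- Both parameters are equal in the old edge, while `(-1, t)` and `(t, 1)` are disjoint: only
    -- the cases of the same piece survive.
    rcases hcase with ⟨rfl, rfl, rfl, rfl⟩ | ⟨rfl, rfl, rfl, rfl⟩ | ⟨hj, rfl, rfl, rfl⟩ <;>
      rcases hcase' with ⟨hj', rfl, rfl, rfl⟩ | ⟨hj', rfl, rfl, rfl⟩ | ⟨hj', rfl, rfl, rfl⟩
    all_goals first
      | exact ⟨rfl, reparam_inj hab h2⟩
      | exact absurd rfl hj'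
      | exact absurd hj' hj
      | (exfalso; linarith)
  f_inj := K.f_inj
  v_e := by
    intro u o x hx h
    obtain ⟨j, a, b, h1, hab, ha, hb, hcase⟩ := K.exists_splitEdgeMap (i := i) (mem_ball_fin_one.1 ht) o
    have hx' := reparam_lt hab hx
    have hb' : reparam a b x ∈ ball (0 : Fin 1 → ℝ) 1 :=
      mem_ball_fin_one.2 ⟨by linarith, by linarith⟩
    rw [h1] at h
    rcases u with _ | u
    · obtain ⟨rfl, h2⟩ := K.e_inj _ _ _ ht _ hb' h
      have h3 := congrFun h2 0
      rcases hcase with ⟨-, rfl, rfl, rfl⟩ | ⟨-, rfl, rfl, rfl⟩ | ⟨hj, -⟩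
      · linarith
      · linarith
      · exact hj rfl
    · exact K.v_e _ _ _ hb' h
  v_f := by
    rintro (_ | u) j x hx h
    · exact K.e_f _ _ _ ht _ hx h
    · exact K.v_f _ _ _ hx h
  e_f := by
    intro o j x hx y hy h
    obtain ⟨j', a, b, h1, hab, ha, hb, hcase⟩ := K.exists_splitEdgeMap (i := i) (mem_ball_fin_one.1 ht) o
    have hx' := reparam_lt hab hx
    rw [h1] at h
    exact K.e_f _ _ _ (mem_ball_fin_one.2 ⟨by linarith, by linarith⟩) _ hy h
  e_bd := by
    intro o x hx
    obtain ⟨j, a, b, h1, hab, ha, hb, hcase⟩ := K.exists_splitEdgeMap (i := i) (mem_ball_fin_one.1 ht) o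
    rw [h1]
    have hval : reparam a b x 0 = a ∨ reparam a b x 0 = b := by
      rcases mem_sphere_fin_one.1 hx with h | h
      · left; simp [reparam, h]
      · right; simp only [reparam, h]; ring
    have key : ∀ c, (c = -1 ∨ c = 1 ∨ c = t 0 ∧ j = i) → reparam a b x 0 = c →
        ∃ u : Option K.V, K.e j (reparam a b x) = u.elim (K.e i t) K.v := by
      rintro c hc hr
      rcases hc with rfl | rfl | ⟨rfl, rfl⟩
      · obtain ⟨u, hu⟩ := K.e_bd j _ (mem_sphere_fin_one.2 (Or.inl hr))
        exact ⟨some u, hu⟩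
      · obtain ⟨u, hu⟩ := K.e_bd j _ (mem_sphere_fin_one.2 (Or.inr hr))
        exact ⟨some u, hu⟩
      · refine ⟨none, congrArg (K.e j) ?_⟩
        ext k; rw [Subsingleton.elim k 0, hr]
    rcases hval with h | h
    · refine key a ?_ h
      rcases hcase with ⟨rfl, rfl, rfl, rfl⟩ | ⟨rfl, rfl, rfl, rfl⟩ | ⟨hj, rfl, rfl, rfl⟩ <;> simp
    · refine key b ?_ h
      rcases hcase with ⟨rfl, rfl, rfl, rfl⟩ | ⟨rfl, rfl, rfl, rfl⟩ | ⟨hj, rfl, rfl, rfl⟩ <;> simp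
  f_bd := by
    intro j x hx
    rcases K.f_bd j x hx with ⟨u, hu⟩ | ⟨j', y, hy, h⟩
    · exact Or.inl ⟨some u, hu⟩
    · by_cases hj : j' = i
      · subst hj
        rcases lt_trichotomy (y 0) (t 0) with hlt | heq | hgt
        · obtain ⟨z, hz, hzy⟩ := exists_reparam (mem_ball_fin_one.1 hy).1 hlt
          exact Or.inr ⟨some j', z, hz, by simp [splitEdgeMap, hzy, h]⟩
        · left
          refine ⟨none, h.trans (congrArg (K.e j') ?_)⟩
          ext k; rw [Subsingleton.elim k 0, heq]
        · obtain ⟨z, hz, hzy⟩ := exists_reparam hgt (mem_ball_fin_one.1 hy).2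
          exact Or.inr ⟨none, z, hz, by simp [splitEdgeMap, hzy, h]⟩
      · exact Or.inr ⟨some j', y, hy, by simp [splitEdgeMap, hj, h]⟩
  cover := by
    intro p
    rcases K.cover p with ⟨u, hu⟩ | ⟨j', y, hy, h⟩ | h
    · exact Or.inl ⟨some u, hu⟩
    · by_cases hj : j' = i
      · subst hj
        rcases lt_trichotomy (y 0) (t 0) with hlt | heq | hgt
        · obtain ⟨z, hz, hzy⟩ := exists_reparam (mem_ball_fin_one.1 hy).1 hlt
          exact Or.inr (Or.inl ⟨some j', z, hz, by simp [splitEdgeMap, hzy, h]⟩)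
        · left
          refine ⟨none, h.trans (congrArg (K.e j') ?_)⟩
          ext k; rw [Subsingleton.elim k 0, heq]
        · obtain ⟨z, hz, hzy⟩ := exists_reparam hgt (mem_ball_fin_one.1 hy).2
          exact Or.inr (Or.inl ⟨none, z, hz, by simp [splitEdgeMap, hzy, h]⟩)
      · exact Or.inr (Or.inl ⟨some j', y, hy, by simp [splitEdgeMap, hj, h]⟩)
    · exact Or.inr (Or.inr h)

/-! A slit parametrization of the square. -/

/-- The homeomorphism of `[-1, 1]` sending `0` to `b`. -/
noncomputable def shiftInterval (b t : ℝ) : ℝ := t + b * (1 - |t|)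

lemma shiftInterval_zero (b : ℝ) : shiftInterval b 0 = b := by simp [shiftInterval]

/-- The absolute value is `1`-Lipschitz, so the perturbation `b * (1 - |t|)` varies strictly less
than `t` when `|b| < 1`. -/
lemma shiftInterval_strictMono {b : ℝ} (hb : |b| < 1) : StrictMono (shiftInterval b) := by
  intro s t hst
  have h1 : |b * (|t| - |s|)| < t - s ∨ |b * (|t| - |s|)| ≤ 0 := by
    rw [abs_mul]
    have h2 : |(|t| - |s|)| ≤ t - s := by
      have := abs_abs_sub_abs_le_abs_sub t s
      rwa [abs_of_pos (sub_pos.2 hst)] at this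
    rcases (abs_nonneg (|t| - |s|)).eq_or_lt with h | h
    · right; rw [← h, mul_zero]
    · left; nlinarith
  have h3 := le_abs_self (b * (|t| - |s|))
  simp only [shiftInterval]
  rcases h1 with h1 | h1 <;> nlinarith

lemma shiftInterval_one (b : ℝ) : shiftInterval b 1 = 1 := by simp [shiftInterval]

lemma shiftInterval_neg_one (b : ℝ) : shiftInterval b (-1) = -1 := by simp [shiftInterval]

lemma continuous_shiftInterval (b : ℝ) : Continuous (shiftInterval b) := by
  unfold shiftInterval; fun_prop

/-- The homeomorphism of the square sending `0` to `b`. -/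
noncomputable def shiftSquare (b x : Fin 2 → ℝ) : Fin 2 → ℝ := fun i => shiftInterval (b i) (x i)

lemma continuous_shiftSquare (b : Fin 2 → ℝ) : Continuous (shiftSquare b) :=
  continuous_pi fun i => (continuous_shiftInterval _).comp (continuous_apply i)

variable {b : Fin 2 → ℝ}

lemma abs_lt_of_mem_ball (hb : b ∈ ball (0 : Fin 2 → ℝ) 1) (i : Fin 2) : |b i| < 1 := by
  rw [mem_ball_zero_iff, pi_norm_lt_iff one_pos] at hb
  exact hb i

lemma shiftSquare_injective (hb : b ∈ ball (0 : Fin 2 → ℝ) 1) :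
    Function.Injective (shiftSquare b) := by
  intro x y h
  ext i
  exact (shiftInterval_strictMono (abs_lt_of_mem_ball hb i)).injective (congrFun h i)

lemma shiftSquare_mem_ball (hb : b ∈ ball (0 : Fin 2 → ℝ) 1) {x : Fin 2 → ℝ} :
    shiftSquare b x ∈ ball (0 : Fin 2 → ℝ) 1 ↔ x ∈ ball (0 : Fin 2 → ℝ) 1 := by
  have key : ∀ i, (-1 < shiftSquare b x i ↔ -1 < x i) ∧ (shiftSquare b x i < 1 ↔ x i < 1) := by
    intro i
    have hm := shiftInterval_strictMono (abs_lt_of_mem_ball hb i)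
    have h1 := hm.lt_iff_lt (a := -1) (b := x i)
    have h2 := hm.lt_iff_lt (a := x i) (b := 1)
    rw [shiftInterval_neg_one] at h1
    rw [shiftInterval_one] at h2
    exact ⟨h1, h2⟩
  rw [mem_ball_fin_two, mem_ball_fin_two, (key 0).1, (key 0).2, (key 1).1, (key 1).2]

lemma shiftSquare_mem_closedBall (hb : b ∈ ball (0 : Fin 2 → ℝ) 1) {x : Fin 2 → ℝ} :
    shiftSquare b x ∈ closedBall (0 : Fin 2 → ℝ) 1 ↔ x ∈ closedBall (0 : Fin 2 → ℝ) 1 := by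
  have key : ∀ i, (-1 ≤ shiftSquare b x i ↔ -1 ≤ x i) ∧ (shiftSquare b x i ≤ 1 ↔ x i ≤ 1) := by
    intro i
    have hm := shiftInterval_strictMono (abs_lt_of_mem_ball hb i)
    have h1 := hm.le_iff_le (a := -1) (b := x i)
    have h2 := hm.le_iff_le (a := x i) (b := 1)
    rw [shiftInterval_neg_one] at h1
    rw [shiftInterval_one] at h2
    exact ⟨h1, h2⟩
  rw [mem_closedBall_fin_two, mem_closedBall_fin_two, (key 0).1, (key 0).2, (key 1).1, (key 1).2]

lemma shiftSquare_mem_sphere (hb : b ∈ ball (0 : Fin 2 → ℝ) 1) {x : Fin 2 → ℝ} :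
    shiftSquare b x ∈ sphere (0 : Fin 2 → ℝ) 1 ↔ x ∈ sphere (0 : Fin 2 → ℝ) 1 := by
  rw [← closedBall_sdiff_ball, Set.mem_sdiff, Set.mem_sdiff, shiftSquare_mem_ball hb,
    shiftSquare_mem_closedBall hb]

lemma exists_shiftSquare (hb : b ∈ ball (0 : Fin 2 → ℝ) 1) {y : Fin 2 → ℝ}
    (hy : y ∈ ball (0 : Fin 2 → ℝ) 1) : ∃ x ∈ ball (0 : Fin 2 → ℝ) 1, shiftSquare b x = y := by
  have : ∀ i, ∃ t, shiftInterval (b i) t = y i := by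
    intro i
    have h := intermediate_value_Icc (a := -1) (b := 1) (by norm_num)
      (continuous_shiftInterval (b i)).continuousOn
    rw [shiftInterval_neg_one, shiftInterval_one] at h
    have hyi := abs_lt.1 (abs_lt_of_mem_ball hy i)
    obtain ⟨t, -, ht⟩ := h ⟨hyi.1.le, hyi.2.le⟩
    exact ⟨t, ht⟩
  choose x hx using this
  have hxy : shiftSquare b x = y := funext hx
  exact ⟨x, (shiftSquare_mem_ball hb).1 (by rw [hxy]; exact hy), hxy⟩

/-- The vector of angle `θ`. -/
noncomputable def direction (θ : ℝ) : Fin 2 → ℝ := ![Real.cos θ, Real.sin θ]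

lemma direction_ne_zero (θ : ℝ) : direction θ ≠ 0 := by
  intro h
  have h0 := congrFun h 0
  have h1 := congrFun h 1
  simp only [direction, Matrix.cons_val_zero, Matrix.cons_val_one, Pi.zero_apply] at h0 h1
  have := Real.cos_sq_add_sin_sq θ
  rw [h0, h1] at this
  norm_num at this

lemma continuous_direction : Continuous direction := by
  refine continuous_pi fun i => ?_
  fin_cases i
  · exact Real.continuous_cos
  · exact Real.continuous_sin

/-- Polar coordinates on the square slit along a radius. -/
noncomputable def slitSquare (x : Fin 2 → ℝ) : Fin 2 → ℝ :=
  ((x 0 + 1) / 2 / ‖direction (Real.pi * x 1)‖) • direction (Real.pi * x 1)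

lemma continuous_slitSquare : Continuous slitSquare := by
  have h : Continuous fun x : Fin 2 → ℝ => direction (Real.pi * x 1) :=
    continuous_direction.comp (by fun_prop)
  unfold slitSquare
  refine Continuous.smul (Continuous.div (by fun_prop) h.norm fun x => ?_) h
  exact norm_ne_zero_iff.2 (direction_ne_zero _)

/-- The norm of `Fin 2 → ℝ` is the supremum norm. Dividing the direction by its norm makes the radii
fill exactly the square. -/
lemma norm_slitSquare {x : Fin 2 → ℝ} (hx : -1 ≤ x 0) : ‖slitSquare x‖ = (x 0 + 1) / 2 := by
  have h := norm_ne_zero_iff.2 (direction_ne_zero (Real.pi * x 1))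
  rw [slitSquare, norm_smul, norm_div, norm_norm, div_mul_cancel₀ _ h, Real.norm_eq_abs,
    abs_of_nonneg (by linarith)]

/-- The complex number with the given coordinates. -/
noncomputable def toC (y : Fin 2 → ℝ) : ℂ := y 0 + y 1 * Complex.I

lemma arg_smul_direction {c θ : ℝ} (hc : 0 < c) (h1 : -Real.pi < θ) (h2 : θ ≤ Real.pi) :
    (toC (c • direction θ)).arg = θ := by
  have : toC (c • direction θ) = c * (Complex.cos θ + Complex.sin θ * Complex.I) := by
    simp [toC, direction]; ring
  rw [this]
  exact Complex.arg_mul_cos_add_sin_mul_I hc ⟨h1, h2⟩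

/-- The norm recovers the radius, and the argument recovers the angle since it remains strictly
between `-π` and `π`. -/
lemma slitSquare_injOn : InjOn slitSquare (ball (0 : Fin 2 → ℝ) 1) := by
  intro x hx y hy h
  rw [mem_ball_fin_two] at hx hy
  have hn := congrArg norm h
  rw [norm_slitSquare hx.1.1.le, norm_slitSquare hy.1.1.le] at hn
  have h0 : x 0 = y 0 := by linarith
  have hpi := Real.pi_pos
  have ha : ∀ z : Fin 2 → ℝ, (-1 < z 0 ∧ z 0 < 1) ∧ -1 < z 1 ∧ z 1 < 1 →
      (toC (slitSquare z)).arg = Real.pi * z 1 := by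
    intro z hz
    refine arg_smul_direction (div_pos (by linarith) (norm_pos_iff.2 (direction_ne_zero _))) ?_ ?_
      <;> nlinarith
  have h1 : Real.pi * x 1 = Real.pi * y 1 := by rw [← ha x hx, ← ha y hy, h]
  have h1' := mul_left_cancel₀ hpi.ne' h1
  ext i; fin_cases i
  · exact h0
  · exact h1'

lemma exists_slitSquare {y : Fin 2 → ℝ} (hy : y ∈ ball (0 : Fin 2 → ℝ) 1)
    (hs : ¬ (y 1 = 0 ∧ y 0 ≤ 0)) : ∃ x ∈ ball (0 : Fin 2 → ℝ) 1, slitSquare x = y := by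
  have hy0 : y ≠ 0 := by rintro rfl; exact hs ⟨rfl, le_rfl⟩
  have hpi := Real.pi_pos
  set z := toC y with hz
  have hre : z.re = y 0 := by simp [hz, toC]
  have him : z.im = y 1 := by simp [hz, toC]
  have hne : z.arg ≠ Real.pi := by
    intro h
    rw [Complex.arg_eq_pi_iff, hre, him] at h
    exact hs ⟨h.2, h.1.le⟩
  have hlt : z.arg < Real.pi := lt_of_le_of_ne (Complex.arg_le_pi z) hne
  have hgt := Complex.neg_pi_lt_arg z
  have hn : ‖y‖ < 1 := by simpa using hy
  have hn0 : 0 < ‖y‖ := norm_pos_iff.2 hy0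
  let x : Fin 2 → ℝ := ![2 * ‖y‖ - 1, z.arg / Real.pi]
  have hx1 : Real.pi * x 1 = z.arg := by show Real.pi * (z.arg / Real.pi) = z.arg; field_simp
  have hyd : y = ‖z‖ • direction z.arg := by
    ext i; fin_cases i
    · simp [direction, Complex.norm_mul_cos_arg, hre]
    · simp [direction, Complex.norm_mul_sin_arg, him]
  refine ⟨x, ?_, ?_⟩
  · rw [mem_ball_fin_two]
    refine ⟨⟨?_, ?_⟩, ?_, ?_⟩
    · simp only [x, Matrix.cons_val_zero]; linarith
    · simp only [x, Matrix.cons_val_zero]; linarith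
    · show -1 < z.arg / Real.pi; rw [lt_div_iff₀ hpi]; linarith
    · show z.arg / Real.pi < 1; rw [div_lt_iff₀ hpi]; linarith
  · have h := norm_ne_zero_iff.2 (direction_ne_zero z.arg)
    have hx0 : (x 0 + 1) / 2 = ‖z‖ * ‖direction z.arg‖ := by
      have : ‖y‖ = ‖z‖ * ‖direction z.arg‖ := by
        conv_lhs => rw [hyd]
        rw [norm_smul, norm_norm]
      rw [← this]; simp [x]
    rw [slitSquare, hx1, hx0, mul_div_cancel_right₀ _ h, ← hyd]

lemma slitSquare_not_mem_slit {x : Fin 2 → ℝ} (hx : x ∈ ball (0 : Fin 2 → ℝ) 1) :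
    ¬ (slitSquare x 1 = 0 ∧ slitSquare x 0 ≤ 0) := by
  rintro ⟨h1, h0⟩
  rw [mem_ball_fin_two] at hx
  have hpi := Real.pi_pos
  have hne : slitSquare x ≠ 0 := by
    rw [← norm_ne_zero_iff, norm_slitSquare hx.1.1.le]
    linarith [hx.1.1]
  have ha : (toC (slitSquare x)).arg = Real.pi * x 1 := by
    refine arg_smul_direction (div_pos (by linarith) (norm_pos_iff.2 (direction_ne_zero _))) ?_ ?_
      <;> nlinarith
  have h2 : (toC (slitSquare x)).arg = Real.pi := by
    rw [Complex.arg_eq_pi_iff]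
    refine ⟨?_, by simp [toC, h1]⟩
    have : slitSquare x 0 ≠ 0 := by
      intro h
      apply hne; ext i; fin_cases i
      · exact h
      · exact h1
    simpa [toC] using lt_of_le_of_ne h0 this
  rw [h2] at ha
  nlinarith

/-- The side `x 0 = 1` is wrapped around the boundary of the square, the sides `x 1 = ±1` become the
two edges of the slit, and the side `x 0 = -1` collapses to the origin. -/
lemma slitSquare_sphere {x : Fin 2 → ℝ} (hx : x ∈ sphere (0 : Fin 2 → ℝ) 1) :
    slitSquare x ∈ sphere (0 : Fin 2 → ℝ) 1 ∨
      ∃ s, 0 ≤ s ∧ s < 1 ∧ slitSquare x = ![-s, 0] := by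
  rw [← closedBall_sdiff_ball, Set.mem_sdiff, mem_closedBall_fin_two, mem_ball_fin_two] at hx
  obtain ⟨⟨⟨h1, h2⟩, h3, h4⟩, hx⟩ := hx
  rcases h2.eq_or_lt with h | hlt
  · left
    rw [mem_sphere_zero_iff_norm, norm_slitSquare h1, h]; norm_num
  right
  refine ⟨(x 0 + 1) / 2, by linarith, by linarith, ?_⟩
  rcases h1.eq_or_lt with h | hgt
  · rw [slitSquare, ← h]; ext i; fin_cases i <;> simp
  have hc : x 1 = -1 ∨ x 1 = 1 := by
    by_contra! hc
    exact hx ⟨⟨hgt, hlt⟩, lt_of_le_of_ne h3 hc.1.symm, lt_of_le_of_ne h4 hc.2⟩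
  have hd : direction (Real.pi * x 1) = ![-1, 0] := by
    rcases hc with h | h <;> simp [direction, h]
  have hn : ‖(![-1, 0] : Fin 2 → ℝ)‖ = 1 := by
    simp [Pi.norm_def, Finset.univ_fin2]
  rw [slitSquare, hd, hn]
  ext i; fin_cases i <;> simp

end CellDec

end MilnorBoundary


/-! ### Division of faces, and the Riemann–Hurwitz formula -/

namespace MilnorBoundary

open Metric

namespace CellDec

variable {X : Type*} [TopologicalSpace X] (K : CellDec X)

open Classical in
/-- The faces of the decomposition in which the face `i` has been slit from its point `b`. -/
noncomputable def splitFaceMap (i : K.F) (b : Fin 2 → ℝ) (j : K.F) : (Fin 2 → ℝ) → X :=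
  if j = i then K.f i ∘ shiftSquare b ∘ slitSquare else K.f j

/-- The slit. -/
noncomputable def slit (x : Fin 1 → ℝ) : Fin 2 → ℝ := ![-((x 0 + 1) / 2), 0]

lemma continuous_slit : Continuous slit := by
  refine continuous_pi fun i => ?_
  fin_cases i
  · show Continuous fun x : Fin 1 → ℝ => -((x 0 + 1) / 2)
    fun_prop
  · exact continuous_const

lemma slit_mem_ball {x : Fin 1 → ℝ} (hx : x ∈ ball (0 : Fin 1 → ℝ) 1) :
    slit x ∈ ball (0 : Fin 2 → ℝ) 1 := by
  rw [mem_ball_fin_one] at hx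
  rw [mem_ball_fin_two]
  simp only [slit, Matrix.cons_val_zero, Matrix.cons_val_one]
  refine ⟨⟨?_, ?_⟩, ?_, ?_⟩ <;> linarith

lemma slit_mem_closedBall {x : Fin 1 → ℝ} (hx : x ∈ closedBall (0 : Fin 1 → ℝ) 1) :
    slit x ∈ closedBall (0 : Fin 2 → ℝ) 1 := by
  rw [mem_closedBall_fin_one] at hx
  rw [mem_closedBall_fin_two]
  simp only [slit, Matrix.cons_val_zero, Matrix.cons_val_one]
  refine ⟨⟨?_, ?_⟩, ?_, ?_⟩ <;> linarith

lemma slit_injective : Function.Injective slit := by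
  intro x y h
  have := congrFun h 0
  simp only [slit, Matrix.cons_val_zero] at this
  ext i; rw [Subsingleton.elim i 0]; linarith

/-- The point of the square which is the end of the slit starting at `b`. -/
noncomputable def slitEnd (b : Fin 2 → ℝ) : Fin 2 → ℝ := shiftSquare b ![-1, 0]

lemma slitEnd_mem_sphere {b : Fin 2 → ℝ} (hb : b ∈ ball (0 : Fin 2 → ℝ) 1) :
    slitEnd b ∈ sphere (0 : Fin 2 → ℝ) 1 := by
  rw [slitEnd, shiftSquare_mem_sphere hb, ← closedBall_sdiff_ball, Set.mem_sdiff,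
    mem_closedBall_fin_two, mem_ball_fin_two]
  norm_num

/-- Every point of the open square is the origin, or on the slit, or in the slit square. -/
lemma slit_cases {y : Fin 2 → ℝ} (hy : y ∈ ball (0 : Fin 2 → ℝ) 1) :
    y = 0 ∨ (∃ x ∈ ball (0 : Fin 1 → ℝ) 1, slit x = y) ∨
      ∃ x ∈ ball (0 : Fin 2 → ℝ) 1, slitSquare x = y := by
  by_cases hs : y 1 = 0 ∧ y 0 ≤ 0
  · rcases hs.2.eq_or_lt with h | h
    · left; ext i; fin_cases i
      · exact h
      · exact hs.1
    · right; left
      have := mem_ball_fin_two.1 hy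
      refine ⟨fun _ => 2 * (-y 0) - 1, mem_ball_fin_one.2 ⟨by linarith, by linarith⟩, ?_⟩
      ext i; fin_cases i
      · simp [slit]; ring
      · simp [slit, hs.1]
  · exact Or.inr (Or.inr (exists_slitSquare hy hs))

lemma slitSquare_mem_ball {x : Fin 2 → ℝ} (hx : x ∈ ball (0 : Fin 2 → ℝ) 1) :
    slitSquare x ∈ ball (0 : Fin 2 → ℝ) 1 := by
  rw [mem_ball_fin_two] at hx
  rw [mem_ball_zero_iff, norm_slitSquare hx.1.1.le]
  linarith

lemma slitSquare_mem_closedBall {x : Fin 2 → ℝ} (hx : x ∈ closedBall (0 : Fin 2 → ℝ) 1) :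
    slitSquare x ∈ closedBall (0 : Fin 2 → ℝ) 1 := by
  rw [mem_closedBall_fin_two] at hx
  rw [mem_closedBall_zero_iff, norm_slitSquare hx.1.1]
  linarith

section

variable {b : Fin 2 → ℝ} (hb : b ∈ ball (0 : Fin 2 → ℝ) 1) (i : K.F)

include hb

/-- As for edges, all faces are old faces precomposed with a map `P` of the square, which lets the
axioms be checked without repeating the two cases. -/
lemma exists_splitFaceMap (j : K.F) :
    ∃ P : (Fin 2 → ℝ) → (Fin 2 → ℝ), K.splitFaceMap i b j = K.f j ∘ P ∧ Continuous P ∧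
      InjOn P (ball 0 1) ∧ MapsTo P (ball 0 1) (ball 0 1) ∧
      MapsTo P (closedBall 0 1) (closedBall 0 1) ∧
      ((j = i ∧ P = shiftSquare b ∘ slitSquare) ∨ (j ≠ i ∧ P = id)) := by
  by_cases h : j = i
  · subst h
    refine ⟨shiftSquare b ∘ slitSquare, by simp [splitFaceMap],
      (continuous_shiftSquare b).comp continuous_slitSquare, ?_, ?_, ?_, Or.inl ⟨rfl, rfl⟩⟩
    · exact (shiftSquare_injective hb).comp_injOn slitSquare_injOn
    · exact fun x hx => (shiftSquare_mem_ball hb).2 (slitSquare_mem_ball hx)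
    · exact fun x hx => (shiftSquare_mem_closedBall hb).2 (slitSquare_mem_closedBall hx)
  · exact ⟨id, by simp [splitFaceMap, h], continuous_id, injOn_id _, mapsTo_id _, mapsTo_id _,
      Or.inr ⟨h, rfl⟩⟩

end

/-- Division of a face by a new vertex and an edge joining it to a vertex of the boundary. -/
noncomputable def splitFace (i : K.F) (b : Fin 2 → ℝ) (hb : b ∈ ball (0 : Fin 2 → ℝ) 1) (w : K.V)
    (hw : K.f i (slitEnd b) = K.v w) : CellDec X where
  V := Option K.V
  E := Option K.E
  F := K.F
  finV := have := K.finV; inferInstance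
  finE := have := K.finE; inferInstance
  finF := K.finF
  v := fun o => o.elim (K.f i b) K.v
  e := fun o => o.elim (K.f i ∘ shiftSquare b ∘ slit) K.e
  f := K.splitFaceMap i b
  e_cont := by
    rintro (_ | j)
    · exact (K.f_cont i).comp ((continuous_shiftSquare b).comp continuous_slit).continuousOn
        fun x hx => (shiftSquare_mem_closedBall hb).2 (slit_mem_closedBall hx)
    · exact K.e_cont j
  f_cont := by
    intro j
    obtain ⟨P, h, hc, -, -, hm, -⟩ := K.exists_splitFaceMap hb i j
    rw [h]
    exact (K.f_cont j).comp hc.continuousOn hm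
  v_inj := by
    rintro (_ | j) (_ | j') h
    · rfl
    · exact absurd h.symm (K.v_f _ _ _ hb)
    · exact absurd h (K.v_f _ _ _ hb)
    · exact congrArg some (K.v_inj _ _ h)
  e_inj := by
    rintro (_ | j) (_ | j') x hx y hy h
    · have := (K.f_inj _ _ _ ((shiftSquare_mem_ball hb).2 (slit_mem_ball hx)) _
        ((shiftSquare_mem_ball hb).2 (slit_mem_ball hy)) h).2
      exact ⟨rfl, slit_injective (shiftSquare_injective hb this)⟩
    · exact absurd h.symm (K.e_f _ _ _ hy _ ((shiftSquare_mem_ball hb).2 (slit_mem_ball hx)))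
    · exact absurd h (K.e_f _ _ _ hx _ ((shiftSquare_mem_ball hb).2 (slit_mem_ball hy)))
    · obtain ⟨rfl, rfl⟩ := K.e_inj _ _ _ hx _ hy h
      exact ⟨rfl, rfl⟩
  f_inj := by
    intro j j' x hx y hy h
    obtain ⟨P, h1, -, hinj, hm, -, hP⟩ := K.exists_splitFaceMap hb i j
    obtain ⟨P', h1', -, hinj', hm', -, hP'⟩ := K.exists_splitFaceMap hb i j'
    rw [h1, h1'] at h
    obtain ⟨rfl, h2⟩ := K.f_inj _ _ _ (hm hx) _ (hm' hy) h
    refine ⟨rfl, hinj hx hy ?_⟩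
    rw [h2]
    rcases hP with ⟨hj, rfl⟩ | ⟨hj, rfl⟩ <;> rcases hP' with ⟨hj', rfl⟩ | ⟨hj', rfl⟩
    · rfl
    · exact absurd hj hj'
    · exact absurd hj' hj
    · rfl
  v_e := by
    rintro (_ | u) (_ | j) x hx h
    · have h1 := (K.f_inj _ _ _ hb _ ((shiftSquare_mem_ball hb).2 (slit_mem_ball hx)) h).2
      have h2 : shiftSquare b 0 = b := funext fun i => shiftInterval_zero _
      have h3 := shiftSquare_injective hb (h2.trans h1)
      have h4 := congrFun h3 0
      simp only [slit, Pi.zero_apply, Matrix.cons_val_zero] at h4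
      have := mem_ball_fin_one.1 hx
      linarith
    · exact K.e_f _ _ _ hx _ hb h.symm
    · exact K.v_f _ _ _ ((shiftSquare_mem_ball hb).2 (slit_mem_ball hx)) h
    · exact K.v_e _ _ _ hx h
  v_f := by
    intro u j x hx h
    obtain ⟨P, h1, -, hinj, hm, -, hP⟩ := K.exists_splitFaceMap hb i j
    rw [h1] at h
    rcases u with _ | u
    · obtain ⟨rfl, h2⟩ := K.f_inj _ _ _ hb _ (hm hx) h
      rcases hP with ⟨-, rfl⟩ | ⟨hj, -⟩
      · have h3 : shiftSquare b 0 = b := funext fun i => shiftInterval_zero _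
        have h4 := shiftSquare_injective hb (h3.trans h2)
        refine slitSquare_not_mem_slit hx ?_
        rw [← h4]; simp
      · exact hj rfl
    · exact K.v_f _ _ _ (hm hx) h
  e_f := by
    intro o j x hx y hy h
    obtain ⟨P, h1, -, hinj, hm, -, hP⟩ := K.exists_splitFaceMap hb i j
    rw [h1] at h
    rcases o with _ | o
    · obtain ⟨rfl, h2⟩ := K.f_inj _ _ _ ((shiftSquare_mem_ball hb).2 (slit_mem_ball hx)) _ (hm hy) h
      rcases hP with ⟨-, rfl⟩ | ⟨hj, -⟩
      · have h4 := shiftSquare_injective hb h2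
        refine slitSquare_not_mem_slit hy ?_
        rw [← h4]
        have := mem_ball_fin_one.1 hx
        simp [slit]; linarith
      · exact hj rfl
    · exact K.e_f _ _ _ hx _ (hm hy) h
  e_bd := by
    rintro (_ | j) x hx
    · rcases mem_sphere_fin_one.1 hx with h | h
      · refine ⟨none, congrArg (K.f i) ?_⟩
        have : slit x = 0 := by ext k; fin_cases k <;> simp [slit, h]
        show shiftSquare b (slit x) = b
        rw [this]
        exact funext fun i => shiftInterval_zero _
      · refine ⟨some w, Eq.trans (congrArg (K.f i) ?_) hw⟩
        have : slit x = ![-1, 0] := by ext k; fin_cases k <;> simp [slit, h]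
        show shiftSquare b (slit x) = _
        rw [this]; rfl
    · obtain ⟨u, hu⟩ := K.e_bd j x hx
      exact ⟨some u, hu⟩
  f_bd := by
    intro j x hx
    obtain ⟨P, h1, -, hinj, hm, -, hP⟩ := K.exists_splitFaceMap hb i j
    rw [h1]
    have hold : ∀ y ∈ sphere (0 : Fin 2 → ℝ) 1,
        (∃ o : Option K.V, K.f j y = o.elim (K.f i b) K.v) ∨ ∃ o : Option K.E, ∃ z ∈ ball 0 1,
          K.f j y = (o.elim (K.f i ∘ shiftSquare b ∘ slit) K.e : (Fin 1 → ℝ) → X) z := by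
      intro y hy
      rcases K.f_bd j y hy with ⟨u, hu⟩ | ⟨j', z, hz, h⟩
      · exact Or.inl ⟨some u, hu⟩
      · exact Or.inr ⟨some j', z, hz, h⟩
    rcases hP with ⟨rfl, rfl⟩ | ⟨hj, rfl⟩
    · rcases slitSquare_sphere hx with h | ⟨s, hs0, hs1, h⟩
      · exact hold _ ((shiftSquare_mem_sphere hb).2 h)
      · rcases hs0.eq_or_lt with rfl | hs0
        · left
          refine ⟨none, congrArg (K.f j) ?_⟩
          show shiftSquare b (slitSquare x) = b
          have : (![-0, 0] : Fin 2 → ℝ) = 0 := by ext k; fin_cases k <;> simp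
          rw [h, this]
          exact funext fun i => shiftInterval_zero _
        · right
          refine ⟨none, fun _ => 2 * s - 1, mem_ball_fin_one.2 ⟨by linarith, by linarith⟩,
            congrArg (K.f j) ?_⟩
          show shiftSquare b (slitSquare x) = shiftSquare b (slit _)
          rw [h]; simp [slit]
    · exact hold x hx
  cover := by
    intro p
    rcases K.cover p with ⟨u, hu⟩ | ⟨j, y, hy, h⟩ | ⟨j, y, hy, h⟩
    · exact Or.inl ⟨some u, hu⟩
    · exact Or.inr (Or.inl ⟨some j, y, hy, h⟩)
    · by_cases hj : j = i
      · subst hj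
        obtain ⟨z, hz, rfl⟩ := exists_shiftSquare hb hy
        rcases slit_cases hz with rfl | ⟨x, hx, rfl⟩ | ⟨x, hx, rfl⟩
        · left
          refine ⟨none, h.trans (congrArg (K.f j) ?_)⟩
          exact funext fun i => shiftInterval_zero _
        · exact Or.inr (Or.inl ⟨none, x, hx, h⟩)
        · exact Or.inr (Or.inr ⟨j, x, hx, by simp [splitFaceMap, h]⟩)
      · exact Or.inr (Or.inr ⟨j, y, hy, by simp [splitFaceMap, hj, h]⟩)

lemma exists_splitEdge_chi {i : K.E} {t : Fin 1 → ℝ} (ht : t ∈ ball (0 : Fin 1 → ℝ) 1) :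
    (K.splitEdge i t ht).chi = K.chi := by
  have := K.finV
  have := K.finE
  show (Nat.card (Option K.V) : ℤ) - Nat.card (Option K.E) + Nat.card K.F = _
  rw [Finite.card_option, Finite.card_option, chi]
  push_cast; ring

lemma exists_splitFace_chi {i : K.F} {b : Fin 2 → ℝ} (hb : b ∈ ball (0 : Fin 2 → ℝ) 1) {w : K.V}
    (hw : K.f i (slitEnd b) = K.v w) : (K.splitFace i b hb w hw).chi = K.chi := by
  have := K.finV
  have := K.finE
  show (Nat.card (Option K.V) : ℤ) - Nat.card (Option K.E) + Nat.card K.F = _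
  rw [Finite.card_option, Finite.card_option, chi]
  push_cast; ring

/-- Subdivision making a point a vertex. -/
lemma exists_subdivision_point (p : X) :
    ∃ L : CellDec X, L.chi = K.chi ∧ range K.v ⊆ range L.v ∧ p ∈ range L.v := by
  rcases K.cover p with ⟨u, hu⟩ | ⟨j, y, hy, h⟩ | ⟨j, y, hy, h⟩
  · exact ⟨K, rfl, subset_rfl, u, hu.symm⟩
  · refine ⟨K.splitEdge j y hy, K.exists_splitEdge_chi hy, ?_, none, h.symm⟩
    rintro _ ⟨u, rfl⟩; exact ⟨some u, rfl⟩
  · rcases K.f_bd j _ (slitEnd_mem_sphere hy) with ⟨w, hw⟩ | ⟨i, t, ht, hw⟩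
    · refine ⟨K.splitFace j y hy w hw, K.exists_splitFace_chi hy hw, ?_, none, h.symm⟩
      rintro _ ⟨u, rfl⟩; exact ⟨some u, rfl⟩
    -- The slit ends in the interior of an edge. This edge is divided first at that point, which
    -- becomes the vertex `none`; the faces are unchanged by this division, so that `hw` still
    -- applies.
    · refine ⟨(K.splitEdge i t ht).splitFace j y hy none hw, ?_, ?_, none, h.symm⟩
      · exact ((K.splitEdge i t ht).exists_splitFace_chi (i := j) (w := none) hy hw).trans
          (K.exists_splitEdge_chi ht)
      · rintro _ ⟨u, rfl⟩; exact ⟨some (some u), rfl⟩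

/-- Subdivision making the points of a finite set vertices. -/
lemma exists_subdivision (B : Finset X) :
    ∃ L : CellDec X, L.chi = K.chi ∧ (B : Set X) ⊆ range L.v := by
  classical
  induction B using Finset.induction_on with
  | empty => exact ⟨K, rfl, by simp⟩
  | insert p B _ ih =>
    obtain ⟨L, h1, h2⟩ := ih
    obtain ⟨L', h1', h2', h3'⟩ := L.exists_subdivision_point p
    refine ⟨L', h1'.trans h1, ?_⟩
    rw [Finset.coe_insert]
    exact insert_subset h3' (h2.trans h2')

end CellDec

/-- The cells of a decomposition. -/
def CellDec.cellType.{u} {X : Type u} [TopologicalSpace X] (K : CellDec X) : ℕ → Type u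
  | 0 => K.V
  | 1 => K.E
  | 2 => K.F
  | _ => PEmpty

/-- The characteristic maps of a decomposition. -/
def CellDec.cellMap.{u} {X : Type u} [TopologicalSpace X] (K : CellDec X) :
    ∀ n, K.cellType n → (Fin n → ℝ) → X
  | 0, i => fun _ => K.v i
  | 1, i => K.e i
  | 2, i => K.f i
  | (_ + 3), i => PEmpty.elim i

/-- A decomposition as a family of cells. -/
def CellDec.toCells {X : Type*} [TopologicalSpace X] (K : CellDec X) : Cells X where
  cell := K.cellType
  map := K.cellMap
  cont := by
    rintro (_ | _ | _ | n) i
    · exact continuousOn_const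
    · exact K.e_cont i
    · exact K.f_cont i
    · exact PEmpty.elim i
  inj := by
    rintro (_ | _ | _ | n) (_ | _ | _ | m) i j x y hx hy h
    any_goals first | exact (show PEmpty from i).elim | exact (show PEmpty from j).elim | skip
    · obtain rfl := K.v_inj _ _ h
      rw [Subsingleton.elim x y]
    · exact absurd h (K.v_e _ _ _ hy)
    · exact absurd h (K.v_f _ _ _ hy)
    · exact absurd h.symm (K.v_e _ _ _ hx)
    · obtain ⟨rfl, rfl⟩ := K.e_inj _ _ _ hx _ hy h
      rfl
    · exact absurd h (K.e_f _ _ _ hx _ hy)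
    · exact absurd h.symm (K.v_f _ _ _ hx)
    · exact absurd h.symm (K.e_f _ _ _ hy _ hx)
    · obtain ⟨rfl, rfl⟩ := K.f_inj _ _ _ hx _ hy h
      rfl
  bd := by
    rintro (_ | _ | _ | n) i x hx
    · rw [mem_sphere_zero_iff_norm, Subsingleton.elim x 0, norm_zero] at hx; exact absurd hx zero_ne_one
    · obtain ⟨j, hj⟩ := K.e_bd i x hx
      exact ⟨0, by norm_num, j, 0, by simp, hj⟩
    · rcases K.f_bd i x hx with ⟨j, hj⟩ | ⟨j, y, hy, hj⟩
      · exact ⟨0, by norm_num, j, 0, by simp, hj⟩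
      · exact ⟨1, by norm_num, j, y, hy, hj⟩
    · exact PEmpty.elim i
  cover := by
    intro p
    rcases K.cover p with ⟨j, h⟩ | ⟨j, y, hy, h⟩ | ⟨j, y, hy, h⟩
    · exact ⟨0, j, 0, by simp, h.symm⟩
    · exact ⟨1, j, y, hy, h.symm⟩
    · exact ⟨2, j, y, hy, h.symm⟩

/-- The decomposition given by a finite CW complex of dimension at most `2`. -/
lemma HasEulerCharacteristic.exists_cellDec {X : Type*} [TopologicalSpace X] {χ : ℤ}
    (h : HasEulerCharacteristic X χ) : ∃ K : CellDec X, K.chi = χ := by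
  obtain ⟨K, hfin, hemp, rfl⟩ := h
  have hsrc : ∀ n (i : K.cell n), (K.map n i).source = ball 0 1 := K.source_eq
  have hinj : ∀ n (i : K.cell n), InjOn (K.map n i) (ball 0 1) := fun n i => by
    rw [← hsrc n i]; exact (K.map n i).injOn
  have hdisj : ∀ {n m : ℕ} {i : K.cell n} {j : K.cell m} {x y}, x ∈ ball 0 1 → y ∈ ball 0 1 →
      K.map n i x = K.map m j y → (⟨n, i⟩ : Σ n, K.cell n) = ⟨m, j⟩ := by
    intro n m i j x y hx hy hxy
    by_contra hne
    exact (K.pairwiseDisjoint' (mem_univ ⟨n, i⟩) (mem_univ ⟨m, j⟩) hne).le_bot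
      ⟨⟨x, hx, rfl⟩, ⟨y, hy, hxy.symm⟩⟩
  have hcov : ∀ p, ∃ n i, ∃ x ∈ ball 0 1, p = K.map n i x := by
    intro p
    have := mem_univ p
    rw [← CWComplex.iUnion_openCell_eq_complex (C := (univ : Set X))] at this
    simp only [mem_iUnion] at this
    obtain ⟨n, i, x, hx, h⟩ := this
    exact ⟨n, i, x, hx, h.symm⟩
  have hbd : ∀ n (i : K.cell n), ∀ x ∈ sphere 0 1, ∃ m < n, ∃ j, ∃ y ∈ ball 0 1,
      K.map n i x = K.map m j y := by
    intro n i x hx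
    obtain ⟨I, hI⟩ := CWComplex.cellFrontier_subset_finite_openCell (C := (univ : Set X)) n i
    have := hI ⟨x, hx, rfl⟩
    simp only [mem_iUnion] at this
    obtain ⟨m, hm, j, -, y, hy, h⟩ := this
    exact ⟨m, hm, j, y, hy, h.symm⟩
  have h00 : ∀ x : Fin 0 → ℝ, x ∈ ball (0 : Fin 0 → ℝ) 1 := fun x => by
    rw [Subsingleton.elim x 0]; simp
  refine ⟨⟨K.cell 0, K.cell 1, K.cell 2, hfin 0, hfin 1, hfin 2, fun i => K.map 0 i 0,
    fun i => K.map 1 i, fun i => K.map 2 i, K.continuousOn 1, K.continuousOn 2, ?_, ?_, ?_, ?_, ?_,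
    ?_, ?_, ?_, ?_⟩, rfl⟩
  · intro i j h
    simpa using hdisj (h00 0) (h00 0) h
  · intro i j x hx y hy h
    have h1 : i = j := by simpa using hdisj hx hy h
    subst h1
    exact ⟨rfl, hinj _ _ hx hy h⟩
  · intro i j x hx y hy h
    have h1 : i = j := by simpa using hdisj hx hy h
    subst h1
    exact ⟨rfl, hinj _ _ hx hy h⟩
  · intro i j x hx h
    simpa using congrArg Sigma.fst (hdisj (h00 0) hx h)
  · intro i j x hx h
    simpa using congrArg Sigma.fst (hdisj (h00 0) hx h)
  · intro i j x hx y hy h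
    simpa using congrArg Sigma.fst (hdisj hx hy h)
  · intro i x hx
    obtain ⟨m, hm, j, y, hy, h⟩ := hbd 1 i x hx
    obtain rfl : m = 0 := by omega
    exact ⟨j, by rw [h, Subsingleton.elim y 0]⟩
  · intro i x hx
    obtain ⟨m, hm, j, y, hy, h⟩ := hbd 2 i x hx
    obtain rfl | rfl : m = 0 ∨ m = 1 := by omega
    · exact Or.inl ⟨j, by rw [h, Subsingleton.elim y 0]⟩
    · exact Or.inr ⟨j, y, hy, h⟩
  · intro p
    obtain ⟨n, i, x, hx, h⟩ := hcov p
    rcases n with _ | _ | _ | n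
    · exact Or.inl ⟨i, by rw [h, Subsingleton.elim x 0]⟩
    · exact Or.inr (Or.inl ⟨i, x, hx, h⟩)
    · exact Or.inr (Or.inr ⟨i, x, hx, h⟩)
    · exact ((hemp (n + 3) (by omega)).false i).elim

/-- The Riemann-Hurwitz formula: the Euler characteristic of a covering with fibers of cardinality
`d`, ramified over the points of `B`. -/
theorem HasEulerCharacteristic.of_ramified.{u} {C F : Type u} [TopologicalSpace C]
    [TopologicalSpace F] [T2Space F] [CompactSpace F] [T2Space C] {ρ : F → C} {B : Finset C} {χ : ℤ}
    (hχ : HasEulerCharacteristic C χ) (hρ : Continuous ρ) (hfin : ∀ q, (ρ ⁻¹' {q}).Finite)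
    (hloc : IsLocalHomeomorphOn ρ (ρ ⁻¹' (B : Set C)ᶜ)) {d : ℕ}
    (hd : ∀ q ∉ B, Nat.card (ρ ⁻¹' {q}) = d) :
    HasEulerCharacteristic F (χ * d + ∑ b ∈ B, ((Nat.card (ρ ⁻¹' {b}) : ℤ) - d)) := by
  classical
  have cov : IsCoveringMapOn ρ (B : Set C)ᶜ := IsCoveringMapOn.of_isLocalHomeomorphOn hρ hloc
  obtain ⟨K₀, rfl⟩ := hχ.exists_cellDec
  obtain ⟨K, hK, hB⟩ := K₀.exists_subdivision B
  rw [← hK]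
  -- After the subdivision the points of `B` are vertices, hence no open cell of positive dimension
  -- meets `B`.
  have hs : ∀ n, n ≠ 0 → ∀ i, ∀ x ∈ ball 0 1, K.toCells.map n i x ∈ (B : Set C)ᶜ := by
    intro n hn i x hx hxB
    obtain ⟨j, hj⟩ := hB hxB
    have := K.toCells.inj (n := 0) (i := j) (x := 0) (by simp) hx hj
    exact hn (congrArg Sigma.fst this).symm
  obtain ⟨L, hL⟩ := K.toCells.exists_lifted hρ hfin cov hs
  have hfinK : ∀ n, Finite (K.toCells.cell n) := by
    rintro (_ | _ | _ | n)
    · exact K.finV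
    · exact K.finE
    · exact K.finF
    · exact inferInstanceAs (Finite PEmpty)
  have hfib : ∀ q, Finite (ρ ⁻¹' {q}) := fun q => hfin q
  have hcard : ∀ n, n ≠ 0 → Nat.card (L.cell n) = Nat.card (K.toCells.cell n) * d := by
    intro n hn
    have := hfinK n
    have := Fintype.ofFinite (K.toCells.cell n)
    rw [hL, Nat.card_sigma, Finset.sum_congr rfl (fun i _ => hd _ (hs n hn i 0 (by simp))),
      Finset.sum_const, Finset.card_univ, smul_eq_mul, Nat.card_eq_fintype_card]
  have hcard0 : (Nat.card (L.cell 0) : ℤ) = Nat.card K.V * d +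
      ∑ b ∈ B, ((Nat.card (ρ ⁻¹' {b}) : ℤ) - d) := by
    have := K.finV
    have := Fintype.ofFinite K.V
    have h1 : Nat.card (L.cell 0) = ∑ i : K.V, Nat.card (ρ ⁻¹' {K.v i}) := by
      rw [hL]; exact Nat.card_sigma (β := fun i : K.V => ρ ⁻¹' {K.v i})
    -- A vertex outside `B` contributes zero, so the correction may be summed over all vertices.
    have h2 : ∑ b ∈ B, ((Nat.card (ρ ⁻¹' {b}) : ℤ) - d) =
        ∑ b ∈ Finset.univ.image K.v, ((Nat.card (ρ ⁻¹' {b}) : ℤ) - d) := by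
      refine Finset.sum_subset ?_ ?_
      · intro b hb
        obtain ⟨i, hi⟩ := hB hb
        exact Finset.mem_image.2 ⟨i, Finset.mem_univ _, hi⟩
      · intro b _ hb
        rw [hd b hb, sub_self]
    rw [h1, h2, Finset.sum_image (fun i _ j _ h => K.v_inj i j h), Finset.sum_sub_distrib,
      Finset.sum_const, Finset.card_univ, Nat.card_eq_fintype_card]
    push_cast
    simp
  have h := L.hasEulerCharacteristic (fun n => by
    rw [hL]; have := hfinK n; infer_instance) (fun n hn => by
    rw [hL]
    refine ⟨fun ⟨i, _⟩ => ?_⟩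
    obtain ⟨m, rfl⟩ := Nat.exists_eq_add_of_le' hn
    exact PEmpty.elim i)
  convert h using 1
  rw [hcard 1 one_ne_zero, hcard 2 two_ne_zero, hcard0, CellDec.chi]
  show _ = _ + _ - ((Nat.card K.E * d : ℕ) : ℤ) + ((Nat.card K.F * d : ℕ) : ℤ)
  push_cast; ring

end MilnorBoundary


namespace MilnorBoundary

/-! ### Cyclic ramified covers -/

/-- `π : E → C` is a ramified cover whose fibers are the orbits of the homeomorphism `T`, the fiber
over `q` having `d q` points. -/
structure IsCyclicCover {E C : Type*} [TopologicalSpace E] [TopologicalSpace C] (π : E → C)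
    (T : E ≃ₜ E) (d : C → ℕ) : Prop where
  continuous : Continuous π
  isOpenMap : IsOpenMap π
  isClosedMap : IsClosedMap π
  surjective : Function.Surjective π
  map_shift : ∀ s, π (T s) = π s
  transitive : ∀ s t, π s = π t → ∃ a : ℤ, (T ^ a) s = t
  period : ∀ s (a : ℤ), (T ^ a) s = s ↔ (d (π s) : ℤ) ∣ a
  pos : ∀ q, 0 < d q
  label : ∀ q, ∃ N, IsOpen N ∧ q ∈ N ∧ ∃ lam : E → ZMod (d q),
    (∀ i, IsOpen {s | π s ∈ N ∧ lam s = i}) ∧ ∀ s, π s ∈ N → lam (T s) = lam s + 1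

namespace IsCyclicCover

variable {E C : Type*} [TopologicalSpace E] [TopologicalSpace C] {π : E → C}
  {T : E ≃ₜ E} {d : C → ℕ}

lemma zpow_add_apply (T : E ≃ₜ E) (a b : ℤ) (s : E) : (T ^ (a + b)) s = (T ^ a) ((T ^ b) s) := by
  rw [zpow_add]; rfl

lemma zpow_induction {P : ℤ → Prop} (h0 : P 0) (h1 : ∀ a, P a ↔ P (a + 1)) (a : ℤ) : P a := by
  induction a using Int.induction_on with
  | zero => exact h0
  | succ i ih => exact (h1 _).1 ih
  | pred i ih => exact (h1 _).2 (by simpa using ih)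

variable (h : IsCyclicCover π T d)
include h

lemma map_zpow (a : ℤ) (s : E) : π ((T ^ a) s) = π s := by
  refine zpow_induction (P := fun a => π ((T ^ a) s) = π s) (by simp) (fun a => ?_) a
  rw [add_comm, zpow_add_apply, zpow_one, h.map_shift]

lemma label_zpow {n : ℕ} {N : Set C} {lam : E → ZMod n}
    (hlam : ∀ s, π s ∈ N → lam (T s) = lam s + 1) (a : ℤ) {s : E} (hs : π s ∈ N) :
    lam ((T ^ a) s) = lam s + a := by
  refine zpow_induction (P := fun a => lam ((T ^ a) s) = lam s + a) (by simp) (fun a => ?_) a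
  rw [add_comm a 1, zpow_add_apply, zpow_one, hlam _ (by rwa [h.map_zpow])]
  push_cast
  constructor
  · intro h; rw [h]; ring
  · intro h; linear_combination h

/-- Labels modulo the number of points of a fiber are reduced modulo a common divisor `n`. These
reductions are what separates the orbits of `T ^ n` in a fiber. -/
lemma exists_label_of_dvd {n : ℕ} (hn : ∀ q, n ∣ d q) (q : C) :
    ∃ N, IsOpen N ∧ q ∈ N ∧ ∃ lam : E → ZMod n,
    (∀ i, IsOpen {s | π s ∈ N ∧ lam s = i}) ∧ ∀ s, π s ∈ N → lam (T s) = lam s + 1 := by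
  obtain ⟨N, hN, hq, lam, h1, h2⟩ := h.label q
  refine ⟨N, hN, hq, fun s => ZMod.castHom (hn q) (ZMod n) (lam s), fun i => ?_, fun s hs => ?_⟩
  · have : {s | π s ∈ N ∧ ZMod.castHom (hn q) (ZMod n) (lam s) = i} =
        ⋃ j ∈ {j | ZMod.castHom (hn q) (ZMod n) j = i}, {s | π s ∈ N ∧ lam s = j} := by
      ext s
      simp only [mem_ofPred_eq, mem_iUnion, exists_prop]
      constructor
      · rintro ⟨a, b⟩; exact ⟨_, b, a, rfl⟩
      · rintro ⟨j, b, a, rfl⟩; exact ⟨a, b⟩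
    rw [this]
    exact isOpen_biUnion fun j _ => h1 j
  · show ZMod.castHom (hn q) (ZMod n) (lam (T s)) = _
    rw [h2 s hs, map_add, map_one]

lemma finite_fiber (q : C) : (π ⁻¹' {q}).Finite := by
  obtain ⟨s, rfl⟩ := h.surjective q
  refine ((Set.finite_lt_nat (d (π s))).image fun a : ℕ => (T ^ (a : ℤ)) s).subset ?_
  intro t ht
  obtain ⟨a, rfl⟩ := h.transitive s t (Eq.symm ht)
  have hpos : (0 : ℤ) < d (π s) := by exact_mod_cast h.pos (π s)
  refine ⟨(a % d (π s)).toNat, ?_, ?_⟩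
  · show (a % d (π s)).toNat < d (π s)
    have := Int.emod_lt_of_pos a hpos
    have := Int.emod_nonneg a hpos.ne'
    omega
  · have h1 : (T ^ ((d (π s) : ℤ) * (a / d (π s)))) s = s := (h.period s _).2 (dvd_mul_right _ _)
    show (T ^ (((a % d (π s)).toNat : ℕ) : ℤ)) s = (T ^ a) s
    rw [Int.toNat_of_nonneg (Int.emod_nonneg a hpos.ne')]
    conv_rhs => rw [← Int.emod_add_mul_ediv a (d (π s)), zpow_add_apply, h1]

/-- The orbit relation of `T ^ n`. -/
def orbitSetoid (T : E ≃ₜ E) (n : ℕ) : Setoid E where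
  r s t := ∃ b : ℤ, (T ^ ((n : ℤ) * b)) s = t
  iseqv := by
    refine ⟨fun s => ⟨0, by simp⟩, ?_, ?_⟩
    · rintro s t ⟨b, rfl⟩
      exact ⟨-b, by rw [← zpow_add_apply]; simp⟩
    · rintro s t u ⟨b, rfl⟩ ⟨c, rfl⟩
      exact ⟨c + b, by rw [← zpow_add_apply, mul_add]⟩

omit h in
lemma isOpenMap_orbit (T : E ≃ₜ E) (n : ℕ) : IsOpenMap (Quotient.mk (orbitSetoid T n)) := by
  intro V hV
  have hq : IsQuotientMap (Quotient.mk (orbitSetoid T n)) := isQuotientMap_quot_mk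
  rw [← hq.isOpen_preimage]
  have : Quotient.mk (orbitSetoid T n) ⁻¹' (Quotient.mk (orbitSetoid T n) '' V) =
      ⋃ b : ℤ, (T ^ ((n : ℤ) * b)) '' V := by
    ext t
    simp only [mem_preimage, mem_image, mem_iUnion]
    constructor
    · rintro ⟨s, hs, hst⟩
      obtain ⟨b, hb⟩ := Quotient.exact hst
      exact ⟨b, s, hs, hb⟩
    · rintro ⟨b, s, hs, hb⟩
      exact ⟨s, hs, Quotient.sound ⟨b, hb⟩⟩
  rw [this]
  exact isOpen_iUnion fun b => (T ^ ((n : ℤ) * b)).isOpenMap V hV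

/-- The projection of the quotient by `T ^ n`. -/
def quotientMap (n : ℕ) : Quotient (orbitSetoid T n) → C :=
  Quotient.lift π (by rintro s t ⟨b, rfl⟩; exact (h.map_zpow _ _).symm)

lemma mk_eq_iff {n : ℕ} (hn : ∀ q, n ∣ d q) {s : E} {a : ℤ} :
    Quotient.mk (orbitSetoid T n) ((T ^ a) s) = Quotient.mk (orbitSetoid T n) s ↔ (n : ℤ) ∣ a := by
  rw [Quotient.eq]
  constructor
  · rintro ⟨b, hb⟩
    rw [← zpow_add_apply, h.period] at hb
    have := (Int.natCast_dvd_natCast.2 (hn (π s))).trans hb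
    exact (Int.dvd_add_right (dvd_mul_right _ _)).1 this
  · rintro ⟨b, rfl⟩
    exact ⟨-b, by rw [← zpow_add_apply]; simp⟩

/-- As `n` divides every `d q`, the power `T ^ n` has exactly `n` orbits in each fiber, and the
ramification disappears. The label modulo `n` descends to the quotient and gives local sheets on
which the projection is injective. The projection is also closed with finite fibers, whence a
covering. -/
lemma isCoveringMap_quotientMap [T2Space C] {n : ℕ} (hn0 : 0 < n) (hn : ∀ q, n ∣ d q) :
    IsCoveringMap (h.quotientMap n) := by
  have : NeZero n := ⟨hn0.ne'⟩
  have hcont : Continuous (h.quotientMap n) := continuous_quot_lift _ h.continuous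
  have hmk : Continuous (Quotient.mk (orbitSetoid T n)) := continuous_quot_mk
  have hopen : IsOpenMap (h.quotientMap n) := by
    intro V hV
    have : h.quotientMap n '' V = π '' (Quotient.mk (orbitSetoid T n) ⁻¹' V) := by
      ext x; constructor
      · rintro ⟨y, hy, rfl⟩
        obtain ⟨s, rfl⟩ := Quotient.exists_rep y
        exact ⟨s, hy, rfl⟩
      · rintro ⟨s, hs, rfl⟩
        exact ⟨_, hs, rfl⟩
    rw [this]
    exact h.isOpenMap _ (hV.preimage hmk)
  have hclosed : IsClosedMap (h.quotientMap n) := by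
    intro V hV
    have : h.quotientMap n '' V = π '' (Quotient.mk (orbitSetoid T n) ⁻¹' V) := by
      ext x; constructor
      · rintro ⟨y, hy, rfl⟩
        obtain ⟨s, rfl⟩ := Quotient.exists_rep y
        exact ⟨s, hy, rfl⟩
      · rintro ⟨s, hs, rfl⟩
        exact ⟨_, hs, rfl⟩
    rw [this]
    exact h.isClosedMap _ (hV.preimage hmk)
  choose N hN hqN lam hlo hlam using h.exists_label_of_dvd hn
  -- The set `O q i` is the sheet of label `i` near `q`. It comes from a set which is saturated for
  -- the orbit relation, as `T ^ n` does not change labels modulo `n`.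
  let O : C → ZMod n → Set (Quotient (orbitSetoid T n)) := fun q i =>
    Quotient.mk (orbitSetoid T n) '' {s | π s ∈ N q ∧ lam q s = i}
  have hO : ∀ q i, IsOpen (O q i) := fun q i => isOpenMap_orbit T n _ (hlo q i)
  have hsat : ∀ q i s, Quotient.mk (orbitSetoid T n) s ∈ O q i → π s ∈ N q ∧ lam q s = i := by
    rintro q i s ⟨t, ⟨ht, hi⟩, hts⟩
    obtain ⟨b, rfl⟩ := Quotient.exact hts
    refine ⟨by rwa [h.map_zpow], ?_⟩
    rw [h.label_zpow (hlam q) _ ht, hi]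
    simp
  have hlamq : ∀ q s t, π s = π t → π s ∈ N q → lam q s = lam q t →
      Quotient.mk (orbitSetoid T n) s = Quotient.mk (orbitSetoid T n) t := by
    intro q s t hst hs hl
    obtain ⟨a, rfl⟩ := h.transitive s t hst
    rw [h.label_zpow (hlam q) a hs, left_eq_add, ZMod.intCast_zmod_eq_zero_iff_dvd] at hl
    exact ((h.mk_eq_iff hn).2 hl).symm
  have hT2 : T2Space (Quotient (orbitSetoid T n)) := by
    refine ⟨fun x y hxy => ?_⟩
    obtain ⟨s, rfl⟩ := Quotient.exists_rep x
    obtain ⟨t, rfl⟩ := Quotient.exists_rep y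
    by_cases hst : π s = π t
    · refine ⟨O (π s) (lam (π s) s), O (π s) (lam (π s) t), hO _ _, hO _ _,
        ⟨s, ⟨hqN _, rfl⟩, rfl⟩, ⟨t, ⟨by rw [← hst]; exact hqN _, rfl⟩, rfl⟩, ?_⟩
      rw [Set.disjoint_left]
      intro z hz hz'
      obtain ⟨u, rfl⟩ := Quotient.exists_rep z
      exact hxy (hlamq (π s) s t hst (hqN _) ((hsat _ _ _ hz).2.symm.trans (hsat _ _ _ hz').2))
    · obtain ⟨U, V, hU, hV, hsU, htV, hd⟩ := t2_separation hst
      exact ⟨h.quotientMap n ⁻¹' U, h.quotientMap n ⁻¹' V, hU.preimage hcont, hV.preimage hcont,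
        hsU, htV, hd.preimage _⟩
  have hloc : IsLocalHomeomorph (h.quotientMap n) := by
    rw [isLocalHomeomorph_iff_isOpenEmbedding_restrict]
    intro x
    obtain ⟨s, rfl⟩ := Quotient.exists_rep x
    have hm : Quotient.mk (orbitSetoid T n) s ∈ O (π s) (lam (π s) s) := ⟨s, ⟨hqN _, rfl⟩, rfl⟩
    refine ⟨O (π s) (lam (π s) s), (hO _ _).mem_nhds hm, ?_⟩
    refine IsOpenEmbedding.of_continuous_injective_isOpenMap
      (hcont.comp continuous_subtype_val) ?_ (hopen.comp (hO _ _).isOpenMap_subtype_val)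
    rintro ⟨x, hx⟩ ⟨y, hy⟩ hxy
    obtain ⟨t, rfl⟩ := Quotient.exists_rep x
    obtain ⟨u, rfl⟩ := Quotient.exists_rep y
    exact Subtype.ext (hlamq (π s) t u hxy (hsat _ _ _ hx).1
      ((hsat _ _ _ hx).2.trans (hsat _ _ _ hy).2.symm))
  rw [isCoveringMap_iff_isCoveringMapOn_univ]
  refine hclosed.isCoveringMapOn_of_isLocalHomeomorphOn (fun q _ => ?_)
    (isLocalHomeomorph_iff_isLocalHomeomorphOn_univ.1 hloc |>.mono (subset_univ _))
  refine ((h.finite_fiber q).image (Quotient.mk (orbitSetoid T n))).subset ?_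
  intro x hx
  obtain ⟨s, rfl⟩ := Quotient.exists_rep x
  exact ⟨s, hx, rfl⟩

/-- Loops acting trivially on the quotient by `T ^ n` detect the components of the cover. -/
lemma dvd_of_joined [T2Space C] {n : ℕ} (hn0 : 0 < n) (hn : ∀ q, n ∣ d q)
    {ι : Type*} {p : C} {α : ι → Path p p}
    (hgen : Subgroup.closure (Set.range fun i =>
      FundamentalGroup.fromPath (Path.Homotopic.Quotient.mk (α i))) = ⊤)
    {δ : ι → ℤ} (hδ : ∀ i s, π s = p → ∃ Γ : C(unitInterval, E), Γ 0 = s ∧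
      (∀ t, π (Γ t) = α i t) ∧ Γ 1 = (T ^ (δ i)) s)
    (hnδ : ∀ i, (n : ℤ) ∣ δ i) {s : E} (hs : π s = p) {a : ℤ} (hj : Joined s ((T ^ a) s)) :
    (n : ℤ) ∣ a := by
  have cov := h.isCoveringMap_quotientMap hn0 hn
  have hmk : Continuous (Quotient.mk (orbitSetoid T n)) := continuous_quot_mk
  -- The monodromy of the quotient along `γ` is computed by projecting any lift of `γ` to the
  -- ramified cover.
  have key : ∀ (γ : Path p p) (t : E) (ht : π t = p) (Γ : C(unitInterval, E)), Γ 0 = t →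
      (∀ τ, π (Γ τ) = γ τ) →
      (cov.monodromyPerm p (FundamentalGroup.fromPath (Path.Homotopic.Quotient.mk γ))
        ⟨Quotient.mk _ t, ht⟩).1 = Quotient.mk _ (Γ 1) := by
    intro γ t ht Γ h0 hΓ
    have := (cov.eq_liftPath_iff' (γ := γ.toContinuousMap) (e := Quotient.mk _ t)
      (γ.source.trans ht.symm) (Γ := (⟨_, hmk⟩ : C(E, Quotient (orbitSetoid T n))).comp Γ)).2
      ⟨funext fun τ => hΓ τ, congrArg _ h0⟩
    exact (DFunLike.congr_fun this 1).symm
  -- A generator moves a point of `E` by `T ^ (δ i)`, which is trivial in the quotient since `n ∣ δ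
  -- i`. The monodromy is thus trivial on the whole fundamental group.
  have htriv : ∀ g, cov.monodromyPerm p g = 1 := by
    have : (⊤ : Subgroup (FundamentalGroup C p)) ≤ (cov.monodromyPerm p).ker := by
      rw [← hgen, Subgroup.closure_le]
      rintro _ ⟨i, rfl⟩
      rw [SetLike.mem_coe, MonoidHom.mem_ker]
      ext ⟨x, hx⟩
      obtain ⟨t, rfl⟩ := Quotient.exists_rep x
      obtain ⟨Γ, h0, hΓ, h1⟩ := hδ i t hx
      rw [key (α i) t hx Γ h0 hΓ, h1]
      exact (h.mk_eq_iff hn).2 (hnδ i)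
    intro g
    exact this (Subgroup.mem_top g)
  -- A path from `s` to `T ^ a s` projects to a loop of `C`, possibly through ramification points.
  -- Trivial monodromy then gives both ends the same class in the quotient.
  obtain ⟨Γ⟩ := hj
  have h1 := key ((Γ.map h.continuous).cast hs.symm (by rw [h.map_zpow, hs])) s hs Γ.toContinuousMap
    Γ.source (fun τ => rfl)
  rw [htriv] at h1
  have h2 : (Γ.toContinuousMap 1) = (T ^ a) s := Γ.target
  rw [h2] at h1
  exact (h.mk_eq_iff hn).1 h1.symm

/-- The components of `E` are clopen by local connectedness. As the projection is both open and
closed, the image of a component is clopen in the connected space `C`. -/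
lemma exists_mem_component [PreconnectedSpace C] [LocallyConnectedSpace E] (s : E) (q : C) :
    ∃ t, π t = q ∧ ConnectedComponents.mk t = ConnectedComponents.mk s := by
  have : π '' connectedComponent s = univ := by
    refine IsClopen.eq_univ ⟨h.isClosedMap _ isClosed_connectedComponent,
      h.isOpenMap _ isOpen_connectedComponent⟩ ⟨_, s, mem_connectedComponent, rfl⟩
  obtain ⟨t, ht, rfl⟩ : q ∈ π '' connectedComponent s := by rw [this]; trivial
  exact ⟨t, rfl, ConnectedComponents.coe_eq_coe'.2 ht⟩

omit h in
lemma mk_zpow_eq (T : E ≃ₜ E) (a : ℤ) {s t : E}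
    (hst : ConnectedComponents.mk s = ConnectedComponents.mk t) :
    ConnectedComponents.mk ((T ^ a) s) = ConnectedComponents.mk ((T ^ a) t) :=
  congrArg (T ^ a).continuous.connectedComponentsMap hst

/-- Each component meets the fiber of `s'`, on which the powers of `T` act transitively. Since they
commute, fixing one component means fixing all. -/
lemma mk_zpow_eq_self [PreconnectedSpace C] [LocallyConnectedSpace E] {a : ℤ} {s : E}
    (hs : ConnectedComponents.mk ((T ^ a) s) = ConnectedComponents.mk s) (s' : E) :
    ConnectedComponents.mk ((T ^ a) s') = ConnectedComponents.mk s' := by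
  obtain ⟨t, ht, hts⟩ := h.exists_mem_component s (π s')
  obtain ⟨b, rfl⟩ := h.transitive t s' ht
  rw [← zpow_add_apply, add_comm, zpow_add_apply]
  apply mk_zpow_eq
  rw [mk_zpow_eq T a hts, hs, hts]

/-- The components of a cyclic cover. -/
theorem mk_zpow_eq_iff [T2Space C] [PreconnectedSpace C] [LocallyPathConnectedSpace E] {n : ℕ}
    (hn0 : 0 < n) (hn : ∀ q, n ∣ d q) {ι : Type*} {p : C} {α : ι → Path p p}
    (hgen : Subgroup.closure (Set.range fun i =>
      FundamentalGroup.fromPath (Path.Homotopic.Quotient.mk (α i))) = ⊤)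
    {δ : ι → ℤ} (hδ : ∀ i s, π s = p → ∃ Γ : C(unitInterval, E), Γ 0 = s ∧
      (∀ t, π (Γ t) = α i t) ∧ Γ 1 = (T ^ (δ i)) s)
    (hnδ : ∀ i, (n : ℤ) ∣ δ i)
    (hmax : ∀ l : ℕ, (∀ q, l ∣ d q) → (∀ i, (l : ℤ) ∣ δ i) → l ∣ n) (s : E) (a : ℤ) :
    ConnectedComponents.mk ((T ^ a) s) = ConnectedComponents.mk s ↔ (n : ℤ) ∣ a := by
  constructor
  · intro hs
    obtain ⟨t, ht, hts⟩ := h.exists_mem_component s p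
    have h1 := h.mk_zpow_eq_self hs t
    rw [ConnectedComponents.coe_eq_coe, ← pathComponent_eq_connectedComponent,
      ← pathComponent_eq_connectedComponent] at h1
    have h2 : Joined t ((T ^ a) t) := by
      have : (T ^ a) t ∈ pathComponent t := by rw [← h1]; exact mem_pathComponent_self _
      exact this
    exact h.dvd_of_joined hn0 hn hgen hδ hnδ ht h2
  -- The powers of `T` fixing all components form a subgroup `lℤ`. It contains each `d q`, because
  -- `T ^ d q` fixes the points over `q`, and each `δ i`, because a lift of the loop is a path; then
  -- `l ∣ n` by the maximality of `n`.
  · let H : AddSubgroup ℤ :=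
      { carrier := {a | ∀ s, ConnectedComponents.mk ((T ^ a) s) = ConnectedComponents.mk s}
        zero_mem' := fun s => by simp
        add_mem' := fun {a b} ha hb s => by rw [zpow_add_apply, ha, hb]
        neg_mem' := fun {a} ha s => by
          rw [← ha ((T ^ (-a)) s), ← zpow_add_apply]; simp }
    obtain ⟨l, hl⟩ := Int.subgroup_cyclic H
    have hmem : ∀ b, b ∈ H ↔ l ∣ b := by
      intro b
      rw [hl, ← AddSubgroup.zmultiples_eq_closure, Int.mem_zmultiples_iff]
    have h1 : ∀ q, (l.natAbs) ∣ d q := by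
      intro q
      obtain ⟨t, ht⟩ := h.surjective q
      rw [← Int.natCast_dvd_natCast, Int.natAbs_dvd, ← hmem]
      have : (T ^ (d q : ℤ)) t = t := (h.period t _).2 (by rw [ht])
      exact fun s' => h.mk_zpow_eq_self (congrArg _ this) s'
    have h2 : ∀ i, ((l.natAbs : ℕ) : ℤ) ∣ δ i := by
      intro i
      obtain ⟨t, ht⟩ := h.surjective p
      rw [Int.natAbs_dvd, ← hmem]
      obtain ⟨Γ, g0, -, g1⟩ := hδ i t ht
      refine fun s' => h.mk_zpow_eq_self (s := t) ?_ s'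
      rw [← g1, ConnectedComponents.coe_eq_coe']
      have : IsPreconnected (range Γ) := isPreconnected_range Γ.continuous
      exact this.subset_connectedComponent ⟨0, g0⟩ ⟨1, rfl⟩
    intro ha
    have h3 : a ∈ H := by
      rw [hmem, ← Int.natAbs_dvd]
      exact (Int.natCast_dvd_natCast.2 (hmax _ h1 h2)).trans ha
    exact h3 s

lemma exists_component_eq [PreconnectedSpace C] [LocallyConnectedSpace E] (s₀ s : E) :
    ∃ a : ℤ, ConnectedComponents.mk ((T ^ a) s₀) = ConnectedComponents.mk s := by
  obtain ⟨t, ht, hts⟩ := h.exists_mem_component s₀ (π s)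
  obtain ⟨a, rfl⟩ := h.transitive t s ht
  exact ⟨a, mk_zpow_eq T a hts.symm⟩

/-- The components of a cyclic cover are cyclically indexed. -/
theorem exists_equiv_zmod [PreconnectedSpace C] [LocallyConnectedSpace E] [Nonempty E] {n : ℕ}
    (hmk : ∀ (s : E) (a : ℤ),
      ConnectedComponents.mk ((T ^ a) s) = ConnectedComponents.mk s ↔ (n : ℤ) ∣ a) :
    ∃ e : ConnectedComponents E ≃ ZMod n, ∀ s, e (ConnectedComponents.mk (T s)) =
      e (ConnectedComponents.mk s) + 1 := by
  obtain ⟨s₀⟩ := ‹Nonempty E›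
  have hiff : ∀ a b : ℤ, ConnectedComponents.mk ((T ^ a) s₀) = ConnectedComponents.mk ((T ^ b) s₀) ↔
      (a : ZMod n) = b := by
    intro a b
    have : (T ^ a) s₀ = (T ^ (a - b)) ((T ^ b) s₀) := by rw [← zpow_add_apply]; simp
    rw [this, hmk, eq_comm, ZMod.intCast_eq_intCast_iff_dvd_sub]
  let e : ZMod n ≃ ConnectedComponents E := Equiv.ofBijective
    (fun i => ConnectedComponents.mk ((T ^ (i.cast : ℤ)) s₀)) ⟨fun i j hij => by
      have := (hiff _ _).1 hij
      simpa using this, fun κ => by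
      obtain ⟨s, rfl⟩ := ConnectedComponents.surjective_coe κ
      obtain ⟨a, ha⟩ := h.exists_component_eq s₀ s
      exact ⟨a, by rw [← ha]; exact (hiff _ _).2 (by simp)⟩⟩
  have he : ∀ a : ℤ, e.symm (ConnectedComponents.mk ((T ^ a) s₀)) = a := by
    intro a
    rw [Equiv.symm_apply_eq]
    exact (hiff _ _).2 (by simp)
  refine ⟨e.symm, fun s => ?_⟩
  obtain ⟨a, ha⟩ := h.exists_component_eq s₀ s
  have h2 := mk_zpow_eq T 1 ha
  rw [← zpow_add_apply, zpow_one] at h2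
  rw [← h2, ← ha, he, he]
  push_cast; ring

/-- The points over `q` in a component of a cyclic cover. -/
theorem card_fiber_component [PreconnectedSpace C] [LocallyConnectedSpace E] {n : ℕ} (hn0 : 0 < n)
    (hn : ∀ q, n ∣ d q) (hmk : ∀ (s : E) (a : ℤ),
      ConnectedComponents.mk ((T ^ a) s) = ConnectedComponents.mk s ↔ (n : ℤ) ∣ a)
    (κ : ConnectedComponents E) (q : C) :
    n * Nat.card ((fun s : {s : E // ConnectedComponents.mk s = κ} => π s) ⁻¹' {q}) = d q := by
  obtain ⟨s, rfl⟩ := ConnectedComponents.surjective_coe κ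
  obtain ⟨t, rfl, hts⟩ := h.exists_mem_component s q
  obtain ⟨m, hm⟩ := hn (π t)
  have hm0 : m ≠ 0 := by rintro rfl; have := h.pos (π t); omega
  have : NeZero m := ⟨hm0⟩
  have hper : ∀ a b : ℤ, (T ^ ((n : ℤ) * a)) t = (T ^ ((n : ℤ) * b)) t ↔ (a : ZMod m) = b := by
    intro a b
    have h1 : (T ^ ((n : ℤ) * a)) t = (T ^ ((n : ℤ) * b)) ((T ^ ((n : ℤ) * (a - b))) t) := by
      rw [← zpow_add_apply]; congr 2; ring
    rw [h1, (T ^ ((n : ℤ) * b)).injective.eq_iff, h.period, hm, eq_comm (a := (a : ZMod m)),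
      ZMod.intCast_eq_intCast_iff_dvd_sub]
    push_cast
    exact mul_dvd_mul_iff_left (by exact_mod_cast hn0.ne')
  -- By `hmk`, the points of the fiber in the component of `t` are the `T ^ (n a) t`; with `d (π t)
  -- = n m` they depend only on `a` modulo `m`.
  let φ : ZMod m → ((fun u : {u : E // ConnectedComponents.mk u = ConnectedComponents.mk s} =>
      π u) ⁻¹' {π t}) := fun i => ⟨⟨(T ^ ((n : ℤ) * (i.cast : ℤ))) t, by
        rw [(hmk t _).2 (dvd_mul_right _ _), hts]⟩, h.map_zpow _ _⟩
  have hφ : Function.Bijective φ := by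
    constructor
    · intro i j hij
      have := (hper _ _).1 (congrArg (fun x => (x.1.1 : E)) hij)
      simpa using this
    · rintro ⟨⟨u, hu⟩, hut⟩
      obtain ⟨a, rfl⟩ := h.transitive t u (Eq.symm hut)
      rw [← hts] at hu
      obtain ⟨b, rfl⟩ := (hmk t a).1 hu
      refine ⟨b, Subtype.ext (Subtype.ext ?_)⟩
      exact (hper _ _).2 (by simp)
  rw [hm, ← Nat.card_congr (Equiv.ofBijective φ hφ), Nat.card_zmod]

end IsCyclicCover

end MilnorBoundary


namespace MilnorBoundary

/-! ### Branches -/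

namespace BranchPoint

variable {Y : Type*} [TopologicalSpace Y] {S : Set Y}

/-- The branch as a connected component of the part of `S` in the open set `U`. -/
def br (s : BranchPoint S) (U : Set Y) (hU : IsOpen U) (hs : s.pt ∈ U) : Set Y :=
  s.branch ⟨⟨U, hU⟩, hs⟩

lemma br_component (s : BranchPoint S) {U : Set Y} (hU : IsOpen U) (hs : s.pt ∈ U) :
    ∃ y ∈ U ∩ S, s.br U hU hs = connectedComponentIn (U ∩ S) y :=
  s.isComponent ⟨⟨U, hU⟩, hs⟩

lemma br_mono (s : BranchPoint S) {U U' : Set Y} (hU : IsOpen U) (hs : s.pt ∈ U)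
    (hU' : IsOpen U') (hs' : s.pt ∈ U') (h : U ⊆ U') : s.br U hU hs ⊆ s.br U' hU' hs' :=
  s.mono _ _ h

lemma br_subset (s : BranchPoint S) {U : Set Y} (hU : IsOpen U) (hs : s.pt ∈ U) :
    s.br U hU hs ⊆ U ∩ S := by
  obtain ⟨y, hy, h⟩ := s.br_component hU hs
  rw [h]; exact connectedComponentIn_subset _ _

lemma br_eq_of_mem (s : BranchPoint S) {U : Set Y} (hU : IsOpen U) (hs : s.pt ∈ U) {y : Y}
    (hy : y ∈ s.br U hU hs) : s.br U hU hs = connectedComponentIn (U ∩ S) y := by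
  obtain ⟨z, hz, h⟩ := s.br_component hU hs
  rw [h] at hy ⊢
  exact connectedComponentIn_eq hy

lemma br_nonempty (s : BranchPoint S) {U : Set Y} (hU : IsOpen U) (hs : s.pt ∈ U) :
    (s.br U hU hs).Nonempty := by
  obtain ⟨y, hy, h⟩ := s.br_component hU hs
  exact ⟨y, by rw [h]; exact mem_connectedComponentIn hy⟩

lemma ext_br {s t : BranchPoint S} (hpt : s.pt = t.pt)
    (h : ∀ U (hU : IsOpen U) (hs : s.pt ∈ U), s.br U hU hs = t.br U hU (hpt ▸ hs)) : s = t := by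
  obtain ⟨p, b, c, m⟩ := s
  obtain ⟨p', b', c', m'⟩ := t
  obtain rfl : p = p' := hpt
  have : b = b' := by
    funext N
    exact h N N.isOpen N.mem
  subst this
  rfl

/-- The branches in a given component of an open set. -/
def basicSet (S U W : Set Y) : Set (BranchPoint S) :=
  {s | ∃ N : TopologicalSpace.OpenNhdsOf s.pt, (N : Set Y) = U ∧ s.branch N = W}

lemma isOpen_basicSet (U W : Set Y) : IsOpen (basicSet S U W) :=
  TopologicalSpace.isOpen_generateFrom_of_mem ⟨U, W, rfl⟩

lemma mem_basicSet_iff {U W : Set Y} (hU : IsOpen U) {s : BranchPoint S} :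
    s ∈ basicSet S U W ↔ ∃ hs : s.pt ∈ U, s.br U hU hs = W := by
  constructor
  · rintro ⟨N, rfl, h⟩
    exact ⟨N.mem, h⟩
  · rintro ⟨hs, h⟩
    exact ⟨⟨⟨U, hU⟩, hs⟩, rfl, h⟩

/-- A connected component of a smaller set lies in one component of a larger set, so a basic set
over `U` contains the basic sets over smaller neighbourhoods. The basic sets around a branch thus
form a base. -/
lemma exists_basicSet_subset {V : Set (BranchPoint S)} (hV : IsOpen V) {s : BranchPoint S}
    (hs : s ∈ V) : ∃ U, IsOpen U ∧ s.pt ∈ U ∧ ∀ U' (hU' : IsOpen U') (hs' : s.pt ∈ U'), U' ⊆ U →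
      basicSet S U' (s.br U' hU' hs') ⊆ V := by
  induction hV with
  | basic A hA =>
    obtain ⟨U, W, rfl⟩ := hA
    obtain ⟨N, rfl, rfl⟩ := hs
    refine ⟨N, N.isOpen, N.mem, fun U' hU' hs' hsub t ht => ?_⟩
    obtain ⟨ht', h⟩ := (mem_basicSet_iff hU').1 ht
    refine (mem_basicSet_iff N.isOpen).2 ⟨hsub ht', ?_⟩
    obtain ⟨y, hy⟩ := s.br_nonempty hU' hs'
    have h1 : y ∈ s.br N N.isOpen N.mem := s.br_mono hU' hs' N.isOpen N.mem hsub hy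
    have h2 : y ∈ t.br N N.isOpen (hsub ht') := t.br_mono hU' ht' N.isOpen _ hsub (by rwa [h])
    show _ = s.br N N.isOpen N.mem
    rw [s.br_eq_of_mem _ _ h1, t.br_eq_of_mem _ _ h2]
  | univ => exact ⟨univ, isOpen_univ, trivial, fun _ _ _ _ => subset_univ _⟩
  | inter A B _ _ ihA ihB =>
    obtain ⟨U, hU, hsU, h⟩ := ihA hs.1
    obtain ⟨U', hU', hsU', h'⟩ := ihB hs.2
    exact ⟨U ∩ U', hU.inter hU', ⟨hsU, hsU'⟩, fun U'' hU'' hs'' hsub => subset_inter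
      (h _ hU'' hs'' (hsub.trans inter_subset_left)) (h' _ hU'' hs'' (hsub.trans inter_subset_right))⟩
  | sUnion F _ ih =>
    obtain ⟨A, hA, hsA⟩ := hs
    obtain ⟨U, hU, hsU, h⟩ := ih A hA hsA
    exact ⟨U, hU, hsU, fun U' hU' hs' hsub => (h U' hU' hs' hsub).trans (subset_sUnion_of_mem hA)⟩

lemma basicSet_mem_nhds (s : BranchPoint S) {U : Set Y} (hU : IsOpen U) (hs : s.pt ∈ U) :
    basicSet S U (s.br U hU hs) ∈ 𝓝 s :=
  (isOpen_basicSet _ _).mem_nhds ((mem_basicSet_iff hU).2 ⟨hs, rfl⟩)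

lemma continuous_pt : Continuous (BranchPoint.pt : BranchPoint S → Y) := by
  rw [continuous_def]
  intro U hU
  rw [isOpen_iff_mem_nhds]
  intro s hs
  filter_upwards [s.basicSet_mem_nhds hU hs] with t ht
  exact ((mem_basicSet_iff hU).1 ht).1

instance [T2Space Y] : T2Space (BranchPoint S) := by
  refine ⟨fun s t hst => ?_⟩
  by_cases hpt : s.pt = t.pt
  · have : ∃ U, ∃ (hU : IsOpen U) (hs : s.pt ∈ U), s.br U hU hs ≠ t.br U hU (hpt ▸ hs) := by
      by_contra! h
      exact hst (ext_br hpt h)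
    obtain ⟨U, hU, hs, hne⟩ := this
    refine ⟨_, _, isOpen_basicSet U (s.br U hU hs), isOpen_basicSet U (t.br U hU (hpt ▸ hs)),
      (mem_basicSet_iff hU).2 ⟨hs, rfl⟩, (mem_basicSet_iff hU).2 ⟨hpt ▸ hs, rfl⟩, ?_⟩
    rw [Set.disjoint_left]
    intro u hu hu'
    obtain ⟨h1, h2⟩ := (mem_basicSet_iff hU).1 hu
    obtain ⟨h1', h2'⟩ := (mem_basicSet_iff hU).1 hu'
    exact hne (h2.symm.trans h2')
  · obtain ⟨U, V, hU, hV, hsU, htV, hd⟩ := t2_separation hpt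
    exact ⟨_, _, hU.preimage continuous_pt, hV.preimage continuous_pt, hsU, htV, hd.preimage _⟩

/-- The filter of neighbourhoods of a point along a branch. -/
def filter (s : BranchPoint S) : Filter Y := ⨅ N : TopologicalSpace.OpenNhdsOf s.pt, 𝓟 (s.branch N)

lemma mem_filter_iff (s : BranchPoint S) {A : Set Y} :
    A ∈ s.filter ↔ ∃ U, ∃ (hU : IsOpen U) (hs : s.pt ∈ U), s.br U hU hs ⊆ A := by
  have hd : Directed (· ≥ ·) fun N : TopologicalSpace.OpenNhdsOf s.pt => 𝓟 (s.branch N) := by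
    intro N N'
    refine ⟨N ⊓ N', principal_mono.2 (s.mono _ _ ?_), principal_mono.2 (s.mono _ _ ?_)⟩
    · exact fun x hx => hx.1
    · exact fun x hx => hx.2
  rw [filter, mem_iInf_of_directed hd]
  constructor
  · rintro ⟨N, h⟩
    exact ⟨N, N.isOpen, N.mem, h⟩
  · rintro ⟨U, hU, hs, h⟩
    exact ⟨⟨⟨U, hU⟩, hs⟩, h⟩

lemma br_mem_filter (s : BranchPoint S) {U : Set Y} (hU : IsOpen U) (hs : s.pt ∈ U) :
    s.br U hU hs ∈ s.filter := s.mem_filter_iff.2 ⟨U, hU, hs, subset_rfl⟩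

instance (s : BranchPoint S) : s.filter.NeBot := by
  refine ⟨fun h => ?_⟩
  have : ∅ ∈ s.filter := by rw [h]; trivial
  obtain ⟨U, hU, hs, hsub⟩ := s.mem_filter_iff.1 this
  obtain ⟨y, hy⟩ := s.br_nonempty hU hs
  exact hsub hy

lemma filter_le (s : BranchPoint S) : s.filter ≤ 𝓝[S] s.pt := by
  intro A hA
  obtain ⟨U, hU, hs, hsub⟩ := mem_nhdsWithin.1 hA
  exact s.mem_filter_iff.2 ⟨U, hU, hs, (s.br_subset hU hs).trans hsub⟩

lemma pt_mem_closure (s : BranchPoint S) : s.pt ∈ closure S := by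
  rw [mem_closure_iff_nhdsWithin_neBot]
  exact neBot_of_le s.filter_le

/-- A function with limits along the branches extends by continuity. -/
lemma continuousAt_limit {Z : Type*} [TopologicalSpace Z] [RegularSpace Z] {F : Y → Z}
    {G : BranchPoint S → Z} {s : BranchPoint S} (h : ∀ᶠ t in 𝓝 s, Tendsto F t.filter (𝓝 (G t))) :
    ContinuousAt G s := by
  rw [ContinuousAt, (closed_nhds_basis (G s)).tendsto_right_iff]
  rintro K ⟨hK, hKc⟩
  obtain ⟨U, hU, hs, hsub⟩ := s.mem_filter_iff.1 (h.self_of_nhds hK)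
  filter_upwards [h, s.basicSet_mem_nhds hU hs] with t ht htU
  obtain ⟨htp, hbr⟩ := (mem_basicSet_iff hU).1 htU
  refine hKc.mem_of_tendsto ht ?_
  filter_upwards [t.br_mem_filter hU htp] with y hy
  rw [hbr] at hy
  exact hsub hy

/-- The branch at a point of `S`. -/
def ofMem (y : Y) (hy : y ∈ S) : BranchPoint S where
  pt := y
  branch N := connectedComponentIn ((N : Set Y) ∩ S) y
  isComponent N := ⟨y, ⟨N.mem, hy⟩, rfl⟩
  mono _ _ h := connectedComponentIn_mono _ (inter_subset_inter_left _ h)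

/-- The label `i` is the value along the branch `s` of the locally constant function `lab`. -/
def HasLabel {d : ℕ} (s : BranchPoint S) (lab : Y → ZMod d) (i : ZMod d) : Prop :=
  ∀ᶠ y in s.filter, lab y = i

lemma HasLabel.unique {d : ℕ} {s : BranchPoint S} {lab : Y → ZMod d} {i j : ZMod d}
    (hi : s.HasLabel lab i) (hj : s.HasLabel lab j) : i = j := by
  obtain ⟨y, h1, h2⟩ := (hi.and hj).exists
  exact h1.symm.trans h2

end BranchPoint

open BranchPoint

section Labels

variable {Y : Type*} [TopologicalSpace Y] {S : Set Y}

/-- A neighbourhood of `q` in which the connected components of `S` are the level sets of `lab`. -/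
structure IsGoodNhd (S : Set Y) (q : Y) {d : ℕ} (lab : Y → ZMod d) (N : Set Y) : Prop where
  isOpen : IsOpen N
  mem : q ∈ N
  component : ∀ y ∈ N ∩ S, connectedComponentIn (N ∩ S) y = {z ∈ N ∩ S | lab z = lab y}
  exists_label : ∀ i, ∃ y ∈ N ∩ S, lab y = i

/-- The branches of `S` at `q` are classified by `lab`. -/
def IsBranchLabel (S : Set Y) (q : Y) {d : ℕ} (lab : Y → ZMod d) : Prop :=
  ∀ U ∈ 𝓝 q, ∃ N ⊆ U, IsGoodNhd S q lab N

variable {q : Y} {d : ℕ} {lab : Y → ZMod d}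

lemma IsGoodNhd.exists_br {N : Set Y} (hN : IsGoodNhd S q lab N) (s : BranchPoint S)
    (hs : s.pt ∈ N) : ∃ i, s.HasLabel lab i ∧ s.br N hN.isOpen hs = {z ∈ N ∩ S | lab z = i} := by
  obtain ⟨y, hy, h⟩ := s.br_component hN.isOpen hs
  rw [hN.component y hy] at h
  refine ⟨lab y, ?_, h⟩
  filter_upwards [s.br_mem_filter hN.isOpen hs] with z hz
  rw [h] at hz; exact hz.2

lemma IsGoodNhd.br_eq {N : Set Y} (hN : IsGoodNhd S q lab N) {s : BranchPoint S}
    (hs : s.pt ∈ N) {i : ZMod d} (hi : s.HasLabel lab i) :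
    s.br N hN.isOpen hs = {z ∈ N ∩ S | lab z = i} := by
  obtain ⟨j, hj, h⟩ := hN.exists_br s hs
  rwa [hi.unique hj]

/-- The branches in a good neighbourhood with a given label. -/
def labelSet (S N : Set Y) {d : ℕ} (lab : Y → ZMod d) (i : ZMod d) : Set (BranchPoint S) :=
  {s | s.pt ∈ N ∧ s.HasLabel lab i}

lemma IsGoodNhd.labelSet_eq {N : Set Y} (hN : IsGoodNhd S q lab N) (i : ZMod d) :
    labelSet S N lab i = basicSet S N {z ∈ N ∩ S | lab z = i} := by
  ext s
  rw [mem_basicSet_iff hN.isOpen]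
  constructor
  · rintro ⟨hs, hi⟩
    exact ⟨hs, hN.br_eq hs hi⟩
  · rintro ⟨hs, hi⟩
    refine ⟨hs, ?_⟩
    filter_upwards [s.br_mem_filter hN.isOpen hs] with z hz
    rw [hi] at hz; exact hz.2

lemma IsGoodNhd.isOpen_labelSet {N : Set Y} (hN : IsGoodNhd S q lab N) (i : ZMod d) :
    IsOpen (labelSet S N lab i) := by
  rw [hN.labelSet_eq]; exact isOpen_basicSet _ _

lemma IsBranchLabel.exists_labelSet_subset (hl : IsBranchLabel S q lab) {V : Set (BranchPoint S)}
    (hV : IsOpen V) {s : BranchPoint S} (hs : s ∈ V) (hpt : s.pt = q) {i : ZMod d}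
    (hi : s.HasLabel lab i) : ∃ U, IsOpen U ∧ q ∈ U ∧
      ∀ N, IsGoodNhd S q lab N → N ⊆ U → labelSet S N lab i ⊆ V := by
  subst hpt
  obtain ⟨U, hU, hsU, h⟩ := exists_basicSet_subset hV hs
  refine ⟨U, hU, hsU, fun N hN hNU => ?_⟩
  rw [hN.labelSet_eq, ← hN.br_eq hN.mem hi]
  exact h N hN.isOpen hN.mem hNU

lemma IsBranchLabel.exists_hasLabel (hl : IsBranchLabel S q lab) (s : BranchPoint S)
    (hs : s.pt = q) : ∃ i, s.HasLabel lab i := by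
  obtain ⟨N, -, hN⟩ := hl univ univ_mem
  obtain ⟨i, hi, -⟩ := hN.exists_br s (hs ▸ hN.mem)
  exact ⟨i, hi⟩

/-- Good neighbourhoods are arbitrarily small, and in each of them the label determines the branch;
a component of a larger set is determined by any of its points. -/
lemma IsBranchLabel.ext (hl : IsBranchLabel S q lab) {s t : BranchPoint S}
    (hs : s.pt = q) (ht : t.pt = q) {i : ZMod d} (hsi : s.HasLabel lab i)
    (hti : t.HasLabel lab i) : s = t := by
  subst hs
  refine ext_br ht.symm fun U hU hsU => ?_
  obtain ⟨N, hNU, hN⟩ := hl U (hU.mem_nhds hsU)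
  obtain ⟨y, hy⟩ := s.br_nonempty hN.isOpen hN.mem
  have h1 := s.br_mono hN.isOpen hN.mem hU hsU hNU hy
  have h2 : y ∈ t.br U hU (ht.symm ▸ hsU) := by
    refine t.br_mono hN.isOpen (ht.symm ▸ hN.mem) hU _ hNU ?_
    rw [hN.br_eq _ hti, ← hN.br_eq hN.mem hsi]
    exact hy
  rw [s.br_eq_of_mem _ _ h1, t.br_eq_of_mem _ _ h2]

/-- For each neighbourhood `U` one takes the component of `U ∩ S` containing the level set of label
`i` in a good neighbourhood inside `U`. These choices are coherent because the level sets of any two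
good neighbourhoods have points in common. -/
lemma IsBranchLabel.exists_branchPoint (hl : IsBranchLabel S q lab) (i : ZMod d) :
    ∃ s : BranchPoint S, s.pt = q ∧ s.HasLabel lab i := by
  choose! N hNU hN using hl
  have : Nonempty Y := ⟨q⟩
  choose! y hy hyi using fun (U : Set Y) (hU : U ∈ 𝓝 q) => (hN U hU).exists_label i
  -- The component chosen in `U` may be computed from any point of label `i` in the good
  -- neighbourhood `N U`, in particular from one chosen for a smaller neighbourhood.
  have key : ∀ U ∈ 𝓝 q, ∀ M ⊆ N U, ∀ z ∈ M ∩ S, lab z = i →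
      connectedComponentIn (U ∩ S) (y U) = connectedComponentIn (U ∩ S) z := by
    intro U hU M hM z hz hzi
    have h1 : z ∈ connectedComponentIn (N U ∩ S) (y U) := by
      rw [(hN U hU).component _ (hy U hU)]
      exact ⟨⟨hM hz.1, hz.2⟩, hzi.trans (hyi U hU).symm⟩
    exact connectedComponentIn_eq
      (connectedComponentIn_mono _ (inter_subset_inter_left _ (hNU U hU)) h1)
  have hnh : ∀ U : TopologicalSpace.OpenNhdsOf q, (U : Set Y) ∈ 𝓝 q := fun U => U.isOpen.mem_nhds U.mem
  refine ⟨⟨q, fun U => connectedComponentIn ((U : Set Y) ∩ S) (y U), fun U =>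
    ⟨y U, ⟨hNU _ (hnh U) (hy _ (hnh U)).1, (hy _ (hnh U)).2⟩, rfl⟩, fun U U' hUU' => ?_⟩, rfl, ?_⟩
  · have hV : N (U : Set Y) ∩ N (U' : Set Y) ∈ 𝓝 q :=
      inter_mem ((hN _ (hnh U)).isOpen.mem_nhds (hN _ (hnh U)).mem)
        ((hN _ (hnh U')).isOpen.mem_nhds (hN _ (hnh U')).mem)
    have hz := hy _ hV
    have hzi := hyi _ hV
    rw [key _ (hnh U) _ ((hNU _ hV).trans inter_subset_left) _ hz hzi,
      key _ (hnh U') _ ((hNU _ hV).trans inter_subset_right) _ hz hzi]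
    exact connectedComponentIn_mono _ (inter_subset_inter_left _ hUU')
  · have h0 : (univ : Set Y) ∈ 𝓝 q := univ_mem
    set s : BranchPoint S := ⟨q, fun U => connectedComponentIn ((U : Set Y) ∩ S) (y U), _, _⟩
    have hg := hN _ ((hN _ h0).isOpen.mem_nhds (hN _ h0).mem)
    -- The branch has some label `j`. The representative chosen for the neighbourhood `N univ` has
    -- label `i` and belongs to the branch, so that `j = i`.
    obtain ⟨j, hj, -⟩ := (hN _ h0).exists_br s (hN _ h0).mem
    have hmem : y (N univ) ∈ s.br (N univ) (hN _ h0).isOpen (hN _ h0).mem := by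
      have := (hN _ h0).isOpen.mem_nhds (hN _ h0).mem
      exact mem_connectedComponentIn ⟨hNU _ this (hy _ this).1, (hy _ this).2⟩
    rw [(hN _ h0).br_eq _ hj] at hmem
    rw [← hyi (N univ) ((hN _ h0).isOpen.mem_nhds (hN _ h0).mem), hmem.2]
    exact hj

end Labels

end MilnorBoundary


/-! ### The cyclic cover formed by the branches over a curve -/

namespace MilnorBoundary

open BranchPoint

/-- Compatible classifications of the branches of `S` at the points of `C`. -/
structure BranchSystem {Y : Type*} [TopologicalSpace Y] (S C : Set Y) where
  d : Y → ℕ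
  lab : ∀ q, Y → ZMod (d q)
  pos : ∀ q ∈ C, 0 < d q
  isLabel : ∀ q ∈ C, IsBranchLabel S q (lab q)
  compat : ∀ q ∈ C, ∃ U, IsOpen U ∧ q ∈ U ∧ ∀ q' ∈ U ∩ C, ∃ hd : d q ∣ d q', ∃ c,
    ∀ᶠ y in 𝓝[S] q', lab q y = ZMod.castHom hd (ZMod (d q)) (lab q' y) + c

namespace BranchSystem

variable {Y : Type*} [TopologicalSpace Y] {S C : Set Y} (B : BranchSystem S C)

/-- The branches at the points of `C`. -/
abbrev Space (S C : Set Y) : Set (BranchPoint S) := {s | s.pt ∈ C}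

lemma exists_shift (a : ℤ) (s : Space S C) : ∃ t : Space S C, t.1.pt = s.1.pt ∧
    ∃ i, s.1.HasLabel (B.lab s.1.pt) i ∧ t.1.HasLabel (B.lab s.1.pt) (i + a) := by
  obtain ⟨i, hi⟩ := (B.isLabel _ s.2).exists_hasLabel s.1 rfl
  obtain ⟨t, ht, hti⟩ := (B.isLabel _ s.2).exists_branchPoint (i + a)
  exact ⟨⟨t, by show t.pt ∈ C; rw [ht]; exact s.2⟩, ht, i, hi, hti⟩

/-- The branch which comes `a` further. -/
noncomputable def shift (a : ℤ) (s : Space S C) : Space S C := (B.exists_shift a s).choose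

lemma shift_pt (a : ℤ) (s : Space S C) : (B.shift a s).1.pt = s.1.pt :=
  (B.exists_shift a s).choose_spec.1

lemma hasLabel_shift (a : ℤ) {s : Space S C} {q : Y} (hq : s.1.pt = q) {i : ZMod (B.d q)}
    (hi : s.1.HasLabel (B.lab q) i) : (B.shift a s).1.HasLabel (B.lab q) (i + a) := by
  subst hq
  obtain ⟨j, hj, h⟩ := (B.exists_shift a s).choose_spec.2
  rw [hi.unique hj]
  exact h

lemma ext {s t : Space S C} {q : Y} (hs : s.1.pt = q) (ht : t.1.pt = q) {i : ZMod (B.d q)}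
    (hsi : s.1.HasLabel (B.lab q) i) (hti : t.1.HasLabel (B.lab q) i) : s = t :=
  Subtype.ext ((B.isLabel q (hs ▸ s.2)).ext hs ht hsi hti)

lemma exists_hasLabel (s : Space S C) : ∃ i, s.1.HasLabel (B.lab s.1.pt) i :=
  (B.isLabel _ s.2).exists_hasLabel s.1 rfl

lemma shift_add (a b : ℤ) (s : Space S C) : B.shift (a + b) s = B.shift a (B.shift b s) := by
  obtain ⟨i, hi⟩ := B.exists_hasLabel s
  refine B.ext (q := s.1.pt) (B.shift_pt _ _) ((B.shift_pt _ _).trans (B.shift_pt _ _))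
    (B.hasLabel_shift _ rfl hi) ?_
  have := B.hasLabel_shift a (B.shift_pt b s) (B.hasLabel_shift b rfl hi)
  convert this using 1
  push_cast; ring

lemma shift_zero (s : Space S C) : B.shift 0 s = s := by
  obtain ⟨i, hi⟩ := B.exists_hasLabel s
  refine B.ext (B.shift_pt _ _) rfl (B.hasLabel_shift _ rfl hi) ?_
  simpa using hi

/-- Labels at a point determine labels at the nearby points. -/
lemma exists_compat {q : Y} (hq : q ∈ C) : ∃ U, IsOpen U ∧ q ∈ U ∧
    ∀ s : Space S C, s.1.pt ∈ U → ∀ a i, s.1.HasLabel (B.lab q) i →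
      (B.shift a s).1.HasLabel (B.lab q) (i + a) := by
  obtain ⟨U, hU, hqU, h⟩ := B.compat q hq
  refine ⟨U, hU, hqU, fun s hs a i hi => ?_⟩
  obtain ⟨hd, c, hc⟩ := h s.1.pt ⟨hs, s.2⟩
  obtain ⟨j, hj⟩ := B.exists_hasLabel s
  have h1 := B.hasLabel_shift a rfl hj
  -- The label at `q` is the label at the nearby point reduced modulo `d q`, up to a constant.
  -- Adding `a` commutes with both operations.
  have h2 : i = ZMod.castHom hd (ZMod (B.d q)) j + c := by
    obtain ⟨y, ⟨hy1, hy2⟩, hy3⟩ := ((hi.and hj).and (s.1.filter_le hc)).exists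
    rw [← hy1, hy3, hy2]
  have h3 : ∀ᶠ y in (B.shift a s).1.filter,
      B.lab q y = ZMod.castHom hd (ZMod (B.d q)) (B.lab s.1.pt y) + c := by
    have := (B.shift a s).1.filter_le
    rw [B.shift_pt] at this
    exact this hc
  filter_upwards [h1, h3] with y hy1 hy3
  rw [hy3, hy1, h2, map_add, map_intCast]
  ring

lemma exists_good {q : Y} (hq : q ∈ C) {U : Set Y} (hU : U ∈ 𝓝 q) : ∃ N ⊆ U,
    IsGoodNhd S q (B.lab q) N ∧ ∀ s : Space S C, s.1.pt ∈ N → ∀ a i, s.1.HasLabel (B.lab q) i →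
      (B.shift a s).1.HasLabel (B.lab q) (i + a) := by
  obtain ⟨V, hV, hqV, h⟩ := B.exists_compat hq
  obtain ⟨N, hN, hg⟩ := B.isLabel q hq _ (inter_mem hU (hV.mem_nhds hqV))
  exact ⟨N, hN.trans inter_subset_left, hg, fun s hs => h s (hN hs).2⟩

/-- The label sets of small good neighbourhoods form a base at a branch, and the shift sends the one
of label `i` into the one of label `i + a` over the same neighbourhood. -/
lemma continuous_shift (a : ℤ) : Continuous (B.shift a) := by
  rw [continuous_iff_continuousAt]
  intro s A hA
  obtain ⟨i, hi⟩ := B.exists_hasLabel s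
  obtain ⟨V, hVA, hV, hsV⟩ := mem_nhds_iff.1 hA
  obtain ⟨V', hV', rfl⟩ := isOpen_induced_iff.1 hV
  have hl := B.isLabel _ s.2
  obtain ⟨U, hU, hsU, hUN⟩ := hl.exists_labelSet_subset hV' hsV (B.shift_pt a s)
    (B.hasLabel_shift a rfl hi)
  obtain ⟨N, hNU, hN, hcomp⟩ := B.exists_good s.2 (hU.mem_nhds hsU)
  have hmem : (Subtype.val : Space S C → _) ⁻¹' labelSet S N (B.lab s.1.pt) i ∈ 𝓝 s :=
    ((hN.isOpen_labelSet i).preimage continuous_subtype_val).mem_nhds ⟨hN.mem, hi⟩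
  rw [mem_map]
  filter_upwards [hmem] with t ht
  exact hVA (hUN N hN hNU ⟨by rw [B.shift_pt]; exact ht.1, hcomp t ht.1 a i ht.2⟩)

/-- The homeomorphism sending a branch to the following one. -/
noncomputable def homeo : Space S C ≃ₜ Space S C where
  toFun := B.shift 1
  invFun := B.shift (-1)
  left_inv s := by rw [← B.shift_add]; exact B.shift_zero s
  right_inv s := by rw [← B.shift_add]; exact B.shift_zero s
  continuous_toFun := B.continuous_shift 1
  continuous_invFun := B.continuous_shift (-1)

lemma homeo_zpow (a : ℤ) (s : Space S C) : (B.homeo ^ a) s = B.shift a s := by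
  refine IsCyclicCover.zpow_induction (P := fun a => (B.homeo ^ a) s = B.shift a s)
    (by simp [B.shift_zero]) (fun a => ?_) a
  rw [add_comm, IsCyclicCover.zpow_add_apply, zpow_one, B.shift_add]
  exact B.homeo.injective.eq_iff.symm

/-- The projection. -/
def proj (S C : Set Y) (s : Space S C) : C := ⟨s.1.pt, s.2⟩

lemma continuous_proj : Continuous (proj S C) :=
  Continuous.subtype_mk (continuous_pt.comp continuous_subtype_val) _

lemma exists_over {q : Y} (hq : q ∈ C) (i : ZMod (B.d q)) :
    ∃ s : Space S C, s.1.pt = q ∧ s.1.HasLabel (B.lab q) i := by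
  obtain ⟨s, hs, hi⟩ := (B.isLabel q hq).exists_branchPoint i
  exact ⟨⟨s, by show s.pt ∈ C; rwa [hs]⟩, hs, hi⟩

/-- Some branch exists over `q'` and has a label for `q`; shifting it by the difference produces any
other label. This is what makes the projection open. -/
lemma exists_over_of_mem {q : Y} {N : Set Y} (hN : IsGoodNhd S q (B.lab q) N)
    (hcomp : ∀ s : Space S C, s.1.pt ∈ N → ∀ a i, s.1.HasLabel (B.lab q) i →
      (B.shift a s).1.HasLabel (B.lab q) (i + a)) {q' : Y} (hq' : q' ∈ N ∩ C) (i : ZMod (B.d q)) :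
    ∃ s : Space S C, s.1.pt = q' ∧ s.1.HasLabel (B.lab q) i := by
  obtain ⟨s, hs, -⟩ := B.exists_over hq'.2 0
  have hsN : s.1.pt ∈ N := by rw [hs]; exact hq'.1
  obtain ⟨j, hj, -⟩ := hN.exists_br s.1 hsN
  obtain ⟨a, ha⟩ := ZMod.intCast_surjective (i - j)
  refine ⟨B.shift a s, (B.shift_pt a s).trans hs, ?_⟩
  have := hcomp s hsN a j hj
  rwa [ha, add_sub_cancel] at this

/-- The branches over `C` form a cyclic cover of `C`. -/
theorem isCyclicCover : IsCyclicCover (proj S C) B.homeo (fun q => B.d q) where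
  continuous := continuous_proj
  surjective := fun q => by
    obtain ⟨s, hs, -⟩ := B.exists_over q.2 0
    exact ⟨s, Subtype.ext hs⟩
  map_shift := fun s => Subtype.ext (B.shift_pt 1 s)
  pos := fun q => B.pos q q.2
  transitive := fun s t hst => by
    have hst' : t.1.pt = s.1.pt := (congrArg Subtype.val hst).symm
    obtain ⟨i, hi⟩ := B.exists_hasLabel s
    obtain ⟨j, hj⟩ := (B.isLabel _ s.2).exists_hasLabel t.1 hst'
    obtain ⟨a, ha⟩ := ZMod.intCast_surjective (j - i)
    refine ⟨a, ?_⟩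
    rw [B.homeo_zpow]
    refine B.ext (B.shift_pt a s) hst' (B.hasLabel_shift a rfl hi) ?_
    rwa [ha, add_sub_cancel]
  period := fun s a => by
    obtain ⟨i, hi⟩ := B.exists_hasLabel s
    rw [B.homeo_zpow]
    show B.shift a s = s ↔ ((B.d s.1.pt : ℕ) : ℤ) ∣ a
    rw [← ZMod.intCast_zmod_eq_zero_iff_dvd a (B.d s.1.pt)]
    have := B.hasLabel_shift a rfl hi
    constructor
    · intro h
      rw [h] at this
      simpa using this.unique hi
    · intro h
      refine B.ext (B.shift_pt a s) rfl this ?_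
      rwa [h, add_zero]
  isOpenMap := by
    rw [isOpenMap_iff_nhds_le]
    intro s A hA
    obtain ⟨i, hi⟩ := B.exists_hasLabel s
    rw [mem_map] at hA
    obtain ⟨V, hVA, hV, hsV⟩ := mem_nhds_iff.1 hA
    obtain ⟨V', hV', rfl⟩ := isOpen_induced_iff.1 hV
    obtain ⟨U, hU, hsU, hUN⟩ := (B.isLabel _ s.2).exists_labelSet_subset hV' hsV rfl hi
    obtain ⟨N, hNU, hN, hcomp⟩ := B.exists_good s.2 (hU.mem_nhds hsU)
    have : (Subtype.val : C → Y) ⁻¹' N ∈ 𝓝 (proj S C s) :=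
      (hN.isOpen.preimage continuous_subtype_val).mem_nhds hN.mem
    filter_upwards [this] with q hq
    -- Over every point of `N ∩ C` there is a branch of label `i`, that is a branch in the given
    -- neighbourhood of `s`.
    obtain ⟨t, ht, hti⟩ := B.exists_over_of_mem hN hcomp ⟨hq, q.2⟩ i
    have h1 : t ∈ proj S C ⁻¹' A := hVA (hUN N hN hNU ⟨by rw [ht]; exact hq, hti⟩)
    have h2 : proj S C t = q := Subtype.ext ht
    rw [← h2]; exact h1
  isClosedMap := by
    rw [isClosedMap_iff_comap_nhds_le]
    intro q A hA
    rw [mem_nhdsSet_iff_exists] at hA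
    obtain ⟨V, hV, hfV, hVA⟩ := hA
    obtain ⟨V', hV', rfl⟩ := isOpen_induced_iff.1 hV
    have : ∀ i : ZMod (B.d q), ∃ U, IsOpen U ∧ (q : Y) ∈ U ∧
        ∀ N, IsGoodNhd S q (B.lab q) N → N ⊆ U →
          (labelSet S N (B.lab q) i ∩ Space S C) ⊆ V' := by
      intro i
      obtain ⟨s, hs, hi⟩ := B.exists_over q.2 i
      obtain ⟨U, hU, hsU, hUN⟩ := (B.isLabel _ q.2).exists_labelSet_subset hV'
        (hfV (show s ∈ proj S C ⁻¹' {q} from Subtype.ext hs)) hs hi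
      exact ⟨U, hU, hsU, fun N hN hNU => inter_subset_left.trans (hUN N hN hNU)⟩
    choose U hU hqU hUN using this
    have : NeZero (B.d q) := ⟨(B.pos q q.2).ne'⟩
    -- There are finitely many labels at `q`, so one good neighbourhood serves all the branches over
    -- `q` at the same time. Any branch over it has one of these labels.
    obtain ⟨N, hNU, hN, -⟩ := B.exists_good q.2
      ((isOpen_iInter_of_finite hU).mem_nhds (mem_iInter.2 hqU))
    refine mem_comap.2 ⟨Subtype.val ⁻¹' N,
      (hN.isOpen.preimage continuous_subtype_val).mem_nhds hN.mem, fun s hs => hVA ?_⟩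
    obtain ⟨i, hi, -⟩ := hN.exists_br s.1 hs
    exact hUN i N hN (hNU.trans (iInter_subset _ i)) ⟨⟨hs, hi⟩, s.2⟩
  label := fun q => by
    obtain ⟨N, -, hN, hcomp⟩ := B.exists_good q.2 univ_mem
    have hex : ∀ s : Space S C, s.1.pt ∈ N → ∃ i, s.1.HasLabel (B.lab q) i := fun s hs => by
      obtain ⟨i, hi, -⟩ := hN.exists_br s.1 hs
      exact ⟨i, hi⟩
    classical
    let lam : Space S C → ZMod (B.d q) := fun s =>
      if hs : s.1.pt ∈ N then (hex s hs).choose else 0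
    have hlam : ∀ s : Space S C, s.1.pt ∈ N → s.1.HasLabel (B.lab q) (lam s) := fun s hs => by
      simp only [lam, dif_pos hs]; exact (hex s hs).choose_spec
    refine ⟨Subtype.val ⁻¹' N, hN.isOpen.preimage continuous_subtype_val, hN.mem, lam, fun i => ?_,
      fun s hs => ?_⟩
    · have : {s : Space S C | proj S C s ∈ Subtype.val ⁻¹' N ∧ lam s = i} =
          Subtype.val ⁻¹' labelSet S N (B.lab q) i := by
        ext s
        constructor
        · rintro ⟨hs, rfl⟩
          exact ⟨hs, hlam s hs⟩
        · rintro ⟨hs, hi⟩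
          exact ⟨hs, (hlam s hs).unique hi⟩
      rw [this]
      exact (hN.isOpen_labelSet i).preimage continuous_subtype_val
    · have h1 : (B.homeo s).1.pt ∈ N := by
        have : (B.homeo s).1.pt = s.1.pt := B.shift_pt 1 s
        rw [this]; exact hs
      have h2 := hcomp s hs 1 _ (hlam s hs)
      rw [Int.cast_one] at h2
      exact (hlam _ h1).unique h2

end BranchSystem

end MilnorBoundary


namespace MilnorBoundary

/-! ### Phases of roots of positive numbers -/

open Classical in
/-- The class `j` such that `z` is a positive multiple of `exp (2 i π j / d)`. -/
noncomputable def phase (d : ℕ) (z : ℂ) : ZMod d :=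
  if h : ∃ j : ℤ, ∃ ρ : ℝ, 0 < ρ ∧ z = ρ * Complex.exp (2 * Real.pi * Complex.I * j / d) then
    (h.choose : ZMod d) else 0

section Phase

variable {d : ℕ}

lemma norm_exp_two_pi (j : ℤ) : ‖Complex.exp (2 * Real.pi * Complex.I * j / d)‖ = 1 := by
  have : (2 * Real.pi * Complex.I * j / d : ℂ) = ((2 * Real.pi * j / d : ℝ) : ℂ) * Complex.I := by
    push_cast; ring
  rw [this, Complex.norm_exp_ofReal_mul_I]

/-- The choice made in the definition is harmless: the modulus determines `ρ`, and the exponential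
determines `j` modulo `d`. -/
lemma phase_eq (hd : 0 < d) {ρ : ℝ} (hρ : 0 < ρ) (j : ℤ) :
    phase d (ρ * Complex.exp (2 * Real.pi * Complex.I * j / d)) = j := by
  have hex : ∃ j' : ℤ, ∃ ρ' : ℝ, 0 < ρ' ∧
      (ρ : ℂ) * Complex.exp (2 * Real.pi * Complex.I * j / d) =
        ρ' * Complex.exp (2 * Real.pi * Complex.I * j' / d) := ⟨j, ρ, hρ, rfl⟩
  rw [phase, dif_pos hex]
  obtain ⟨ρ', hρ', h⟩ := hex.choose_spec
  set j' := hex.choose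
  have h1 : ρ = ρ' := by
    have := congrArg norm h
    rw [norm_mul, norm_mul, norm_exp_two_pi, norm_exp_two_pi, mul_one, mul_one] at this
    simpa [abs_of_pos hρ, abs_of_pos hρ'] using this
  subst h1
  have h2 := mul_left_cancel₀ (by exact_mod_cast hρ.ne') h
  obtain ⟨n, hn⟩ := Complex.exp_eq_exp_iff_exists_int.1 h2
  have hd' : (d : ℂ) ≠ 0 := by exact_mod_cast hd.ne'
  have hpi : (2 * Real.pi * Complex.I : ℂ) ≠ 0 := Complex.two_pi_I_ne_zero
  have h3 : (j : ℂ) = j' + n * d := by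
    have : (2 * Real.pi * Complex.I : ℂ) * j = 2 * Real.pi * Complex.I * (j' + n * d) := by
      field_simp at hn ⊢
      linear_combination hn
    exact mul_left_cancel₀ hpi this
  have h4 : j = j' + n * d := by exact_mod_cast h3
  rw [h4]; push_cast; simp

lemma exists_phase (hd : 0 < d) {z : ℂ} {r : ℝ} (hr : 0 < r) (h : z ^ d = r) :
    ∃ j : ℤ, z = ‖z‖ * Complex.exp (2 * Real.pi * Complex.I * j / d) := by
  have hd' : (d : ℂ) ≠ 0 := by exact_mod_cast hd.ne'
  have h1 : ‖z‖ ^ d = r := by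
    have := congrArg norm h
    simpa [abs_of_pos hr] using this
  have h2 : Complex.exp (d * (z.arg * Complex.I)) = 1 := by
    have h4 := Complex.norm_mul_exp_arg_mul_I z
    rw [← h4, mul_pow, ← Complex.exp_nat_mul] at h
    have h5 : ((‖z‖ : ℂ)) ^ d = r := by exact_mod_cast h1
    rw [h5] at h
    have : (r : ℂ) ≠ 0 := by exact_mod_cast hr.ne'
    exact mul_left_cancel₀ this (by rw [h, mul_one])
  obtain ⟨n, hn⟩ := Complex.exp_eq_one_iff.1 h2
  refine ⟨n, ?_⟩
  conv_lhs => rw [← Complex.norm_mul_exp_arg_mul_I z]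
  congr 2
  rw [eq_div_iff hd']
  linear_combination hn

lemma norm_pos_of_pow_eq (hd : 0 < d) {z : ℂ} {r : ℝ} (hr : 0 < r) (h : z ^ d = r) : 0 < ‖z‖ := by
  rw [norm_pos_iff]
  rintro rfl
  rw [zero_pow hd.ne'] at h
  exact hr.ne' (by exact_mod_cast h.symm)

lemma phase_mul_pos {z : ℂ} {a : ℝ} (ha : 0 < a) (hd : 0 < d) {r : ℝ} (hr : 0 < r)
    (h : z ^ d = r) : phase d (a * z) = phase d z := by
  obtain ⟨j, hj⟩ := exists_phase hd hr h
  have hz := norm_pos_of_pow_eq hd hr h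
  rw [hj, phase_eq hd hz, ← mul_assoc, ← Complex.ofReal_mul, phase_eq hd (mul_pos ha hz)]

lemma phase_congr (hd : 0 < d) {z z' : ℂ} {r r' : ℝ} (hr : 0 < r) (h : z ^ d = r)
    (hr' : 0 < r') (h' : z' ^ d = r') (hzz : z / ‖z‖ = z' / ‖z'‖) : phase d z = phase d z' := by
  have hz := norm_pos_of_pow_eq hd hr h
  have hz' := norm_pos_of_pow_eq hd hr' h'
  have h1 : (‖z‖ : ℂ) ≠ 0 := by exact_mod_cast hz.ne'
  have h2 : (‖z'‖ : ℂ) ≠ 0 := by exact_mod_cast hz'.ne'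
  have : z = ((‖z‖ / ‖z'‖ : ℝ) : ℂ) * z' := by
    push_cast
    field_simp at hzz ⊢
    linear_combination hzz
  rw [this, phase_mul_pos (div_pos hz hz') hd hr' h']

/-- Raising to the power `d' / d` turns a `d'`-th root of unity of index `j` into the `d`-th root of
unity of the same index, and a factor `ζ` translates indices. This relates the labels given by a
`d`-th and a `d'`-th root of the same function. -/
lemma phase_root_mul_pow {d' : ℕ} (hd' : 0 < d') (hdd : d ∣ d') {ζ z : ℂ} (hζ : ζ ^ d = 1) {r : ℝ}
    (hr : 0 < r) (h : z ^ d' = r) :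
    phase d (ζ * z ^ (d' / d)) = ZMod.castHom hdd (ZMod d) (phase d' z) + phase d ζ := by
  have hd : 0 < d := Nat.pos_of_dvd_of_pos hdd hd'
  obtain ⟨e, rfl⟩ := hdd
  have he : 0 < e := Nat.pos_of_mul_pos_left hd'
  obtain ⟨j, hj⟩ := exists_phase hd' hr h
  obtain ⟨i, hi⟩ := exists_phase hd one_pos (by rw [hζ]; simp : ζ ^ d = (1 : ℝ))
  have hz := norm_pos_of_pow_eq hd' hr h
  have hζ' := norm_pos_of_pow_eq hd one_pos (by rw [hζ]; simp : ζ ^ d = (1 : ℝ))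
  have h1 : ζ * z ^ (d * e / d) = ((‖ζ‖ * ‖z‖ ^ e : ℝ) : ℂ) *
      Complex.exp (2 * Real.pi * Complex.I * (j + i : ℤ) / d) := by
    rw [Nat.mul_div_cancel_left _ hd]
    conv_lhs => rw [hi, hj, mul_pow, ← Complex.exp_nat_mul]
    have : (2 * Real.pi * Complex.I * (j + i : ℤ) / d : ℂ) = 2 * Real.pi * Complex.I * i / d +
        e * (2 * Real.pi * Complex.I * j / (d * e : ℕ)) := by
      have h1 : (d : ℂ) ≠ 0 := by exact_mod_cast hd.ne'
      have h2 : (e : ℂ) ≠ 0 := by exact_mod_cast he.ne'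
      push_cast; field_simp; ring
    rw [this, Complex.exp_add]
    push_cast; ring
  rw [h1, phase_eq hd (by positivity), hj, phase_eq hd' hz]
  conv_rhs => rw [hi, phase_eq hd hζ']
  rw [map_intCast]; push_cast; ring

end Phase

lemma rootsOfUnity_subsingleton_of_isPreconnected {Z : Type*} [TopologicalSpace Z] {R : Set Z}
    (hR : IsPreconnected R) {d : ℕ} (hd : 0 < d) {F : Z → ℂ} (hF : ContinuousOn F R)
    (h1 : ∀ z ∈ R, F z ^ d = 1) {x y : Z} (hx : x ∈ R) (hy : y ∈ R) : F x = F y := by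
  have hfin : {z : ℂ | z ^ d = 1}.Finite := by
    have : {z : ℂ | z ^ d = 1} ⊆ ((Polynomial.nthRoots d (1 : ℂ)).toFinset : Set ℂ) := by
      intro z hz
      simpa [Polynomial.mem_nthRoots hd] using hz
    exact (Finset.finite_toSet _).subset this
  exact hR.constant_of_mapsTo hfin.isDiscrete hF h1 hx hy

/-- `φ` is a `d`-th root of `f` near `q` which classifies the branches of `S` at `q`. -/
structure IsRootAt {Y : Type*} [TopologicalSpace Y] (S : Set Y) (f : Y → ℂ) (q : Y) (d : ℕ)
    (φ : Y → ℂ) : Prop where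
  pos : 0 < d
  pow : ∀ᶠ y in 𝓝 q, φ y ^ d = f y
  cont : ∀ᶠ y in 𝓝 q, ContinuousAt φ y
  isLabel : IsBranchLabel S q (fun y => phase d (φ y))
  conn : ∀ U ∈ 𝓝 q, ∃ R ⊆ U, IsPreconnected R ∧ R ∈ 𝓝[S] q ∧ R.Nonempty ∧ ∀ y ∈ R, f y ≠ 0

/-- Comparison of the labels given by two roots. -/
lemma IsRootAt.compare {Y : Type*} [TopologicalSpace Y] {S : Set Y} {f : Y → ℂ} {q' : Y} {d d' : ℕ}
    {φ φ' : Y → ℂ} (hφ' : IsRootAt S f q' d' φ') (hS : ∀ y ∈ S, ∃ r : ℝ, 0 < r ∧ f y = r)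
    (hdd : d ∣ d') (hpow : ∀ᶠ y in 𝓝 q', φ y ^ d = f y) (hcont : ∀ᶠ y in 𝓝 q', ContinuousAt φ y) :
    ∃ c, ∀ᶠ y in 𝓝[S] q',
      phase d (φ y) = ZMod.castHom hdd (ZMod d) (phase d' (φ' y)) + c := by
  have hd : 0 < d := Nat.pos_of_dvd_of_pos hdd hφ'.pos
  obtain ⟨R, hRU, hR, hRn, ⟨y₀, hy₀⟩, hR0⟩ :=
    hφ'.conn _ (inter_mem (inter_mem hφ'.pow hφ'.cont) (inter_mem hpow hcont))
  -- The quotient of the two roots is a continuous function with values in the finite set of `d`-th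
  -- roots of unity, so it is constant on the connected set `R`. The set `S` itself has several
  -- branches and would not be sufficient here.
  set F : Y → ℂ := fun y => φ y / φ' y ^ (d' / d)
  have hne : ∀ y ∈ R, φ' y ≠ 0 := fun y hy h0 => hR0 y hy (by
    rw [← (hRU hy).1.1, h0, zero_pow hφ'.pos.ne'])
  have hF : ContinuousOn F R := fun y hy =>
    ((hRU hy).2.2.div ((hRU hy).1.2.pow _) (pow_ne_zero _ (hne y hy))).continuousWithinAt
  have hF1 : ∀ y ∈ R, F y ^ d = 1 := fun y hy => by
    rw [div_pow, ← pow_mul, Nat.div_mul_cancel hdd, (hRU hy).2.1, (hRU hy).1.1,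
      div_self (hR0 y hy)]
  refine ⟨phase d (F y₀), ?_⟩
  filter_upwards [hRn, self_mem_nhdsWithin] with y hy hyS
  obtain ⟨r, hr, hfr⟩ := hS y hyS
  have h1 := rootsOfUnity_subsingleton_of_isPreconnected hR hd hF hF1 hy₀ hy
  rw [← phase_root_mul_pow hφ'.pos hdd (hF1 y₀ hy₀) hr ((hRU hy).1.1.trans hfr), h1]
  congr 1
  exact (div_mul_cancel₀ _ (pow_ne_zero _ (hne y hy))).symm

end MilnorBoundary


namespace MilnorBoundary

/-! ### Branches in logarithmic coordinates -/

lemma exists_section_of_isOpenEmbedding {Y Z : Type*} [TopologicalSpace Y] [TopologicalSpace Z]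
    {U : Set Y} {h : Y → Z} (hne : U.Nonempty) (hh : IsOpenEmbedding (U.domRestrict h)) :
    ∃ σ : Z → Y, ContinuousOn σ (h '' U) ∧ ∀ y ∈ U, σ (h y) = y := by
  classical
  obtain ⟨y₀, hy₀⟩ := hne
  have : Nonempty U := ⟨⟨y₀, hy₀⟩⟩
  let e := hh.toOpenPartialHomeomorph
  refine ⟨fun z => (e.symm z : Y), ?_, fun y hy => ?_⟩
  · have h1 : h '' U = e.target := by
      rw [hh.toOpenPartialHomeomorph_target, Set.range_domRestrict]
    rw [h1]
    exact continuous_subtype_val.comp_continuousOn e.continuousOn_symm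
  · have : h y = e ⟨y, hy⟩ := rfl
    simp only [this]
    rw [e.left_inv (by simp [e])]

/-- Coordinates on the part of `S` in a neighbourhood of a point, the third one being uniformized
by a map defined on a convex set. -/
structure LogForm {Y : Type*} [TopologicalSpace Y] (S : Set Y) (f : Y → ℂ) (φ : Y → ℂ) (d : ℕ)
    (N : Set Y) where
  h : Y → Fin 3 → ℂ
  U : Set Y
  emb : IsOpenEmbedding (U.domRestrict h)
  ρ : ℝ
  a₁ : ℕ
  a₂ : ℕ
  a₃ : ℕ
  c₁ : ℝ
  c₃ : ℝ
  d_pos : 0 < d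
  a₂_pos : 0 < a₂
  c₁_pos : 0 < c₁
  T : Set ℂ
  ω : ℂ → ℂ
  conv : Convex ℝ T
  nonempty : T.Nonempty
  cont : ContinuousOn ω T
  mem : ∀ z₁ z₂ t : ℂ, z₁.re < ρ → z₂.re < ρ → t ∈ T → ∃ y ∈ N,
    h y = ![Complex.exp z₁, Complex.exp z₂, ω t]
  sub : N ⊆ U
  surj : ∀ y ∈ N, f y ≠ 0 → y ∈ S → ∃ z₁ z₂ t : ℂ, z₁.re < ρ ∧ z₂.re < ρ ∧ t ∈ T ∧
    h y = ![Complex.exp z₁, Complex.exp z₂, ω t]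
  f_eq : ∀ y ∈ N, ∀ z₁ z₂ t : ℂ, t ∈ T → h y = ![Complex.exp z₁, Complex.exp z₂, ω t] →
    f y = Complex.exp (a₁ * z₁ + a₂ * z₂ + a₃ * t)
  φ_eq : ∀ y ∈ N, ∀ z₁ z₂ t : ℂ, t ∈ T → h y = ![Complex.exp z₁, Complex.exp z₂, ω t] →
    φ y = Complex.exp ((a₁ * z₁ + a₂ * z₂ + a₃ * t) / d)
  mem_iff : ∀ y ∈ N, ∀ z₁ z₂ t : ℂ, t ∈ T → h y = ![Complex.exp z₁, Complex.exp z₂, ω t] →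
    (y ∈ S ↔ f y = (Real.exp (a₁ * z₁.re + c₁ * z₁.re + c₃ * t.re) : ℝ))
  f_ne : ∀ y ∈ S, f y ≠ 0
  cont_φ : ContinuousOn φ N
  pow_φ : ∀ y ∈ N, φ y ^ d = f y
  lattice : ∀ z : ℤ, (d : ℤ) ∣ z → ∃ n₁ n₂ n₃ : ℤ, a₁ * n₁ + a₂ * n₂ + a₃ * n₃ = z ∧
    ∀ t ∈ T, t + 2 * Real.pi * Complex.I * n₃ ∈ T ∧ ω (t + 2 * Real.pi * Complex.I * n₃) = ω t

namespace LogForm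

variable {Y : Type*} [TopologicalSpace Y] {S : Set Y} {f φ : Y → ℂ} {d : ℕ} {N : Set Y}
  (L : LogForm S f φ d N)

/-- The logarithmic coordinates. -/
def cell : Set (ℂ × ℂ × ℂ) := {p | p.1.re < L.ρ ∧ p.2.1.re < L.ρ ∧ p.2.2 ∈ L.T}

/-- The logarithmic coordinates of a branch. -/
def sheet (j : ℤ) : Set (ℂ × ℂ × ℂ) := {p ∈ L.cell |
  L.a₂ * p.2.1.re = L.c₁ * p.1.re + (L.c₃ - L.a₃) * p.2.2.re ∧
  L.a₁ * p.1.im + L.a₂ * p.2.1.im + L.a₃ * p.2.2.im = 2 * Real.pi * j}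

lemma convex_cell : Convex ℝ L.cell := by
  rintro ⟨x, y, t⟩ ⟨h1, h2, h3⟩ ⟨x', y', t'⟩ ⟨h1', h2', h3'⟩ a b ha hb hab
  have key : ∀ r s : ℝ, r < L.ρ → s < L.ρ → a * r + b * s < L.ρ := fun r s hr hs =>
    (convex_Iio L.ρ) hr hs ha hb hab
  refine ⟨?_, ?_, L.conv h3 h3' ha hb hab⟩
  · simpa using key _ _ h1 h1'
  · simpa using key _ _ h2 h2'

/-- In logarithmic coordinates a branch is cut out by real affine equations in a convex set. This
convexity is the source of the connectedness of the branches. -/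
lemma convex_sheet (j : ℤ) : Convex ℝ (L.sheet j) := by
  rintro p ⟨h0, h1, h2⟩ p' ⟨h0', h1', h2'⟩ a b ha hb hab
  refine ⟨L.convex_cell h0 h0' ha hb hab, ?_, ?_⟩
  · simp only [Prod.fst_add, Prod.snd_add, Prod.smul_fst, Prod.smul_snd, Complex.add_re,
      Complex.smul_re, smul_eq_mul]
    linear_combination a * h1 + b * h1'
  · simp only [Prod.fst_add, Prod.snd_add, Prod.smul_fst, Prod.smul_snd, Complex.add_im,
      Complex.smul_im, smul_eq_mul]
    linear_combination a * h2 + b * h2' + 2 * Real.pi * j * hab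

/-- The coefficient `c₁` is positive, so the equation of the moduli makes `Re z₂` tend to `-∞` with
`Re z₁`. Both are below `ρ` for `Re z₁` negative enough, and the imaginary part of `z₂` is free to
satisfy the second equation. -/
lemma exists_mem_sheet (j : ℤ) : (L.sheet j).Nonempty := by
  obtain ⟨t, ht⟩ := L.nonempty
  have ha : (0 : ℝ) < L.a₂ := by exact_mod_cast L.a₂_pos
  obtain ⟨x, hx1, hx2⟩ : ∃ x : ℝ, x < L.ρ ∧
      (L.c₁ * x + (L.c₃ - L.a₃) * t.re) / L.a₂ < L.ρ := by
    have h1 : Tendsto (fun x : ℝ => (L.c₁ * x + (L.c₃ - L.a₃) * t.re) / L.a₂) atBot atBot :=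
      (tendsto_atBot_add_const_right _ _ (tendsto_id.const_mul_atBot L.c₁_pos)).atBot_div_const ha
    exact ((eventually_lt_atBot L.ρ).and (h1.eventually_lt_atBot L.ρ)).exists
  refine ⟨(x, ⟨(L.c₁ * x + (L.c₃ - L.a₃) * t.re) / L.a₂, (2 * Real.pi * j - L.a₃ * t.im) / L.a₂⟩, t),
    ⟨?_, hx2, ht⟩, ?_, ?_⟩
  · simpa using hx1
  · simp only [Complex.ofReal_re]
    field_simp
  · simp only [Complex.ofReal_im]
    field_simp
    ring

/-- Uniformization by the logarithmic coordinates. -/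
lemma exists_param (hN : N.Nonempty) : ∃ Φ : ℂ × ℂ × ℂ → Y, ContinuousOn Φ L.cell ∧
    ∀ p ∈ L.cell, Φ p ∈ N ∧ L.h (Φ p) = ![Complex.exp p.1, Complex.exp p.2.1, L.ω p.2.2] := by
  obtain ⟨σ, hσ, hσU⟩ := exists_section_of_isOpenEmbedding (hN.mono L.sub) L.emb
  refine ⟨fun p => σ ![Complex.exp p.1, Complex.exp p.2.1, L.ω p.2.2], ?_, fun p hp => ?_⟩
  · refine hσ.comp (continuousOn_pi.2 fun i => ?_) fun p hp => ?_
    · fin_cases i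
      · exact (Complex.continuous_exp.comp continuous_fst).continuousOn
      · exact (Complex.continuous_exp.comp (continuous_fst.comp continuous_snd)).continuousOn
      · exact L.cont.comp (continuous_snd.comp continuous_snd).continuousOn fun p hp => hp.2.2
    · obtain ⟨y, hy, hhy⟩ := L.mem p.1 p.2.1 p.2.2 hp.1 hp.2.1 hp.2.2
      exact ⟨y, L.sub hy, hhy⟩
  · obtain ⟨y, hy, hhy⟩ := L.mem p.1 p.2.1 p.2.2 hp.1 hp.2.1 hp.2.2
    simp only
    rw [← hhy, hσU y (L.sub hy)]
    exact ⟨hy, rfl⟩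

lemma eq_of_h_eq {y y' : Y} (hy : y ∈ N) (hy' : y' ∈ N) (h : L.h y = L.h y') : y = y' :=
  congrArg Subtype.val (L.emb.injective (a₁ := ⟨y, L.sub hy⟩) (a₂ := ⟨y', L.sub hy'⟩) h)

lemma f_pos (L : LogForm S f φ d N) {y : Y} (hy : y ∈ N) (hyS : y ∈ S) : ∃ r : ℝ, 0 < r ∧ f y = r := by
  obtain ⟨z₁, z₂, t, -, -, ht, h⟩ := L.surj y hy (L.f_ne y hyS) hyS
  exact ⟨_, Real.exp_pos _, (L.mem_iff y hy z₁ z₂ t ht h).1 hyS⟩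

/-- A branch is the image of its logarithmic coordinates. -/
lemma mem_sheet_iff {Φ : ℂ × ℂ × ℂ → Y}
    (hΦ : ∀ p ∈ L.cell, Φ p ∈ N ∧ L.h (Φ p) = ![Complex.exp p.1, Complex.exp p.2.1, L.ω p.2.2])
    (j : ℤ) (y : Y) : y ∈ Φ '' L.sheet j ↔ y ∈ N ∩ S ∧ phase d (φ y) = j := by
  have hd' : (d : ℂ) ≠ 0 := by exact_mod_cast L.d_pos.ne'
  constructor
  · rintro ⟨⟨z₁, z₂, t⟩, ⟨hp, h1, h2⟩, rfl⟩
    obtain ⟨hN, hh⟩ := hΦ _ hp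
    simp only at h1 h2 hh
    -- On the sheet of index `j` the logarithm of `f` is a real number plus `2πij`. Hence `f` is
    -- positive, and its `d`-th root `φ` has phase `j`.
    have hsum : (L.a₁ * z₁ + L.a₂ * z₂ + L.a₃ * t : ℂ) =
        ((L.a₁ * z₁.re + L.c₁ * z₁.re + L.c₃ * t.re : ℝ) : ℂ) +
          2 * Real.pi * Complex.I * j := by
      apply Complex.ext
      · simp
        linear_combination h1
      · simp
        linear_combination h2
    refine ⟨⟨hN, (L.mem_iff _ hN z₁ z₂ t hp.2.2 hh).2 ?_⟩, ?_⟩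
    · rw [L.f_eq _ hN z₁ z₂ t hp.2.2 hh, hsum, Complex.exp_add, Complex.ofReal_exp,
        mul_comm (2 * Real.pi * Complex.I : ℂ), Complex.exp_int_mul_two_pi_mul_I, mul_one]
    · rw [L.φ_eq _ hN z₁ z₂ t hp.2.2 hh, hsum, add_div, Complex.exp_add]
      rw [← phase_eq L.d_pos (Real.exp_pos ((L.a₁ * z₁.re + L.c₁ * z₁.re + L.c₃ * t.re) / d)) j]
      push_cast
      rfl
  · rintro ⟨⟨hN, hS⟩, hj⟩
    obtain ⟨z₁, z₂, t, h1, h2, ht, hh⟩ := L.surj y hN (L.f_ne y hS) hS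
    have hf := (L.mem_iff y hN z₁ z₂ t ht hh).1 hS
    rw [L.f_eq y hN z₁ z₂ t ht hh, Complex.ofReal_exp] at hf
    obtain ⟨m, hm⟩ := Complex.exp_eq_exp_iff_exists_int.1 hf
    have hre := congrArg Complex.re hm
    have him := congrArg Complex.im hm
    simp at hre him
    have hφ : phase d (φ y) = m := by
      rw [L.φ_eq y hN z₁ z₂ t ht hh, hm, add_div, Complex.exp_add,
        ← phase_eq L.d_pos (Real.exp_pos ((L.a₁ * z₁.re + L.c₁ * z₁.re + L.c₃ * t.re) / d)) m]
      push_cast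
      congr 3; ring
    have hdvd : (d : ℤ) ∣ j - m := by
      rw [← ZMod.intCast_eq_intCast_iff_dvd_sub]
      exact hφ.symm.trans hj
    -- The logarithms found have some index `m` with the same class as `j` modulo `d`. Changing them
    -- by multiples of `2πi` does not move the point and changes the index from `m` to `j`.
    obtain ⟨n₁, n₂, n₃, hn, hT⟩ := L.lattice _ hdvd
    have hn' : (L.a₁ * n₁ + L.a₂ * n₂ + L.a₃ * n₃ : ℝ) = j - m := by exact_mod_cast hn
    have hper : ∀ n : ℤ, ∀ z : ℂ, Complex.exp (z + 2 * Real.pi * Complex.I * n) = Complex.exp z := by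
      intro n z
      rw [Complex.exp_add, mul_comm (2 * Real.pi * Complex.I : ℂ),
        Complex.exp_int_mul_two_pi_mul_I, mul_one]
    have hcell : ((z₁ + 2 * Real.pi * Complex.I * n₁, z₂ + 2 * Real.pi * Complex.I * n₂,
        t + 2 * Real.pi * Complex.I * n₃) : ℂ × ℂ × ℂ) ∈ L.cell :=
      ⟨by simpa using h1, by simpa using h2, (hT t ht).1⟩
    refine ⟨_, ⟨hcell, ?_, ?_⟩, ?_⟩
    · simp
      linear_combination hre
    · simp
      linear_combination him + 2 * Real.pi * hn'
    · obtain ⟨hN', hh'⟩ := hΦ _ hcell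
      refine L.eq_of_h_eq hN' hN ?_
      rw [hh', hh]
      simp only [hper, (hT t ht).2]

/-- Each level set of the phase is the image of a convex sheet, so it is connected. Conversely `φ /
‖φ‖` is continuous on `S` with values in the `d`-th roots of unity, so it is constant on a connected
component. -/
lemma isGoodNhd (L : LogForm S f φ d N) {q : Y} (hN : IsOpen N) (hq : q ∈ N) :
    IsGoodNhd S q (fun y => phase d (φ y)) N := by
  obtain ⟨Φ, hΦc, hΦ⟩ := L.exists_param ⟨q, hq⟩
  refine ⟨hN, hq, fun y hy => ?_, fun i => ?_⟩
  · obtain ⟨j, hj⟩ := ZMod.intCast_surjective (phase d (φ y))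
    have himg : Φ '' L.sheet j = {z ∈ N ∩ S | phase d (φ z) = phase d (φ y)} := by
      ext z
      rw [L.mem_sheet_iff hΦ, hj]
      rfl
    rw [← himg]
    have hconn : IsPreconnected (Φ '' L.sheet j) :=
      (L.convex_sheet j).isPreconnected.image _ (hΦc.mono fun p hp => hp.1)
    refine subset_antisymm ?_ (hconn.subset_connectedComponentIn ?_ ?_)
    · rw [himg]
      intro z hz
      have hzN := connectedComponentIn_subset _ _ hz
      refine ⟨hzN, ?_⟩
      have hφ0 : ∀ x ∈ N ∩ S, φ x ≠ 0 := fun x hx h0 => L.f_ne x hx.2 (by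
        rw [← L.pow_φ x hx.1, h0, zero_pow L.d_pos.ne'])
      have hn0 : ∀ x ∈ N ∩ S, (‖φ x‖ : ℂ) ≠ 0 := fun x hx => by
        exact_mod_cast norm_ne_zero_iff.2 (hφ0 x hx)
      have hcont : ContinuousOn (fun x => φ x / ‖φ x‖) (N ∩ S) := by
        have h1 := L.cont_φ.mono (inter_subset_left : N ∩ S ⊆ N)
        exact h1.div (Complex.continuous_ofReal.comp_continuousOn h1.norm) hn0
      have hroot : ∀ x ∈ N ∩ S, (φ x / ‖φ x‖) ^ d = 1 := by
        intro x hx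
        obtain ⟨r, hr, hfr⟩ := L.f_pos hx.1 hx.2
        have h1 := L.pow_φ x hx.1
        rw [hfr] at h1
        have h2 : ‖φ x‖ ^ d = r := by
          have := congrArg norm h1
          simpa [abs_of_pos hr] using this
        rw [div_pow, h1, ← Complex.ofReal_pow, h2, div_self]
        exact_mod_cast hr.ne'
      have heq := rootsOfUnity_subsingleton_of_isPreconnected
        (isPreconnected_connectedComponentIn (F := N ∩ S) (x := y)) L.d_pos
        (hcont.mono (connectedComponentIn_subset _ _))
        (fun x hx => hroot x (connectedComponentIn_subset _ _ hx)) hz (mem_connectedComponentIn hy)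
      obtain ⟨r, hr, hfr⟩ := L.f_pos hzN.1 hzN.2
      obtain ⟨r', hr', hfr'⟩ := L.f_pos hy.1 hy.2
      exact phase_congr L.d_pos hr ((L.pow_φ z hzN.1).trans hfr) hr' ((L.pow_φ y hy.1).trans hfr') heq
    · rw [himg]; exact ⟨hy, rfl⟩
    · rw [himg]; exact fun z hz => hz.1
  · obtain ⟨j, rfl⟩ := ZMod.intCast_surjective i
    obtain ⟨p, hp⟩ := L.exists_mem_sheet j
    obtain ⟨h1, h2⟩ := (L.mem_sheet_iff hΦ j (Φ p)).1 (mem_image_of_mem _ hp)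
    exact ⟨Φ p, h1, h2⟩

/-- The image of all the logarithmic coordinates is connected, contains all branches at once, and
avoids the zeros of `f`. Two roots of `f` are compared along it. -/
lemma exists_isPreconnected (L : LogForm S f φ d N) (hN : N.Nonempty) :
    ∃ R ⊆ N, IsPreconnected R ∧ N ∩ S ⊆ R ∧ R.Nonempty ∧ ∀ y ∈ R, f y ≠ 0 := by
  obtain ⟨Φ, hΦc, hΦ⟩ := L.exists_param hN
  refine ⟨Φ '' L.cell, ?_, L.convex_cell.isPreconnected.image _ hΦc, ?_, ?_, ?_⟩
  · rintro _ ⟨p, hp, rfl⟩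
    exact (hΦ p hp).1
  · rintro y ⟨hyN, hyS⟩
    obtain ⟨z₁, z₂, t, h1, h2, ht, hh⟩ := L.surj y hyN (L.f_ne y hyS) hyS
    have hc : ((z₁, z₂, t) : ℂ × ℂ × ℂ) ∈ L.cell := ⟨h1, h2, ht⟩
    exact ⟨_, hc, L.eq_of_h_eq (hΦ _ hc).1 hyN ((hΦ _ hc).2.trans hh.symm)⟩
  · obtain ⟨p, hp⟩ := L.exists_mem_sheet 0
    exact ⟨Φ p, p, hp.1, rfl⟩
  · rintro _ ⟨p, hp, rfl⟩
    rw [L.f_eq _ (hΦ p hp).1 p.1 p.2.1 p.2.2 hp.2.2 (hΦ p hp).2]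
    exact Complex.exp_ne_zero _

end LogForm

end MilnorBoundary


/-! ### Monomial equations, and the branches at generic and double points -/

namespace MilnorBoundary

/-- Coordinates at a point of a curve `u = v = 0` in which `f` is a monomial and `S` is the locus
`f = (|u|^b₁ |w|^b₃)^k`. -/
structure MonomialForm {Y : Type*} [TopologicalSpace Y] (S : Set Y) (f : Y → ℂ) (q : Y)
    (a₁ a₂ a₃ : ℕ) where
  U : Set Y
  h : Y → Fin 3 → ℂ
  b₁ : ℕ
  b₃ : ℕ
  k : ℕ
  isOpen : IsOpen U
  mem : q ∈ U
  emb : IsOpenEmbedding (U.domRestrict h)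
  zero : h q 0 = 0
  one : h q 1 = 0
  a₂_pos : 0 < a₂
  lt : a₁ < k * b₁
  f_eq : ∀ y ∈ U, f y = h y 0 ^ a₁ * h y 1 ^ a₂ * h y 2 ^ a₃
  mem_iff : ∀ y ∈ U, y ∈ S ↔ f y = (((‖h y 0‖ ^ b₁ * ‖h y 2‖ ^ b₃) ^ k : ℝ) : ℂ) ∧ f y ≠ 0
  f_ne : ∀ y ∈ S, f y ≠ 0

namespace MonomialForm

variable {Y : Type*} [TopologicalSpace Y] {S : Set Y} {f : Y → ℂ} {q : Y} {a₁ a₂ a₃ : ℕ}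
  (L : MonomialForm S f q a₁ a₂ a₃)

lemma continuousOn (i : Fin 3) : ContinuousOn (fun y => L.h y i) L.U :=
  (continuous_apply i).comp_continuousOn
    (continuousOn_iff_continuous_domRestrict.2 L.emb.continuous)

lemma exists_polydisc {V : Set Y} (hV : V ∈ 𝓝 q) : ∃ r > 0, ∀ x : Fin 3 → ℂ,
    ‖x 0‖ < r → ‖x 1‖ < r → ‖x 2 - L.h q 2‖ < r → ∃ y ∈ L.U ∩ V, L.h y = x := by
  have h1 : L.h '' (L.U ∩ interior V) ∈ 𝓝 (L.h q) := by
    have : IsOpen (L.h '' (L.U ∩ interior V)) := by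
      have := L.emb.isOpenMap _ (isOpen_interior.preimage continuous_subtype_val :
        IsOpen ((Subtype.val : L.U → Y) ⁻¹' interior V))
      convert this using 1
      ext x
      constructor
      · rintro ⟨y, ⟨hy, hy'⟩, rfl⟩
        exact ⟨⟨y, hy⟩, hy', rfl⟩
      · rintro ⟨⟨y, hy⟩, hy', rfl⟩
        exact ⟨y, ⟨hy, hy'⟩, rfl⟩
    exact this.mem_nhds ⟨q, ⟨L.mem, mem_interior_iff_mem_nhds.2 hV⟩, rfl⟩
  obtain ⟨r, hr, hb⟩ := Metric.mem_nhds_iff.1 h1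
  refine ⟨r, hr, fun x h0 h1 h2 => ?_⟩
  have hx : x ∈ Metric.ball (L.h q) r := by
    rw [Metric.mem_ball, dist_pi_lt_iff hr]
    intro i
    rw [dist_eq_norm]
    fin_cases i
    · simpa [L.zero] using h0
    · simpa [L.one] using h1
    · exact h2
  obtain ⟨y, hy, rfl⟩ := hb hx
  exact ⟨y, ⟨hy.1, interior_subset hy.2⟩, rfl⟩

/-- The logarithmic coordinates associated with a uniformization of the third coordinate. -/
noncomputable def logForm {d : ℕ} (hd : 0 < d) (hd₁ : d ∣ a₁) (hd₂ : d ∣ a₂)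
    {W T : Set ℂ} {V : Set Y} {r : ℝ} (hr : 0 < r)
    (hpoly : ∀ x : Fin 3 → ℂ, ‖x 0‖ < r → ‖x 1‖ < r → x 2 ∈ W → ∃ y ∈ L.U ∩ V, L.h y = x)
    {ω ψ : ℂ → ℂ} (hT : Convex ℝ T) (hTn : T.Nonempty) (hω : ContinuousOn ω T)
    (hTW : MapsTo ω T W) (hω₁ : ∀ t ∈ T, ω t ^ a₃ = Complex.exp (a₃ * t))
    (hω₂ : ∀ t ∈ T, ‖ω t‖ ^ L.b₃ = Real.exp (L.b₃ * t.re))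
    (hsurj : ∀ w ∈ W, w ^ a₃ ≠ 0 → w ^ L.b₃ ≠ 0 → ∃ t ∈ T, ω t = w)
    (hψ : ContinuousOn ψ W) (hψ₁ : ∀ t ∈ T, ψ (ω t) = Complex.exp (a₃ * t / d))
    (hψ₂ : ∀ w ∈ W, ψ w ^ d = w ^ a₃)
    (hlat : ∀ z : ℤ, (d : ℤ) ∣ z → ∃ n₁ n₂ n₃ : ℤ, a₁ * n₁ + a₂ * n₂ + a₃ * n₃ = z ∧
      ∀ t ∈ T, t + 2 * Real.pi * Complex.I * n₃ ∈ T ∧ ω (t + 2 * Real.pi * Complex.I * n₃) = ω t) :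
    LogForm S f (fun y => L.h y 0 ^ (a₁ / d) * L.h y 1 ^ (a₂ / d) * ψ (L.h y 2)) d
      {y ∈ L.U ∩ V | ‖L.h y 0‖ < r ∧ ‖L.h y 1‖ < r ∧ L.h y 2 ∈ W} := by
  have hd' : (d : ℂ) ≠ 0 := by exact_mod_cast hd.ne'
  have hlog : ∀ z : ℂ, z.re < Real.log r ↔ ‖Complex.exp z‖ < r := fun z => by
    rw [Complex.norm_exp, Real.lt_log_iff_exp_lt hr]
  have hk : L.k ≠ 0 := by
    rintro h
    have := L.lt
    simp [h] at this
  have hb : L.b₁ ≠ 0 := by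
    rintro h
    have := L.lt
    simp [h] at this
  refine ⟨L.h, L.U, L.emb, Real.log r, a₁, a₂, a₃, L.k * L.b₁ - a₁, L.k * L.b₃, hd, L.a₂_pos,
    ?_, T, ω, hT, hTn, hω, ?_, fun y hy => hy.1.1, ?_, ?_, ?_, ?_, L.f_ne, ?_, ?_, hlat⟩
  · rw [sub_pos]; exact_mod_cast L.lt
  · intro z₁ z₂ t h1 h2 ht
    rw [hlog] at h1 h2
    obtain ⟨y, hy, hhy⟩ := hpoly ![Complex.exp z₁, Complex.exp z₂, ω t] h1 h2 (hTW ht)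
    refine ⟨y, ⟨hy, ?_⟩, hhy⟩
    rw [hhy]
    exact ⟨h1, h2, hTW ht⟩
  · rintro y ⟨hyU, h0, h1, h2⟩ hf hyS
    have hf' := L.f_eq y hyU.1
    have hγ := ((L.mem_iff y hyU.1).1 hyS).1
    have hne1 : L.h y 0 ≠ 0 := by
      intro h
      rw [h, norm_zero, zero_pow hb, zero_mul, zero_pow hk] at hγ
      exact hf (by simpa using hγ)
    have hne2 : L.h y 1 ≠ 0 := by
      intro h
      rw [h, zero_pow L.a₂_pos.ne'] at hf'
      exact hf (by simpa using hf')
    have hne3 : L.h y 2 ^ a₃ ≠ 0 := by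
      intro h
      rw [h] at hf'
      exact hf (by simpa using hf')
    have hne4 : L.h y 2 ^ L.b₃ ≠ 0 := by
      intro h
      rw [← norm_pow (L.h y 2), h, norm_zero, mul_zero, zero_pow hk] at hγ
      exact hf (by simpa using hγ)
    obtain ⟨t, ht, htw⟩ := hsurj _ h2 hne3 hne4
    refine ⟨Complex.log (L.h y 0), Complex.log (L.h y 1), t, ?_, ?_, ht, ?_⟩
    · rwa [hlog, Complex.exp_log hne1]
    · rwa [hlog, Complex.exp_log hne2]
    · rw [Complex.exp_log hne1, Complex.exp_log hne2, htw]
      ext i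
      fin_cases i <;> rfl
  · rintro y hy z₁ z₂ t ht hh
    rw [L.f_eq y hy.1.1, hh]
    simp only [Matrix.cons_val]
    rw [hω₁ t ht, ← Complex.exp_nat_mul, ← Complex.exp_nat_mul, ← Complex.exp_add,
      ← Complex.exp_add]
  · rintro y hy z₁ z₂ t ht hh
    simp only [hh, Matrix.cons_val]
    rw [hψ₁ t ht, ← Complex.exp_nat_mul, ← Complex.exp_nat_mul, ← Complex.exp_add,
      ← Complex.exp_add, Nat.cast_div hd₁ hd', Nat.cast_div hd₂ hd']
    congr 1
    field_simp
  · rintro y hy z₁ z₂ t ht hh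
    have hf : f y ≠ 0 := by
      rw [L.f_eq y hy.1.1, hh]
      simp only [Matrix.cons_val]
      rw [hω₁ t ht]
      exact mul_ne_zero (mul_ne_zero (pow_ne_zero _ (Complex.exp_ne_zero _))
        (pow_ne_zero _ (Complex.exp_ne_zero _))) (Complex.exp_ne_zero _)
    rw [L.mem_iff y hy.1.1, hh]
    simp only [Matrix.cons_val]
    rw [hω₂ t ht, Complex.norm_exp, ← Real.exp_nat_mul, ← Real.exp_add, ← Real.exp_nat_mul]
    have : (L.k * (L.b₁ * z₁.re + L.b₃ * t.re) : ℝ) =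
      a₁ * z₁.re + (L.k * L.b₁ - a₁) * z₁.re + L.k * L.b₃ * t.re := by ring
    rw [this]
    exact and_iff_left hf
  · have h1 : {y ∈ L.U ∩ V | ‖L.h y 0‖ < r ∧ ‖L.h y 1‖ < r ∧ L.h y 2 ∈ W} ⊆ L.U :=
      fun y hy => hy.1.1
    refine ((((L.continuousOn 0).mono h1).pow _).mul (((L.continuousOn 1).mono h1).pow _)).mul
      (hψ.comp ((L.continuousOn 2).mono h1) fun y hy => hy.2.2.2)
  · rintro y hy
    rw [mul_pow, mul_pow, hψ₂ _ hy.2.2.2, ← pow_mul, ← pow_mul, Nat.div_mul_cancel hd₁,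
      Nat.div_mul_cancel hd₂, L.f_eq y hy.1.1]

lemma isOpen_polydisc {V : Set Y} (hV : IsOpen V) {W : Set ℂ} (hW : IsOpen W) (r : ℝ) :
    IsOpen {y ∈ L.U ∩ V | ‖L.h y 0‖ < r ∧ ‖L.h y 1‖ < r ∧ L.h y 2 ∈ W} := by
  have h0 := (L.continuousOn 0).isOpen_inter_preimage L.isOpen (Metric.isOpen_ball (x := (0 : ℂ))
    (ε := r))
  have h1 := (L.continuousOn 1).isOpen_inter_preimage L.isOpen (Metric.isOpen_ball (x := (0 : ℂ))
    (ε := r))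
  have h2 := (L.continuousOn 2).isOpen_inter_preimage L.isOpen hW
  convert (hV.inter h0).inter (h1.inter h2) using 1
  ext y
  simp only [mem_inter_iff, mem_preimage, mem_ball_zero_iff]
  constructor
  · rintro ⟨⟨a, b⟩, c, e, g⟩
    exact ⟨⟨b, a, c⟩, ⟨a, e⟩, a, g⟩
  · rintro ⟨⟨b, a, c⟩, ⟨-, e⟩, -, g⟩
    exact ⟨⟨a, b⟩, c, e, g⟩

lemma lattice_two (a₁ a₂ : ℕ) {z : ℤ} (hz : ((a₁.gcd a₂ : ℕ) : ℤ) ∣ z) :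
    ∃ n₁ n₂ : ℤ, a₁ * n₁ + a₂ * n₂ = z := by
  obtain ⟨e, rfl⟩ := hz
  refine ⟨Nat.gcdA a₁ a₂ * e, Nat.gcdB a₁ a₂ * e, ?_⟩
  rw [Nat.gcd_eq_gcd_ab]; ring

lemma lattice_three (a₁ a₂ a₃ : ℕ) {z : ℤ} (hz : (((a₁.gcd a₂).gcd a₃ : ℕ) : ℤ) ∣ z) :
    ∃ n₁ n₂ n₃ : ℤ, a₁ * n₁ + a₂ * n₂ + a₃ * n₃ = z := by
  obtain ⟨n, n₃, h⟩ := lattice_two _ _ hz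
  obtain ⟨n₁, n₂, h'⟩ := lattice_two a₁ a₂ (z := (a₁.gcd a₂ : ℕ) * n) ⟨n, rfl⟩
  exact ⟨n₁, n₂, n₃, by rw [h', h]⟩

/-- The equations of the logarithmic coordinates of a branch. -/
def InSheet (j : ℤ) (z₁ z₂ t : ℂ) : Prop :=
  a₂ * z₂.re = (L.k * L.b₁ - a₁) * z₁.re + (L.k * L.b₃ - a₃) * t.re ∧
  a₁ * z₁.im + a₂ * z₂.im + a₃ * t.im = 2 * Real.pi * j

/-- A neighbourhood in which the branches are described by logarithmic coordinates. -/
structure IsSheetNhd (ω : ℂ → ℂ) (d : ℕ) (φ : Y → ℂ) (T : Set ℂ) (ρ : ℝ) (N : Set Y) : Prop where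
  good : IsGoodNhd S q (fun y => phase d (φ y)) N
  sub : N ⊆ L.U
  exists_log : ∀ y ∈ N ∩ S, ∀ j : ℤ, phase d (φ y) = j → ∃ z₁ z₂ t, z₁.re < ρ ∧ z₂.re < ρ ∧
    t ∈ T ∧ L.InSheet j z₁ z₂ t ∧ L.h y = ![Complex.exp z₁, Complex.exp z₂, ω t]
  exists_pt : ∀ z₁ z₂ t, ∀ j : ℤ, z₁.re < ρ → z₂.re < ρ → t ∈ T → L.InSheet j z₁ z₂ t →
    ∃ y ∈ N ∩ S, L.h y = ![Complex.exp z₁, Complex.exp z₂, ω t] ∧ phase d (φ y) = j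
  exists_preconnected : ∃ R ⊆ N, IsPreconnected R ∧ N ∩ S ⊆ R ∧ R.Nonempty ∧ ∀ y ∈ R, f y ≠ 0
  pow : ∀ y ∈ N, φ y ^ d = f y
  cont : ContinuousOn φ N

omit L in
lemma isRootAt_of_isSheetNhd {d : ℕ} (hd : 0 < d) {φ : Y → ℂ}
    (h : ∀ U ∈ 𝓝 q, ∃ L : MonomialForm S f q a₁ a₂ a₃, ∃ N ⊆ U, ∃ ω T ρ,
      L.IsSheetNhd ω d φ T ρ N) : IsRootAt S f q d φ where
  pos := hd
  pow := by
    obtain ⟨L, N, -, ω, T, ρ, hN⟩ := h univ univ_mem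
    exact Filter.mem_of_superset (hN.good.isOpen.mem_nhds hN.good.mem) hN.pow
  cont := by
    obtain ⟨L, N, -, ω, T, ρ, hN⟩ := h univ univ_mem
    exact Filter.mem_of_superset (hN.good.isOpen.mem_nhds hN.good.mem) fun y hy =>
      hN.cont.continuousAt (hN.good.isOpen.mem_nhds hy)
  isLabel := fun U hU => by
    obtain ⟨L, N, hNU, ω, T, ρ, hN⟩ := h U hU
    exact ⟨N, hNU, hN.good⟩
  conn := fun U hU => by
    obtain ⟨L, N, hNU, ω, T, ρ, hN⟩ := h U hU
    obtain ⟨R, hRN, hR, hS, hne, hf⟩ := hN.exists_preconnected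
    exact ⟨R, hRN.trans hNU, hR, mem_nhdsWithin.2 ⟨N, hN.good.isOpen, hN.good.mem, hS⟩, hne, hf⟩

lemma isSheetNhd_of_logForm {d : ℕ} {φ : Y → ℂ} {N : Set Y} (L' : LogForm S f φ d N)
    (hN : IsOpen N) (hq : q ∈ N) (hh : L'.h = L.h) (hNU : N ⊆ L.U)
    (h1 : L'.a₁ = a₁) (h2 : L'.a₂ = a₂) (h3 : L'.a₃ = a₃) (hc₁ : L'.c₁ = L.k * L.b₁ - a₁)
    (hc₃ : L'.c₃ = L.k * L.b₃) : L.IsSheetNhd L'.ω d φ L'.T L'.ρ N := by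
  obtain ⟨Φ, hΦc, hΦ⟩ := L'.exists_param ⟨q, hq⟩
  refine ⟨L'.isGoodNhd hN hq, hNU, fun y hy j hj => ?_, fun z₁ z₂ t j hz₁ hz₂ ht hs => ?_,
    L'.exists_isPreconnected ⟨q, hq⟩, L'.pow_φ, L'.cont_φ⟩
  · obtain ⟨⟨z₁, z₂, t⟩, ⟨hc, hs⟩, rfl⟩ := (L'.mem_sheet_iff hΦ j y).2 ⟨hy, hj⟩
    rw [h1, h2, h3, hc₁, hc₃] at hs
    refine ⟨z₁, z₂, t, hc.1, hc.2.1, hc.2.2, hs, ?_⟩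
    rw [← hh]
    exact (hΦ _ hc).2
  · have hc : ((z₁, z₂, t) : ℂ × ℂ × ℂ) ∈ L'.cell := ⟨hz₁, hz₂, ht⟩
    have hp : ((z₁, z₂, t) : ℂ × ℂ × ℂ) ∈ L'.sheet j := by
      refine ⟨hc, ?_⟩
      rw [h1, h2, h3, hc₁, hc₃]
      exact hs
    obtain ⟨hy, hj⟩ := (L'.mem_sheet_iff hΦ j _).1 (mem_image_of_mem Φ hp)
    exact ⟨_, hy, by rw [← hh]; exact (hΦ _ hc).2, hj⟩

end MonomialForm

/-- A local biholomorphism of `ℂ`, with inverses `lg t` defined near the points `t`. -/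
structure IsUniformizer (ω : ℂ → ℂ) (lg : ℂ → ℂ → ℂ) : Prop where
  analyticAt : ∀ t, AnalyticAt ℂ ω t
  lg_analyticAt : ∀ t, AnalyticAt ℂ (lg t) (ω t)
  isOpenMap : IsOpenMap ω
  lg_apply : ∀ t₁ t, ‖t - t₁‖ < 1 → lg t₁ (ω t) = t
  continuousOn : ∀ t₁, ContinuousOn (lg t₁) (ω '' Metric.ball t₁ 1)

lemma isUniformizer_id : IsUniformizer id fun _ => id where
  analyticAt := fun _ => analyticAt_id
  lg_analyticAt := fun _ => analyticAt_id
  isOpenMap := IsOpenMap.id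
  lg_apply := fun _ _ _ => rfl
  continuousOn := fun _ => continuousOn_id

/-- On a disc of radius `1` imaginary parts differ from that of the center by less than `1 < π / 2`,
so after division by `exp t₁` the principal logarithm is an inverse and its argument stays in the
right half-plane. -/
lemma isUniformizer_exp : IsUniformizer Complex.exp
    fun t₁ w => Complex.log (w / Complex.exp t₁) + t₁ := by
  have hpi := Real.pi_gt_three
  have him : ∀ t₁ t : ℂ, ‖t - t₁‖ < 1 → |(t - t₁).im| < 1 := fun t₁ t h =>
    (Complex.abs_im_le_norm _).trans_lt h
  refine ⟨fun t => analyticAt_cexp, fun t => ?_,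
    Complex.isOpenMap_exp, fun t₁ t ht => ?_, fun t₁ => ?_⟩
  · refine AnalyticAt.add (AnalyticAt.clog (analyticAt_id.div_const) ?_) analyticAt_const
    simp
  · have h3 := abs_lt.1 (him t₁ t ht)
    show Complex.log (Complex.exp t / Complex.exp t₁) + t₁ = t
    rw [← Complex.exp_sub, Complex.log_exp (by linarith) (by linarith), sub_add_cancel]
  · refine (ContinuousOn.clog (continuousOn_id.div_const _) ?_).add continuousOn_const
    rintro _ ⟨t, ht, rfl⟩
    rw [mem_ball_iff_norm] at ht
    have h3 := abs_lt.1 (him t₁ t ht)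
    rw [id_eq, ← Complex.exp_sub]
    refine Complex.mem_slitPlane_iff.2 (Or.inl ?_)
    rw [Complex.exp_re]
    exact mul_pos (Real.exp_pos _) (Real.cos_pos_of_mem_Ioo ⟨by linarith, by linarith⟩)

namespace MonomialForm

variable {Y : Type*} [TopologicalSpace Y] {S : Set Y} {f : Y → ℂ} {q : Y} {a₁ a₂ a₃ : ℕ}
  (L : MonomialForm S f q a₁ a₂ a₃)

/-- The monomial `w^a₃` and `|w|^b₃` are exponentials in the uniformizing coordinate. -/
def Fits (ω : ℂ → ℂ) : Prop :=
  ∀ t, ω t ^ a₃ = Complex.exp (a₃ * t) ∧ ‖ω t‖ ^ L.b₃ = Real.exp (L.b₃ * t.re)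

/-- The root of `f` at a point with third coordinate `ω t₁`. -/
noncomputable def root (lg : ℂ → ℂ → ℂ) (t₁ : ℂ) (y : Y) : ℂ :=
  L.h y 0 ^ (a₁ / a₁.gcd a₂) * L.h y 1 ^ (a₂ / a₁.gcd a₂) *
    Complex.exp (a₃ * lg t₁ (L.h y 2) / (a₁.gcd a₂ : ℕ))

lemma gcd_pos (L : MonomialForm S f q a₁ a₂ a₃) : 0 < a₁.gcd a₂ :=
  Nat.gcd_pos_of_pos_right _ L.a₂_pos

/-- Branches at a generic point. -/
theorem exists_isSheetNhd {ω : ℂ → ℂ} {lg : ℂ → ℂ → ℂ} (hω : IsUniformizer ω lg) (hL : L.Fits ω)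
    {t₁ : ℂ} (ht₁ : L.h q 2 = ω t₁) {V : Set Y} (hV : V ∈ 𝓝 q) {ε : ℝ} (hε : 0 < ε) :
    ∃ N ⊆ V, ∃ ρ δ, 0 < δ ∧ δ ≤ ε ∧
      L.IsSheetNhd ω (a₁.gcd a₂) (L.root lg t₁) (Metric.ball t₁ δ) ρ N := by
  set d := a₁.gcd a₂ with hd
  have hd0 : 0 < d := L.gcd_pos
  have hd' : (d : ℂ) ≠ 0 := by exact_mod_cast hd0.ne'
  have hd₁ : d ∣ a₁ := Nat.gcd_dvd_left _ _
  have hd₂ : d ∣ a₂ := Nat.gcd_dvd_right _ _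
  obtain ⟨r, hr, hpoly⟩ := L.exists_polydisc (interior_mem_nhds.2 hV)
  obtain ⟨ε', hε', hball⟩ : ∃ ε' > 0, ∀ t ∈ Metric.ball t₁ ε', ‖ω t - ω t₁‖ < r := by
    obtain ⟨ε', hε', h⟩ := Metric.continuousAt_iff.1 (hω.analyticAt t₁).continuousAt r hr
    refine ⟨ε', hε', fun t ht => ?_⟩
    rw [← dist_eq_norm]
    exact h ht
  -- The bound `1` keeps the local inverse `lg t₁` valid on `T`, the bound `ε'` keeps the third
  -- coordinate in the polydisc.
  set δ := min ε (min ε' 1)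
  have hδ : 0 < δ := lt_min hε (lt_min hε' one_pos)
  set T := Metric.ball t₁ δ
  have hT1 : ∀ t ∈ T, ‖t - t₁‖ < 1 := fun t ht => by
    rw [← dist_eq_norm]
    exact lt_of_lt_of_le ht ((min_le_right _ _).trans (min_le_right _ _))
  have hcont : Continuous ω := continuous_iff_continuousAt.2 fun t => (hω.analyticAt t).continuousAt
  have hrest := L.isOpen_polydisc isOpen_interior (hω.isOpenMap _ (Metric.isOpen_ball : IsOpen T)) r
    (V := interior V)
  have hqN : q ∈ {y ∈ L.U ∩ interior V | ‖L.h y 0‖ < r ∧ ‖L.h y 1‖ < r ∧ L.h y 2 ∈ ω '' T} := by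
    refine ⟨⟨L.mem, mem_interior_iff_mem_nhds.2 hV⟩, ?_, ?_, ?_⟩
    · rw [L.zero]; simpa
    · rw [L.one]; simpa
    · exact ⟨t₁, Metric.mem_ball_self hδ, ht₁.symm⟩
  let L' := L.logForm (V := interior V) (ψ := fun w => Complex.exp (a₃ * lg t₁ w / d)) (ω := ω)
      (W := ω '' T) (T := T) hd0 hd₁ hd₂ hr
    (by
      rintro x h0 h1 ⟨t, ht, hx⟩
      refine hpoly x h0 h1 ?_
      rw [← hx, ht₁]
      exact hball t (Metric.ball_subset_ball ((min_le_right _ _).trans (min_le_left _ _)) ht))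
    (convex_ball _ _) ⟨_, Metric.mem_ball_self hδ⟩ hcont.continuousOn (mapsTo_image _ _)
    (fun t _ => (hL t).1) (fun t _ => (hL t).2)
    (by rintro _ ⟨t, ht, rfl⟩ - -; exact ⟨t, ht, rfl⟩)
    (Complex.continuous_exp.comp_continuousOn (ContinuousOn.div_const
      (continuousOn_const.mul ((hω.continuousOn t₁).mono (image_mono fun t ht => by
        rw [mem_ball_iff_norm]; exact hT1 t ht))) _))
    (fun t ht => by simp only [hω.lg_apply t₁ t (hT1 t ht)])
    (by
      rintro _ ⟨t, ht, rfl⟩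
      simp only [hω.lg_apply t₁ t (hT1 t ht)]
      rw [(hL t).1, ← Complex.exp_nat_mul, mul_div_cancel₀ _ hd'])
    (fun z hz => by
      -- In the disc `T` the third logarithm cannot wind, so `n₃ = 0`: only the first two exponents
      -- enter the number of branches.
      obtain ⟨n₁, n₂, h⟩ := lattice_two _ _ hz
      exact ⟨n₁, n₂, 0, by rw [← h]; ring, fun t ht => by simpa using ht⟩)
  refine ⟨_, ?_, Real.log r, δ, hδ, min_le_left _ _,
    L.isSheetNhd_of_logForm L' hrest hqN rfl (fun y hy => hy.1.1) rfl rfl rfl rfl rfl⟩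
  exact fun y hy => interior_subset hy.1.2

theorem isRootAt_generic {ω : ℂ → ℂ} {lg : ℂ → ℂ → ℂ} (hω : IsUniformizer ω lg) (hL : L.Fits ω)
    {t₁ : ℂ} (ht₁ : L.h q 2 = ω t₁) : IsRootAt S f q (a₁.gcd a₂) (L.root lg t₁) :=
  isRootAt_of_isSheetNhd L.gcd_pos fun U hU => by
    obtain ⟨N, hN, ρ, δ, -, -, h⟩ := L.exists_isSheetNhd hω hL ht₁ hU one_pos
    exact ⟨L, N, hN, _, _, _, h⟩

/-- The root of `f` at a double point. -/
noncomputable def doubleRoot (y : Y) : ℂ :=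
  L.h y 0 ^ (a₁ / (a₁.gcd a₂).gcd a₃) * L.h y 1 ^ (a₂ / (a₁.gcd a₂).gcd a₃) *
    L.h y 2 ^ (a₃ / (a₁.gcd a₂).gcd a₃)

/-- Branches at a double point. -/
theorem exists_isSheetNhd_double (h2 : L.h q 2 = 0) (h3 : a₃ ≠ 0 ∨ L.b₃ ≠ 0) {V : Set Y}
    (hV : V ∈ 𝓝 q) : ∃ r > 0, (∀ y ∈ L.U, ‖L.h y 0‖ < r → ‖L.h y 1‖ < r → ‖L.h y 2‖ < r → y ∈ V) ∧
      (∀ x : Fin 3 → ℂ, ‖x 0‖ < r → ‖x 1‖ < r → ‖x 2‖ < r → ∃ y ∈ L.U, L.h y = x) ∧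
      L.IsSheetNhd Complex.exp ((a₁.gcd a₂).gcd a₃) L.doubleRoot {t | t.re < Real.log r} (Real.log r)
        {y ∈ L.U | ‖L.h y 0‖ < r ∧ ‖L.h y 1‖ < r ∧ ‖L.h y 2‖ < r} := by
  set d := (a₁.gcd a₂).gcd a₃ with hd
  have hd0 : 0 < d := Nat.gcd_pos_of_pos_left _ L.gcd_pos
  have hd' : (d : ℂ) ≠ 0 := by exact_mod_cast hd0.ne'
  have hd₁ : d ∣ a₁ := (Nat.gcd_dvd_left _ _).trans (Nat.gcd_dvd_left _ _)
  have hd₂ : d ∣ a₂ := (Nat.gcd_dvd_left _ _).trans (Nat.gcd_dvd_right _ _)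
  have hd₃ : d ∣ a₃ := Nat.gcd_dvd_right _ _
  obtain ⟨r, hr, hpoly⟩ := L.exists_polydisc hV
  rw [h2] at hpoly
  simp only [sub_zero] at hpoly
  have hNeq : {y ∈ L.U | ‖L.h y 0‖ < r ∧ ‖L.h y 1‖ < r ∧ ‖L.h y 2‖ < r} =
      {y ∈ L.U ∩ univ | ‖L.h y 0‖ < r ∧ ‖L.h y 1‖ < r ∧ L.h y 2 ∈ Metric.ball (0 : ℂ) r} := by
    ext y; simp
  refine ⟨r, hr, fun y hy h0 h1 h2 => ?_, fun x h0 h1 h2 => ?_, ?_⟩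
  · obtain ⟨y', hy', hyy⟩ := hpoly (L.h y) h0 h1 h2
    have : y' = y := congrArg Subtype.val
      (L.emb.injective (a₁ := ⟨y', hy'.1⟩) (a₂ := ⟨y, hy⟩) hyy)
    rw [← this]; exact hy'.2
  · obtain ⟨y', hy', hyy⟩ := hpoly x h0 h1 h2
    exact ⟨y', hy'.1, hyy⟩
  rw [hNeq]
  have hrest := L.isOpen_polydisc isOpen_univ (Metric.isOpen_ball (x := (0 : ℂ)) (ε := r)) r
  let L' := L.logForm (V := univ) (W := Metric.ball 0 r) (ψ := fun w => w ^ (a₃ / d))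
      (ω := Complex.exp) (T := {t | t.re < Real.log r}) hd0 hd₁ hd₂ hr
    (by
      intro x h0 h1 h2
      obtain ⟨y, hy, h⟩ := hpoly x h0 h1 (by simpa using h2)
      exact ⟨y, ⟨hy.1, mem_univ _⟩, h⟩)
    (convex_halfSpace_re_lt _)
    ⟨(Real.log r - 1 : ℝ), by
      show (((Real.log r - 1 : ℝ) : ℂ)).re < _
      rw [Complex.ofReal_re]; linarith⟩
    Complex.continuous_exp.continuousOn
    (by
      intro t ht
      rw [mem_ball_zero_iff, Complex.norm_exp]
      exact (Real.lt_log_iff_exp_lt hr).1 ht)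
    (fun t _ => by rw [Complex.exp_nat_mul])
    (fun t _ => by rw [Complex.norm_exp, Real.exp_nat_mul])
    (by
      intro w hw h5 h4
      have hw0 : w ≠ 0 := by
        rintro rfl
        exact h3.elim (fun h => h5 (zero_pow h)) fun h => h4 (zero_pow h)
      refine ⟨Complex.log w, ?_, Complex.exp_log hw0⟩
      show (Complex.log w).re < _
      rw [Complex.log_re]
      exact Real.log_lt_log (norm_pos_iff.2 hw0) (by simpa using hw))
    (continuous_pow _).continuousOn
    (by
      intro t _
      show Complex.exp t ^ _ = _
      rw [← Complex.exp_nat_mul, Nat.cast_div hd₃ hd']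
      congr 1; ring)
    (by
      intro w _
      rw [← pow_mul, Nat.div_mul_cancel hd₃])
    (by
      intro z hz
      -- The half-plane `T` is invariant under translation by `2πi`, so the third coordinate may
      -- wind around `0` and the third exponent enters the gcd.
      obtain ⟨n₁, n₂, n₃, h⟩ := lattice_three _ _ _ hz
      refine ⟨n₁, n₂, n₃, h, fun t ht => ⟨?_, ?_⟩⟩
      · simpa using ht
      · rw [Complex.exp_add, mul_comm (2 * Real.pi * Complex.I : ℂ),
          Complex.exp_int_mul_two_pi_mul_I, mul_one])
  exact L.isSheetNhd_of_logForm L' hrest ⟨⟨L.mem, mem_univ _⟩, by rw [L.zero]; simpa,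
    by rw [L.one]; simpa, by rw [h2]; simpa⟩ rfl (fun y hy => hy.1.1) rfl rfl rfl rfl rfl

theorem isRootAt_double (h2 : L.h q 2 = 0) (h3 : a₃ ≠ 0 ∨ L.b₃ ≠ 0) :
    IsRootAt S f q ((a₁.gcd a₂).gcd a₃) L.doubleRoot :=
  isRootAt_of_isSheetNhd (Nat.gcd_pos_of_pos_left _ L.gcd_pos) fun U hU => by
    obtain ⟨r, hr, hU', -, h⟩ := L.exists_isSheetNhd_double h2 h3 hU
    exact ⟨L, _, fun y hy => hU' y hy.1 hy.2.1 hy.2.2.1 hy.2.2.2, _, _, _, h⟩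

end MonomialForm

end MilnorBoundary


namespace MilnorBoundary

/-! ### Charts, regular points and irreducible components -/

section Components

variable {Y : Type*} [TopologicalSpace Y] {hol : Y → (Y → ℂ) → Prop} {A : Set Y}

lemma IsChartOn.exists_section {U : Set Y} {d : ℕ} {h : Y → Fin d → ℂ} (hh : IsChartOn hol A U h)
    {q : Y} (hq : q ∈ A ∩ U) : ∃ σ : (Fin d → ℂ) → Y, (∀ y ∈ A ∩ U, σ (h y) = y) ∧
      ∃ O : Set (Fin d → ℂ), IsOpen O ∧ h q ∈ O ∧ ContinuousOn σ O ∧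
        ∀ x ∈ O, σ x ∈ A ∩ U ∧ h (σ x) = x := by
  obtain ⟨σ, hσ, hσU⟩ := exists_section_of_isOpenEmbedding ⟨q, hq⟩ hh.isOpenEmbedding
  refine ⟨σ, hσU, h '' (A ∩ U), ?_, mem_image_of_mem _ hq, hσ, ?_⟩
  · rw [← Set.range_domRestrict]
    exact hh.isOpenEmbedding.isOpen_range
  · rintro _ ⟨y, hy, rfl⟩
    rw [hσU y hy]
    exact ⟨hy, rfl⟩

lemma IsChartOn.continuousOn {U : Set Y} {d : ℕ} {h : Y → Fin d → ℂ} (hh : IsChartOn hol A U h) :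
    ContinuousOn h (A ∩ U) :=
  continuousOn_iff_continuous_domRestrict.2 hh.isOpenEmbedding.continuous

lemma IsChartOn.nhdsWithin_eq {U : Set Y} {d : ℕ} {h : Y → Fin d → ℂ} (hh : IsChartOn hol A U h)
    {q : Y} (hq : q ∈ A ∩ U) : 𝓝[A] q = 𝓝[A ∩ U] q :=
  (nhdsWithin_inter_of_mem' (mem_nhdsWithin_of_mem_nhds (hh.isOpen.mem_nhds hq.2))).symm

lemma IsChartOn.eventually_iff {U : Set Y} {d : ℕ} {h : Y → Fin d → ℂ} (hh : IsChartOn hol A U h)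
    {q : Y} (hq : q ∈ A ∩ U) {σ : (Fin d → ℂ) → Y} (hσ : ∀ y ∈ A ∩ U, σ (h y) = y)
    {p : Y → Prop} : (∀ᶠ y in 𝓝[A] q, p y) ↔ ∀ᶠ x in 𝓝 (h q), p (σ x) := by
  rw [hh.nhdsWithin_eq hq, nhdsWithin_eq_map_subtype_coe hq, eventually_map]
  have := hh.isOpenEmbedding.map_nhds_eq ⟨q, hq⟩
  show _ ↔ ∀ᶠ x in 𝓝 ((A ∩ U).domRestrict h ⟨q, hq⟩), p (σ x)
  rw [← this, eventually_map]
  exact eventually_congr (Eventually.of_forall fun y => by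
    show p y ↔ p (σ (h y))
    rw [hσ y y.2])

lemma mem_regularLocus_of_chart {U : Set Y} {d : ℕ} {h : Y → Fin d → ℂ}
    (hh : IsChartOn hol A U h) {y : Y} (hy : y ∈ A ∩ U) : y ∈ regularLocus hol A :=
  ⟨hy.1, d, U, h, hy.2, hh⟩

/-- A small ball in a chart is connected and made of regular points; the regular locus is therefore
open in `A` and locally connected. -/
lemma connectedComponentIn_regularLocus_mem_nhdsWithin {y : Y} (hy : y ∈ regularLocus hol A) :
    connectedComponentIn (regularLocus hol A) y ∈ 𝓝[A] y := by
  obtain ⟨hyA, d, U, h, hyU, hh⟩ := hy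
  obtain ⟨σ, hσ, O, hO, hqO, hσO, hO'⟩ := hh.exists_section ⟨hyA, hyU⟩
  obtain ⟨r, hr, hb⟩ := Metric.isOpen_iff.1 hO _ hqO
  have h1 : IsPreconnected (σ '' Metric.ball (h y) r) :=
    (convex_ball (h y) r).isPreconnected.image _ (hσO.mono hb)
  have h2 : σ '' Metric.ball (h y) r ⊆ connectedComponentIn (regularLocus hol A) y := by
    refine h1.subset_connectedComponentIn ⟨h y, Metric.mem_ball_self hr, hσ y ⟨hyA, hyU⟩⟩ ?_
    rintro _ ⟨x, hx, rfl⟩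
    exact mem_regularLocus_of_chart hh (hO' x (hb hx)).1
  exact (hh.eventually_iff ⟨hyA, hyU⟩ hσ).2 (Filter.mem_of_superset (Metric.ball_mem_nhds _ hr)
    fun x hx => h2 (mem_image_of_mem _ hx))

/-- The component at a regular point. -/
lemma eq_of_mem_regularLocus {D : Set Y} (hD : D ∈ irreducibleComponentsOf hol A) {y : Y}
    (hy : y ∈ regularLocus hol A) (hyD : y ∈ D) :
    D = closure (connectedComponentIn (regularLocus hol A) y) := by
  obtain ⟨x, hx, rfl⟩ := hD
  obtain ⟨V, hV, hyV, hVs⟩ := mem_nhdsWithin.1 (connectedComponentIn_regularLocus_mem_nhdsWithin hy)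
  obtain ⟨z, hzV, hz⟩ := mem_closure_iff.1 hyD V hV hyV
  have hz' := hVs ⟨hzV, (connectedComponentIn_subset _ _ hz).1⟩
  rw [connectedComponentIn_eq hz, connectedComponentIn_eq hz']

lemma mem_nhdsWithin_of_mem_regularLocus {D : Set Y} (hD : D ∈ irreducibleComponentsOf hol A)
    {y : Y} (hy : y ∈ regularLocus hol A) (hyD : y ∈ D) : D ∈ 𝓝[A] y := by
  rw [eq_of_mem_regularLocus hD hy hyD]
  exact Filter.mem_of_superset (connectedComponentIn_regularLocus_mem_nhdsWithin hy) subset_closure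

lemma closure_regular {D : Set Y} (hD : D ∈ irreducibleComponentsOf hol A) {y : Y} (hy : y ∈ D) :
    ∃ᶠ z in 𝓝 y, z ∈ D ∧ z ∈ regularLocus hol A := by
  obtain ⟨x, hx, rfl⟩ := hD
  rw [mem_closure_iff_frequently] at hy
  exact hy.mono fun z hz => ⟨subset_closure hz, connectedComponentIn_subset _ _ hz⟩

/-- The identity theorem. -/
lemma eq_zero_of_eventually_eq_zero {F : Y → ℂ} (hF : ∀ y, hol y F) (hFc : Continuous F) {D : Set Y}
    (hD : D ∈ irreducibleComponentsOf hol A) {y : Y} (hy : y ∈ regularLocus hol A) (hyD : y ∈ D)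
    (h0 : ∀ᶠ z in 𝓝[A] y, F z = 0) : ∀ z ∈ D, F z = 0 := by
  rw [eq_of_mem_regularLocus hD hy hyD]
  set R := connectedComponentIn (regularLocus hol A) y
  have hRreg : ∀ z ∈ R, z ∈ regularLocus hol A := fun z hz => connectedComponentIn_subset _ _ hz
  have hRnhds : ∀ z ∈ R, R ∈ 𝓝[A] z := fun z hz => by
    have := connectedComponentIn_regularLocus_mem_nhdsWithin (hRreg z hz)
    rwa [← connectedComponentIn_eq hz] at this
  -- The points of `R` near which `F` vanishes identically form an open set by definition. In a ball
  -- of a chart the identity principle makes this condition hold everywhere or nowhere, so the set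
  -- is closed as well.
  let Z : Set R := {z | ∀ᶠ x in 𝓝[A] (z : Y), F x = 0}
  have hloc : ∀ z : R, ∃ V ∈ 𝓝 z, (∃ z' ∈ V, z' ∈ Z) → ∀ z' ∈ V, z' ∈ Z := by
    rintro ⟨z, hz⟩
    obtain ⟨hzA, d, U, h, hzU, hh⟩ := hRreg z hz
    obtain ⟨σ, hσ, O, hO, hqO, hσO, hO'⟩ := hh.exists_section ⟨hzA, hzU⟩
    obtain ⟨G, hG, hFG⟩ := hh.factor z ⟨hzA, hzU⟩ F (hF z)
    obtain ⟨r, hr, hGr⟩ := hG.exists_ball_analyticOnNhd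
    have hFG' := (hh.eventually_iff ⟨hzA, hzU⟩ hσ).1 hFG
    obtain ⟨s, hs, hb⟩ := Metric.mem_nhds_iff.1 (inter_mem (inter_mem hFG'
      (Metric.ball_mem_nhds _ hr)) (hO.mem_nhds hqO))
    have hB : ∀ x ∈ Metric.ball (h z) s, F (σ x) = G x := fun x hx => by
      have h1 : F (σ x) = (G ∘ h) (σ x) := (hb hx).1.1
      rw [h1, Function.comp_apply, (hO' x (hb hx).2).2]
    have hBan : AnalyticOnNhd ℂ G (Metric.ball (h z) s) := fun x hx => hGr x (hb hx).1.2
    have hiff : ∀ z' : R, (z' : Y) ∈ U → h z' ∈ Metric.ball (h z) s →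
        (z' ∈ Z ↔ G =ᶠ[𝓝 (h z')] 0) := fun z' hz'U hz'b => by
      show (∀ᶠ x in 𝓝[A] (z' : Y), F x = 0) ↔ _
      rw [hh.eventually_iff ⟨(hRreg _ z'.2).1, hz'U⟩ hσ]
      exact eventually_congr (Filter.mem_of_superset (Metric.isOpen_ball.mem_nhds hz'b) fun x hx => by
        show F (σ x) = 0 ↔ G x = 0
        rw [hB x hx])
    have hV : {z' : R | (z' : Y) ∈ U ∧ h z' ∈ Metric.ball (h z) s} ∈ 𝓝 (⟨z, hz⟩ : R) := by
      have h1 : ContinuousOn h (A ∩ U) := hh.continuousOn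
      have h2 : ∀ᶠ x in 𝓝[A] z, x ∈ U ∧ h x ∈ Metric.ball (h z) s := by
        rw [hh.nhdsWithin_eq ⟨hzA, hzU⟩]
        filter_upwards [h1 z ⟨hzA, hzU⟩ (Metric.ball_mem_nhds _ hs), self_mem_nhdsWithin] with x hx hx'
        exact ⟨hx'.2, hx⟩
      have h3 : R ⊆ A := fun x hx => (hRreg x hx).1
      exact preimage_coe_mem_nhds_subtype.2 (show {x | x ∈ U ∧ h x ∈ Metric.ball (h z) s} ∈
        𝓝[R] ((⟨z, hz⟩ : R) : Y) from nhdsWithin_mono z h3 h2)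
    refine ⟨_, hV, ?_⟩
    rintro ⟨z₁, ⟨hz₁U, hz₁b⟩, hz₁Z⟩ z' ⟨hz'U, hz'b⟩
    rw [hiff _ hz'U hz'b]
    have := hBan.eqOn_zero_of_preconnected_of_eventuallyEq_zero
      (convex_ball (h z) s).isPreconnected hz₁b ((hiff _ hz₁U hz₁b).1 hz₁Z)
    exact Filter.mem_of_superset (Metric.isOpen_ball.mem_nhds hz'b) this
  have hopen : IsOpen Z := by
    rw [isOpen_iff_mem_nhds]
    intro z hz
    obtain ⟨V, hV, h⟩ := hloc z
    exact Filter.mem_of_superset hV (h ⟨z, mem_of_mem_nhds hV, hz⟩)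
  have hclosed : IsClosed Z := by
    rw [← isOpen_compl_iff, isOpen_iff_mem_nhds]
    intro z hz
    obtain ⟨V, hV, h⟩ := hloc z
    exact Filter.mem_of_superset hV fun z' hz' hz'Z => hz (h ⟨z', hz', hz'Z⟩ z (mem_of_mem_nhds hV))
  have : PreconnectedSpace R := Subtype.preconnectedSpace isPreconnected_connectedComponentIn
  have hyR : y ∈ R := mem_connectedComponentIn hy
  have huniv : Z = univ := IsClopen.eq_univ ⟨hclosed, hopen⟩ ⟨⟨y, hyR⟩, h0⟩
  have hR0 : ∀ z ∈ R, F z = 0 := fun z hz => by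
    have : (⟨z, hz⟩ : R) ∈ Z := huniv ▸ mem_univ _
    exact (show ∀ᶠ x in 𝓝[A] z, F x = 0 from this).self_of_nhdsWithin (hRreg z hz).1
  exact fun z hz => closure_minimal hR0 (isClosed_eq hFc continuous_const) hz

lemma ComplexSpace.continuousAt (X : ComplexSpace Y) {y : Y} {F : Y → ℂ} (hF : X.hol y F) :
    ContinuousAt F y := by
  obtain ⟨n, U, φ, Ω, hy, hU, hφ, -, h⟩ := X.local_model y
  obtain ⟨G, hG, hFG⟩ := (h y hy F).1 hF
  have hφc : ContinuousAt φ y :=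
    (continuousOn_iff_continuous_domRestrict.2 hφ.continuous).continuousAt (hU.mem_nhds hy)
  exact (ContinuousAt.comp (f := φ) hG.continuousAt hφc).congr hFG.symm

end Components

end MilnorBoundary


/-! ### Components of a normal crossings divisor in coordinates -/

namespace MilnorBoundary

section NormalCrossings

variable {Y : Type*} [TopologicalSpace Y] {hol : Y → (Y → ℂ) → Prop} {A : Set Y}

/-- Coordinates of the ambient space in which `A` is a union of coordinate hyperplanes. -/
structure IsNCChart (hol : Y → (Y → ℂ) → Prop) (A U : Set Y) (h : Y → Fin 3 → ℂ)
    (I : Set (Fin 3)) : Prop where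
  chart : IsChartOn hol univ U h
  inter_eq : A ∩ U = {x ∈ U | ∃ i ∈ I, h x i = 0}

namespace IsNCChart

variable {U : Set Y} {h : Y → Fin 3 → ℂ} {I : Set (Fin 3)} (H : IsNCChart hol A U h I)
include H

lemma mem_iff {y : Y} (hy : y ∈ U) : y ∈ A ↔ ∃ i ∈ I, h y i = 0 := by
  have : y ∈ A ∩ U ↔ y ∈ {x ∈ U | ∃ i ∈ I, h x i = 0} := by rw [H.inter_eq]
  simpa [hy] using this

lemma emb : IsOpenEmbedding (U.domRestrict h) := by
  have := H.chart.isOpenEmbedding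
  rwa [univ_inter] at this

lemma continuousOn (i : Fin 3) : ContinuousOn (fun y => h y i) U := by
  have := H.chart.continuousOn
  rw [univ_inter] at this
  exact (continuous_apply i).comp_continuousOn this

lemma continuousAt (i : Fin 3) {y : Y} (hy : y ∈ U) : ContinuousAt (fun y => h y i) y :=
  (H.continuousOn i).continuousAt (H.chart.isOpen.mem_nhds hy)

/-- The chart of the hyperplane `h i = 0`. -/
lemma mem_regularLocus {i : Fin 3} (hi : i ∈ I) {y : Y} (hy : y ∈ U) (h0 : h y i = 0)
    (hne : ∀ l, l ≠ i → l ∈ I → h y l ≠ 0) : y ∈ regularLocus hol A := by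
  set U' : Set Y := {x ∈ U | ∀ l, l ≠ i → l ∈ I → h x l ≠ 0}
  set ins : (Fin 2 → ℂ) → (Fin 3 → ℂ) := fun z => i.insertNth (α := fun _ => ℂ) 0 z
  have hins : Continuous ins := by
    refine continuous_pi fun j => ?_
    rcases Fin.eq_self_or_eq_succAbove i j with rfl | ⟨j, rfl⟩
    · simpa [ins] using continuous_const
    · simpa [ins] using continuous_apply j
  have hU' : IsOpen U' := by
    have : U' = ⋂ l : Fin 3, {x ∈ U | l ≠ i → l ∈ I → h x l ≠ 0} := by
      ext x
      simp only [U', mem_ofPred_eq, mem_iInter]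
      exact ⟨fun hx l => ⟨hx.1, hx.2 l⟩, fun hx => ⟨(hx 0).1, fun l => (hx l).2⟩⟩
    rw [this]
    refine isOpen_iInter_of_finite fun l => ?_
    by_cases hl : l ≠ i ∧ l ∈ I
    · convert (H.continuousOn l).isOpen_inter_preimage H.chart.isOpen
        (isOpen_compl_singleton (x := (0 : ℂ))) using 1
      ext x
      simp [hl.1, hl.2]
    · convert H.chart.isOpen using 1
      ext x
      simp only [mem_ofPred_eq, and_iff_left_iff_imp]
      exact fun _ h1 h2 => absurd ⟨h1, h2⟩ hl
  have hAU' : ∀ x, x ∈ A ∩ U' ↔ x ∈ U' ∧ h x i = 0 := fun x => by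
    constructor
    · rintro ⟨hxA, hx⟩
      obtain ⟨l, hl, hxl⟩ := (H.mem_iff hx.1).1 hxA
      by_cases hli : l = i
      · exact ⟨hx, hli ▸ hxl⟩
      · exact absurd hxl (hx.2 l hli hl)
    · rintro ⟨hx, h0⟩
      exact ⟨(H.mem_iff hx.1).2 ⟨i, hi, h0⟩, hx⟩
  have hcomp : ∀ x ∈ A ∩ U', ins (fun j => h x (i.succAbove j)) = h x := fun x hx => by
    funext j
    rcases Fin.eq_self_or_eq_succAbove i j with rfl | ⟨j, rfl⟩
    · simp [ins, ((hAU' x).1 hx).2]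
    · simp [ins]
  have hchart : IsChartOn hol A U' (fun x (j : Fin 2) => h x (i.succAbove j)) := by
    refine ⟨hU', fun j x hx => H.chart.hol_coord _ x ⟨mem_univ _, hx.2.1⟩, ?_, fun x hx F hF => ?_⟩
    · have hsub : A ∩ U' ⊆ U := fun x hx => hx.2.1
      have he : IsEmbedding ((A ∩ U').domRestrict h) := by
        have := H.emb.isEmbedding.comp (IsEmbedding.inclusion hsub)
        exact this
      refine ⟨IsEmbedding.of_comp ?_ hins ?_, ?_⟩
      · refine continuous_pi fun j => ?_
        exact continuousOn_iff_continuous_domRestrict.1 ((H.continuousOn (i.succAbove j)).mono hsub)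
      · convert he using 1
        funext x
        exact hcomp x x.2
      · have ho : IsOpen (h '' U') := by
          have := H.emb.isOpenMap _ (hU'.preimage continuous_subtype_val)
          convert this using 1
          ext z
          constructor
          · rintro ⟨x, hx, rfl⟩
            exact ⟨⟨x, hx.1⟩, hx, rfl⟩
          · rintro ⟨⟨x, hx⟩, hx', rfl⟩
            exact ⟨x, hx', rfl⟩
        convert ho.preimage hins using 1
        ext z
        constructor
        · rintro ⟨x, rfl⟩
          exact ⟨x, x.2.2, (hcomp x x.2).symm⟩
        · rintro ⟨x, hx, hxz⟩
          have hx0 : x ∈ A ∩ U' := (hAU' x).2 ⟨hx, by rw [hxz]; simp [ins]⟩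
          refine ⟨⟨x, hx0⟩, ?_⟩
          funext j
          show h x (i.succAbove j) = z j
          rw [hxz]; simp [ins]
    · obtain ⟨G, hG, hFG⟩ := H.chart.factor x ⟨mem_univ _, hx.2.1⟩ F hF
      rw [nhdsWithin_univ] at hFG
      refine ⟨G ∘ ins, ?_, ?_⟩
      · refine AnalyticAt.comp (by rw [hcomp x hx]; exact hG) ?_
        refine AnalyticAt.pi fun j => ?_
        rcases Fin.eq_self_or_eq_succAbove i j with rfl | ⟨j, rfl⟩
        · simpa [ins] using analyticAt_const
        · have : (fun z : Fin 2 → ℂ => ins z (i.succAbove j)) = fun z => z j := by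
            funext z; simp [ins]
          rw [this]
          exact (ContinuousLinearMap.proj (R := ℂ) (φ := fun _ : Fin 2 => ℂ) j).analyticAt _
      · filter_upwards [hFG.filter_mono nhdsWithin_le_nhds,
          mem_nhdsWithin_of_mem_nhds (hU'.mem_nhds hx.2), self_mem_nhdsWithin] with z hz hzU hzA
        rw [hz, Function.comp_apply, Function.comp_apply, Function.comp_apply, hcomp z ⟨hzA, hzU⟩]
  exact mem_regularLocus_of_chart hchart ((hAU' y).2 ⟨⟨hy, hne⟩, h0⟩)

lemma exists_polydisc {q : Y} (hq : q ∈ U) {V : Set Y} (hV : V ∈ 𝓝 q) : ∃ r > 0, ∀ x : Fin 3 → ℂ,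
    (∀ l, ‖x l - h q l‖ < r) → ∃ y ∈ U ∩ V, h y = x := by
  obtain ⟨σ, hσ, O, hO, hqO, hσO, hO'⟩ := H.chart.exists_section ⟨mem_univ q, hq⟩
  have hc : ContinuousAt σ (h q) := hσO.continuousAt (hO.mem_nhds hqO)
  have hV' : σ ⁻¹' V ∈ 𝓝 (h q) := hc (by rw [hσ q ⟨mem_univ _, hq⟩]; exact hV)
  obtain ⟨r, hr, hb⟩ := Metric.mem_nhds_iff.1 (inter_mem hV' (hO.mem_nhds hqO))
  refine ⟨r, hr, fun x hx => ?_⟩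
  have hxb : x ∈ Metric.ball (h q) r := by
    rw [Metric.mem_ball, dist_pi_lt_iff hr]
    intro l
    rw [dist_eq_norm]; exact hx l
  exact ⟨σ x, ⟨(hO' x (hb hxb).2).1.2, (hb hxb).1⟩, (hO' x (hb hxb).2).2⟩

-- When `a = 0` the punctured disc is the image of a half-plane under the exponential. Otherwise the
-- disc does not contain `0` and is convex.
omit H in
lemma isPreconnected_punctured (a : ℂ) {r : ℝ} (hr : 0 < r) (h : a ≠ 0 → r ≤ ‖a‖) :
    IsPreconnected {z : ℂ | ‖z - a‖ < r ∧ z ≠ 0} := by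
  by_cases ha : a = 0
  · subst ha
    have : {z : ℂ | ‖z - 0‖ < r ∧ z ≠ 0} = Complex.exp '' {z | z.re < Real.log r} := by
      ext z
      constructor
      · rintro ⟨h1, h2⟩
        refine ⟨Complex.log z, ?_, Complex.exp_log h2⟩
        show (Complex.log z).re < _
        rw [Complex.log_re]
        exact Real.log_lt_log (norm_pos_iff.2 h2) (by simpa using h1)
      · rintro ⟨t, ht, rfl⟩
        refine ⟨?_, Complex.exp_ne_zero _⟩
        rw [sub_zero, Complex.norm_exp]
        exact (Real.lt_log_iff_exp_lt hr).1 ht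
    rw [this]
    exact (convex_halfSpace_re_lt _).isPreconnected.image _ Complex.continuous_exp.continuousOn
  · have : {z : ℂ | ‖z - a‖ < r ∧ z ≠ 0} = Metric.ball a r := by
      ext z
      rw [Metric.mem_ball, dist_eq_norm]
      refine and_iff_left_of_imp fun hz => ?_
      rintro rfl
      rw [zero_sub, norm_neg] at hz
      exact absurd (h ha) (not_le.2 hz)
    rw [this]
    exact (convex_ball a r).isPreconnected

/-- The irreducible component at a point containing the branch `h i = 0`. -/
lemma exists_component {q : Y} (hq : q ∈ U) {i : Fin 3} (hi : i ∈ I) (h0 : h q i = 0) :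
    ∃ D ∈ irreducibleComponentsOf hol A, ∃ V ∈ 𝓝 q,
      (∀ y ∈ V, h y i = 0 → y ∈ D) ∧
      (∀ y ∈ V, h y i = 0 → ∃ᶠ z in 𝓝 y, z ∈ V ∧ h z i = 0 ∧ (∀ l, l ≠ i → h z l ≠ 0) ∧
        z ∈ regularLocus hol A ∧ z ∈ D) := by
  obtain ⟨r₀, hr₀, hpoly₀⟩ := H.exists_polydisc hq univ_mem
  obtain ⟨r, hr, hrr, hrq⟩ : ∃ r > 0, r ≤ r₀ ∧ ∀ l, h q l ≠ 0 → r ≤ ‖h q l‖ := by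
    have hfin : ∀ l : Fin 3, ∃ r > 0, h q l ≠ 0 → r ≤ ‖h q l‖ := fun l => by
      by_cases hl : h q l = 0
      · exact ⟨1, one_pos, fun h => absurd hl h⟩
      · exact ⟨‖h q l‖, norm_pos_iff.2 hl, fun _ => le_rfl⟩
    choose s hs hs' using hfin
    refine ⟨min r₀ (min (s 0) (min (s 1) (s 2))), by simp [hr₀, hs], min_le_left _ _, fun l hl => ?_⟩
    refine le_trans ?_ (hs' l hl)
    fin_cases l <;> simp
  obtain ⟨σ, hσ, O, hO, hqO, hσO, hO'⟩ := H.chart.exists_section ⟨mem_univ q, hq⟩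
  have hpoly : ∀ x : Fin 3 → ℂ, (∀ l, ‖x l - h q l‖ < r) → σ x ∈ U ∧ h (σ x) = x := fun x hx => by
    obtain ⟨y, hy, rfl⟩ := hpoly₀ x fun l => (hx l).trans_le hrr
    rw [hσ y ⟨mem_univ _, hy.1⟩]
    exact ⟨hy.1, rfl⟩
  -- This is the part of the hyperplane `h i = 0` off all other coordinate hyperplanes. It is a
  -- product of a point with discs, punctured or not, hence connected, and it consists of regular
  -- points: it lies in a single component.
  set B : Set (Fin 3 → ℂ) := pi univ fun l =>
    if l = i then {0} else {z | ‖z - h q l‖ < r ∧ z ≠ 0}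
  have hB : ∀ x, x ∈ B ↔ x i = 0 ∧ ∀ l, l ≠ i → ‖x l - h q l‖ < r ∧ x l ≠ 0 := fun x => by
    simp only [B, mem_univ_pi]
    constructor
    · intro hx
      refine ⟨by simpa using hx i, fun l hl => by simpa [hl] using hx l⟩
    · rintro ⟨h1, h2⟩ l
      by_cases hl : l = i
      · subst hl; simpa using h1
      · simpa [hl] using h2 l hl
  have hBn : ∀ x ∈ B, ∀ l, ‖x l - h q l‖ < r := fun x hx l => by
    by_cases hl : l = i
    · subst hl; rw [((hB x).1 hx).1, h0]; simpa
    · exact (((hB x).1 hx).2 l hl).1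
  have hBpre : IsPreconnected B := isPreconnected_univ_pi fun l => by
    by_cases hl : l = i
    · simpa [hl] using isPreconnected_singleton
    · simpa [hl] using isPreconnected_punctured (h q l) hr (hrq l)
  have hσB : ContinuousOn σ B := by
    obtain ⟨σ', hσ', hσU'⟩ := exists_section_of_isOpenEmbedding ⟨q, hq⟩ H.emb
    refine (hσ'.mono ?_).congr ?_
    · intro x hx
      obtain ⟨hx1, hx2⟩ := hpoly x (hBn x hx)
      exact ⟨_, hx1, hx2⟩
    · intro x hx
      obtain ⟨hx1, hx2⟩ := hpoly x (hBn x hx)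
      rw [← hx2, hσU' _ hx1, hx2]
  have hreg : σ '' B ⊆ regularLocus hol A := by
    rintro _ ⟨x, hx, rfl⟩
    obtain ⟨hx1, hx2⟩ := hpoly x (hBn x hx)
    refine H.mem_regularLocus hi hx1 ?_ fun l hl _ => ?_
    · rw [hx2]; exact ((hB x).1 hx).1
    · rw [hx2]; exact (((hB x).1 hx).2 l hl).2
  set V : Set Y := {y ∈ U | ∀ l, ‖h y l - h q l‖ < r}
  have hVo : IsOpen V := by
    have : V = ⋂ l : Fin 3, U ∩ (fun y => h y l) ⁻¹' Metric.ball (h q l) r := by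
      ext x
      simp only [V, mem_ofPred_eq, mem_iInter, mem_inter_iff, mem_preimage, Metric.mem_ball,
        dist_eq_norm]
      exact ⟨fun hx l => ⟨hx.1, hx.2 l⟩, fun hx => ⟨(hx 0).1, fun l => (hx l).2⟩⟩
    rw [this]
    exact isOpen_iInter_of_finite fun l =>
      (H.continuousOn l).isOpen_inter_preimage H.chart.isOpen Metric.isOpen_ball
  have hqV : q ∈ V := ⟨hq, fun l => by simpa using hr⟩
  have hfreq : ∀ y ∈ V, h y i = 0 → ∃ᶠ z in 𝓝 y, z ∈ V ∧ z ∈ σ '' B := by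
    intro y hy hyi
    obtain ⟨τ, hτ, O₁, hO₁, hyO₁, hτO₁, hO₁'⟩ := H.chart.exists_section ⟨mem_univ y, hy.1⟩
    -- Adding a small positive `ε` to the other coordinates leaves all coordinate hyperplanes but
    -- the `i`-th; this shows that `B` is dense in the hyperplane near `q`.
    set x : ℝ → Fin 3 → ℂ := fun ε l => if l = i then 0 else h y l + ε
    have hxc : Continuous x := continuous_pi fun l => by
      by_cases hl : l = i
      · simpa [x, hl] using continuous_const
      · simp only [x, hl, if_false]; fun_prop
    have hx0 : x 0 = h y := by
      funext l
      by_cases hl : l = i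
      · simp [x, hl, hyi]
      · simp [x, hl]
    have hxO : ∀ᶠ ε in 𝓝 (0 : ℝ), x ε ∈ O₁ := hxc.continuousAt (by rw [hx0]; exact hO₁.mem_nhds hyO₁)
    have hτx : Tendsto (fun ε => τ (x ε)) (𝓝[>] 0) (𝓝 y) := by
      have h1 : ContinuousAt (fun ε => τ (x ε)) 0 := by
        refine ContinuousAt.comp (f := x) (g := τ) ?_ hxc.continuousAt
        rw [hx0]; exact hτO₁.continuousAt (hO₁.mem_nhds hyO₁)
      have h2 := h1.tendsto
      rw [hx0, hτ y ⟨mem_univ _, hy.1⟩] at h2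
      exact h2.mono_left nhdsWithin_le_nhds
    have hne : ∀ l, ∀ᶠ ε : ℝ in 𝓝[>] (0 : ℝ), h y l + (ε : ℂ) ≠ 0 := fun l => by
      by_cases hl : h y l = 0
      · filter_upwards [self_mem_nhdsWithin] with ε hε
        rw [hl, zero_add]
        exact_mod_cast (ne_of_gt hε)
      · have h1 : ContinuousAt (fun ε : ℝ => h y l + (ε : ℂ)) 0 := by fun_prop
        have h2 := h1.eventually_ne (y := 0) (by simpa using hl)
        exact h2.filter_mono nhdsWithin_le_nhds
    have hV' : ∀ᶠ ε in 𝓝[>] (0 : ℝ), τ (x ε) ∈ V := hτx (hVo.mem_nhds hy)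
    refine hτx.frequently (Eventually.frequently ?_)
    filter_upwards [hV', hxO.filter_mono nhdsWithin_le_nhds, hne 0, hne 1, hne 2] with
      ε h1 h2 h3 h4 h5
    have hne' : ∀ l, h y l + ε ≠ 0 := fun l => by fin_cases l <;> assumption
    refine ⟨h1, x ε, (hB _).2 ⟨by simp [x], fun l hl => ?_⟩, ?_⟩
    · have h6 := h1.2 l
      rw [(hO₁' _ h2).2] at h6
      exact ⟨h6, by simpa [x, hl] using hne' l⟩
    · have h7 := hσ _ (hO₁' _ h2).1
      rwa [(hO₁' _ h2).2] at h7
  obtain ⟨z₀, -, hz₀⟩ := (hfreq q hqV h0).exists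
  have hBsub : σ '' B ⊆ connectedComponentIn (regularLocus hol A) z₀ :=
    (hBpre.image σ hσB).subset_connectedComponentIn hz₀ hreg
  refine ⟨_, ⟨z₀, hreg hz₀, rfl⟩, V, hVo.mem_nhds hqV, fun y hy hyi => ?_, fun y hy hyi => ?_⟩
  · rw [mem_closure_iff_frequently]
    exact (hfreq y hy hyi).mono fun z hz => hBsub hz.2
  · refine (hfreq y hy hyi).mono ?_
    rintro z ⟨hzV, hz⟩
    refine ⟨hzV, ?_⟩
    have hz' := hz
    obtain ⟨x, hx, rfl⟩ := hz
    obtain ⟨hx1, hx2⟩ := hpoly x (hBn x hx)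
    rw [hx2]
    exact ⟨((hB x).1 hx).1, fun l hl => (((hB x).1 hx).2 l hl).2, hreg hz',
      subset_closure (hBsub hz')⟩

/-- The irreducible components at a point. -/
lemma exists_components {q : Y} (hq : q ∈ U) : ∃ 𝒟 : Fin 3 → Set Y, ∃ V ∈ 𝓝 q, V ⊆ U ∧
    (∀ i ∈ I, h q i = 0 → 𝒟 i ∈ irreducibleComponentsOf hol A ∧
      (∀ y ∈ V, h y i = 0 → y ∈ 𝒟 i) ∧
      (∃ᶠ z in 𝓝 q, h z i = 0 ∧ (∀ l, l ≠ i → h z l ≠ 0) ∧ z ∈ regularLocus hol A ∧ z ∈ 𝒟 i) ∧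
      ∀ E ∈ irreducibleComponentsOf hol A, (∀ᶠ y in 𝓝 q, h y i = 0 → y ∈ E) → E = 𝒟 i) ∧
    ∀ D ∈ irreducibleComponentsOf hol A, ∀ y ∈ V, y ∈ D →
      ∃ i ∈ I, h q i = 0 ∧ h y i = 0 ∧ D = 𝒟 i := by
  have key : ∀ i, ∃ D V, i ∈ I → h q i = 0 → D ∈ irreducibleComponentsOf hol A ∧ V ∈ 𝓝 q ∧
      (∀ y ∈ V, h y i = 0 → y ∈ D) ∧
      (∀ y ∈ V, h y i = 0 → ∃ᶠ z in 𝓝 y, z ∈ V ∧ h z i = 0 ∧ (∀ l, l ≠ i → h z l ≠ 0) ∧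
        z ∈ regularLocus hol A ∧ z ∈ D) := fun i => by
    by_cases hi : i ∈ I ∧ h q i = 0
    · obtain ⟨D, hD, V, hV, h1, h2⟩ := H.exists_component hq hi.1 hi.2
      exact ⟨D, V, fun _ _ => ⟨hD, hV, h1, h2⟩⟩
    · exact ⟨∅, ∅, fun h1 h2 => absurd ⟨h1, h2⟩ hi⟩
  choose 𝒟 W hW using key
  have hWn : ∀ i, {y | i ∈ I → h q i = 0 → y ∈ W i} ∈ 𝓝 q := fun i => by
    by_cases hi : i ∈ I ∧ h q i = 0
    · filter_upwards [(hW i hi.1 hi.2).2.1] with y hy _ _ using hy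
    · exact Filter.Eventually.of_forall fun y h1 h2 => absurd ⟨h1, h2⟩ hi
  have hne : ∀ i, {y | h q i ≠ 0 → h y i ≠ 0} ∈ 𝓝 q := fun i => by
    by_cases hi : h q i = 0
    · exact Filter.Eventually.of_forall fun y h1 => absurd hi h1
    · filter_upwards [(H.continuousAt i hq).eventually_ne hi] with y hy _ using hy
  have hV : U ∩ ⋂ i, ({y | i ∈ I → h q i = 0 → y ∈ W i} ∩ {y | h q i ≠ 0 → h y i ≠ 0}) ∈ 𝓝 q :=
    inter_mem (H.chart.isOpen.mem_nhds hq)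
      (Filter.iInter_mem.2 fun i => inter_mem (hWn i) (hne i))
  refine ⟨𝒟, _, isOpen_interior.mem_nhds (mem_interior_iff_mem_nhds.2 hV),
    interior_subset.trans inter_subset_left, fun i hi h0 => ?_, fun D hD y hy hyD => ?_⟩
  · obtain ⟨h1, h2, h3, h4⟩ := hW i hi h0
    refine ⟨h1, fun y hy hyi => h3 y ?_ hyi, ?_, fun E hE hEi => ?_⟩
    · exact (mem_iInter.1 (interior_subset hy).2 i).1 hi h0
    · exact (h4 q (mem_of_mem_nhds h2) h0).mono fun z hz => hz.2
    · obtain ⟨z, ⟨-, hzi, -, hzr, hzD⟩, hzE⟩ := ((h4 q (mem_of_mem_nhds h2) h0).and_eventually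
        hEi).exists
      rw [eq_of_mem_regularLocus hE hzr (hzE hzi), eq_of_mem_regularLocus h1 hzr hzD]
  · have hyV := interior_subset hy
    have hne' : ∀ i, {z | h y i ≠ 0 → h z i ≠ 0} ∈ 𝓝 y := fun i => by
      by_cases hi : h y i = 0
      · exact Filter.Eventually.of_forall fun y h1 => absurd hi h1
      · filter_upwards [(H.continuousAt i hyV.1).eventually_ne hi] with z hz _ using hz
    obtain ⟨z, ⟨hzD, hzr⟩, hzV, hz⟩ := ((closure_regular hD hyD).and_eventually
      (inter_mem (isOpen_interior.mem_nhds hy) (Filter.iInter_mem.2 hne'))).exists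
    obtain ⟨i, hi, hzi⟩ := (H.mem_iff (interior_subset hzV).1).1 hzr.1
    have hyi : h y i = 0 := by
      by_contra hc
      exact mem_iInter.1 hz i hc hzi
    have hqi : h q i = 0 := by
      by_contra hc
      exact (mem_iInter.1 hyV.2 i).2 hc hyi
    refine ⟨i, hi, hqi, hyi, ?_⟩
    obtain ⟨h1, h2, h3, h4⟩ := hW i hi hqi
    -- Near its regular point `z` the component `D` fills the divisor, so it contains regular points
    -- of `𝒟 i`. A regular point lies in only one component, hence `D = 𝒟 i`.
    obtain ⟨W', hW', hzW', hsub⟩ := mem_nhdsWithin.1 (mem_nhdsWithin_of_mem_regularLocus hD hzr hzD)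
    obtain ⟨x, ⟨-, -, -, hxr, hx⟩, hxW'⟩ := ((h4 z ((mem_iInter.1 (interior_subset hzV).2 i).1 hi hqi)
      hzi).and_eventually (hW'.mem_nhds hzW')).exists
    rw [eq_of_mem_regularLocus hD hxr (hsub ⟨hxW', hxr.1⟩), eq_of_mem_regularLocus h1 hxr hx]

end IsNCChart

end NormalCrossings

end MilnorBoundary


/-! ### Orders of vanishing, and components not sent to the origin -/

namespace MilnorBoundary

section Charts

variable {Y : Type*} [TopologicalSpace Y] {hol : Y → (Y → ℂ) → Prop} {A : Set Y}

/-- Permutation of the coordinates and restriction of a chart. -/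
lemma IsChartOn.permute {U U' : Set Y} {d : ℕ} {h : Y → Fin d → ℂ} (hh : IsChartOn hol A U h)
    (hU' : IsOpen U') (hUU : U' ⊆ U) (e : Equiv.Perm (Fin d)) :
    IsChartOn hol A U' (fun y j => h y (e j)) := by
  let Φ : (Fin d → ℂ) ≃ₜ (Fin d → ℂ) :=
    { toFun := fun x j => x (e j)
      invFun := fun x j => x (e.symm j)
      left_inv := fun x => by simp
      right_inv := fun x => by simp
      continuous_toFun := by fun_prop
      continuous_invFun := by fun_prop }
  refine ⟨hU', fun i x hx => hh.hol_coord _ x ⟨hx.1, hUU hx.2⟩, ?_, fun x hx F hF => ?_⟩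
  · have hsub : A ∩ U' ⊆ A ∩ U := inter_subset_inter_right _ hUU
    have h1 : IsOpenEmbedding (Set.inclusion hsub) := by
      refine ⟨IsEmbedding.inclusion hsub, ?_⟩
      rw [Set.range_inclusion]
      have : {x : ↑(A ∩ U) | (x : Y) ∈ A ∩ U'} = Subtype.val ⁻¹' U' := by
        ext x
        exact ⟨fun h => h.2, fun h => ⟨x.2.1, h⟩⟩
      rw [this]
      exact hU'.preimage continuous_subtype_val
    exact Φ.isOpenEmbedding.comp (hh.isOpenEmbedding.comp h1)
  · obtain ⟨G, hG, hFG⟩ := hh.factor x ⟨hx.1, hUU hx.2⟩ F hF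
    refine ⟨G ∘ Φ.symm, ?_, ?_⟩
    · refine AnalyticAt.comp (g := G) (f := Φ.symm) ?_ (AnalyticAt.pi fun j => ?_)
      · have : Φ.symm (fun j => h x (e j)) = h x := Φ.symm_apply_apply (h x)
        rw [this]; exact hG
      · exact (ContinuousLinearMap.proj (R := ℂ) (φ := fun _ : Fin d => ℂ) (e.symm j)).analyticAt _
    · filter_upwards [hFG] with y hy
      rw [hy]
      show G (h y) = G (Φ.symm (Φ (h y)))
      rw [Φ.symm_apply_apply]

namespace IsNCChart

variable {U : Set Y} {h : Y → Fin 3 → ℂ} {I : Set (Fin 3)}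

/-- Two hyperplanes are not contained in a single one for other coordinates. -/
lemma not_eventually_eq_zero (H : IsNCChart hol A U h I) {q : Y} (hq : q ∈ U) {i l : Fin 3}
    (hil : i ≠ l) (hi : h q i = 0) (hl : h q l = 0) {U' : Set Y} {h' : Y → Fin 3 → ℂ}
    (H' : IsChartOn hol univ U' h') (hq' : q ∈ U') (j : Fin 3)
    (hj : ∀ᶠ y in 𝓝 q, h y i = 0 ∨ h y l = 0 → h' y j = 0) : False := by
  obtain ⟨G, hG, hGh⟩ := H.chart.factor q ⟨mem_univ _, hq⟩ _ (H'.hol_coord j q ⟨mem_univ _, hq'⟩)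
  choose K hK hKh using fun m => H'.factor q ⟨mem_univ _, hq'⟩ _
    (H.chart.hol_coord m q ⟨mem_univ _, hq⟩)
  rw [nhdsWithin_univ] at hGh
  simp only [nhdsWithin_univ] at hKh
  obtain ⟨σ, hσ, O, hO, hqO, hσO, hO'⟩ := H.chart.exists_section ⟨mem_univ q, hq⟩
  obtain ⟨σ', hσ', O₁, hO₁, hqO₁, hσO₁, hO₁'⟩ := H'.exists_section ⟨mem_univ q, hq'⟩
  set Kv : (Fin 3 → ℂ) → (Fin 3 → ℂ) := fun x m => K m x
  have hKv : DifferentiableAt ℂ Kv (h' q) :=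
    differentiableAt_pi.2 fun m => (hK m).differentiableAt
  have hKq : Kv (h' q) = h q := funext fun m => ((hKh m).self_of_nhds).symm
  have hGd : DifferentiableAt ℂ G (Kv (h' q)) := by rw [hKq]; exact hG.differentiableAt
  have hcomp : G ∘ Kv =ᶠ[𝓝 (h' q)] fun x => x j := by
    have h1 : ∀ᶠ y in 𝓝 q, G (Kv (h' y)) = h' y j := by
      filter_upwards [hGh, hKh 0, hKh 1, hKh 2] with y hy h0 h1 h2
      have : Kv (h' y) = h y := by
        funext m
        fin_cases m
        · exact h0.symm
        · exact h1.symm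
        · exact h2.symm
      rw [this]; exact hy.symm
    rw [← nhdsWithin_univ, H'.eventually_iff ⟨mem_univ q, hq'⟩ hσ'] at h1
    filter_upwards [h1, hO₁.mem_nhds hqO₁] with x hx hxO
    rw [(hO₁' x hxO).2] at hx
    exact hx
  -- Since `G` expresses the coordinate `h' j` in the coordinates `h`, its derivative composed with
  -- that of the change of coordinates is a projection, in particular nonzero.
  have hderiv : (fderiv ℂ G (h q)).comp (fderiv ℂ Kv (h' q)) =
      ContinuousLinearMap.proj (R := ℂ) (φ := fun _ : Fin 3 => ℂ) j := by
    rw [← hKq, ← fderiv_comp _ hGd hKv, hcomp.fderiv_eq]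
    exact (ContinuousLinearMap.proj (R := ℂ) (φ := fun _ : Fin 3 => ℂ) j).fderiv
  have hzero : ∀ᶠ x in 𝓝 (h q), x i = 0 ∨ x l = 0 → G x = 0 := by
    have h1 : ∀ᶠ y in 𝓝 q, h y i = 0 ∨ h y l = 0 → G (h y) = 0 := by
      filter_upwards [hj, hGh] with y hy hy' h0
      exact hy'.symm.trans (hy h0)
    rw [← nhdsWithin_univ, H.chart.eventually_iff ⟨mem_univ q, hq⟩ hσ] at h1
    filter_upwards [h1, hO.mem_nhds hqO] with x hx hxO
    rwa [(hO' x hxO).2] at hx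
  -- Each coordinate axis through `h q` lies in one of the two hyperplanes, on which `G` vanishes.
  -- All partial derivatives are thus zero, a contradiction.
  have hbasis : ∀ m : Fin 3, fderiv ℂ G (h q) (Pi.single m 1) = 0 := fun m => by
    have hc : HasDerivAt (fun t : ℂ => h q + t • (Pi.single m 1 : Fin 3 → ℂ))
        (Pi.single m 1) 0 := by
      simpa using ((hasDerivAt_id (0 : ℂ)).smul_const (Pi.single m 1 : Fin 3 → ℂ)).const_add (h q)
    have h1 : HasDerivAt (fun t : ℂ => G (h q + t • (Pi.single m 1 : Fin 3 → ℂ)))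
        (fderiv ℂ G (h q) (Pi.single m 1)) 0 := by
      have := hG.differentiableAt.hasFDerivAt
      refine HasFDerivAt.comp_hasDerivAt (0 : ℂ) (l := G) ?_ hc
      simpa using this
    have h2 : (fun t : ℂ => G (h q + t • (Pi.single m 1 : Fin 3 → ℂ))) =ᶠ[𝓝 0] fun _ => 0 := by
      have hct : Tendsto (fun t : ℂ => h q + t • (Pi.single m 1 : Fin 3 → ℂ)) (𝓝 0) (𝓝 (h q)) := by
        simpa using hc.continuousAt.tendsto
      filter_upwards [hct.eventually hzero] with t ht
      refine ht ?_
      by_cases hm : m = i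
      · right
        simp [hl, hm, hil]
      · left
        simp [hi, Ne.symm hm]
    rw [h1.deriv.symm.trans (h2.deriv_eq.trans (deriv_const _ _))]
  have hG0 : fderiv ℂ G (h q) = 0 := by
    ext x
    have : x = ∑ m, x m • (Pi.single m 1 : Fin 3 → ℂ) := by
      funext n
      simp [Pi.single_apply]
    rw [this, map_sum]
    simp [hbasis]
  have := congrArg (fun L => L (Pi.single j 1)) hderiv
  simp [hG0] at this

lemma frequently_ne_zero (H : IsNCChart hol A U h I) {z : Y} (hz : z ∈ U) (i : Fin 3) :
    ∃ᶠ y in 𝓝 z, y ∈ U ∧ h y i ≠ 0 := by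
  rw [frequently_iff]
  intro V hV
  obtain ⟨r, hr, hpoly⟩ := H.exists_polydisc hz hV
  by_cases h0 : h z i = 0
  · obtain ⟨y, hy, hyx⟩ := hpoly (Function.update (h z) i ((r / 2 : ℝ) : ℂ)) fun l => by
      by_cases hl : l = i
      · subst hl
        simp only [Function.update_self, h0, sub_zero, Complex.norm_real, Real.norm_eq_abs]
        rw [abs_of_pos (by linarith)]; linarith
      · simpa [hl] using hr
    refine ⟨y, hy.2, hy.1, ?_⟩
    rw [hyx, Function.update_self]
    exact_mod_cast (by linarith : r / 2 ≠ 0)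
  · exact ⟨z, mem_of_mem_nhds hV, hz, h0⟩

/-- Uniqueness of the order of vanishing. -/
lemma order_unique (H : IsNCChart hol A U h I) {z : Y} (hz : z ∈ U) {i : Fin 3} (h0 : h z i = 0)
    {R R' : Y → ℂ} (hR : ContinuousAt R z) (hR' : ContinuousAt R' z) (hRz : R z ≠ 0) {a b : ℕ}
    (heq : ∀ᶠ y in 𝓝 z, R y * h y i ^ a = R' y * h y i ^ b) : b ≤ a := by
  by_contra! hab
  have hc : ContinuousAt (fun y => R y - R' y * h y i ^ (b - a)) z :=
    hR.sub (hR'.mul ((H.continuousAt i hz).pow _))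
  have hne : (fun y => R y - R' y * h y i ^ (b - a)) z ≠ 0 := by
    simp only [h0]
    rw [zero_pow (by omega), mul_zero, sub_zero]
    exact hRz
  obtain ⟨y, ⟨-, hy⟩, hy1, hy2⟩ := ((H.frequently_ne_zero hz i).and_eventually
    (heq.and (hc.eventually_ne hne))).exists
  refine hy2 ?_
  have h1 : h y i ^ a ≠ 0 := pow_ne_zero _ hy
  have h2 : h y i ^ b = h y i ^ (b - a) * h y i ^ a := by rw [← pow_add]; congr 1; omega
  rw [h2, ← mul_assoc] at hy1
  rw [mul_right_cancel₀ h1 hy1, sub_self]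

end IsNCChart

end Charts

namespace Modification

variable {X : Type*} [TopologicalSpace X] {P : SmoothingGerm X} {Y : Type*} [TopologicalSpace Y]
  (M : Modification P Y)

lemma hol_pullF (y : Y) : M.space.hol y M.pullF := M.hol_comp y P.f (P.f_hol _)

lemma hol_pullG (y : Y) : M.space.hol y M.pullG := M.hol_comp y P.g (P.g_hol _)

lemma continuous_pullF : Continuous M.pullF :=
  continuous_iff_continuousAt.2 fun y => M.space.continuousAt (M.hol_pullF y)

lemma continuous_pullG : Continuous M.pullG :=
  continuous_iff_continuousAt.2 fun y => M.space.continuousAt (M.hol_pullG y)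

lemma isClosed_divisor : IsClosed M.divisor :=
  isClosed_eq (M.continuous_pullF.mul M.continuous_pullG) continuous_const

/-- The equation `f = |g|^k` is closed, so the closure adds nothing off the total transform.
Conversely a point with `f g ≠ 0` does not lie over the origin. -/
lemma mem_openPart_iff {k : ℕ} {y : Y} :
    y ∈ M.openPart k ↔ M.pullF y = ((‖M.pullG y‖ ^ k : ℝ) : ℂ) ∧ M.pullF y * M.pullG y ≠ 0 := by
  constructor
  · rintro ⟨h1, h2⟩
    refine ⟨?_, h2⟩
    have hc : IsClosed {y | M.pullF y = ((‖M.pullG y‖ ^ k : ℝ) : ℂ)} :=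
      isClosed_eq M.continuous_pullF
        (Complex.continuous_ofReal.comp (M.continuous_pullG.norm.pow k))
    exact closure_minimal (fun z hz => hz.1) hc h1
  · rintro ⟨h1, h2⟩
    refine ⟨subset_closure ⟨h1, fun h => h2 ?_⟩, h2⟩
    have : M.r y = P.o := h
    rw [pullF, this, P.f_o, zero_mul]

/-- The images of the neighbourhoods of a point at which `r` is an isomorphism. -/
lemma image_mem_nhds {y : Y} (hy : M.r y ∉ ({x | P.f x = 0} \ {x | P.g x = 0}) ∪ {P.o}) {V : Set Y}
    (hV : V ∈ 𝓝 y) : M.r '' V ∈ 𝓝 (M.r y) := by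
  obtain ⟨W, hW, hyW, hbij, -⟩ := M.iso_over _ hy
  have hfib : ∀ z, M.r z = M.r y → z = y := fun z hz =>
    hbij.injOn (show M.r z ∈ W by rw [hz]; exact hyW) hyW hz
  -- A proper map is closed, and the fiber of `y` is reduced to `y`. The image of the complement of
  -- `V` is therefore a closed set avoiding `M.r y`.
  have hcl := M.isProperMap.isClosedMap _ (isOpen_interior (s := V)).isClosed_compl
  have hny : M.r y ∉ M.r '' (interior V)ᶜ := by
    rintro ⟨z, hz, hzy⟩
    rw [hfib z hzy] at hz
    exact hz (mem_interior_iff_mem_nhds.2 hV)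
  filter_upwards [hW.mem_nhds hyW, hcl.isOpen_compl.mem_nhds hny] with x hx hx'
  obtain ⟨z, hz, rfl⟩ := hbij.surjOn hx
  refine ⟨z, ?_, rfl⟩
  by_contra hzV
  exact hx' ⟨z, fun h => hzV (interior_subset h), rfl⟩

/-- A component which is not sent to the origin is not contained in both `V(f)` and `V(g)`. -/
lemma not_forall_eq_zero [T2Space X] {D : Set Y} (hD : D ∈ M.components)
    (ho : ¬ M.r '' D ⊆ {P.o}) (hf : ∀ y ∈ D, M.pullF y = 0) (hg : ∀ y ∈ D, M.pullG y = 0) : False := by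
  obtain ⟨_, ⟨y₀, hy₀, rfl⟩, hne⟩ := not_subset.1 ho
  have hopen : IsOpen {y | M.r y ≠ P.o} := isOpen_ne.preimage M.isProperMap.continuous
  obtain ⟨y, ⟨hyD, hyr⟩, hyo⟩ := ((closure_regular hD hy₀).and_eventually
    (hopen.mem_nhds hne)).exists
  obtain ⟨W, hW, hyW, hWD⟩ := mem_nhdsWithin.1 (mem_nhdsWithin_of_mem_regularLocus hD hyr hyD)
  have hfy : P.f (M.r y) = 0 := hf y hyD
  have hgy : P.g (M.r y) = 0 := hg y hyD
  obtain ⟨U, h, hyU, hh, hfU, hgU⟩ := P.transverse _ hyo hfy hgy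
  have himg : M.r '' W ∩ U ∈ 𝓝 (M.r y) :=
    inter_mem (M.image_mem_nhds (by
      rintro (h1 | h1)
      · exact h1.2 hgy
      · exact hyo h1) (hW.mem_nhds hyW)) (hh.isOpen.mem_nhds hyU)
  obtain ⟨σ, hσ, O, hO, hqO, hσO, hO'⟩ := hh.exists_section ⟨mem_univ (M.r y), hyU⟩
  have hσc : ContinuousAt σ (h (M.r y)) := hσO.continuousAt (hO.mem_nhds hqO)
  have hpre : σ ⁻¹' (M.r '' W ∩ U) ∈ 𝓝 (h (M.r y)) := hσc (by
    rw [hσ _ ⟨mem_univ _, hyU⟩]; exact himg)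
  have h0 : h (M.r y) 0 = 0 := by
    have : M.r y ∈ {y ∈ U | h y 0 = 0} := hfU ▸ ⟨hyU, hfy⟩
    exact this.2
  have h1 : h (M.r y) 1 = 0 := by
    have : M.r y ∈ {y ∈ U | h y 1 = 0} := hgU ▸ ⟨hyU, hgy⟩
    exact this.2
  obtain ⟨r, hr, hb⟩ := Metric.mem_nhds_iff.1 (inter_mem hpre (hO.mem_nhds hqO))
  -- This point is on `V(f)`, where the coordinate `0` vanishes, and off `V(g)`, where the
  -- coordinate `1` vanishes. Its preimage near `y` lies in the total transform, hence in `D`,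
  -- although `g ∘ r` is zero on `D`.
  set x : Fin 3 → ℂ := Function.update (h (M.r y)) 1 ((r / 2 : ℝ) : ℂ)
  have hx : x ∈ Metric.ball (h (M.r y)) r := by
    rw [Metric.mem_ball, dist_pi_lt_iff hr]
    intro l
    rw [dist_eq_norm]
    by_cases hl : l = 1
    · subst hl
      simp only [x, Function.update_self, h1, sub_zero, Complex.norm_real, Real.norm_eq_abs]
      rw [abs_of_pos (by linarith)]; linarith
    · simpa [x, hl] using hr
  obtain ⟨⟨⟨z, hzW, hz⟩, hσU⟩, hxO⟩ := hb hx
  have hhz : h (M.r z) = x := by rw [hz]; exact (hO' x hxO).2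
  have hzf : P.f (M.r z) = 0 := by
    have : M.r z ∈ {y ∈ U | P.f y = 0} := by
      rw [hfU]
      refine ⟨hz ▸ hσU, ?_⟩
      rw [hhz]; simp [x, h0]
    exact this.2
  have hzD : z ∈ D := hWD ⟨hzW, by
    show M.pullF z * M.pullG z = 0
    rw [pullF, hzf, zero_mul]⟩
  have hzg : M.r z ∈ {y ∈ U | P.g y = 0} := ⟨hz ▸ hσU, hg z hzD⟩
  rw [hgU] at hzg
  have := hzg.2
  rw [hhz] at this
  simp only [x, Function.update_self] at this
  have h3 : r / 2 = 0 := by exact_mod_cast this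
  linarith

end Modification

end MilnorBoundary


/-! ### Adapted charts along a compact curve -/

namespace MilnorBoundary

variable {X : Type*} [TopologicalSpace X] {P : SmoothingGerm X} {Y : Type*} [TopologicalSpace Y]

namespace AdaptedChart

variable {M : Modification P Y} (c : AdaptedChart M)

/-- The exponents of `f`. -/
def expF : Fin 3 → ℕ := ![c.m₁, c.m₂, c.m₃]

/-- The exponents of `g`. -/
def expG : Fin 3 → ℕ := ![c.n₁, 0, c.n₃]

lemma pullF_eq_prod {y : Y} (hy : y ∈ c.U) : M.pullF y = ∏ i, c.coord y i ^ c.expF i := by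
  rw [c.pullF_eq y hy, Fin.prod_univ_three]
  rfl

lemma pullG_eq_prod {y : Y} (hy : y ∈ c.U) : M.pullG y = ∏ i, c.coord y i ^ c.expG i := by
  rw [c.pullG_eq y hy, Fin.prod_univ_three]
  simp [expG]

/-- The coordinates occurring in the equation of the total transform. -/
def support : Set (Fin 3) := {i | c.expF i ≠ 0 ∨ c.expG i ≠ 0}

lemma zero_mem_support : (0 : Fin 3) ∈ c.support := Or.inr c.n₁_pos.ne'

lemma one_mem_support : (1 : Fin 3) ∈ c.support := Or.inl c.m₂_pos.ne'

lemma two_mem_support : (2 : Fin 3) ∈ c.support ↔ c.IsDouble := Iff.rfl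

lemma isNCChart : IsNCChart M.space.hol M.divisor c.U c.coord c.support := by
  refine ⟨c.isChartOn, ?_⟩
  ext y
  constructor
  · rintro ⟨hy, hyU⟩
    refine ⟨hyU, ?_⟩
    rcases mul_eq_zero.1 hy with h | h
    · rw [c.pullF_eq_prod hyU, Finset.prod_eq_zero_iff] at h
      obtain ⟨i, -, hi⟩ := h
      exact ⟨i, Or.inl (pow_eq_zero_iff'.1 hi).2, (pow_eq_zero_iff'.1 hi).1⟩
    · rw [c.pullG_eq_prod hyU, Finset.prod_eq_zero_iff] at h
      obtain ⟨i, -, hi⟩ := h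
      exact ⟨i, Or.inr (pow_eq_zero_iff'.1 hi).2, (pow_eq_zero_iff'.1 hi).1⟩
  · rintro ⟨hyU, i, hi, h0⟩
    refine ⟨mul_eq_zero.2 ?_, hyU⟩
    rcases hi with hi | hi
    · left
      rw [c.pullF_eq_prod hyU]
      exact Finset.prod_eq_zero (Finset.mem_univ i) (by rw [h0, zero_pow hi])
    · right
      rw [c.pullG_eq_prod hyU]
      exact Finset.prod_eq_zero (Finset.mem_univ i) (by rw [h0, zero_pow hi])

end AdaptedChart

section

variable {M : Modification P Y} {U : Set Y} {h : Y → Fin 3 → ℂ} {I : Set (Fin 3)}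

/-- The multiplicity along a coordinate hyperplane. -/
lemma IsNCChart.exponent_eq (H : IsNCChart M.space.hol M.divisor U h I) {F : Y → ℂ} {a : Fin 3 → ℕ}
    (hF : ∀ y ∈ U, F y = ∏ i, h y i ^ a i) {i : Fin 3} (hi : i ∈ I) {z : Y} (hz : z ∈ U)
    (h0 : h z i = 0) (hne : ∀ l, l ≠ i → h z l ≠ 0) {D : Set Y} (hzD : z ∈ D) {m : ℕ}
    (hm : M.IsMultiplicity F D m) : a i = m := by
  set U' : Set Y := U ∩ ⋂ l, {x | l ≠ i → h x l ≠ 0} ∩ U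
  have hU' : IsOpen U' := by
    have : U' = ⋂ l, U ∩ {x | l ≠ i → h x l ≠ 0} := by
      ext x
      simp only [U', mem_inter_iff, mem_iInter]
      exact ⟨fun hx l => ⟨hx.1, (hx.2 l).1⟩, fun hx => ⟨(hx 0).1, fun l => ⟨(hx l).2, (hx 0).1⟩⟩⟩
    rw [this]
    refine isOpen_iInter_of_finite fun l => ?_
    by_cases hl : l = i
    · simpa [hl] using H.chart.isOpen
    · convert (H.continuousOn l).isOpen_inter_preimage H.chart.isOpen
        (isOpen_compl_singleton (x := (0 : ℂ))) using 1
      ext x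
      simp [hl]
  have hzU' : z ∈ U' := ⟨hz, mem_iInter.2 fun l => ⟨hne l, hz⟩⟩
  -- The definition of the multiplicity uses charts in which the divisor is the hyperplane of
  -- coordinate `0`. The `i`-th coordinate is moved there, on the open set where the other ones do
  -- not vanish.
  have hchart := H.chart.permute hU' inter_subset_left (Equiv.swap 0 i)
  obtain ⟨J, hJ, hJz, hJF⟩ := hm z hzD U' _ hzU' hchart (by
    ext x
    constructor
    · rintro ⟨hx, hxU⟩
      refine ⟨hxU, ?_⟩
      obtain ⟨l, hl, hl0⟩ := (H.mem_iff hxU.1).1 hx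
      have hli : l = i := by
        by_contra hc
        exact (mem_iInter.1 hxU.2 l).1 hc hl0
      rw [Equiv.swap_apply_left, ← hli]
      exact hl0
    · rintro ⟨hxU, hx⟩
      rw [Equiv.swap_apply_left] at hx
      exact ⟨(H.mem_iff hxU.1).2 ⟨i, hi, hx⟩, hxU⟩)
  simp only [Equiv.swap_apply_left] at hJF
  set R : Y → ℂ := fun y => ∏ l ∈ Finset.univ.erase i, h y l ^ a l
  have hR : ContinuousAt R z := tendsto_finsetProd _ fun l _ => (H.continuousAt l hz).pow _
  have hRz : R z ≠ 0 := Finset.prod_ne_zero_iff.2 fun l hl =>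
    pow_ne_zero _ (hne l (Finset.ne_of_mem_erase hl))
  have hFR : ∀ y ∈ U, F y = R y * h y i ^ a i := fun y hy => by
    rw [hF y hy, Finset.prod_erase_mul _ _ (Finset.mem_univ i)]
  have heq : ∀ᶠ y in 𝓝 z, R y * h y i ^ a i = J y * h y i ^ m := by
    filter_upwards [hJF, H.chart.isOpen.mem_nhds hz] with y hy hyU
    rw [← hFR y hyU, hy]
  have hJc := M.space.continuousAt hJ
  exact le_antisymm (H.order_unique hz h0 hJc hR hJz (heq.mono fun y hy => hy.symm))
    (H.order_unique hz h0 hR hJc hRz heq)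

end

/-- The coordinates of the chart `c`, permuted by `e`, at a point of a compact curve. -/
structure IsLocalForm {M : Modification P Y} (c : AdaptedChart M) (e : Equiv.Perm (Fin 3))
    (D₁ D₂ C : Set Y) (m : Set Y → ℕ) (k : ℕ) (q : Y) : Prop where
  mem : q ∈ c.U
  mem_curve : q ∈ C
  perm : e = 1 ∨ (e = Equiv.swap 0 2 ∧ c.n₃ ≠ 0) ∨ (e = Equiv.swap 1 2 ∧ c.IsMinus)
  zero : c.coord q (e 0) = 0
  one : c.coord q (e 1) = 0
  curve : ∀ᶠ y in 𝓝 q, y ∈ C ↔ c.coord y (e 0) = 0 ∧ c.coord y (e 1) = 0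
  exp_left : c.expF (e 1) = m D₁
  exp_right : c.expF (e 0) = m D₂
  exp_pos : 0 < c.expF (e 1)
  expG_left : c.expG (e 1) = 0
  lt : c.expF (e 0) < k * c.expG (e 0)
  generic : (e 2 ∈ c.support → c.coord q (e 2) ≠ 0) →
    ∀ᶠ y in 𝓝 q, ∀ D ∈ M.components, y ∈ D → D = D₁ ∨ D = D₂
  double : e 2 ∈ c.support → c.coord q (e 2) = 0 → ∃ D₃ ∈ M.thirdComponents D₁ D₂ C, q ∈ D₃ ∧
    c.expF (e 2) = m D₃ ∧ ∀ᶠ y in 𝓝 q, (y ∈ D₃ ↔ c.coord y (e 2) = 0) ∧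
      ∀ D ∈ M.components, y ∈ D → D = D₁ ∨ D = D₂ ∨ D = D₃

/-- The local form of the coordinates at the points of a compact curve. -/
theorem exists_isLocalForm [T2Space X] {M : Modification P Y} {m n : Set Y → ℕ}
    (hm : ∀ D ∈ M.components, M.IsMultiplicity M.pullF D (m D))
    (hn : ∀ D ∈ M.components, M.IsMultiplicity M.pullG D (n D))
    {k : ℕ} (hk : IsAdmissibleExponent M m n k) {D₁ D₂ C : Set Y} (hC : M.IsCompactCurve D₁ D₂ C)
    {q : Y} (hq : q ∈ C) (hsnc : M.IsSNCAt q) (c : AdaptedChart M) (hqc : q ∈ c.U) :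
    ∃ e, IsLocalForm c e D₁ D₂ C m k q := by
  obtain ⟨hD₁, hD₂, -, p₀, hp₀, hCe⟩ := hC
  have hCsub : C ⊆ D₁ ∩ D₂ := hCe ▸ connectedComponentIn_subset _ _
  have hD₁c : D₁ ∈ M.components := hD₁.1
  have hD₂c : D₂ ∈ M.components := hD₂.elim (fun h => h.1) fun h => h.1
  have hD₂g : ∀ y ∈ D₂, M.pullG y = 0 := by
    rcases hD₂ with h | h
    · intro y hy
      have : M.r y = P.o := h.2 (mem_image_of_mem _ hy)
      rw [Modification.pullG, this, P.g_o]
    · exact h.2.2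
  have H := c.isNCChart
  obtain ⟨𝒟, V, hV, hVU, h𝒟, hall⟩ := H.exists_components hqc
  -- distinct hyperplanes lie in distinct components
  have hdist : ∀ i ∈ c.support, ∀ l ∈ c.support, c.coord q i = 0 → c.coord q l = 0 →
      𝒟 i = 𝒟 l → i = l := by
    intro i hi l hl hi0 hl0 hil
    by_contra hne
    obtain ⟨U', h', hqU', hchart, hq0, J, hJ, hJD⟩ := hsnc
    have H' : IsNCChart M.space.hol M.divisor U' h' J := ⟨hchart, hJ⟩
    obtain ⟨𝒟', V', hV', -, h𝒟', hall'⟩ := H'.exists_components hqU'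
    have hqD : q ∈ 𝒟 i := (h𝒟 i hi hi0).2.1 q (mem_of_mem_nhds hV) hi0
    obtain ⟨j, hj, hj0, -, hDj⟩ := hall' _ (h𝒟 i hi hi0).1 q (mem_of_mem_nhds hV') hqD
    obtain ⟨E, hE, hEU⟩ := hJD j hj
    have hEj : E = 𝒟' j := (h𝒟' j hj hj0).2.2.2 E hE (by
      filter_upwards [hchart.isOpen.mem_nhds hqU'] with y hy h0
      have : y ∈ E ∩ U' := hEU ▸ ⟨hy, h0⟩
      exact this.1)
    -- In a chart with simple normal crossings a component through `q` contains just one hyperplane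
    -- and agrees with it. Two hyperplanes of the adapted chart lying in the same component would
    -- both be contained in this smooth hypersurface.
    refine H.not_eventually_eq_zero hqc hne hi0 hl0 hchart hqU' j ?_
    filter_upwards [hV, hchart.isOpen.mem_nhds hqU'] with y hy hyU' h0
    have hyE : y ∈ E := by
      rw [hEj, ← hDj]
      rcases h0 with h0 | h0
      · exact (h𝒟 i hi hi0).2.1 y hy h0
      · rw [hil]; exact (h𝒟 l hl hl0).2.1 y hy h0
    have : y ∈ {x ∈ U' | h' x j = 0} := hEU ▸ ⟨hyE, hyU'⟩
    exact this.2
  have hloc : ∀ i ∈ c.support, c.coord q i = 0 → ∀ y ∈ V, y ∈ 𝒟 i ↔ c.coord y i = 0 := by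
    intro i hi hi0 y hy
    refine ⟨fun hyD => ?_, (h𝒟 i hi hi0).2.1 y hy⟩
    obtain ⟨l, hl, hl0, hyl, hil⟩ := hall _ (h𝒟 i hi hi0).1 y hy hyD
    rw [hdist i hi l hl hi0 hl0 hil]
    exact hyl
  have hreg : ∀ i ∈ c.support, c.coord q i = 0 → ∃ z ∈ c.U, c.coord z i = 0 ∧
      (∀ l, l ≠ i → c.coord z l ≠ 0) ∧ z ∈ regularLocus M.space.hol M.divisor ∧ z ∈ 𝒟 i := by
    intro i hi hi0
    obtain ⟨z, hz, hzU⟩ := ((h𝒟 i hi hi0).2.2.1.and_eventually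
      (c.isChartOn.isOpen.mem_nhds hqc)).exists
    exact ⟨z, hzU, hz⟩
  -- vanishing at one point of a component and vanishing on the component
  have hvan : ∀ i ∈ c.support, c.coord q i = 0 → ∀ (F : Y → ℂ) (a : Fin 3 → ℕ),
      (∀ y, M.space.hol y F) → (∀ y ∈ c.U, F y = ∏ l, c.coord y l ^ a l) →
      ((∀ y ∈ 𝒟 i, F y = 0) ↔ a i ≠ 0) := by
    intro i hi hi0 F a hF hFa
    obtain ⟨z, hzU, hz0, hzne, hzr, hzD⟩ := hreg i hi hi0
    constructor
    · intro h h0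
      have := h z hzD
      rw [hFa z hzU, Finset.prod_eq_zero_iff] at this
      obtain ⟨l, -, hl⟩ := this
      by_cases hli : l = i
      · rw [hli, h0, pow_zero] at hl
        exact one_ne_zero hl
      · exact hzne l hli (pow_eq_zero_iff'.1 hl).1
    · intro ha
      refine eq_zero_of_eventually_eq_zero hF
        (continuous_iff_continuousAt.2 fun y => M.space.continuousAt (hF y))
        (h𝒟 i hi hi0).1 hzr hzD ?_
      have hev : ∀ l, ∀ᶠ y in 𝓝 z, l ≠ i → c.coord y l ≠ 0 := fun l => by
        by_cases hl : l = i
        · exact Eventually.of_forall fun y h => absurd hl h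
        · filter_upwards [(H.continuousAt l hzU).eventually_ne (hzne l hl)] with y hy _ using hy
      filter_upwards [(eventually_all.2 hev).filter_mono nhdsWithin_le_nhds,
        mem_nhdsWithin_of_mem_nhds (c.isChartOn.isOpen.mem_nhds hzU), self_mem_nhdsWithin]
        with y hy hyU hyA
      obtain ⟨l, hl, hl0⟩ := (H.mem_iff hyU).1 hyA
      have hli : l = i := by
        by_contra hc
        exact hy l hc hl0
      rw [hFa y hyU]
      exact Finset.prod_eq_zero (Finset.mem_univ i) (by rw [← hli, hl0, zero_pow (hli ▸ ha)])
  have hexpF : ∀ i ∈ c.support, c.coord q i = 0 → c.expF i = m (𝒟 i) := by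
    intro i hi hi0
    obtain ⟨z, hzU, hz0, hzne, hzr, hzD⟩ := hreg i hi hi0
    exact H.exponent_eq (fun y hy => c.pullF_eq_prod hy) hi hzU hz0 hzne hzD
      (hm _ (h𝒟 i hi hi0).1)
  have hexpG : ∀ i ∈ c.support, c.coord q i = 0 → c.expG i = n (𝒟 i) := by
    intro i hi hi0
    obtain ⟨z, hzU, hz0, hzne, hzr, hzD⟩ := hreg i hi hi0
    exact H.exponent_eq (fun y hy => c.pullG_eq_prod hy) hi hzU hz0 hzne hzD
      (hn _ (h𝒟 i hi hi0).1)
  obtain ⟨i₁, hi₁, hi₁0, -, hDi₁⟩ := hall D₁ hD₁c q (mem_of_mem_nhds hV) (hCsub hq).1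
  obtain ⟨i₂, hi₂, hi₂0, -, hDi₂⟩ := hall D₂ hD₂c q (mem_of_mem_nhds hV) (hCsub hq).2
  have vF := fun i hi hi0 => hvan i hi hi0 M.pullF c.expF M.hol_pullF fun y hy => c.pullF_eq_prod hy
  have vG := fun i hi hi0 => hvan i hi hi0 M.pullG c.expG M.hol_pullG fun y hy => c.pullG_eq_prod hy
  have ha₁ : c.expF i₁ ≠ 0 := (vF i₁ hi₁ hi₁0).1 (hDi₁ ▸ hD₁.2.2)
  -- If `g` vanished on the hyperplane it would vanish on the whole of `D₁`. By transversality
  -- outside the origin a component not sent to it cannot lie over both `V(f)` and `V(g)`.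
  have hb₁ : c.expG i₁ = 0 := by
    by_contra hb
    exact M.not_forall_eq_zero hD₁c hD₁.2.1 hD₁.2.2 (hDi₁ ▸ (vG i₁ hi₁ hi₁0).2 hb)
  have hb₂ : c.expG i₂ ≠ 0 := (vG i₂ hi₂ hi₂0).1 (hDi₂ ▸ hD₂g)
  -- For a component over the origin this is the condition on `k`; for a component of the strict
  -- transform of `V(g)` the exponent of `f` is zero.
  have hlt : c.expF i₂ < k * c.expG i₂ := by
    rcases hD₂ with h | h
    · have := hk.lt D₂ h
      rwa [hDi₂, ← hexpF i₂ hi₂ hi₂0, ← hexpG i₂ hi₂ hi₂0] at this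
    · have : c.expF i₂ = 0 := by
        by_contra ha
        exact M.not_forall_eq_zero hD₂c h.2.1 (hDi₂ ▸ (vF i₂ hi₂ hi₂0).2 ha) h.2.2
      rw [this]
      exact Nat.mul_pos hk.pos (Nat.pos_of_ne_zero hb₂)
  -- At a point of the curve the hyperplane of `D₁` is one on which `g` does not vanish identically,
  -- and that of `D₂` one on which it does. At a double point of type `⊕` the rôle of `D₂` may be
  -- played by `u` or `w`, and at one of type `⊖` the rôle of `D₁` by `v` or `w`; the permutation
  -- records which.
  obtain ⟨e, he₁, he₂, hperm⟩ : ∃ e : Equiv.Perm (Fin 3), e 1 = i₁ ∧ e 0 = i₂ ∧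
      (e = 1 ∨ (e = Equiv.swap 0 2 ∧ c.n₃ ≠ 0) ∨ (e = Equiv.swap 1 2 ∧ c.IsMinus)) := by
    have h1 : i₁ ≠ 0 := by
      rintro rfl
      exact c.n₁_pos.ne' hb₁
    have h2 : i₂ ≠ 1 := by
      rintro rfl
      exact hb₂ rfl
    have h12 : i₁ ≠ i₂ := by
      rintro rfl
      exact hb₂ hb₁
    have h3 : i₁ = 1 ∧ i₂ = 0 ∨ i₁ = 1 ∧ i₂ = 2 ∨ i₁ = 2 ∧ i₂ = 0 := by
      revert h1 h2 h12; clear * -; revert i₁ i₂; decide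
    rcases h3 with ⟨rfl, rfl⟩ | ⟨rfl, rfl⟩ | ⟨rfl, rfl⟩
    · exact ⟨1, rfl, rfl, Or.inl rfl⟩
    · exact ⟨Equiv.swap 0 2, rfl, rfl, Or.inr (Or.inl ⟨rfl, hb₂⟩)⟩
    · exact ⟨Equiv.swap 1 2, rfl, rfl, Or.inr (Or.inr ⟨rfl, hb₁, ha₁⟩)⟩
  have hcases : ∀ i, i = e 0 ∨ i = e 1 ∨ i = e 2 := fun i => by
    obtain ⟨j, rfl⟩ := e.surjective i
    fin_cases j <;> simp
  subst he₁ he₂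
  refine ⟨e, ⟨hqc, hq, hperm, hi₂0, hi₁0, ?_, ?_, ?_, Nat.pos_of_ne_zero ha₁, hb₁, hlt,
    fun hg => ?_, fun hs h0 => ?_⟩⟩
  · obtain ⟨r, hr, hpoly⟩ := H.exists_polydisc hqc hV
    obtain ⟨σ, hσ, hσU⟩ := exists_section_of_isOpenEmbedding ⟨q, hqc⟩ H.emb
    set B : Set (Fin 3 → ℂ) := Metric.ball (c.coord q) r ∩ {x | x (e 0) = 0 ∧ x (e 1) = 0}
    have hBpoly : ∀ x ∈ B, ∃ y ∈ c.U ∩ V, c.coord y = x := fun x hx => hpoly x fun l => by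
      rw [← dist_eq_norm]
      exact (dist_le_pi_dist x (c.coord q) l).trans_lt hx.1
    have hBpre : IsPreconnected B := by
      refine Convex.isPreconnected ((convex_ball _ _).inter ?_)
      rintro x ⟨hx0, hx1⟩ y ⟨hy0, hy1⟩ a b - - -
      constructor <;> simp [hx0, hx1, hy0, hy1]
    have hσB : ContinuousOn σ B := hσ.mono fun x hx => by
      obtain ⟨y, hy, rfl⟩ := hBpoly x hx
      exact ⟨y, hy.1, rfl⟩
    -- The coordinate line through `q` is connected and contained in `D₁ ∩ D₂`, so it lies in the
    -- connected component `C`.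
    have hsub : σ '' B ⊆ C := by
      rw [hCe] at hq ⊢
      rw [connectedComponentIn_eq hq]
      refine (hBpre.image σ hσB).subset_connectedComponentIn ⟨c.coord q, ⟨Metric.mem_ball_self hr,
        hi₂0, hi₁0⟩, hσU q hqc⟩ ?_
      rintro _ ⟨x, hx, rfl⟩
      obtain ⟨y, hy, rfl⟩ := hBpoly x hx
      rw [hσU y hy.1, hDi₁, hDi₂]
      exact ⟨(hloc _ hi₁ hi₁0 y hy.2).2 hx.2.2, (hloc _ hi₂ hi₂0 y hy.2).2 hx.2.1⟩
    have hnear : ∀ᶠ y in 𝓝 q, c.coord y ∈ Metric.ball (c.coord q) r :=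
      (continuousAt_pi.2 fun l => H.continuousAt l hqc) (Metric.ball_mem_nhds _ hr)
    filter_upwards [hV, hnear] with y hy hyB
    constructor
    · intro hyC
      have := hCsub hyC
      rw [hDi₁, hDi₂] at this
      exact ⟨(hloc _ hi₂ hi₂0 y hy).1 this.2, (hloc _ hi₁ hi₁0 y hy).1 this.1⟩
    · intro h
      exact hsub ⟨c.coord y, ⟨hyB, h⟩, hσU y (hVU hy)⟩
  · rw [hDi₁]; exact hexpF _ hi₁ hi₁0
  · rw [hDi₂]; exact hexpF _ hi₂ hi₂0
  · filter_upwards [hV] with y hy D hD hyD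
    obtain ⟨i, hi, hi0, -, hDi⟩ := hall D hD y hy hyD
    rcases hcases i with rfl | rfl | rfl
    · exact Or.inr (hDi.trans hDi₂.symm)
    · exact Or.inl (hDi.trans hDi₁.symm)
    · exact absurd hi0 (hg hi)
  · have hqD : q ∈ 𝒟 (e 2) := (hloc _ hs h0 q (mem_of_mem_nhds hV)).2 h0
    refine ⟨𝒟 (e 2), ⟨(h𝒟 _ hs h0).1, fun h => ?_, fun h => ?_, ⟨q, hqD, hq⟩⟩, hqD,
      hexpF _ hs h0, ?_⟩
    · exact absurd (e.injective (hdist _ hs _ hi₁ h0 hi₁0 (h.trans hDi₁))) (by decide)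
    · exact absurd (e.injective (hdist _ hs _ hi₂ h0 hi₂0 (h.trans hDi₂))) (by decide)
    · filter_upwards [hV] with y hy
      refine ⟨hloc _ hs h0 y hy, fun D hD hyD => ?_⟩
      obtain ⟨i, hi, hi0, -, hDi⟩ := hall D hD y hy hyD
      rcases hcases i with rfl | rfl | rfl
      · exact Or.inr (Or.inl (hDi.trans hDi₂.symm))
      · exact Or.inl (hDi.trans hDi₁.symm)
      · exact Or.inr (Or.inr hDi)

end MilnorBoundary


/-! ### The sheets of branches along a curve -/

namespace MilnorBoundary

open BranchPoint

lemma IsGoodNhd.hasLabel_ofMem {Y : Type*} [TopologicalSpace Y] {S : Set Y} {q : Y} {d : ℕ}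
    {lab : Y → ZMod d} {N : Set Y} (hN : IsGoodNhd S q lab N) {y : Y} (hy : y ∈ N) (hyS : y ∈ S) :
    (ofMem y hyS).HasLabel lab (lab y) := by
  refine (ofMem y hyS).mem_filter_iff.2 ⟨N, hN.isOpen, hy, ?_⟩
  show connectedComponentIn (N ∩ S) y ⊆ _
  rw [hN.component y ⟨hy, hyS⟩]
  exact fun z hz => hz.2

/-- Continuity of the inclusion of `S` along continuous families. -/
lemma eventually_ofMem {Y Z : Type*} [TopologicalSpace Y] [TopologicalSpace Z]
    [LocallyConnectedSpace Z] {S : Set Y} {κ : Z → Y} {O : Set Z} (hO : IsOpen O)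
    (hκ : ContinuousOn κ O) (hS : ∀ z ∈ O, κ z ∈ S) {z₀ : Z} (hz₀ : z₀ ∈ O)
    {V : Set (BranchPoint S)} (hV : V ∈ 𝓝 (ofMem (κ z₀) (hS z₀ hz₀))) :
    ∀ᶠ z in 𝓝 z₀, ∀ h : κ z ∈ S, ofMem (κ z) h ∈ V := by
  obtain ⟨V', hV'V, hV', hs⟩ := mem_nhds_iff.1 hV
  obtain ⟨U, hU, hzU, hUV⟩ := exists_basicSet_subset hV' hs
  have hpre : O ∩ κ ⁻¹' U ∈ 𝓝 z₀ :=
    inter_mem (hO.mem_nhds hz₀) ((hκ.continuousAt (hO.mem_nhds hz₀)) (hU.mem_nhds hzU))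
  obtain ⟨W, ⟨hW, hzW, hWc⟩, hWsub⟩ :=
    (LocallyConnectedSpace.open_connected_basis z₀).mem_iff.1 hpre
  filter_upwards [hW.mem_nhds hzW] with z hz h
  refine hV'V (hUV U hU hzU subset_rfl ?_)
  rw [mem_basicSet_iff hU]
  refine ⟨(hWsub hz).2, ?_⟩
  show connectedComponentIn (U ∩ S) (κ z) = connectedComponentIn (U ∩ S) (κ z₀)
  have hsub : κ '' W ⊆ U ∩ S := by
    rintro _ ⟨x, hx, rfl⟩
    exact ⟨(hWsub hx).2, hS x (hWsub hx).1⟩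
  exact (connectedComponentIn_eq ((hWc.isPreconnected.image κ (hκ.mono fun x hx =>
    (hWsub hx).1)).subset_connectedComponentIn (mem_image_of_mem κ hz) hsub
      (mem_image_of_mem κ hzW)))

namespace MonomialForm

variable {Y : Type*} [TopologicalSpace Y] {S : Set Y} {f : Y → ℂ} {q : Y} {a₁ a₂ a₃ : ℕ}
  (L : MonomialForm S f q a₁ a₂ a₃)

/-- The same coordinates at another point. -/
def recenter {q' : Y} (hU : q' ∈ L.U) (h0 : L.h q' 0 = 0) (h1 : L.h q' 1 = 0) :
    MonomialForm S f q' a₁ a₂ a₃ where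
  U := L.U
  h := L.h
  b₁ := L.b₁
  b₃ := L.b₃
  k := L.k
  isOpen := L.isOpen
  mem := hU
  emb := L.emb
  zero := h0
  one := h1
  a₂_pos := L.a₂_pos
  lt := L.lt
  f_eq := L.f_eq
  mem_iff := L.mem_iff
  f_ne := L.f_ne

lemma eq_of_h_eq {y y' : Y} (hy : y ∈ L.U) (hy' : y' ∈ L.U) (h : L.h y = L.h y') : y = y' :=
  congrArg Subtype.val (L.emb.injective (a₁ := ⟨y, hy⟩) (a₂ := ⟨y', hy'⟩) h)

lemma exists_mem_of_small {V : Set Y} (hV : V ∈ 𝓝 q) : ∃ r > 0, ∀ y ∈ L.U,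
    ‖L.h y 0‖ < r → ‖L.h y 1‖ < r → ‖L.h y 2 - L.h q 2‖ < r → y ∈ V := by
  obtain ⟨r, hr, h⟩ := L.exists_polydisc hV
  refine ⟨r, hr, fun y hy h0 h1 h2 => ?_⟩
  obtain ⟨y', hy', hyy⟩ := h (L.h y) h0 h1 h2
  rw [← L.eq_of_h_eq hy'.1 hy hyy]
  exact hy'.2

lemma phase_exp {d : ℕ} (hd : 0 < d) {j : ℤ} {z₁ z₂ t : ℂ} (hs : L.InSheet j z₁ z₂ t) :
    phase d (Complex.exp ((a₁ * z₁ + a₂ * z₂ + a₃ * t) / d)) = j := by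
  have hsum : (a₁ * z₁ + a₂ * z₂ + a₃ * t : ℂ) =
      ((a₁ * z₁.re + a₂ * z₂.re + a₃ * t.re : ℝ) : ℂ) + 2 * Real.pi * Complex.I * j := by
    apply Complex.ext
    · simp
    · simp
      linear_combination hs.2
  rw [hsum, add_div, Complex.exp_add,
    ← phase_eq hd (Real.exp_pos ((a₁ * z₁.re + a₂ * z₂.re + a₃ * t.re) / d)) j]
  push_cast
  rfl

lemma phase_root {ω : ℂ → ℂ} {lg : ℂ → ℂ → ℂ} (hω : IsUniformizer ω lg) {t₁ : ℂ} {j : ℤ}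
    {z₁ z₂ t : ℂ} (hs : L.InSheet j z₁ z₂ t) (ht : ‖t - t₁‖ < 1) {y : Y}
    (hy : L.h y = ![Complex.exp z₁, Complex.exp z₂, ω t]) :
    phase (a₁.gcd a₂) (L.root lg t₁ y) = j := by
  have hg : ((a₁.gcd a₂ : ℕ) : ℂ) ≠ 0 := by exact_mod_cast L.gcd_pos.ne'
  rw [← L.phase_exp L.gcd_pos hs, root, hy]
  simp only [Matrix.cons_val]
  rw [hω.lg_apply t₁ t ht, ← Complex.exp_nat_mul, ← Complex.exp_nat_mul, ← Complex.exp_add,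
    ← Complex.exp_add, Nat.cast_div (Nat.gcd_dvd_left _ _) hg, Nat.cast_div (Nat.gcd_dvd_right _ _) hg]
  congr 2
  field_simp

lemma phase_doubleRoot {j : ℤ} {z₁ z₂ t : ℂ} (hs : L.InSheet j z₁ z₂ t) {y : Y}
    (hy : L.h y = ![Complex.exp z₁, Complex.exp z₂, Complex.exp t]) :
    phase ((a₁.gcd a₂).gcd a₃) (L.doubleRoot y) = j := by
  have hd0 : 0 < (a₁.gcd a₂).gcd a₃ := Nat.gcd_pos_of_pos_left _ L.gcd_pos
  have hg : (((a₁.gcd a₂).gcd a₃ : ℕ) : ℂ) ≠ 0 := by exact_mod_cast hd0.ne'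
  rw [← L.phase_exp hd0 hs, doubleRoot, hy]
  simp only [Matrix.cons_val]
  rw [← Complex.exp_nat_mul, ← Complex.exp_nat_mul, ← Complex.exp_nat_mul, ← Complex.exp_add,
    ← Complex.exp_add, Nat.cast_div ((Nat.gcd_dvd_left _ _).trans (Nat.gcd_dvd_left _ _)) hg,
    Nat.cast_div ((Nat.gcd_dvd_left _ _).trans (Nat.gcd_dvd_right _ _)) hg,
    Nat.cast_div (Nat.gcd_dvd_right _ _) hg]
  congr 2
  field_simp

/-- The branch `s` at the point `(0, 0, ω t₁)` lies in the sheet of index `j`. -/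
def OnSheet (ω : ℂ → ℂ) (lg : ℂ → ℂ → ℂ) (t₁ : ℂ) (j : ℤ) (s : BranchPoint S) : Prop :=
  s.pt ∈ L.U ∧ L.h s.pt = ![0, 0, ω t₁] ∧
    s.HasLabel (fun y => phase (a₁.gcd a₂) (L.root lg t₁ y)) (j : ZMod (a₁.gcd a₂))

/-- On a sheet `a₂ Re z₂` is an affine function of `Re z₁` and `Re t`, with a positive coefficient
for `Re z₁`. As `Re t` remains bounded near `t₁`, one bound on `Re z₁` controls both real parts, for
all sheets at the same time. -/
lemma exists_re_lt (t₁ : ℂ) (ρ : ℝ) : ∃ M : ℝ, ∀ (j : ℤ) (z₁ z₂ t : ℂ), ‖t - t₁‖ < 1 → z₁.re < M →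
    L.InSheet j z₁ z₂ t → z₁.re < ρ ∧ z₂.re < ρ := by
  have ha₂ : (0 : ℝ) < a₂ := by exact_mod_cast L.a₂_pos
  have hc₁ : (0 : ℝ) < L.k * L.b₁ - a₁ := by rw [sub_pos]; exact_mod_cast L.lt
  set c₃ : ℝ := L.k * L.b₃ - a₃
  set c₁ : ℝ := L.k * L.b₁ - a₁
  refine ⟨min ρ ((a₂ * ρ - |c₃| * (|t₁.re| + 1)) / c₁), fun j z₁ z₂ t ht hz₁ hsh =>
    ⟨hz₁.trans_le (min_le_left _ _), ?_⟩⟩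
  have hlt2 := hz₁.trans_le (min_le_right _ _)
  have htre : |t.re| ≤ |t₁.re| + 1 := by
    have h1 : |t.re - t₁.re| < 1 := by
      rw [← Complex.sub_re]; exact (Complex.abs_re_le_norm _).trans_lt ht
    have h2 := abs_sub_abs_le_abs_sub t.re t₁.re
    linarith
  rw [lt_div_iff₀ hc₁] at hlt2
  have h1 := hsh.1
  have h2 : c₃ * t.re ≤ |c₃| * (|t₁.re| + 1) :=
    (le_abs_self _).trans (by rw [abs_mul]; exact mul_le_mul_of_nonneg_left htre (abs_nonneg _))
  have h3 : a₂ * z₂.re < a₂ * ρ := by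
    rw [h1]; linarith
  exact lt_of_mul_lt_mul_left h3 ha₂.le

variable {ω : ℂ → ℂ} {lg : ℂ → ℂ → ℂ} (hω : IsUniformizer ω lg) (hL : L.Fits ω)
include hω hL

lemma isRootAt_recenter {t₁ : ℂ} {q' : Y} (hU : q' ∈ L.U) (h : L.h q' = ![0, 0, ω t₁]) :
    IsRootAt S f q' (a₁.gcd a₂) (L.root lg t₁) :=
  (L.recenter hU (by rw [h]; rfl) (by rw [h]; rfl)).isRootAt_generic hω hL (by
    show L.h q' 2 = _
    rw [h]; rfl)

lemma exists_isSheetNhd_recenter {t₁ : ℂ} {q' : Y} (hU : q' ∈ L.U) (h : L.h q' = ![0, 0, ω t₁])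
    {V : Set Y} (hV : V ∈ 𝓝 q') {ε : ℝ} (hε : 0 < ε) : ∃ N ⊆ V, ∃ ρ δ, 0 < δ ∧ δ ≤ ε ∧
      (L.recenter hU (by rw [h]; rfl) (by rw [h]; rfl)).IsSheetNhd ω (a₁.gcd a₂) (L.root lg t₁)
        (Metric.ball t₁ δ) ρ N :=
  (L.recenter hU (by rw [h]; rfl) (by rw [h]; rfl)).exists_isSheetNhd hω hL (by
    show L.h q' 2 = _
    rw [h]; rfl) hV hε

lemma exists_onSheet {t₁ : ℂ} {q' : Y} (hU : q' ∈ L.U) (h : L.h q' = ![0, 0, ω t₁]) (j : ℤ) :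
    ∃ s : BranchPoint S, s.pt = q' ∧ L.OnSheet ω lg t₁ j s := by
  obtain ⟨s, rfl, hl⟩ := (L.isRootAt_recenter hω hL hU h).isLabel.exists_branchPoint (j : ZMod _)
  exact ⟨s, rfl, hU, h, hl⟩

lemma exists_onSheet_of_pt {t₁ : ℂ} {s : BranchPoint S} (hU : s.pt ∈ L.U)
    (h : L.h s.pt = ![0, 0, ω t₁]) : ∃ j : ℤ, L.OnSheet ω lg t₁ j s := by
  obtain ⟨i, hi⟩ := (L.isRootAt_recenter hω hL hU h).isLabel.exists_hasLabel s rfl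
  obtain ⟨j, rfl⟩ := ZMod.intCast_surjective i
  exact ⟨j, hU, h, hi⟩

lemma OnSheet.unique {t₁ : ℂ} {j : ℤ} {s s' : BranchPoint S} (hs : L.OnSheet ω lg t₁ j s)
    (hs' : L.OnSheet ω lg t₁ j s') : s = s' := by
  have hpt : s'.pt = s.pt := L.eq_of_h_eq hs'.1 hs.1 (hs'.2.1.trans hs.2.1.symm)
  exact (L.isRootAt_recenter hω hL hs.1 hs.2.1).isLabel.ext rfl hpt hs.2.2 hs'.2.2

lemma OnSheet.eventually {t₁ : ℂ} {j : ℤ} {s : BranchPoint S} (hs : L.OnSheet ω lg t₁ j s)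
    {ε : ℝ} (hε : 0 < ε) : ∀ᶠ y in s.filter, y ∈ S ∧ y ∈ L.U ∧ ∃ z₁ z₂ t, ‖t - t₁‖ < ε ∧
      L.InSheet j z₁ z₂ t ∧ L.h y = ![Complex.exp z₁, Complex.exp z₂, ω t] := by
  obtain ⟨N, -, ρ, δ, hδ, hδε, hN⟩ := L.exists_isSheetNhd_recenter hω hL hs.1 hs.2.1 univ_mem hε
  have hbr := hN.good.br_eq hN.good.mem hs.2.2
  filter_upwards [s.br_mem_filter hN.good.isOpen hN.good.mem] with y hy
  rw [hbr] at hy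
  obtain ⟨z₁, z₂, t, -, -, ht, hsh, hh⟩ := hN.exists_log y hy.1 j hy.2
  exact ⟨hy.1.2, hN.sub hy.1.1, z₁, z₂, t,
    by rw [← dist_eq_norm]; exact lt_of_lt_of_le ht hδε, hsh, hh⟩

/-- Functions of the uniformizing coordinate have limits along the branches. -/
lemma OnSheet.tendsto {t₁ : ℂ} {j : ℤ} {s : BranchPoint S} (hs : L.OnSheet ω lg t₁ j s)
    {Z : Type*} [TopologicalSpace Z] (τ : Y → Z) (Θ : ℂ → Z) (hΘ : ContinuousAt Θ t₁)
    (hτ : ∀ y ∈ L.U, y ∈ S → ∀ z₁ z₂ t, L.InSheet j z₁ z₂ t →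
      L.h y = ![Complex.exp z₁, Complex.exp z₂, ω t] → τ y = Θ t) :
    Tendsto τ s.filter (𝓝 (Θ t₁)) := by
  intro A hA
  obtain ⟨ε, hε, hb⟩ := Metric.mem_nhds_iff.1 (hΘ hA)
  rw [mem_map]
  filter_upwards [OnSheet.eventually L hω hL hs hε] with y hy
  obtain ⟨hyS, hyU, z₁, z₂, t, ht, hsh, hh⟩ := hy
  show τ y ∈ A
  rw [hτ y hyU hyS z₁ z₂ t hsh hh]
  exact hb (by rw [mem_ball_iff_norm]; exact ht)

/-- Along the branch the uniformizing coordinate stays within `1 / 2` of `t₁`, hence within `1` of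
`t₂`, where the inverse `lg t₂` is valid and reads off the same index. The roots at nearby base
points define the same sheets. -/
lemma OnSheet.change {t₁ t₂ : ℂ} (ht : ‖t₁ - t₂‖ < 1 / 2) {j : ℤ} {s : BranchPoint S}
    (hs : L.OnSheet ω lg t₁ j s) :
    s.HasLabel (fun y => phase (a₁.gcd a₂) (L.root lg t₂ y)) (j : ZMod (a₁.gcd a₂)) := by
  filter_upwards [OnSheet.eventually L hω hL hs (one_half_pos (α := ℝ))] with y hy
  obtain ⟨hyS, hyU, z₁, z₂, t, ht', hsh, hh⟩ := hy
  refine L.phase_root hω hsh ?_ hh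
  calc ‖t - t₂‖ ≤ ‖t - t₁‖ + ‖t₁ - t₂‖ := norm_sub_le_norm_sub_add_norm_sub _ _ _
    _ < 1 := by linarith

/-- Neighbourhoods of a branch in terms of the uniformizing coordinate. -/
lemma OnSheet.exists_nhds {t₁ : ℂ} {j : ℤ} {s : BranchPoint S} (hs : L.OnSheet ω lg t₁ j s)
    {V : Set (BranchPoint S)} (hV : V ∈ 𝓝 s) : ∃ δ > 0, ∃ M : ℝ, ∀ t ∈ Metric.ball t₁ δ,
      (∀ s', L.OnSheet ω lg t j s' → s' ∈ V) ∧
      ∀ y ∈ L.U, ∀ hy : y ∈ S, ∀ z₁ z₂, z₁.re < M → L.InSheet j z₁ z₂ t →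
        L.h y = ![Complex.exp z₁, Complex.exp z₂, ω t] → ofMem y hy ∈ V := by
  obtain ⟨V', hV'V, hV', hsV⟩ := mem_nhds_iff.1 hV
  obtain ⟨U', hU', hsU', hUV⟩ := (L.isRootAt_recenter hω hL hs.1 hs.2.1).isLabel.exists_labelSet_subset
    hV' hsV rfl hs.2.2
  obtain ⟨N, hNU, ρ, δ₀, -, -, hN⟩ := L.exists_isSheetNhd_recenter hω hL hs.1 hs.2.1
    (hU'.mem_nhds hsU') one_pos
  have hsub := hUV N hN.good hNU
  obtain ⟨r, hr, hsmall⟩ := (L.recenter hs.1 (by rw [hs.2.1]; rfl)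
    (by rw [hs.2.1]; rfl)).exists_mem_of_small (hN.good.isOpen.mem_nhds hN.good.mem)
  have hsmall' : ∀ y ∈ L.U, ‖L.h y 0‖ < r → ‖L.h y 1‖ < r → ‖L.h y 2 - ω t₁‖ < r → y ∈ N := by
    intro y hy h0 h1 h2
    refine hsmall y hy h0 h1 ?_
    show ‖L.h y 2 - L.h s.pt 2‖ < r
    rw [hs.2.1]; exact h2
  obtain ⟨ε, hε, hball⟩ := Metric.continuousAt_iff.1 (hω.analyticAt t₁).continuousAt r hr
  obtain ⟨M, hM⟩ := L.exists_re_lt t₁ (Real.log r)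
  refine ⟨min ε (1 / 2), lt_min hε one_half_pos,
    M, fun t ht => ⟨?_, ?_⟩⟩
  · intro s' hs'
    refine hV'V (hsub ⟨?_, OnSheet.change L hω hL ?_ hs'⟩)
    · refine hsmall' _ hs'.1 ?_ ?_ ?_
      · rw [hs'.2.1]; simpa
      · rw [hs'.2.1]; simpa
      · rw [hs'.2.1, ← dist_eq_norm]
        exact hball (lt_of_lt_of_le ht (min_le_left _ _))
    · rw [← dist_eq_norm]
      exact lt_of_lt_of_le ht (min_le_right _ _)
  · intro y hyU hyS z₁ z₂ hz₁ hsh hh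
    have ht1 : ‖t - t₁‖ < 1 / 2 := by
      rw [← dist_eq_norm]; exact lt_of_lt_of_le ht (min_le_right _ _)
    obtain ⟨hlt1, hz₂⟩ := hM j z₁ z₂ t (by linarith) hz₁ hsh
    have hyN : y ∈ N := by
      refine hsmall' y hyU ?_ ?_ ?_
      · rw [hh]
        show ‖Complex.exp z₁‖ < r
        rw [Complex.norm_exp]; exact (Real.lt_log_iff_exp_lt hr).1 hlt1
      · rw [hh]
        show ‖Complex.exp z₂‖ < r
        rw [Complex.norm_exp]; exact (Real.lt_log_iff_exp_lt hr).1 hz₂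
      · rw [hh, ← dist_eq_norm]
        exact hball (lt_of_lt_of_le ht (min_le_left _ _))
    refine hV'V (hsub ⟨hyN, ?_⟩)
    have := hN.good.hasLabel_ofMem hyN hyS
    rwa [L.phase_root hω hsh (by linarith) hh] at this

end MonomialForm

end MilnorBoundary


/-! ### Holomorphic functions on the curve of branches -/

namespace MilnorBoundary

open BranchPoint

/-- The map `t ↦ α Re t + i κ Im t`. -/
def zmap (α κ : ℝ) (t : ℂ) : ℂ := ⟨α * t.re, κ * t.im⟩

lemma continuous_zmap (α κ : ℝ) : Continuous (zmap α κ) := by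
  have : zmap α κ = fun t => ((α * t.re : ℝ) : ℂ) + ((κ * t.im : ℝ) : ℂ) * Complex.I := by
    funext t
    apply Complex.ext <;> simp [zmap]
  rw [this]
  fun_prop

lemma zmap_zmap {α κ β κ' : ℝ} (h : α * β = 1) (h' : κ * κ' = 1) (t : ℂ) :
    zmap α κ (zmap β κ' t) = t := by
  apply Complex.ext
  · show α * (β * t.re) = t.re
    rw [← mul_assoc, h, one_mul]
  · show κ * (κ' * t.im) = t.im
    rw [← mul_assoc, h', one_mul]

/-- Germs of functions on the space of branches which are holomorphic in the coordinates `μ`. -/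
def HolModel {Y : Type*} [TopologicalSpace Y] (S U : Set Y) (μ : Y → Fin 3 → ℂ) (s : BranchPoint S)
    (F : BranchPoint S → ℂ) : Prop :=
  ∃ V : Set (BranchPoint S), IsOpen V ∧ s ∈ V ∧ (∀ t ∈ V, t.pt ∈ U) ∧ ContinuousOn F V ∧
    ∀ t ∈ V, t.pt ∈ S → ∃ G : (Fin 3 → ℂ) → ℂ, AnalyticAt ℂ G (μ t.pt) ∧
      F =ᶠ[𝓝 t] fun t' => G (μ t'.pt)

namespace MonomialForm

variable {Y : Type*} [TopologicalSpace Y] {S : Set Y} {f : Y → ℂ} {q : Y} {a₁ a₂ a₃ : ℕ}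
  (L : MonomialForm S f q a₁ a₂ a₃)

/-- The coordinates `μ` are holomorphic functions of `z₁` and of the coordinate `zmap α κ t`. -/
structure HasModel (ω : ℂ → ℂ) (μ : Y → Fin 3 → ℂ) (e : Equiv.Perm (Fin 3)) (α κ : ℝ) : Prop where
  pos : 0 < α
  sq : κ * κ = 1
  eq : ∀ y ∈ L.U, y ∈ S → ∀ (j : ℤ) (z₁ z₂ t : ℂ), L.InSheet j z₁ z₂ t →
    L.h y = ![Complex.exp z₁, Complex.exp z₂, ω t] → μ y (e 0) = Complex.exp z₁ ∧
      μ y (e 1) = Complex.exp ((a₁ * z₁ + κ * a₃ * zmap α κ t - 2 * Real.pi * Complex.I * j) / a₂) ∧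
      μ y (e 2) = ω (zmap α κ t)

variable {L} {ω : ℂ → ℂ} {μ : Y → Fin 3 → ℂ} {e : Equiv.Perm (Fin 3)} {α κ : ℝ}

lemma HasModel.inv_right (hμ : L.HasModel ω μ e α κ) (t : ℂ) : zmap α κ (zmap α⁻¹ κ t) = t :=
  zmap_zmap (mul_inv_cancel₀ hμ.pos.ne') hμ.sq t

lemma HasModel.inv_left (hμ : L.HasModel ω μ e α κ) (t : ℂ) : zmap α⁻¹ κ (zmap α κ t) = t :=
  zmap_zmap (inv_mul_cancel₀ hμ.pos.ne') hμ.sq t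

variable (L)
variable {lg : ℂ → ℂ → ℂ} (hω : IsUniformizer ω lg) (hL : L.Fits ω)
include hω hL

/-- Restriction of holomorphic functions to the curve of branches. -/
theorem OnSheet.factor (hμ : L.HasModel ω μ e α κ) {t₁ : ℂ} {j : ℤ} {s : BranchPoint S}
    (hs : L.OnSheet ω lg t₁ j s) {F : BranchPoint S → ℂ} (hF : HolModel S L.U μ s F) :
    ∃ G : ℂ → ℂ, AnalyticAt ℂ G (zmap α κ t₁) ∧
      ∀ᶠ t in 𝓝 t₁, ∀ s', L.OnSheet ω lg t j s' → F s' = G (zmap α κ t) := by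
  classical
  obtain ⟨V, hV, hsV, hVU, hFc, hFG⟩ := hF
  have hnhds := fun {t : ℂ} {s' : BranchPoint S} (hs' : L.OnSheet ω lg t j s')
    {W : Set (BranchPoint S)} (hW : W ∈ 𝓝 s') => OnSheet.exists_nhds L hω hL hs' hW
  obtain ⟨δ, hδ, M, hδM⟩ := hnhds hs (hV.mem_nhds hsV)
  obtain ⟨N, -, ρ, δ₁, hδ₁, -, hN⟩ := L.exists_isSheetNhd_recenter hω hL hs.1 hs.2.1 univ_mem one_pos
  obtain ⟨M₁, hM₁⟩ := L.exists_re_lt t₁ ρ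
  obtain ⟨r, hr, hpoly⟩ := (L.recenter hs.1 (by rw [hs.2.1]; rfl)
    (by rw [hs.2.1]; rfl)).exists_polydisc univ_mem
  obtain ⟨δ₂, hδ₂, hball⟩ := Metric.continuousAt_iff.1 (hω.analyticAt t₁).continuousAt r hr
  obtain ⟨σ, hσ, hσU⟩ := exists_section_of_isOpenEmbedding ⟨s.pt, hs.1⟩ L.emb
  have hcω : Continuous ω := continuous_iff_continuousAt.2 fun t => (hω.analyticAt t).continuousAt
  set A : ℂ → ℂ := zmap α⁻¹ κ
  have hA : Continuous A := continuous_zmap _ _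
  set ζ₁ := zmap α κ t₁
  have hAζ₁ : A ζ₁ = t₁ := hμ.inv_left t₁
  set O : Set ℂ := A ⁻¹' (Metric.ball t₁ (min (min δ δ₁) (min δ₂ 1)))
  have hO : IsOpen O := Metric.isOpen_ball.preimage hA
  have hζ₁O : ζ₁ ∈ O := by
    show A ζ₁ ∈ Metric.ball t₁ (min (min δ δ₁) (min δ₂ 1))
    rw [hAζ₁]; exact Metric.mem_ball_self (by positivity)
  have hOd : ∀ ζ ∈ O, A ζ ∈ Metric.ball t₁ δ ∧ A ζ ∈ Metric.ball t₁ δ₁ ∧ dist (A ζ) t₁ < δ₂ ∧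
      ‖A ζ - t₁‖ < 1 := by
    intro ζ hζ
    have hζ' : dist (A ζ) t₁ < min (min δ δ₁) (min δ₂ 1) := hζ
    rw [lt_min_iff, lt_min_iff, lt_min_iff] at hζ'
    rw [← dist_eq_norm]
    exact ⟨hζ'.1.1, hζ'.1.2, hζ'.2.1, hζ'.2.2⟩
  -- the sheet over the curve
  have hex : ∀ ζ ∈ O, ∃ s' : BranchPoint S, L.OnSheet ω lg (A ζ) j s' := by
    intro ζ hζ
    obtain ⟨y, hy, hyh⟩ := hpoly ![0, 0, ω (A ζ)] (by simpa using hr) (by simpa using hr) (by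
      show ‖ω (A ζ) - L.h s.pt 2‖ < r
      rw [hs.2.1, ← dist_eq_norm]
      exact hball (hOd ζ hζ).2.2.1)
    obtain ⟨s', -, hs'⟩ := L.exists_onSheet hω hL hy.1 hyh j
    exact ⟨s', hs'⟩
  have : Nonempty (BranchPoint S) := ⟨s⟩
  choose! b hb using hex
  -- holomorphic discs in the branch
  set z₂ : ℝ → ℂ → ℂ := fun ξ t => ⟨((L.k * L.b₁ - a₁) * ξ + (L.k * L.b₃ - a₃) * t.re) / a₂,
    (2 * Real.pi * j - a₃ * t.im) / a₂⟩
  have ha₂ : (a₂ : ℝ) ≠ 0 := by exact_mod_cast L.a₂_pos.ne'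
  have hsheet : ∀ (ξ : ℝ) (t : ℂ), L.InSheet j (ξ : ℂ) (z₂ ξ t) t := by
    intro ξ t
    constructor
    · simp only [z₂, Complex.ofReal_re]
      field_simp
    · simp only [z₂, Complex.ofReal_im]
      field_simp
      ring
  -- For fixed `ξ` the map `K ξ` is a disc in the branch, parallel to the curve, on which the first
  -- coordinate has the constant value `exp ξ`. These discs approach the curve as `ξ` tends to `-∞`.
  set K : ℝ → ℂ → Y := fun ξ ζ => σ ![Complex.exp ξ, Complex.exp (z₂ ξ (A ζ)), ω (A ζ)]
  have hK : ∀ ξ < M₁, ∀ ζ ∈ O, K ξ ζ ∈ S ∧ K ξ ζ ∈ L.U ∧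
      L.h (K ξ ζ) = ![Complex.exp ξ, Complex.exp (z₂ ξ (A ζ)), ω (A ζ)] := by
    intro ξ hξ ζ hζ
    obtain ⟨h1, h2⟩ := hM₁ j ξ (z₂ ξ (A ζ)) (A ζ) (hOd ζ hζ).2.2.2 (by simpa using hξ) (hsheet _ _)
    obtain ⟨y, hy, hyh, -⟩ := hN.exists_pt ξ (z₂ ξ (A ζ)) (A ζ) j h1 h2 (hOd ζ hζ).2.1 (hsheet _ _)
    have hyh' : L.h y = ![Complex.exp ξ, Complex.exp (z₂ ξ (A ζ)), ω (A ζ)] := hyh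
    have hyU : y ∈ L.U := hN.sub hy.1
    have : K ξ ζ = y := by
      show σ _ = y
      rw [← hyh', hσU y hyU]
    rw [this]
    exact ⟨hy.2, hyU, hyh'⟩
  have hKc : ∀ ξ < M₁, ContinuousOn (K ξ) O := by
    intro ξ hξ
    refine hσ.comp (Continuous.continuousOn (continuous_pi fun i => ?_)) fun ζ hζ => ?_
    · fin_cases i
      · exact continuous_const
      · show Continuous fun ζ => Complex.exp (z₂ ξ (A ζ))
        have h1 : Continuous (z₂ ξ) := by
          have : z₂ ξ = fun t => (((((L.k * L.b₁ - a₁) * ξ + (L.k * L.b₃ - a₃) * t.re) / a₂ : ℝ)) : ℂ) +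
              (((2 * Real.pi * j - a₃ * t.im) / a₂ : ℝ) : ℂ) * Complex.I := by
            funext t
            apply Complex.ext <;> simp [z₂, -Complex.ofReal_sub, -Complex.ofReal_div,
              -Complex.ofReal_add, -Complex.ofReal_mul]
          rw [this]
          fun_prop
        exact Complex.continuous_exp.comp (h1.comp hA)
      · exact hcω.comp hA
    · obtain ⟨-, h2, h3⟩ := hK ξ hξ ζ hζ
      exact ⟨_, h2, h3⟩
  set Fl : Y → ℂ := fun y => if hy : y ∈ S then F (ofMem y hy) else 0
  have hdiff : ∀ ξ < min M M₁, DifferentiableOn ℂ (fun ζ => Fl (K ξ ζ)) O := by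
    intro ξ hξ ζ hζ
    obtain ⟨hξM, hξM₁⟩ := lt_min_iff.1 hξ
    obtain ⟨hKS, hKU, hKh⟩ := hK ξ hξM₁ ζ hζ
    have hmem : ofMem (K ξ ζ) hKS ∈ V := (hδM (A ζ) (hOd ζ hζ).1).2 _ hKU hKS ξ _
      (by simpa using hξM) (hsheet _ _) hKh
    obtain ⟨G, hG, hFG'⟩ := hFG _ hmem hKS
    have hev := eventually_ofMem hO (hKc ξ hξM₁) (fun z hz => (hK ξ hξM₁ z hz).1) hζ hFG'
    -- Although `K ξ` need not be holomorphic in `ζ`, the model coordinates are holomorphic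
    -- functions `ν` of `ζ` along it. So is `F`, which is holomorphic in the model coordinates off
    -- the divisor.
    set ν : ℂ → Fin 3 → ℂ := fun ζ i => (![Complex.exp ξ, Complex.exp ((a₁ * ξ + κ * a₃ * ζ -
      2 * Real.pi * Complex.I * j) / a₂), ω ζ] : Fin 3 → ℂ) (e.symm i)
    have hν : ∀ ζ ∈ O, μ (K ξ ζ) = ν ζ := by
      intro ζ hζ
      obtain ⟨hKS, hKU, hKh⟩ := hK ξ hξM₁ ζ hζ
      obtain ⟨h0, h1, h2⟩ := hμ.eq _ hKU hKS j _ _ _ (hsheet _ _) hKh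
      rw [hμ.inv_right] at h1 h2
      funext i
      obtain ⟨l, rfl⟩ := e.surjective i
      simp only [ν, Equiv.symm_apply_apply]
      fin_cases l
      · exact h0
      · exact h1
      · exact h2
    have hνd : DifferentiableAt ℂ ν ζ := by
      refine differentiableAt_pi.2 fun i => ?_
      obtain ⟨l, rfl⟩ := e.surjective i
      simp only [ν, Equiv.symm_apply_apply]
      fin_cases l
      · exact differentiableAt_const _
      · show DifferentiableAt ℂ (fun ζ : ℂ => Complex.exp ((a₁ * ξ + κ * a₃ * ζ -
          2 * Real.pi * Complex.I * j) / a₂)) ζ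
        fun_prop
      · exact (hω.analyticAt ζ).differentiableAt
    have hGd : DifferentiableAt ℂ (G ∘ ν) ζ := by
      refine DifferentiableAt.comp ζ ?_ hνd
      rw [← hν ζ hζ]; exact hG.differentiableAt
    refine (hGd.congr_of_eventuallyEq ?_).differentiableWithinAt
    filter_upwards [hev, hO.mem_nhds hζ] with z hz hzO
    obtain ⟨hS, -, -⟩ := hK ξ hξM₁ z hzO
    have h1 : Fl (K ξ z) = F (ofMem (K ξ z) hS) := by simp only [Fl, dif_pos hS]
    rw [h1, Function.comp_apply, ← hν z hzO]
    exact hz hS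
  -- Continuity of `F` on the space of branches, together with the description of the neighbourhoods
  -- of a branch, gives locally uniform convergence of the restrictions to discs. The limit on the
  -- curve is then holomorphic.
  have hlim : TendstoLocallyUniformlyOn (fun (n : ℕ) ζ => Fl (K (-n) ζ)) (fun ζ => F (b ζ)) atTop O := by
    rw [Metric.tendstoLocallyUniformlyOn_iff]
    intro ε hε ζ hζ
    have hbV : b ζ ∈ V := (hδM (A ζ) (hOd ζ hζ).1).1 _ (hb ζ hζ)
    have hnear : F ⁻¹' Metric.ball (F (b ζ)) (ε / 2) ∈ 𝓝 (b ζ) :=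
      (hFc.continuousAt (hV.mem_nhds hbV)) (Metric.ball_mem_nhds _ (half_pos hε))
    obtain ⟨δ₃, hδ₃, M₃, h₃⟩ := hnhds (hb ζ hζ) hnear
    refine ⟨O ∩ A ⁻¹' Metric.ball (A ζ) δ₃, inter_mem self_mem_nhdsWithin (mem_nhdsWithin_of_mem_nhds
      (hA.continuousAt (Metric.ball_mem_nhds _ hδ₃))), ?_⟩
    have hn : ∀ᶠ n : ℕ in atTop, (-n : ℝ) < min M₁ M₃ :=
      (tendsto_neg_atTop_atBot.comp tendsto_natCast_atTop_atTop).eventually_lt_atBot _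
    filter_upwards [hn] with n hn z hz
    obtain ⟨hn1, hn3⟩ := lt_min_iff.1 hn
    obtain ⟨hKS, hKU, hKh⟩ := hK _ hn1 z hz.1
    have h1 : F (b z) ∈ Metric.ball (F (b ζ)) (ε / 2) := (h₃ (A z) hz.2).1 _ (hb z hz.1)
    have h2 : F (ofMem _ hKS) ∈ Metric.ball (F (b ζ)) (ε / 2) :=
      (h₃ (A z) hz.2).2 _ hKU hKS ((-(n : ℝ) : ℝ) : ℂ) _ (by rwa [Complex.ofReal_re]) (hsheet _ _) hKh
    have h4 : Fl (K (-n) z) = F (ofMem _ hKS) := by simp only [Fl, dif_pos hKS]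
    rw [h4]
    calc dist (F (b z)) (F (ofMem _ hKS)) ≤ dist (F (b z)) (F (b ζ)) +
          dist (F (ofMem _ hKS)) (F (b ζ)) := dist_triangle_right _ _ _
      _ < ε := by
        rw [Metric.mem_ball] at h1 h2
        linarith
  have hFd : DifferentiableOn ℂ (fun ζ => F (b ζ)) O := by
    refine hlim.differentiableOn ?_ hO
    have hn : ∀ᶠ n : ℕ in atTop, (-n : ℝ) < min M M₁ :=
      (tendsto_neg_atTop_atBot.comp tendsto_natCast_atTop_atTop).eventually_lt_atBot _
    filter_upwards [hn] with n hn using hdiff _ hn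
  refine ⟨fun ζ => F (b ζ), hFd.analyticAt (hO.mem_nhds hζ₁O), ?_⟩
  have hZ : ∀ᶠ t in 𝓝 t₁, zmap α κ t ∈ O := (continuous_zmap α κ).continuousAt (hO.mem_nhds hζ₁O)
  filter_upwards [hZ] with t ht s' hs'
  have h1 := hb _ ht
  have h2 : A (zmap α κ t) = t := hμ.inv_left t
  rw [h2] at h1
  rw [OnSheet.unique L hω hL hs' h1]

end MonomialForm

end MilnorBoundary


/-! ### A criterion for charts of the curve of branches -/

namespace MilnorBoundary

open BranchPoint

lemma isChartOn_of_injOn {E : Type*} [TopologicalSpace E] {hol : E → (E → ℂ) → Prop} {A V : Set E}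
    {φ : E → ℂ} (hV : IsOpen V) (hφ : ∀ s ∈ A ∩ V, hol s φ) (hc : ContinuousOn φ (A ∩ V))
    (hinj : InjOn φ (A ∩ V)) (hopen : ∀ s ∈ A ∩ V, ∀ W ∈ 𝓝 s, φ '' (A ∩ V ∩ W) ∈ 𝓝 (φ s))
    (hfac : ∀ s ∈ A ∩ V, ∀ F, hol s F → ∃ G : ℂ → ℂ, AnalyticAt ℂ G (φ s) ∧
      ∀ᶠ s' in 𝓝[A] s, F s' = G (φ s')) :
    IsChartOn hol A V fun s (_ : Fin 1) => φ s where
  isOpen := hV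
  hol_coord _ s hs := hφ s hs
  isOpenEmbedding := by
    have hemb : IsOpenEmbedding ((A ∩ V).domRestrict φ) := by
      refine IsOpenEmbedding.of_continuous_injective_isOpenMap
        (continuousOn_iff_continuous_domRestrict.1 hc)
        (fun x y h => Subtype.ext (hinj x.2 y.2 h)) ?_
      refine isOpenMap_iff_nhds_le.2 fun s W hW => ?_
      obtain ⟨W', hW', hsub⟩ := (mem_nhds_subtype _ _ _).1 hW
      refine mem_of_superset (hopen s.1 s.2 W' hW') ?_
      rintro _ ⟨s', hs', rfl⟩
      exact hsub (show (⟨s', hs'.1⟩ : ↥(A ∩ V)) ∈ Subtype.val ⁻¹' W' from hs'.2)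
    exact (Homeomorph.funUnique (Fin 1) ℂ).symm.isOpenEmbedding.comp hemb
  factor s hs F hF := by
    obtain ⟨G, hG, h⟩ := hfac s hs F hF
    refine ⟨fun x => G (x 0), ?_, h⟩
    exact AnalyticAt.fun_comp (f := fun x : Fin 1 → ℂ => x 0) hG
      ((ContinuousLinearMap.proj (R := ℂ) (φ := fun _ : Fin 1 => ℂ) 0).analyticAt _)

/-- Limits along the branches of holomorphic functions of the coordinates `μ`. -/
lemma holModel_of_tendsto {Y : Type*} [TopologicalSpace Y] {S U : Set Y} {μ : Y → Fin 3 → ℂ}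
    {V : Set (BranchPoint S)} (hV : IsOpen V) (hVU : ∀ t ∈ V, t.pt ∈ U)
    (hS : ∀ y ∈ S, ∀ᶠ y' in 𝓝 y, y' ∈ closure S → y' ∈ S) {τ : Y → ℂ} {φ : BranchPoint S → ℂ}
    (hτ : ∀ y ∈ S, y ∈ U → ContinuousWithinAt τ S y ∧
      ∃ G : (Fin 3 → ℂ) → ℂ, AnalyticAt ℂ G (μ y) ∧ τ =ᶠ[𝓝[S] y] fun y' => G (μ y'))
    (hφ : ∀ t ∈ V, Tendsto τ t.filter (𝓝 (φ t))) {s : BranchPoint S} (hs : s ∈ V) :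
    HolModel S U μ s φ := by
  have hc : ContinuousOn φ V := fun t ht =>
    (continuousAt_limit (mem_of_superset (hV.mem_nhds ht) hφ)).continuousWithinAt
  refine ⟨V, hV, hs, hVU, hc, fun t ht htS => ?_⟩
  obtain ⟨-, G, hG, hG'⟩ := hτ _ htS (hVU t ht)
  refine ⟨G, hG, ?_⟩
  filter_upwards [continuous_pt.continuousAt.eventually (hS _ htS),
    continuous_pt.continuousAt.eventually (eventually_nhdsWithin_iff.1 hG'), hV.mem_nhds ht] with
    t' h1 h2 h3
  have ht'S : t'.pt ∈ S := h1 t'.pt_mem_closure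
  rw [← h2 ht'S]
  exact tendsto_nhds_unique (hφ t' h3) ((hτ _ ht'S (hVU _ h3)).1.mono_left t'.filter_le)

namespace MonomialForm

variable {Y : Type*} [TopologicalSpace Y] {S : Set Y} {f : Y → ℂ} {q : Y} {a₁ a₂ a₃ : ℕ}
  (L : MonomialForm S f q a₁ a₂ a₃)

lemma OnSheet.eventually_exists {ω : ℂ → ℂ} {lg : ℂ → ℂ → ℂ} (hω : IsUniformizer ω lg)
    (hL : L.Fits ω) {t₁ : ℂ} {j : ℤ} {s : BranchPoint S}
    (hs : L.OnSheet ω lg t₁ j s) {W : Set (BranchPoint S)} (hW : W ∈ 𝓝 s) :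
    ∀ᶠ t in 𝓝 t₁, ∃ s', L.OnSheet ω lg t j s' ∧ s' ∈ W := by
  obtain ⟨δ, hδ, M, hδM⟩ := OnSheet.exists_nhds L hω hL hs hW
  obtain ⟨r, hr, hpoly⟩ := (L.recenter hs.1 (by rw [hs.2.1]; rfl)
    (by rw [hs.2.1]; rfl)).exists_polydisc univ_mem
  obtain ⟨δ₂, hδ₂, hball⟩ := Metric.continuousAt_iff.1 (hω.analyticAt t₁).continuousAt r hr
  filter_upwards [Metric.ball_mem_nhds t₁ hδ, Metric.ball_mem_nhds t₁ hδ₂] with t ht ht₂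
  obtain ⟨y, hy, hyh⟩ := hpoly ![0, 0, ω t] (by simpa using hr) (by simpa using hr) (by
    show ‖ω t - L.h s.pt 2‖ < r
    rw [hs.2.1, ← dist_eq_norm]
    exact hball ht₂)
  obtain ⟨s', -, hs'⟩ := L.exists_onSheet hω hL hy.1 hyh j
  exact ⟨s', hs', (hδM t ht).1 _ hs'⟩

/-- Data for a chart of the curve of branches: the coordinate is a function `θ` of the uniformizing
coordinate, with the exception of some points, sent to `0`. -/
structure IsSheetChart (ω : ℂ → ℂ) (lg : ℂ → ℂ → ℂ) (μ : Y → Fin 3 → ℂ) (α κ : ℝ) (j : ℤ)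
    (A V : Set (BranchPoint S)) (φ : BranchPoint S → ℂ) (θ : ℂ → ℂ) : Prop where
  isOpen : IsOpen V
  hol : ∀ s ∈ V, HolModel S L.U μ s φ
  injOn : InjOn φ (A ∩ V)
  analyticAt : ∀ ζ, AnalyticAt ℂ θ ζ
  deriv_ne : ∀ ζ, deriv θ ζ ≠ 0
  mem : ∀ t, ∀ s ∈ V, L.OnSheet ω lg t j s → s ∈ A
  val : ∀ t, ∀ s ∈ V, L.OnSheet ω lg t j s → φ s = θ (zmap α κ t)
  cases : ∀ s ∈ A ∩ V, (∃ t, L.OnSheet ω lg t j s) ∨ φ s = 0 ∧ ∀ W ∈ 𝓝 s, ∃ ε > 0, ∀ z : ℂ,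
    z ≠ 0 → ‖z‖ < ε → ∃ t s', L.OnSheet ω lg t j s' ∧ s' ∈ W ∧ θ (zmap α κ t) = z

variable {L} {ω : ℂ → ℂ} {lg : ℂ → ℂ → ℂ} {μ : Y → Fin 3 → ℂ} {e : Equiv.Perm (Fin 3)} {α κ : ℝ}
  {j : ℤ} {A V : Set (BranchPoint S)} {φ : BranchPoint S → ℂ} {θ : ℂ → ℂ}

/-- Where the uniformizing coordinate is available, a local inverse of `θ` yields the branches with
a given value of `φ`, and `OnSheet.factor` the factorization of holomorphic functions. At an
exceptional point, sent to `0`, a punctured neighbourhood of `0` is filled by such branches. -/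
theorem IsSheetChart.isChartOn (hω : IsUniformizer ω lg) (hL : L.Fits ω)
    (hμ : L.HasModel ω μ e α κ) (H : L.IsSheetChart ω lg μ α κ j A V φ θ) :
    IsChartOn (HolModel S L.U μ) A V fun s (_ : Fin 1) => φ s := by
  have hc : ContinuousOn φ V := fun s hs => by
    obtain ⟨V', hV', hsV', -, h, -⟩ := H.hol s hs
    exact (h.continuousAt (hV'.mem_nhds hsV')).continuousWithinAt
  -- points of the sheet with a given coordinate
  have key : ∀ t₁, ∀ s ∈ V, L.OnSheet ω lg t₁ j s → ∀ W ∈ 𝓝 s, ∃ η : ℂ → ℂ,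
      AnalyticAt ℂ η (φ s) ∧ η (φ s) = zmap α κ t₁ ∧ ∀ᶠ z in 𝓝 (φ s), ∃ t s',
        L.OnSheet ω lg t j s' ∧ s' ∈ V ∩ W ∧ zmap α κ t = η z ∧ φ s' = z := by
    intro t₁ s hsV hs W hW
    set ζ₁ := zmap α κ t₁
    have hst := (H.analyticAt ζ₁).hasStrictDerivAt
    set η := hst.localInverse _ _ _ (H.deriv_ne ζ₁)
    have hη : AnalyticAt ℂ η (θ ζ₁) := (H.analyticAt ζ₁).analyticAt_localInverse (H.deriv_ne ζ₁)
    have hη₁ : η (θ ζ₁) = ζ₁ := HasStrictFDerivAt.localInverse_apply_image ..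
    have hη₂ : ∀ᶠ z in 𝓝 (θ ζ₁), θ (η z) = z := hst.eventually_right_inverse (H.deriv_ne ζ₁)
    rw [H.val t₁ s hsV hs]
    refine ⟨η, hη, hη₁, ?_⟩
    have hZ : Tendsto (fun z => zmap α⁻¹ κ (η z)) (𝓝 (θ ζ₁)) (𝓝 t₁) := by
      have h1 := (continuous_zmap α⁻¹ κ).continuousAt (x := η (θ ζ₁))
      have h2 := Tendsto.comp h1 hη.continuousAt
      rwa [hη₁, hμ.inv_left] at h2
    filter_upwards [hη₂, hZ.eventually (OnSheet.eventually_exists L hω hL hs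
      (inter_mem (H.isOpen.mem_nhds hsV) hW))] with z hz ⟨s', hs', hs'W⟩
    refine ⟨_, s', hs', hs'W, hμ.inv_right _, ?_⟩
    rw [H.val _ s' hs'W.1 hs', hμ.inv_right, hz]
  have hfac : ∀ t₁, ∀ s ∈ V, L.OnSheet ω lg t₁ j s → ∀ F, HolModel S L.U μ s F →
      ∃ G : ℂ → ℂ, AnalyticAt ℂ G (φ s) ∧ ∀ᶠ z in 𝓝 (φ s), ∃ s' ∈ A ∩ V, φ s' = z ∧ F s' = G z := by
    intro t₁ s hsV hs F hF
    obtain ⟨G, hG, hGF⟩ := OnSheet.factor L hω hL hμ hs hF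
    obtain ⟨η, hη, hη₁, hev⟩ := key t₁ s hsV hs univ univ_mem
    refine ⟨G ∘ η, AnalyticAt.comp (hη₁ ▸ hG) hη, ?_⟩
    have hZ : Tendsto (fun z => zmap α⁻¹ κ (η z)) (𝓝 (φ s)) (𝓝 t₁) := by
      have h1 := (continuous_zmap α⁻¹ κ).continuousAt (x := η (φ s))
      have h2 := Tendsto.comp h1 hη.continuousAt
      rwa [hη₁, hμ.inv_left] at h2
    filter_upwards [hev, hZ.eventually hGF] with z ⟨t, s', hs', hs'V, ht, hz⟩ h
    refine ⟨s', ⟨H.mem t s' hs'V.1 hs', hs'V.1⟩, hz, ?_⟩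
    rw [← ht, hμ.inv_left] at h
    rw [h s' hs', Function.comp_apply, ht]
  have hopen : ∀ s ∈ A ∩ V, ∀ W ∈ 𝓝 s, φ '' (A ∩ V ∩ W) ∈ 𝓝 (φ s) := by
    intro s hs W hW
    rcases H.cases s hs with ⟨t, ht⟩ | ⟨h0, h⟩
    · obtain ⟨η, -, -, hev⟩ := key t s hs.2 ht W hW
      filter_upwards [hev] with z ⟨t, s', hs', hs'V, _, hz⟩
      exact ⟨s', ⟨⟨H.mem t s' hs'V.1 hs', hs'V.1⟩, hs'V.2⟩, hz⟩
    · obtain ⟨ε, hε, hz⟩ := h (V ∩ W) (inter_mem (H.isOpen.mem_nhds hs.2) hW)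
      rw [h0]
      filter_upwards [Metric.ball_mem_nhds (0 : ℂ) hε] with z hzε
      by_cases hz0 : z = 0
      · exact ⟨s, ⟨hs, mem_of_mem_nhds hW⟩, by rw [h0, hz0]⟩
      · obtain ⟨t, s', hs', hs'V, hθ⟩ := hz z hz0 (by simpa using hzε)
        exact ⟨s', ⟨⟨H.mem t s' hs'V.1 hs', hs'V.1⟩, hs'V.2⟩, by rw [H.val t s' hs'V.1 hs', hθ]⟩
  refine isChartOn_of_injOn H.isOpen (fun s hs => H.hol s hs.2) (hc.mono inter_subset_right)
    H.injOn hopen fun s hs F hF => ?_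
  have : Nonempty (BranchPoint S) := ⟨s⟩
  set ψ := Function.invFunOn φ (A ∩ V)
  have hψ : ∀ s' ∈ A ∩ V, ψ (φ s') = s' := fun s' hs' => H.injOn.leftInvOn_invFunOn hs'
  have hAV : ∀ᶠ s' in 𝓝[A] s, s' ∈ A ∩ V := by
    filter_upwards [self_mem_nhdsWithin, mem_nhdsWithin_of_mem_nhds (H.isOpen.mem_nhds hs.2)] with
      s' h1 h2 using ⟨h1, h2⟩
  refine ⟨fun z => F (ψ z), ?_, ?_⟩
  swap
  · filter_upwards [hAV] with s' hs'
    rw [hψ s' hs']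
  have hsheet : ∀ t₁, ∀ s ∈ V, L.OnSheet ω lg t₁ j s → HolModel S L.U μ s F →
      AnalyticAt ℂ (fun z => F (ψ z)) (φ s) := by
    intro t₁ s hsV hst hF
    obtain ⟨G, hG, h⟩ := hfac t₁ s hsV hst F hF
    refine hG.congr ?_
    filter_upwards [h] with z ⟨s', hs', hz, hFz⟩
    rw [← hFz, ← hz, hψ s' hs']
  rcases H.cases s hs with ⟨t, ht⟩ | ⟨h0, h⟩
  · exact hsheet t s hs.2 ht hF
  · obtain ⟨V', hV', hsV', hV'U, hFc, hFG⟩ := hF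
    obtain ⟨ε, hε, hz⟩ := h (V ∩ V') (inter_mem (H.isOpen.mem_nhds hs.2) (hV'.mem_nhds hsV'))
    -- Read in the coordinate `φ`, the function is holomorphic off `0` and continuous at `0`, so the
    -- singularity is removable.
    refine Complex.analyticAt_of_differentiable_on_punctured_nhds_of_continuousAt ?_ ?_
    · rw [h0, eventually_nhdsWithin_iff]
      filter_upwards [Metric.ball_mem_nhds (0 : ℂ) hε] with z hzε hz0
      obtain ⟨t, s', hs', hs'V, hθ⟩ := hz z hz0 (by simpa using hzε)
      have := hsheet t s' hs'V.1 hs' ⟨V', hV', hs'V.2, hV'U, hFc, hFG⟩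
      rw [H.val t s' hs'V.1 hs', hθ] at this
      exact this.differentiableAt
    · intro O hO
      have hψs : ψ (φ s) = s := hψ s hs
      have hO : O ∈ 𝓝 (F (ψ (φ s))) := hO
      rw [hψs] at hO
      have hW := hopen s hs _ ((hFc.continuousAt (hV'.mem_nhds hsV')) hO)
      rw [mem_map]
      filter_upwards [hW] with z ⟨s', hs', hz'⟩
      show F (ψ z) ∈ O
      rw [← hz', hψ s' hs'.1]
      exact hs'.2

end MonomialForm

end MilnorBoundary


/-! ### The complex models in logarithmic coordinates -/

namespace MilnorBoundary

variable {X : Type*} [TopologicalSpace X] {P : SmoothingGerm X} {Y : Type*} [TopologicalSpace Y]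
  {M : Modification P Y} {c : AdaptedChart M} {e : Equiv.Perm (Fin 3)} {D₁ D₂ C : Set Y}
  {m : Set Y → ℕ} {k : ℕ} {q : Y}

lemma prod_eq_perm (e : Equiv.Perm (Fin 3)) (x : Fin 3 → ℂ) :
    ∏ i, x i = x (e 0) * x (e 1) * x (e 2) := by
  rw [← Equiv.prod_comp e, Fin.prod_univ_three]

/-- The strict transform is closed and the divisor is closed, so the open part is locally closed.
Hence a branch centered near one of its points is again centered at a point of the open part. -/
lemma openPart_eventually {k : ℕ} {y : Y} (hy : y ∈ M.openPart k) :
    ∀ᶠ y' in 𝓝 y, y' ∈ closure (M.openPart k) → y' ∈ M.openPart k := by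
  filter_upwards [M.isClosed_divisor.isOpen_compl.mem_nhds hy.2] with y' h1 h2
  refine ⟨?_, h1⟩
  have : closure (M.openPart k) ⊆ M.strictTransform k :=
    closure_minimal (fun z hz => hz.1) isClosed_closure
  exact this h2

namespace IsLocalForm

variable (H : IsLocalForm c e D₁ D₂ C m k q)
include H

lemma isMinus_perm (h : c.IsMinus) : e = 1 ∨ e = Equiv.swap 1 2 := by
  rcases H.perm with h1 | ⟨-, h1⟩ | ⟨h1, -⟩
  · exact Or.inl h1
  · exact absurd h.1 h1
  · exact Or.inr h1

lemma not_isMinus_perm (h : ¬ c.IsMinus) : e = 1 ∨ e = Equiv.swap 0 2 := by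
  rcases H.perm with h1 | ⟨h1, -⟩ | ⟨-, h1⟩
  · exact Or.inl h1
  · exact Or.inr h1
  · exact absurd h1 h

lemma k_pos : 0 < k := by
  have := H.lt
  by_contra! h
  rw [Nat.le_zero.1 h] at this
  omega

/-- The monomial form of `f` and of the strict transform at a point of the curve. -/
noncomputable def monomialForm :
    MonomialForm (M.openPart k) M.pullF q (c.expF (e 0)) (c.expF (e 1)) (c.expF (e 2)) where
  U := c.U
  h := fun y j => c.coord y (e j)
  b₁ := c.expG (e 0)
  b₃ := c.expG (e 2)
  k := k
  isOpen := c.isChartOn.isOpen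
  mem := H.mem
  emb := by
    have := (c.isChartOn.permute c.isChartOn.isOpen subset_rfl e).isOpenEmbedding
    rwa [univ_inter] at this
  zero := H.zero
  one := H.one
  a₂_pos := H.exp_pos
  lt := H.lt
  f_eq y hy := by rw [c.pullF_eq_prod hy, prod_eq_perm e]
  mem_iff y hy := by
    have hG : ‖M.pullG y‖ = ‖c.coord y (e 0)‖ ^ c.expG (e 0) * ‖c.coord y (e 2)‖ ^ c.expG (e 2) := by
      rw [c.pullG_eq_prod hy, prod_eq_perm e, H.expG_left, pow_zero, mul_one, norm_mul, norm_pow, norm_pow]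
    rw [M.mem_openPart_iff, ← hG]
    refine and_congr_right fun h => ⟨fun h' => left_ne_zero_of_mul h', fun h' => mul_ne_zero h' ?_⟩
    intro h0
    rw [h0, norm_zero, zero_pow H.k_pos.ne'] at h
    exact h' (by simpa using h)
  f_ne y hy := left_ne_zero_of_mul (M.mem_openPart_iff.1 hy).2

lemma fits_exp : H.monomialForm.Fits Complex.exp := fun t =>
  ⟨by rw [Complex.exp_nat_mul], by rw [Complex.norm_exp, Real.exp_nat_mul]⟩

/-- When the third hyperplane is not in the divisor, both third exponents are zero and the third
coordinate itself may serve as uniformizing coordinate, even where it vanishes. -/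
lemma fits_id (h : e 2 ∉ c.support) : H.monomialForm.Fits id := by
  have h1 : c.expF (e 2) = 0 := by_contra fun h' => h (Or.inl h')
  have h2 : c.expG (e 2) = 0 := by_contra fun h' => h (Or.inr h')
  intro t
  change id t ^ c.expF (e 2) = Complex.exp (c.expF (e 2) * t) ∧
    ‖id t‖ ^ c.expG (e 2) = Real.exp (c.expG (e 2) * t.re)
  rw [h1, h2]
  simp

omit H in
lemma mem_support_of_isMinus (h : c.IsMinus) : e 2 ∈ c.support := by
  have h0 : (0 : Fin 3) ∈ c.support := c.zero_mem_support
  have h1 : (1 : Fin 3) ∈ c.support := c.one_mem_support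
  have h2 : (2 : Fin 3) ∈ c.support := c.two_mem_support.2 (Or.inl h.2)
  generalize e 2 = i
  fin_cases i <;> assumption

lemma model_zero (y : Y) : c.model k y (e 0) = c.coord y (e 0) := by
  by_cases h : c.IsMinus
  · rcases H.isMinus_perm h with rfl | rfl
    · simp [AdaptedChart.model, h]
    · simp [AdaptedChart.model, h, show Equiv.swap (1 : Fin 3) 2 0 = 0 by decide]
  · rcases H.not_isMinus_perm h with rfl | rfl
    · simp [AdaptedChart.model, h]
    · simp [AdaptedChart.model, h]

lemma model_of_isMinus (h : c.IsMinus) (y : Y) (i : Fin 3) (hi : i ≠ 0) : c.model k y (e i) =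
    (c.coord y (e i))⁻¹ * ((‖c.coord y (e i)‖ ^ ((k * c.expG (e 0) : ℝ) /
      (k * c.expG (e 0) - c.expF (e 0))) : ℝ) : ℂ) := by
  rcases H.isMinus_perm h with rfl | rfl
  · fin_cases i
    · exact absurd rfl hi
    · simp [AdaptedChart.model, h, AdaptedChart.expF, AdaptedChart.expG]
    · simp [AdaptedChart.model, h, AdaptedChart.expF, AdaptedChart.expG]
  · have : Equiv.swap (1 : Fin 3) 2 0 = 0 := by decide
    fin_cases i
    · exact absurd rfl hi
    · simp [AdaptedChart.model, h, AdaptedChart.expF, AdaptedChart.expG, this]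
    · simp [AdaptedChart.model, h, AdaptedChart.expF, AdaptedChart.expG, this]

lemma model_two_of_not_isMinus (h : ¬ c.IsMinus) (y : Y) :
    c.model k y (e 2) = c.coord y (e 2) := by
  rcases H.not_isMinus_perm h with rfl | rfl
  · simp [AdaptedChart.model, h]
  · simp [AdaptedChart.model, h]

lemma model_one_of_not_isMinus (h : ¬ c.IsMinus) (y : Y) : c.model k y (e 1) =
    (c.coord y (e 1))⁻¹ * ((‖c.coord y (e 0)‖ ^ ((k * c.expG (e 0) : ℝ) / c.expF (e 1)) *
        ‖c.coord y (e 2)‖ ^ ((k * c.expG (e 2) : ℝ) / c.expF (e 1)) : ℝ) : ℂ) := by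
  have : Equiv.swap (0 : Fin 3) 2 1 = 1 := by decide
  rcases H.not_isMinus_perm h with rfl | rfl
  · simp [AdaptedChart.model, h, AdaptedChart.expF, AdaptedChart.expG]
  · simp [AdaptedChart.model, h, AdaptedChart.expF, AdaptedChart.expG, this, mul_comm]

lemma exp_pos_of_isMinus (h : c.IsMinus) : 0 < c.expF (e 0) := by
  have := c.minus_origin h.1 h.2
  rcases H.isMinus_perm h with rfl | rfl
  · exact this
  · rwa [show Equiv.swap (1 : Fin 3) 2 0 = 0 by decide]

/-- The modulus of `v⁻¹ |u|^(k n₁ / m₂) |w|^(k n₃ / m₂)` is governed by the real equation of the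
sheet, its argument by the imaginary one. Together they make it the exponential of a complex affine
function of `z₁` and `t`, with no distortion of `t`. -/
lemma hasModel_of_not_isMinus (h : ¬ c.IsMinus) {ω : ℂ → ℂ} (hω : H.monomialForm.Fits ω) :
    H.monomialForm.HasModel ω (c.model k) e 1 1 where
  pos := one_pos
  sq := one_mul 1
  eq y _ _ j z₁ z₂ t hs hh := by
    have h0 : c.coord y (e 0) = Complex.exp z₁ := congrFun hh 0
    have h1 : c.coord y (e 1) = Complex.exp z₂ := congrFun hh 1
    have h2 : c.coord y (e 2) = ω t := congrFun hh 2
    have hz : zmap 1 1 t = t := Complex.ext (one_mul _) (one_mul _)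
    have ha₂ : (c.expF (e 1) : ℝ) ≠ 0 := by exact_mod_cast H.exp_pos.ne'
    rw [H.model_zero, H.model_one_of_not_isMinus h, H.model_two_of_not_isMinus h, h0, h1, h2, hz]
    refine ⟨rfl, ?_, rfl⟩
    have hw : ‖ω t‖ ^ ((k * c.expG (e 2) : ℝ) / c.expF (e 1)) =
        Real.exp (c.expG (e 2) * t.re * (k / c.expF (e 1))) := by
      have hw2 : ‖ω t‖ ^ c.expG (e 2) = Real.exp (c.expG (e 2) * t.re) := (hω t).2
      rw [show (k * c.expG (e 2) : ℝ) / c.expF (e 1) = (c.expG (e 2) : ℕ) * (k / c.expF (e 1)) by ring,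
        Real.rpow_natCast_mul (norm_nonneg _), hw2, ← Real.exp_mul]
    rw [hw, Complex.norm_exp, ← Real.exp_mul, ← Real.exp_add, Complex.ofReal_exp, ← Complex.exp_neg,
      ← Complex.exp_add]
    congr 1
    obtain ⟨hs1, hs2⟩ := hs
    change (c.expF (e 1) : ℝ) * z₂.re = (k * c.expG (e 0) - c.expF (e 0)) * z₁.re +
      (k * c.expG (e 2) - c.expF (e 2)) * t.re at hs1
    have ha : (c.expF (e 1) : ℂ) ≠ 0 := by exact_mod_cast H.exp_pos.ne'
    rw [eq_div_iff ha]
    apply Complex.ext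
    · simp
      field_simp
      linear_combination -hs1
    · simp
      linear_combination -hs2

/-- Passing from `w = exp t` to `w⁻¹ |w|^e` multiplies `Re t` by `e - 1`, which is the stated
quotient, and changes the sign of `Im t`. The value `κ = -1` is the reason for the reversed
orientation at the points of type `⊖`. -/
lemma hasModel_of_isMinus (h : c.IsMinus) : H.monomialForm.HasModel Complex.exp (c.model k) e
    (c.expF (e 0) / (k * c.expG (e 0) - c.expF (e 0))) (-1) := by
  have hc : (0 : ℝ) < k * c.expG (e 0) - c.expF (e 0) := by
    rw [sub_pos]; exact_mod_cast H.lt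
  have ha₁ : (0 : ℝ) < c.expF (e 0) := by exact_mod_cast H.exp_pos_of_isMinus h
  refine ⟨div_pos ha₁ hc, by norm_num, fun y _ _ j z₁ z₂ t hs hh => ?_⟩
  have h0 : c.coord y (e 0) = Complex.exp z₁ := congrFun hh 0
  have h1 : c.coord y (e 1) = Complex.exp z₂ := congrFun hh 1
  have h2 : c.coord y (e 2) = Complex.exp t := congrFun hh 2
  have hb : (c.expG (e 2) : ℝ) = 0 := by
    rcases H.isMinus_perm h with rfl | rfl
    · simpa [AdaptedChart.expG] using h.1
    · simp [AdaptedChart.expG]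
  obtain ⟨hs1, hs2⟩ := hs
  change (c.expF (e 1) : ℝ) * z₂.re = (k * c.expG (e 0) - c.expF (e 0)) * z₁.re +
    (k * c.expG (e 2) - c.expF (e 2)) * t.re at hs1
  rw [hb, mul_zero, zero_sub] at hs1
  rw [H.model_zero, H.model_of_isMinus h _ _ one_ne_zero, H.model_of_isMinus h _ 2 (by decide),
    h0, h1, h2]
  set A : ℝ := k * c.expG (e 0) - c.expF (e 0)
  have hE : (k * c.expG (e 0) : ℝ) = A + c.expF (e 0) := by ring
  have ha : (c.expF (e 1) : ℂ) ≠ 0 := by exact_mod_cast H.exp_pos.ne'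
  rw [hE]
  refine ⟨rfl, ?_, ?_⟩
  · rw [Complex.norm_exp, ← Real.exp_mul, Complex.ofReal_exp, ← Complex.exp_neg, ← Complex.exp_add]
    congr 1
    rw [eq_div_iff ha]
    apply Complex.ext
    · simp [zmap]
      field_simp
      linear_combination (c.expF (e 0) : ℝ) * hs1
    · simp [zmap]
      linear_combination -hs2
  · rw [Complex.norm_exp, ← Real.exp_mul, Complex.ofReal_exp, ← Complex.exp_neg, ← Complex.exp_add]
    congr 1
    apply Complex.ext
    · simp [zmap]
      field_simp
      ring
    · simp [zmap]

end IsLocalForm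

end MilnorBoundary


/-! ### Charts of the curve of branches at generic points -/

namespace MilnorBoundary

open BranchPoint

lemma IsUniformizer.deriv_ne_zero {ω : ℂ → ℂ} {lg : ℂ → ℂ → ℂ} (hω : IsUniformizer ω lg) (t : ℂ) :
    deriv ω t ≠ 0 := by
  have h1 : HasDerivAt (lg t ∘ ω) (deriv (lg t) (ω t) * deriv ω t) t :=
    (hω.lg_analyticAt t).differentiableAt.hasDerivAt.comp t
      (hω.analyticAt t).differentiableAt.hasDerivAt
  have h2 : HasDerivAt (lg t ∘ ω) 1 t := by
    refine (hasDerivAt_id t).congr_of_eventuallyEq ?_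
    filter_upwards [Metric.ball_mem_nhds t one_pos] with z hz
    exact hω.lg_apply t z (by rwa [← dist_eq_norm])
  intro h
  have := h1.unique h2
  simp [h] at this

namespace MonomialForm

variable {Y : Type*} [TopologicalSpace Y] {S : Set Y} {f : Y → ℂ} {q : Y} {a₁ a₂ a₃ : ℕ}
  (L : MonomialForm S f q a₁ a₂ a₃)

lemma continuousOn_h : ContinuousOn L.h L.U :=
  continuousOn_iff_continuous_domRestrict.2 L.emb.continuous

lemma eq_of_mem_closure {Z : Type*} [TopologicalSpace Z] [T2Space Z] {F G : (Fin 3 → ℂ) → Z}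
    (hF : Continuous F) (hG : Continuous G) (h : ∀ y ∈ L.U, y ∈ S → F (L.h y) = G (L.h y)) {y : Y}
    (hy : y ∈ L.U) (hyS : y ∈ closure S) : F (L.h y) = G (L.h y) := by
  rw [mem_closure_iff_nhdsWithin_neBot] at hyS
  have hc := (L.continuousOn_h.continuousAt (L.isOpen.mem_nhds hy)).mono_left
    (nhdsWithin_le_nhds (s := S))
  refine tendsto_nhds_unique_of_eventuallyEq ((hF.tendsto _).comp hc) ((hG.tendsto _).comp hc) ?_
  filter_upwards [self_mem_nhdsWithin, mem_nhdsWithin_of_mem_nhds (L.isOpen.mem_nhds hy)] with y' h1 h2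
  exact h y' h2 h1

lemma k_ne_zero : L.k ≠ 0 := by
  rintro h
  have := L.lt
  simp [h] at this

lemma b₁_ne_zero : L.b₁ ≠ 0 := by
  rintro h
  have := L.lt
  simp [h] at this

lemma h_zero_ne {y : Y} (hy : y ∈ L.U) (hyS : y ∈ S) : L.h y 0 ≠ 0 := by
  intro h
  obtain ⟨h1, h2⟩ := (L.mem_iff y hy).1 hyS
  rw [h, norm_zero, zero_pow L.b₁_ne_zero, zero_mul, zero_pow L.k_ne_zero] at h1
  exact h2 (by simpa using h1)

lemma h_one_ne {y : Y} (hy : y ∈ L.U) (hyS : y ∈ S) : L.h y 1 ≠ 0 := by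
  intro h
  have h1 := L.f_ne y hyS
  rw [L.f_eq y hy, h, zero_pow L.a₂_pos.ne', mul_zero, zero_mul] at h1
  exact h1 rfl

lemma h_two_ne (h3 : a₃ ≠ 0 ∨ L.b₃ ≠ 0) {y : Y} (hy : y ∈ L.U) (hyS : y ∈ S) : L.h y 2 ≠ 0 := by
  intro h
  rcases h3 with h3 | h3
  · have h1 := L.f_ne y hyS
    rw [L.f_eq y hy, h, zero_pow h3, mul_zero] at h1
    exact h1 rfl
  · obtain ⟨h1, h2⟩ := (L.mem_iff y hy).1 hyS
    rw [h, norm_zero, zero_pow h3, mul_zero, zero_pow L.k_ne_zero] at h1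
    exact h2 (by simpa using h1)

/-- The points of the closure of `S`. -/
lemma mem_or_eq_zero {y : Y} (hy : y ∈ L.U) (hyS : y ∈ closure S) (h3 : L.h y 2 ^ a₃ ≠ 0)
    (h4 : ‖L.h y 2‖ ^ L.b₃ ≠ 0) : y ∈ S ∨ L.h y 0 = 0 ∧ L.h y 1 = 0 := by
  by_cases hf : f y = 0
  · right
    have hγ := L.eq_of_mem_closure (F := fun x => x 0 ^ a₁ * x 1 ^ a₂ * x 2 ^ a₃)
      (G := fun x => (((‖x 0‖ ^ L.b₁ * ‖x 2‖ ^ L.b₃) ^ L.k : ℝ) : ℂ)) (by fun_prop) (by fun_prop)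
      (fun y hy hyS => by rw [← L.f_eq y hy, ((L.mem_iff y hy).1 hyS).1]) hy hyS
    -- On `S` the norm equation may be divided by `|u|^a₁`. The quotient equation passes to the
    -- closure and, as `a₁ < k b₁`, shows that `v` vanishes wherever `u` does, as long as `w`
    -- contributes no zero.
    have hn := L.eq_of_mem_closure (F := fun x => ‖x 1‖ ^ a₂ * ‖x 2‖ ^ a₃)
      (G := fun x => ‖x 0‖ ^ (L.k * L.b₁ - a₁) * ‖x 2‖ ^ (L.b₃ * L.k)) (by fun_prop) (by fun_prop)
      (fun y hy hyS => by
        have h1 := congrArg norm ((L.mem_iff y hy).1 hyS).1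
        rw [L.f_eq y hy, norm_mul, norm_mul, norm_pow, norm_pow, norm_pow, Complex.norm_real,
          Real.norm_of_nonneg (by positivity), mul_pow, ← pow_mul, ← pow_mul, mul_assoc,
          mul_comm L.b₁, ← Nat.add_sub_of_le L.lt.le, pow_add, mul_assoc] at h1
        exact mul_left_cancel₀ (pow_ne_zero _ (norm_ne_zero_iff.2 (L.h_zero_ne hy hyS))) h1) hy hyS
    rw [← L.f_eq y hy, hf] at hγ
    have h0 : L.h y 0 = 0 := by
      by_contra h
      have := pow_ne_zero L.k (mul_ne_zero (pow_ne_zero L.b₁ (norm_ne_zero_iff.2 h)) h4)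
      exact this (by exact_mod_cast hγ.symm)
    refine ⟨h0, ?_⟩
    rw [h0, norm_zero, zero_pow (Nat.sub_pos_of_lt L.lt).ne', zero_mul] at hn
    rcases mul_eq_zero.1 hn with h | h
    · exact norm_eq_zero.1 (pow_eq_zero_iff'.1 h).1
    · rw [← norm_pow, norm_eq_zero] at h
      exact absurd h h3
  · left
    refine (L.mem_iff y hy).2 ⟨?_, hf⟩
    rw [L.f_eq y hy]
    exact L.eq_of_mem_closure (F := fun x => x 0 ^ a₁ * x 1 ^ a₂ * x 2 ^ a₃)
      (G := fun x => (((‖x 0‖ ^ L.b₁ * ‖x 2‖ ^ L.b₃) ^ L.k : ℝ) : ℂ)) (by fun_prop) (by fun_prop)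
      (fun y hy hyS => by rw [← L.f_eq y hy, ((L.mem_iff y hy).1 hyS).1]) hy hyS

variable {L} {ω : ℂ → ℂ} {lg : ℂ → ℂ → ℂ} {μ : Y → Fin 3 → ℂ} {e : Equiv.Perm (Fin 3)} {α κ : ℝ}
  {j : ℤ} {C : Set Y}

lemma OnSheet.of_hasLabel (hω : IsUniformizer ω lg) (hL : L.Fits ω) {t₁ t : ℂ} (ht : ‖t - t₁‖ < 1 / 2)
    {s : BranchPoint S} (hU : s.pt ∈ L.U) (hh : L.h s.pt = ![0, 0, ω t])
    (hs : s.HasLabel (fun y => phase (a₁.gcd a₂) (L.root lg t₁ y)) (j : ZMod (a₁.gcd a₂))) :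
    L.OnSheet ω lg t j s := by
  obtain ⟨j', hj'⟩ := L.exists_onSheet_of_pt hω hL hU hh
  have := OnSheet.change L hω hL ht hj'
  refine ⟨hU, hh, ?_⟩
  rw [hs.unique this]
  exact hj'.2.2

/-- Charts of the curve of branches at a generic point. -/
theorem exists_chart_generic (hω : IsUniformizer ω lg) (hL : L.Fits ω)
    (hμ : L.HasModel ω μ e α κ) (hS : ∀ y ∈ S, ∀ᶠ y' in 𝓝 y, y' ∈ closure S → y' ∈ S)
    (hμc : ∀ y ∈ S, y ∈ L.U → ContinuousWithinAt μ S y) {t₁ : ℂ} {s₀ : BranchPoint S}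
    (hU : s₀.pt ∈ L.U) (hs : L.h s₀.pt = ![0, 0, ω t₁])
    (hC : ∀ᶠ y in 𝓝 s₀.pt, y ∈ C ↔ L.h y 0 = 0 ∧ L.h y 1 = 0) :
    ∃ (V : Set (BranchPoint S)) (φ : BranchPoint S → ℂ), s₀ ∈ V ∧
      IsChartOn (HolModel S L.U μ) {s | s.pt ∈ C} V (fun s (_ : Fin 1) => φ s) ∧
      ∀ s ∈ V, s.pt ∈ C → ∃ t, L.h s.pt 2 = ω t ∧ φ s = ω (zmap α κ t) := by
  obtain ⟨j, hs₀⟩ := L.exists_onSheet_of_pt hω hL hU hs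
  obtain ⟨δ₀, hδ₀, hδ₀'⟩ := Metric.continuousAt_iff.1
    ((continuous_zmap α κ).continuousAt (x := t₁)) 1 one_pos
  set B : Set ℂ := Metric.ball t₁ (min δ₀ (1 / 2))
  have hB : IsOpen B := Metric.isOpen_ball
  have ht₁B : t₁ ∈ B := Metric.mem_ball_self (lt_min hδ₀ one_half_pos)
  have hnear : {y | y ∈ C ↔ L.h y 0 = 0 ∧ L.h y 1 = 0} ∩ {y | L.h y 2 ∈ ω '' B} ∈ 𝓝 s₀.pt := by
    refine inter_mem hC ?_
    refine ((L.continuousOn 2).continuousAt (L.isOpen.mem_nhds hU)) ?_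
    refine (hω.isOpenMap _ hB).mem_nhds ?_
    show L.h s₀.pt 2 ∈ ω '' B
    rw [hs]
    exact mem_image_of_mem _ ht₁B
  obtain ⟨N, hNV, ρ, δ, -, -, hN⟩ := L.exists_isSheetNhd_recenter hω hL hU hs hnear one_pos
  have hNU : N ⊆ L.U := hN.sub
  set V := labelSet S N (fun y => phase (a₁.gcd a₂) (L.root lg t₁ y)) (j : ZMod (a₁.gcd a₂))
  have hV : IsOpen V := hN.good.isOpen_labelSet _
  have hsheet : ∀ s ∈ V, L.h s.pt 0 = 0 → L.h s.pt 1 = 0 → ∃ t ∈ B, L.OnSheet ω lg t j s := by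
    intro s hs h0 h1
    obtain ⟨t, ht, htw⟩ := (hNV hs.1).2
    have htB : dist t t₁ < min δ₀ (1 / 2) := ht
    refine ⟨t, ht, OnSheet.of_hasLabel hω hL (by
      rw [← dist_eq_norm]; exact lt_of_lt_of_le htB (min_le_right _ _)) (hNU hs.1) ?_ hs.2⟩
    ext i
    fin_cases i
    · exact h0
    · exact h1
    · exact htw.symm
  have hτS : ∀ y ∈ S, y ∈ L.U → ContinuousWithinAt (fun y => μ y (e 2)) S y := fun y hy hyU =>
    (continuousWithinAt_pi.1 (hμc y hy hyU)) _
  have hval : ∀ t, ∀ s, L.OnSheet ω lg t j s →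
      Tendsto (fun y => μ y (e 2)) s.filter (𝓝 (ω (zmap α κ t))) := fun t s hs =>
    OnSheet.tendsto L hω hL hs _ (fun t => ω (zmap α κ t))
      ((hω.analyticAt _).continuousAt.comp (continuous_zmap α κ).continuousAt)
      fun y hyU hyS z₁ z₂ t hsh hh => (hμ.eq y hyU hyS j z₁ z₂ t hsh hh).2.2
  -- The chart is defined by the limit of the third model coordinate along a branch. The branches
  -- near `s₀` are centered either at points of `S`, where this coordinate is continuous, or at
  -- points of the curve, where the sheet gives the limit.
  have hlim : ∀ s ∈ V, ∃ l, Tendsto (fun y => μ y (e 2)) s.filter (𝓝 l) := by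
    intro s hs
    obtain ⟨t, -, htw⟩ := (hNV hs.1).2
    rcases L.mem_or_eq_zero (hNU hs.1) s.pt_mem_closure (by
      rw [← htw, (hL t).1]; exact Complex.exp_ne_zero _) (by
      rw [← htw, (hL t).2]; exact Real.exp_ne_zero _) with h | h
    · exact ⟨_, (hτS _ h (hNU hs.1)).mono_left s.filter_le⟩
    · obtain ⟨t, -, ht⟩ := hsheet s hs h.1 h.2
      exact ⟨_, hval t s ht⟩
  choose! φ hφ using hlim
  have hφval : ∀ t, ∀ s ∈ V, L.OnSheet ω lg t j s → φ s = ω (zmap α κ t) := fun t s hsV hs =>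
    tendsto_nhds_unique (hφ s hsV) (hval t s hs)
  have hcurve : ∀ s ∈ V, s.pt ∈ C → ∃ t ∈ B, L.OnSheet ω lg t j s := fun s hs hsC =>
    hsheet s hs ((hNV hs.1).1.1 hsC).1 ((hNV hs.1).1.1 hsC).2
  have H : L.IsSheetChart ω lg μ α κ j {s | s.pt ∈ C} V φ ω := by
    refine ⟨hV, fun s hs => ?_, ?_, hω.analyticAt, hω.deriv_ne_zero, ?_, hφval, ?_⟩
    · refine holModel_of_tendsto hV (fun s hs => hNU hs.1) hS (fun y hy hyU => ⟨hτS y hy hyU,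
        fun x => x (e 2), ?_, EventuallyEq.rfl⟩) hφ hs
      exact (ContinuousLinearMap.proj (R := ℂ) (φ := fun _ : Fin 3 => ℂ) (e 2)).analyticAt _
    · rintro s ⟨hsC, hsV⟩ s' ⟨hsC', hsV'⟩ h
      obtain ⟨t, ht, hst⟩ := hcurve s hsV hsC
      obtain ⟨t', ht', hst'⟩ := hcurve s' hsV' hsC'
      rw [hφval t s hsV hst, hφval t' s' hsV' hst'] at h
      have hz : ∀ t ∈ B, ‖zmap α κ t - zmap α κ t₁‖ < 1 := fun t ht => by
        rw [← dist_eq_norm]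
        exact hδ₀' (lt_of_lt_of_le ht (min_le_left _ _))
      have h2 := congrArg (lg (zmap α κ t₁)) h
      rw [hω.lg_apply _ _ (hz t ht), hω.lg_apply _ _ (hz t' ht')] at h2
      have h3 : t = t' := by rw [← hμ.inv_left t, h2, hμ.inv_left]
      subst h3
      exact OnSheet.unique L hω hL hst hst'
    · intro t s hsV hst
      refine (hNV hsV.1).1.2 ?_
      rw [hst.2.1]
      exact ⟨rfl, rfl⟩
    · rintro s ⟨hsC, hsV⟩
      obtain ⟨t, -, ht⟩ := hcurve s hsV hsC
      exact Or.inl ⟨t, ht⟩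
  refine ⟨V, φ, ⟨hN.good.mem, hs₀.2.2⟩, H.isChartOn hω hL hμ, fun s hsV hsC => ?_⟩
  obtain ⟨t, -, ht⟩ := hcurve s hsV hsC
  refine ⟨t, ?_, hφval t s hsV ht⟩
  rw [ht.2.1]
  rfl

end MonomialForm

end MilnorBoundary


/-! ### Charts of the curve of branches at double points -/

namespace MilnorBoundary

open BranchPoint

/-- The branches of the logarithm. -/
noncomputable def logAt (t₁ w : ℂ) : ℂ := Complex.log (w / Complex.exp t₁) + t₁

lemma isUniformizer_logAt : IsUniformizer Complex.exp logAt := isUniformizer_exp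

namespace MonomialForm

variable {Y : Type*} [TopologicalSpace Y] {S : Set Y} {f : Y → ℂ} {q : Y} {a₁ a₂ a₃ : ℕ}
  (L : MonomialForm S f q a₁ a₂ a₃)

-- The integers `ℓ` and `c` are the quotients of `gcd(a₁, a₂)` and `a₃` by their gcd, which are
-- coprime. Here `ℓ` is the number of generic branches merging into one branch at the double point,
-- and the Bézout coefficients are the exponents of a local coordinate.
include L in
lemma exists_bezout : ∃ l s : ℤ, ∃ ℓ c : ℕ, 0 < ℓ ∧ s * c + l * ℓ = 1 ∧
    c * a₁.gcd a₂ = a₃ * ℓ := by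
  set g := a₁.gcd a₂
  have hg : 0 < g := L.gcd_pos
  have hd : 0 < g.gcd a₃ := Nat.gcd_pos_of_pos_left _ hg
  have hcop : (g / g.gcd a₃).Coprime (a₃ / g.gcd a₃) := Nat.coprime_div_gcd_div_gcd hd
  have hb := Nat.gcd_eq_gcd_ab (g / g.gcd a₃) (a₃ / g.gcd a₃)
  rw [Nat.Coprime.gcd_eq_one hcop] at hb
  refine ⟨Nat.gcdA (g / g.gcd a₃) (a₃ / g.gcd a₃), Nat.gcdB (g / g.gcd a₃) (a₃ / g.gcd a₃), g / g.gcd a₃, a₃ / g.gcd a₃, Nat.div_pos (Nat.gcd_le_left _ hg) hd, ?_, ?_⟩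
  swap
  · calc a₃ / g.gcd a₃ * g = a₃ / g.gcd a₃ * (g.gcd a₃ * (g / g.gcd a₃)) := by
          rw [Nat.mul_div_cancel' (Nat.gcd_dvd_left _ _)]
      _ = a₃ / g.gcd a₃ * g.gcd a₃ * (g / g.gcd a₃) := by ring
      _ = _ := by rw [Nat.div_mul_cancel (Nat.gcd_dvd_right _ _)]
  · rw [Nat.cast_one] at hb
    linear_combination -hb

-- Turning `n` times around the double point changes `t` by `2πin`, so the imaginary equation of the
-- sheet changes its index by `a₃ n`.
variable {L} in
lemma OnSheet.translate (hL : L.Fits Complex.exp) {t₁ : ℂ} {j : ℤ} {s : BranchPoint S}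
    (hs : L.OnSheet Complex.exp logAt t₁ j s) (n : ℤ) :
    L.OnSheet Complex.exp logAt (t₁ + n * (2 * Real.pi * Complex.I)) (j + a₃ * n) s := by
  refine ⟨hs.1, ?_, ?_⟩
  · rw [hs.2.1, Complex.exp_add, Complex.exp_int_mul_two_pi_mul_I, mul_one]
  · filter_upwards [OnSheet.eventually L isUniformizer_logAt hL hs one_pos] with
      y ⟨_, _, z₁, z₂, t, ht, ⟨h1, h2⟩, hh⟩
    refine L.phase_root isUniformizer_logAt (z₁ := z₁) (z₂ := z₂)
      (t := t + n * (2 * Real.pi * Complex.I)) ⟨?_, ?_⟩ (by simpa using ht) ?_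
    · simpa using h1
    · push_cast
      simp
      linear_combination h2
    · rw [hh, Complex.exp_add, Complex.exp_int_mul_two_pi_mul_I, mul_one]

/-- Logarithms of the same point differ by multiples of `2πi`. Those of the first two coordinates
change the index by multiples of `gcd(a₁, a₂)`, so only the winding of the third one remains
visible. -/
lemma InSheet.congr {j j' : ℤ} {z₁ z₂ t z₁' z₂' t' : ℂ} (hs : L.InSheet j z₁ z₂ t)
    (hs' : L.InSheet j' z₁' z₂' t') (h1 : Complex.exp z₁ = Complex.exp z₁')
    (h2 : Complex.exp z₂ = Complex.exp z₂') {n : ℤ} (h3 : t = t' + n * (2 * Real.pi * Complex.I)) :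
    (j : ZMod (a₁.gcd a₂)) = ((j' + a₃ * n : ℤ) : ZMod (a₁.gcd a₂)) := by
  obtain ⟨n₁, rfl⟩ := Complex.exp_eq_exp_iff_exists_int.1 h1
  obtain ⟨n₂, rfl⟩ := Complex.exp_eq_exp_iff_exists_int.1 h2
  subst h3
  have e1 := hs.2
  have e2 := hs'.2
  simp at e1
  have h : (j : ℝ) = j' + a₃ * n + (a₁ * n₁ + a₂ * n₂) := by
    have hpi : (2 * Real.pi : ℝ) ≠ 0 := by positivity
    refine mul_left_cancel₀ hpi ?_
    linear_combination e2 - e1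
  have h' : j = j' + a₃ * n + (a₁ * n₁ + a₂ * n₂) := by exact_mod_cast h
  rw [h']
  push_cast
  have ha₁ : (a₁ : ZMod (a₁.gcd a₂)) = 0 := (ZMod.natCast_eq_zero_iff _ _).2 (Nat.gcd_dvd_left _ _)
  have ha₂ : (a₂ : ZMod (a₁.gcd a₂)) = 0 := (ZMod.natCast_eq_zero_iff _ _).2 (Nat.gcd_dvd_right _ _)
  rw [ha₁, ha₂]
  ring

variable {L} {μ : Y → Fin 3 → ℂ} {e : Equiv.Perm (Fin 3)} {α κ : ℝ} {j : ℤ} {C : Set Y}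

/-- A function of the coordinates which is an `ℓ`-th root of the third one along the branches of
index `j`. -/
lemma HasModel.exists_monomial (hμ : L.HasModel Complex.exp μ e α κ) {s l : ℤ} {ℓ c : ℕ}
    (hℓ : 0 < ℓ) (hs : s * c + l * ℓ = 1) (hc : c * a₁.gcd a₂ = a₃ * ℓ) (j : ℤ) :
    ∃ (n : Fin 3 → ℤ) (K : ℂ), ‖K‖ = 1 ∧ ∀ y ∈ L.U, y ∈ S → ∀ z₁ z₂ t, L.InSheet j z₁ z₂ t →
      L.h y = ![Complex.exp z₁, Complex.exp z₂, Complex.exp t] →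
      ∏ i, μ y i ^ n i = K * Complex.exp (zmap α κ t / ℓ) := by
  obtain ⟨σ, hσ⟩ : ∃ σ : ℤ, (σ : ℝ) = κ * s := by
    rcases mul_self_eq_one_iff.1 hμ.sq with h | h
    · exact ⟨s, by rw [h, one_mul]⟩
    · exact ⟨-s, by rw [h]; push_cast; ring⟩
  have hg : ((a₁.gcd a₂ : ℕ) : ℂ) ≠ 0 := by exact_mod_cast L.gcd_pos.ne'
  have hℓ' : (ℓ : ℂ) ≠ 0 := by exact_mod_cast hℓ.ne'
  have ha₂ : (a₂ : ℂ) ≠ 0 := by exact_mod_cast L.a₂_pos.ne'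
  -- With `g = gcd(a₁, a₂)` and `Z = zmap α κ t`, the monomial `x^(-a₁/g) y^(a₂/g)` is a constant
  -- times `exp(κ a₃ Z / g)`, and `a₃ / g = c / ℓ`. Its power `σ = κ s` times `z^l` is a constant
  -- times `exp((s c + l ℓ) Z / ℓ)`, that is `exp(Z / ℓ)`. The constant `K` comes from the index
  -- `j`.
  refine ⟨fun i => ![-(σ * (a₁ / a₁.gcd a₂ : ℕ)), σ * (a₂ / a₁.gcd a₂ : ℕ), l] (e.symm i),
    Complex.exp ((-(σ * (2 * Real.pi * j) / (a₁.gcd a₂ : ℕ)) : ℝ) * Complex.I),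
    Complex.norm_exp_ofReal_mul_I _, fun y hyU hyS z₁ z₂ t hsh hh => ?_⟩
  obtain ⟨h0, h1, h2⟩ := hμ.eq y hyU hyS j z₁ z₂ t hsh hh
  rw [prod_eq_perm e]
  simp only [Equiv.symm_apply_apply, Matrix.cons_val]
  rw [h0, h1, h2, ← Complex.exp_int_mul, ← Complex.exp_int_mul, ← Complex.exp_int_mul,
    ← Complex.exp_add, ← Complex.exp_add, ← Complex.exp_add]
  congr 1
  rw [Int.cast_neg, Int.cast_mul, Int.cast_mul, Int.cast_natCast, Int.cast_natCast,
    Nat.cast_div (Nat.gcd_dvd_left _ _) hg, Nat.cast_div (Nat.gcd_dvd_right _ _) hg]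
  push_cast
  have hσ' : (σ * κ : ℂ) = s := by
    have : (σ * κ : ℝ) = s := by rw [hσ, mul_right_comm, hμ.sq, one_mul]
    exact_mod_cast this
  have hs' : (s * c + l * ℓ : ℂ) = 1 := by exact_mod_cast hs
  have hc' : (c * (a₁.gcd a₂ : ℕ) : ℂ) = a₃ * ℓ := by exact_mod_cast hc
  set g : ℂ := ((a₁.gcd a₂ : ℕ) : ℂ)
  set Z := zmap α κ t
  field_simp
  linear_combination (a₃ * Z * ℓ) * hσ' + (g * Z) * hs' - s * Z * hc'

/-- Charts of the curve of branches at a double point. -/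
theorem exists_chart_double (hL : L.Fits Complex.exp)
    (hμ : L.HasModel Complex.exp μ e α κ) (hS : ∀ y ∈ S, ∀ᶠ y' in 𝓝 y, y' ∈ closure S → y' ∈ S)
    (hμc : ∀ y ∈ S, y ∈ L.U → ContinuousWithinAt μ S y)
    (hμ0 : ∀ y ∈ S, y ∈ L.U → ∀ i, μ y i ≠ 0) (h2 : L.h q 2 = 0) (h3 : a₃ ≠ 0 ∨ L.b₃ ≠ 0)
    {s₀ : BranchPoint S} (hs₀ : s₀.pt = q) (hC : ∀ᶠ y in 𝓝 q, y ∈ C ↔ L.h y 0 = 0 ∧ L.h y 1 = 0) :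
    ∃ (V : Set (BranchPoint S)) (φ : BranchPoint S → ℂ), s₀ ∈ V ∧
      IsChartOn (HolModel S L.U μ) {s | s.pt ∈ C} V (fun s (_ : Fin 1) => φ s) := by
  have hω := isUniformizer_logAt
  have hroot := L.isRootAt_double h2 h3
  obtain ⟨i, hi⟩ := hroot.isLabel.exists_hasLabel s₀ hs₀
  obtain ⟨j, rfl⟩ := ZMod.intCast_surjective i
  obtain ⟨l, s, ℓ, c', hℓ, hb, hc⟩ := L.exists_bezout
  obtain ⟨n, K, hK, hτ⟩ := hμ.exists_monomial hℓ hb hc j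
  have hK0 : K ≠ 0 := by rw [← norm_ne_zero_iff, hK]; exact one_ne_zero
  have hℓ' : (ℓ : ℂ) ≠ 0 := by exact_mod_cast hℓ.ne'
  have hℓr : (0 : ℝ) < ℓ := by exact_mod_cast hℓ
  set τ : Y → ℂ := fun y => ∏ i, μ y i ^ n i
  set θ : ℂ → ℂ := fun ζ => K * Complex.exp (ζ / ℓ)
  have hθd : ∀ ζ, HasDerivAt θ (K * (Complex.exp (ζ / ℓ) * (1 / ℓ))) ζ := fun ζ =>
    (((hasDerivAt_id ζ).div_const _).cexp).const_mul K
  obtain ⟨r, hr, hNC, hpoly, hN⟩ := L.exists_isSheetNhd_double h2 h3 hC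
  set N := {y ∈ L.U | ‖L.h y 0‖ < r ∧ ‖L.h y 1‖ < r ∧ ‖L.h y 2‖ < r}
  set V := labelSet S N (fun y => phase ((a₁.gcd a₂).gcd a₃) (L.doubleRoot y))
    (j : ZMod ((a₁.gcd a₂).gcd a₃))
  have hV : IsOpen V := hN.good.isOpen_labelSet _
  have hVC : ∀ s ∈ V, (s.pt ∈ C ↔ L.h s.pt 0 = 0 ∧ L.h s.pt 1 = 0) := fun s hs =>
    hNC s.pt hs.1.1 hs.1.2.1 hs.1.2.2.1 hs.1.2.2.2
  have hlog : ∀ s ∈ V, ∀ᶠ y in s.filter, y ∈ S ∧ y ∈ L.U ∧ ∃ z₁ z₂ t, L.InSheet j z₁ z₂ t ∧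
      L.h y = ![Complex.exp z₁, Complex.exp z₂, Complex.exp t] := by
    intro s hs
    filter_upwards [s.br_mem_filter hN.good.isOpen hs.1] with y hy
    rw [hN.good.br_eq hs.1 hs.2] at hy
    obtain ⟨z₁, z₂, t, -, -, -, hsh, hh⟩ := hN.exists_log y hy.1 j hy.2
    exact ⟨hy.1.2, hy.1.1.1, z₁, z₂, t, hsh, hh⟩
  have hcoord : ∀ s ∈ V, Tendsto (fun y => L.h y 2) s.filter (𝓝 (L.h s.pt 2)) := fun s hs =>
    ((L.continuousOn 2).continuousAt (L.isOpen.mem_nhds hs.1.1)).mono_left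
      (s.filter_le.trans nhdsWithin_le_nhds)
  have hsheet : ∀ s ∈ V, L.h s.pt 0 = 0 → L.h s.pt 1 = 0 → L.h s.pt 2 ≠ 0 →
      ∃ t, L.OnSheet Complex.exp logAt t j s := by
    intro s hs h0 h1 hw
    obtain ⟨j', hj'⟩ := L.exists_onSheet_of_pt hω hL hs.1.1 (t₁ := Complex.log (L.h s.pt 2)) (by
      rw [Complex.exp_log hw]
      ext i; fin_cases i
      · exact h0
      · exact h1
      · rfl)
    obtain ⟨y, ⟨-, -, z₁, z₂, t, hsh, hh⟩, -, -, z₁', z₂', t', -, hsh', hh'⟩ :=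
      ((hlog s hs).and (OnSheet.eventually L hω hL hj' one_pos)).exists
    rw [hh] at hh'
    -- The logarithm of `w` was chosen arbitrarily, so the index found there need not be `j`. A
    -- point of the branch written in both ways tells by how many turns `t` has to be translated.
    obtain ⟨n, hn⟩ := Complex.exp_eq_exp_iff_exists_int.1 (congrFun hh' 2)
    have := hj'.translate hL n
    refine ⟨_, this.1, this.2.1, ?_⟩
    rw [InSheet.congr L hsh hsh' (congrFun hh' 0) (congrFun hh' 1) hn]
    exact this.2.2
  have hmono : ∀ t, ∀ s, L.OnSheet Complex.exp logAt t j s →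
      Tendsto τ s.filter (𝓝 (θ (zmap α κ t))) := fun t s hs =>
    OnSheet.tendsto L hω hL hs τ (fun t => θ (zmap α κ t))
      ((hθd _).continuousAt.comp (continuous_zmap α κ).continuousAt)
      fun y hyU hyS z₁ z₂ t hsh hh => hτ y hyU hyS z₁ z₂ t hsh hh
  -- Since `|K| = 1`, the modulus of the monomial on the sheet is `|w|^(α / ℓ)`, which tends to zero
  -- with `w`.
  have hzero : ∀ s ∈ V, L.h s.pt 2 = 0 → Tendsto τ s.filter (𝓝 0) := by
    intro s hs hw
    rw [tendsto_zero_iff_norm_tendsto_zero]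
    have h1 : Tendsto (fun y => ‖L.h y 2‖ ^ (α / ℓ)) s.filter (𝓝 0) := by
      have h1 := (hcoord s hs).norm
      rw [hw, norm_zero] at h1
      have h2 := (Real.continuousAt_rpow_const 0 (α / ℓ)
        (Or.inr (div_pos hμ.pos hℓr).le)).tendsto.comp h1
      rwa [Real.zero_rpow (div_pos hμ.pos hℓr).ne'] at h2
    refine h1.congr' ?_
    filter_upwards [hlog s hs] with y ⟨hyS, hyU, z₁, z₂, t, hsh, hh⟩
    show _ = ‖∏ i, μ y i ^ n i‖
    rw [hτ y hyU hyS z₁ z₂ t hsh hh, hh, norm_mul, hK, one_mul, Complex.norm_exp]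
    simp only [Matrix.cons_val]
    rw [Complex.norm_exp, ← Real.exp_mul, Complex.div_natCast_re]
    congr 1
    show _ = α * t.re / ℓ
    ring
  have hτS : ∀ y ∈ S, y ∈ L.U → ContinuousWithinAt τ S y ∧
      ∃ G : (Fin 3 → ℂ) → ℂ, AnalyticAt ℂ G (μ y) ∧ τ =ᶠ[𝓝[S] y] fun y' => G (μ y') := by
    intro y hyS hyU
    have hG : AnalyticAt ℂ (fun x : Fin 3 → ℂ => ∏ i, x i ^ n i) (μ y) := by
      refine Finset.analyticAt_fun_prod _ fun i _ => AnalyticAt.fun_zpow ?_ (hμ0 y hyS hyU i)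
      exact (ContinuousLinearMap.proj (R := ℂ) (φ := fun _ : Fin 3 => ℂ) i).analyticAt _
    exact ⟨hG.continuousAt.comp_continuousWithinAt (hμc y hyS hyU), _, hG, EventuallyEq.rfl⟩
  have hlim : ∀ s ∈ V, ∃ l, Tendsto τ s.filter (𝓝 l) := by
    intro s hs
    by_cases hw : L.h s.pt 2 = 0
    · exact ⟨0, hzero s hs hw⟩
    rcases L.mem_or_eq_zero hs.1.1 s.pt_mem_closure (pow_ne_zero _ hw)
      (pow_ne_zero _ (norm_ne_zero_iff.2 hw)) with h | h
    · exact ⟨_, (hτS _ h hs.1.1).1.mono_left s.filter_le⟩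
    · obtain ⟨t, ht⟩ := hsheet s hs h.1 h.2 hw
      exact ⟨_, hmono t s ht⟩
  choose! φ hφ using hlim
  have hφval : ∀ t, ∀ s ∈ V, L.OnSheet Complex.exp logAt t j s → φ s = θ (zmap α κ t) :=
    fun t s hsV hs => tendsto_nhds_unique (hφ s hsV) (hmono t s hs)
  have hφ0 : ∀ s ∈ V, L.h s.pt 2 = 0 → φ s = 0 := fun s hs hw =>
    tendsto_nhds_unique (hφ s hs) (hzero s hs hw)
  have hθ0 : ∀ ζ, θ ζ ≠ 0 := fun ζ => mul_ne_zero hK0 (Complex.exp_ne_zero _)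
  have hne : ∀ t s, L.OnSheet Complex.exp logAt t j s → L.h s.pt 2 ≠ 0 := by
    intro t s hs
    rw [hs.2.1]
    exact Complex.exp_ne_zero _
  have hcentre : ∀ s ∈ V, s.pt ∈ C → L.h s.pt 2 = 0 → s = s₀ := by
    intro s hs hsC hw
    have hpt : s.pt = q := by
      refine L.eq_of_h_eq hs.1.1 L.mem ?_
      ext i
      fin_cases i
      · exact ((hVC s hs).1 hsC).1.trans L.zero.symm
      · exact ((hVC s hs).1 hsC).2.trans L.one.symm
      · exact hw.trans h2.symm
    exact hroot.isLabel.ext hpt hs₀ hs.2 hi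
  have hqN : s₀.pt ∈ N := by rw [hs₀]; exact hN.good.mem
  have H : L.IsSheetChart Complex.exp logAt μ α κ j {s | s.pt ∈ C} V φ θ := by
    refine ⟨hV, fun s hs => holModel_of_tendsto hV (fun s hs => hs.1.1) hS hτS hφ hs, ?_,
      fun ζ => ?_, fun ζ => ?_, fun t s hsV hst => ?_, hφval, ?_⟩
    · rintro s ⟨hsC, hsV⟩ s' ⟨hsC', hsV'⟩ h
      obtain ⟨h0, h1⟩ := (hVC s hsV).1 hsC
      obtain ⟨h0', h1'⟩ := (hVC s' hsV').1 hsC'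
      by_cases hw : L.h s.pt 2 = 0
      · by_cases hw' : L.h s'.pt 2 = 0
        · rw [hcentre s hsV hsC hw, hcentre s' hsV' hsC' hw']
        · obtain ⟨t', ht'⟩ := hsheet s' hsV' h0' h1' hw'
          rw [hφ0 s hsV hw, hφval t' s' hsV' ht'] at h
          exact absurd h.symm (hθ0 _)
      · obtain ⟨t, ht⟩ := hsheet s hsV h0 h1 hw
        by_cases hw' : L.h s'.pt 2 = 0
        · rw [hφ0 s' hsV' hw', hφval t s hsV ht] at h
          exact absurd h (hθ0 _)
        · obtain ⟨t', ht'⟩ := hsheet s' hsV' h0' h1' hw'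
          rw [hφval t s hsV ht, hφval t' s' hsV' ht'] at h
          -- Equal values of `φ` mean that the coordinates `t` differ by a multiple `ℓ ν` of `2πi`.
          -- This translation changes the index by `a₃ ℓ ν`, a multiple of `gcd(a₁, a₂)`, so the two
          -- branches coincide.
          obtain ⟨a, ha⟩ := Complex.exp_eq_exp_iff_exists_int.1 (mul_left_cancel₀ hK0 h)
          have ha' : zmap α κ t = zmap α κ t' + (ℓ * a : ℤ) * (2 * Real.pi * Complex.I) := by
            field_simp at ha
            rw [ha]; push_cast; ring
          obtain ⟨ν, hν⟩ : ∃ ν : ℤ, (a : ℝ) = κ * ν := by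
            rcases mul_self_eq_one_iff.1 hμ.sq with h | h
            · exact ⟨a, by rw [h, one_mul]⟩
            · exact ⟨-a, by rw [h]; push_cast; ring⟩
          have htt : t = t' + (ℓ * ν : ℤ) * (2 * Real.pi * Complex.I) := by
            rw [← hμ.inv_left t, ← hμ.inv_left (t' + _), ha']
            congr 1
            apply Complex.ext
            · simp [zmap]
            · simp [zmap, hν]
              ring
          have h5 := ht'.translate hL (ℓ * ν)
          rw [← htt] at h5
          have h6 : ((j + a₃ * (ℓ * ν) : ℤ) : ZMod (a₁.gcd a₂)) = j := by
            have h7 : (a₃ * (ℓ * ν) : ℤ) = c' * a₁.gcd a₂ * ν := by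
              have : (c' * a₁.gcd a₂ : ℤ) = a₃ * ℓ := by exact_mod_cast hc
              rw [this]; ring
            rw [h7]
            push_cast
            simp
          exact OnSheet.unique L hω hL ht ⟨h5.1, h5.2.1, by rw [← h6]; exact h5.2.2⟩
    · exact (analyticAt_const.mul (AnalyticAt.cexp (analyticAt_id.div_const)))
    · rw [(hθd ζ).deriv]
      exact mul_ne_zero hK0 (mul_ne_zero (Complex.exp_ne_zero _) (one_div_ne_zero hℓ'))
    · refine (hVC s hsV).2 ?_
      rw [hst.2.1]
      exact ⟨rfl, rfl⟩
    · rintro s ⟨hsC, hsV⟩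
      obtain ⟨h0, h1⟩ := (hVC s hsV).1 hsC
      by_cases hw : L.h s.pt 2 = 0
      · right
        refine ⟨hφ0 s hsV hw, fun W hW => ?_⟩
        rw [hcentre s hsV hsC hw] at hW
        obtain ⟨W', hW'W, hW', hsW'⟩ := mem_nhds_iff.1 hW
        obtain ⟨O, hO, hqO, hOW⟩ := hroot.isLabel.exists_labelSet_subset hW' hsW' hs₀ hi
        obtain ⟨r', hr', hN'O, hpoly', hN'⟩ := L.exists_isSheetNhd_double h2 h3 (hO.mem_nhds hqO)
        have hsub := hOW _ hN'.good fun y hy => hN'O y hy.1 hy.2.1 hy.2.2.1 hy.2.2.2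
        -- The radius is `r' ^ (α / ℓ)`, the value of `|w|^(α / ℓ)` on the boundary of the polydisc.
        -- A smaller nonzero `z` is then attained, at the point whose coordinate comes from a
        -- logarithm of `z / K`.
        refine ⟨Real.exp (α * Real.log r' / ℓ), Real.exp_pos _, fun z hz hzε => ?_⟩
        set ζ : ℂ := ℓ * Complex.log (z / K)
        have hζ : θ ζ = z := by
          show K * Complex.exp (ℓ * Complex.log (z / K) / ℓ) = z
          rw [mul_div_cancel_left₀ _ hℓ', Complex.exp_log (div_ne_zero hz hK0),
            mul_div_cancel₀ _ hK0]
        set t := zmap α⁻¹ κ ζ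
        have hre : t.re < Real.log r' := by
          show α⁻¹ * ζ.re < _
          have h4 : ζ.re = ℓ * Real.log ‖z‖ := by
            show ((ℓ : ℂ) * Complex.log (z / K)).re = _
            rw [← Complex.ofReal_natCast, Complex.re_ofReal_mul, Complex.log_re, norm_div, hK, div_one]
          have h5 := Real.log_lt_log (norm_pos_iff.2 hz) hzε
          rw [Real.log_exp, lt_div_iff₀ hℓr] at h5
          rw [h4, inv_mul_lt_iff₀ hμ.pos]
          linarith
        have hnt : ‖Complex.exp t‖ < r' := by
          rw [Complex.norm_exp]
          exact (Real.lt_log_iff_exp_lt hr').1 hre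
        obtain ⟨y, hyU, hyh⟩ := hpoly' ![0, 0, Complex.exp t] (by simpa using hr')
          (by simpa using hr') hnt
        obtain ⟨s', rfl, hs'⟩ := L.exists_onSheet hω hL hyU hyh j
        refine ⟨t, s', hs', hW'W (hsub ⟨?_, ?_⟩), by rw [hμ.inv_right, hζ]⟩
        · refine ⟨hyU, ?_, ?_, ?_⟩ <;> rw [hyh]
          · simpa using hr'
          · simpa using hr'
          · exact hnt
        · filter_upwards [OnSheet.eventually L hω hL hs' one_pos] with
            y ⟨_, _, z₁, z₂, t, _, hsh, hh⟩
          exact L.phase_doubleRoot hsh hh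
      · obtain ⟨t, ht⟩ := hsheet s hsV h0 h1 hw
        exact Or.inl ⟨t, ht⟩
  exact ⟨V, φ, ⟨hqN, hi⟩, H.isChartOn hω hL hμ⟩

end MonomialForm

end MilnorBoundary


/-! ### Orientation preserving changes of coordinates -/

namespace MilnorBoundary

/-- Orientation preserving real analytic germs of maps of the plane. -/
def IsPosAt (T : ℂ → ℂ) (w : ℂ) : Prop := AnalyticAt ℝ T w ∧ 0 < (fderiv ℝ T w).det

lemma IsPosAt.congr {T T' : ℂ → ℂ} {w : ℂ} (h : IsPosAt T w) (hT : T =ᶠ[𝓝 w] T') :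
    IsPosAt T' w := ⟨h.1.congr hT, by rw [← hT.fderiv_eq]; exact h.2⟩

lemma fderiv_comp_det {T T' : ℂ → ℂ} {w : ℂ} (h : DifferentiableAt ℝ T w)
    (h' : DifferentiableAt ℝ T' (T w)) :
    (fderiv ℝ (T' ∘ T) w).det = (fderiv ℝ T' (T w)).det * (fderiv ℝ T w).det := by
  rw [fderiv_comp w h' h]
  exact LinearMap.det_comp _ _

lemma IsPosAt.comp {T T' : ℂ → ℂ} {w : ℂ} (h' : IsPosAt T' (T w)) (h : IsPosAt T w) :
    IsPosAt (T' ∘ T) w := by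
  refine ⟨h'.1.comp h.1, ?_⟩
  rw [fderiv_comp_det h.1.differentiableAt h'.1.differentiableAt]
  exact mul_pos h'.2 h.2

lemma isPosAt_of_linear {ℓ : ℂ →L[ℝ] ℂ} (h : 0 < ℓ.det) (w : ℂ) : IsPosAt ℓ w :=
  ⟨ℓ.analyticAt w, by rwa [ℓ.fderiv]⟩

/-- The real Jacobian of a holomorphic function is the square of the modulus of its derivative. -/
lemma isPosAt_of_analyticAt {T : ℂ → ℂ} {w : ℂ} (h : AnalyticAt ℂ T w) (hd : deriv T w ≠ 0) :
    IsPosAt T w := by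
  refine ⟨h.restrictScalars, ?_⟩
  have h1 := h.differentiableAt.hasDerivAt.complexToReal_fderiv
  rw [h1.fderiv]
  have h2 : (deriv T w • (1 : ℂ →L[ℝ] ℂ)).det = Complex.normSq (deriv T w) := by
    show LinearMap.det _ = _
    rw [← LinearMap.det_toMatrix Complex.basisOneI, Matrix.det_fin_two]
    simp [LinearMap.toMatrix_apply, Complex.normSq_apply]
  rw [h2]
  exact Complex.normSq_pos.2 hd

/-- The determinant of the conjugation occurs twice, hence squared, in the Jacobian. -/
lemma IsPosAt.conj_conj {T : ℂ → ℂ} {w : ℂ} (h : IsPosAt T w) :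
    IsPosAt (fun z => starRingEnd ℂ (T (starRingEnd ℂ z))) (starRingEnd ℂ w) := by
  set κ : ℂ →L[ℝ] ℂ := Complex.conjCLE.toContinuousLinearMap
  have hκ : κ.det ≠ 0 := by
    have : κ.comp κ = ContinuousLinearMap.id ℝ ℂ := by
      ext z
      all_goals simp [κ]
    have h2 : κ.det * κ.det = 1 := by
      have h3 : (κ.comp κ).det = κ.det * κ.det := LinearMap.det_comp _ _
      rw [← h3, this]
      exact LinearMap.det_id
    exact left_ne_zero_of_mul (h2 ▸ one_ne_zero)
  have hw : κ (starRingEnd ℂ w) = w := Complex.conj_conj w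
  have hT : AnalyticAt ℝ T (κ (starRingEnd ℂ w)) := by rw [hw]; exact h.1
  have h1 : AnalyticAt ℝ (T ∘ κ) (starRingEnd ℂ w) := hT.comp (κ.analyticAt _)
  refine ⟨(κ.analyticAt _).comp h1, ?_⟩
  have e1 := fderiv_comp_det h1.differentiableAt (κ.differentiableAt (x := (T ∘ κ) (starRingEnd ℂ w)))
  rw [fderiv_comp_det κ.differentiableAt hT.differentiableAt, κ.fderiv, κ.fderiv, hw] at e1
  change 0 < (fderiv ℝ (κ ∘ T ∘ κ) _).det
  rw [e1, mul_comm, mul_assoc]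
  exact mul_pos h.2 (mul_self_pos.2 hκ)

/-- The homeomorphism `r exp(iθ) ↦ r ^ α exp(iθ)`. -/
noncomputable def radial (α : ℝ) (w : ℂ) : ℂ := Complex.exp (zmap α 1 (Complex.log w))

lemma zmap_add (α κ : ℝ) (t t' : ℂ) : zmap α κ (t + t') = zmap α κ t + zmap α κ t' := by
  apply Complex.ext <;> simp [zmap, mul_add]

lemma zmap_two_pi (α : ℝ) (n : ℤ) :
    zmap α 1 (n * (2 * Real.pi * Complex.I)) = n * (2 * Real.pi * Complex.I) := by
  apply Complex.ext <;> simp [zmap]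

/-- The value does not depend on the choice of the logarithm, because `zmap α 1` fixes the multiples
of `2πi`. -/
lemma radial_exp (α : ℝ) (t : ℂ) : radial α (Complex.exp t) = Complex.exp (zmap α 1 t) := by
  obtain ⟨n, hn⟩ := Complex.exp_eq_exp_iff_exists_int.1 (Complex.exp_log (Complex.exp_ne_zero t))
  rw [radial, hn, zmap_add, zmap_two_pi, Complex.exp_add, Complex.exp_int_mul_two_pi_mul_I, mul_one]

lemma radial_radial {α : ℝ} (hα : 0 < α) {w : ℂ} (hw : w ≠ 0) : radial α⁻¹ (radial α w) = w := by
  rw [← Complex.exp_log hw, radial_exp, radial_exp,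
    zmap_zmap (inv_mul_cancel₀ hα.ne') (one_mul 1)]

/-- Near `w` the map is a composition of a branch of the logarithm, a real linear map of determinant
`α > 0`, and the exponential. -/
lemma isPosAt_radial {α : ℝ} (hα : 0 < α) {w : ℂ} (hw : w ≠ 0) : IsPosAt (radial α) w := by
  set t₀ := Complex.log w
  have ht₀ : Complex.exp t₀ = w := Complex.exp_log hw
  have hω := isUniformizer_logAt
  have hlog : logAt t₀ w = t₀ := by
    rw [← ht₀]; exact hω.lg_apply t₀ t₀ (by simp)
  set ℓ : ℂ →L[ℝ] ℂ := LinearMap.toContinuousLinearMap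
    { toFun := zmap α 1
      map_add' := zmap_add α 1
      map_smul' := fun r z => by apply Complex.ext <;> simp [zmap]; ring }
  have hℓ : 0 < ℓ.det := by
    have : ℓ.det = α := by
      show LinearMap.det _ = _
      rw [← LinearMap.det_toMatrix Complex.basisOneI, Matrix.det_fin_two]
      simp [LinearMap.toMatrix_apply, ℓ, zmap]
    rw [this]; exact hα
  have h1 : IsPosAt (logAt t₀) w := by
    have ha := hω.lg_analyticAt t₀
    rw [ht₀] at ha
    refine isPosAt_of_analyticAt ha ?_
    have h2 : HasDerivAt (Complex.exp ∘ logAt t₀) (Complex.exp (logAt t₀ w) * deriv (logAt t₀) w) w :=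
      (Complex.hasDerivAt_exp _).comp w ha.differentiableAt.hasDerivAt
    have h3 : HasDerivAt (Complex.exp ∘ logAt t₀) 1 w := by
      refine (hasDerivAt_id w).congr_of_eventuallyEq ?_
      filter_upwards [eventually_ne_nhds hw] with z hz
      show Complex.exp (Complex.log (z / Complex.exp t₀) + t₀) = z
      rw [Complex.exp_add, Complex.exp_log (div_ne_zero hz (Complex.exp_ne_zero _)),
        div_mul_cancel₀ _ (Complex.exp_ne_zero _)]
    exact right_ne_zero_of_mul ((h2.unique h3).symm ▸ one_ne_zero)
  have h2 : IsPosAt (Complex.exp ∘ (ℓ ∘ logAt t₀)) w := by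
    refine IsPosAt.comp (isPosAt_of_analyticAt analyticAt_cexp ?_)
      (IsPosAt.comp (isPosAt_of_linear hℓ _) h1)
    rw [Complex.deriv_exp]
    exact Complex.exp_ne_zero _
  refine h2.congr ?_
  filter_upwards [eventually_ne_nhds hw] with z hz
  have hz' : Complex.exp (logAt t₀ z) = z := by
    show Complex.exp (Complex.log (z / Complex.exp t₀) + t₀) = z
    rw [Complex.exp_add, Complex.exp_log (div_ne_zero hz (Complex.exp_ne_zero _)),
      div_mul_cancel₀ _ (Complex.exp_ne_zero _)]
  conv_rhs => rw [← hz', radial_exp]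
  rfl

/-- `ψ'` is an orientation preserving real analytic function of `ψ` near `s`. -/
def IsTransition {E : Type*} [TopologicalSpace E] (A : Set E) (s : E) (ψ ψ' : E → ℂ) : Prop :=
  ∃ T : ℂ → ℂ, IsPosAt T (ψ s) ∧ ψ' =ᶠ[𝓝[A] s] T ∘ ψ

lemma isTransition_of_eventuallyEq {E : Type*} [TopologicalSpace E] {A : Set E} {s : E}
    {ψ ψ' : E → ℂ} (h : ψ =ᶠ[𝓝[A] s] ψ') : IsTransition A s ψ ψ' :=
  ⟨id, isPosAt_of_analyticAt analyticAt_id (by simp), h.symm⟩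

lemma IsTransition.trans {E : Type*} [TopologicalSpace E] {A : Set E} {s : E} (hs : s ∈ A)
    {ψ ψ' ψ'' : E → ℂ} (h : IsTransition A s ψ ψ') (h' : IsTransition A s ψ' ψ'') :
    IsTransition A s ψ ψ'' := by
  obtain ⟨T, hT, h1⟩ := h
  obtain ⟨T', hT', h2⟩ := h'
  have h3 : ψ' s = T (ψ s) := h1.self_of_nhdsWithin hs
  refine ⟨T' ∘ T, IsPosAt.comp (h3 ▸ hT') hT, ?_⟩
  filter_upwards [h1, h2] with x hx hx'
  rw [hx', Function.comp_apply, hx]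
  rfl

lemma IsTransition.conj {E : Type*} [TopologicalSpace E] {A : Set E} {s : E} {ψ ψ' : E → ℂ}
    (h : IsTransition A s ψ ψ') :
    IsTransition A s (fun x => starRingEnd ℂ (ψ x)) (fun x => starRingEnd ℂ (ψ' x)) := by
  obtain ⟨T, hT, h⟩ := h
  refine ⟨_, hT.conj_conj, ?_⟩
  filter_upwards [h] with x hx
  simp [hx]

section Charts

variable {E : Type*} [TopologicalSpace E] {hol : E → (E → ℂ) → Prop} {A V V' : Set E} {φ φ' : E → ℂ}

lemma IsChartOn.isOpenEmbedding_one (h : IsChartOn hol A V fun s (_ : Fin 1) => φ s) :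
    IsOpenEmbedding ((A ∩ V).domRestrict φ) :=
  (Homeomorph.funUnique (Fin 1) ℂ).isOpenEmbedding.comp h.isOpenEmbedding

lemma eventually_of_comp (h : IsOpenEmbedding ((A ∩ V).domRestrict φ)) (hV : IsOpen V) {s : E}
    (hs : s ∈ A ∩ V) {p : ℂ → Prop} (hp : ∀ᶠ x in 𝓝[A] s, p (φ x)) : ∀ᶠ z in 𝓝 (φ s), p z := by
  have h1 : ∀ᶠ x : ↥(A ∩ V) in 𝓝 ⟨s, hs⟩, p ((A ∩ V).domRestrict φ x) := by
    have h2 : 𝓝[A ∩ V] s = 𝓝[A] s := nhdsWithin_inter_of_mem' (mem_nhdsWithin_of_mem_nhds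
      (hV.mem_nhds hs.2))
    rw [← h2, ← map_nhds_subtype_val ⟨s, hs⟩] at hp
    exact hp
  have h3 := h.map_nhds_eq ⟨s, hs⟩
  have h4 : ∀ᶠ z in map ((A ∩ V).domRestrict φ) (𝓝 ⟨s, hs⟩), p z := h1
  rwa [h3] at h4

/-- Two charts of a curve differ by a holomorphic change of coordinate. -/
lemma IsChartOn.isTransition (h : IsChartOn hol A V fun s (_ : Fin 1) => φ s)
    (h' : IsChartOn hol A V' fun s (_ : Fin 1) => φ' s) {s : E} (hs : s ∈ A ∩ (V ∩ V')) :
    IsTransition A s φ φ' := by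
  obtain ⟨G, hG, hG'⟩ := h.factor s ⟨hs.1, hs.2.1⟩ _ (h'.hol_coord 0 s ⟨hs.1, hs.2.2⟩)
  obtain ⟨H, hH, hH'⟩ := h'.factor s ⟨hs.1, hs.2.2⟩ _ (h.hol_coord 0 s ⟨hs.1, hs.2.1⟩)
  have hι : ∀ z, AnalyticAt ℂ (fun (z : ℂ) (_ : Fin 1) => z) z := fun z =>
    AnalyticAt.pi fun _ => analyticAt_id
  have hG1 : AnalyticAt ℂ (fun z => G fun _ => z) (φ s) := AnalyticAt.fun_comp hG (hι _)
  have hH1 : AnalyticAt ℂ (fun z => H fun _ => z) (φ' s) := AnalyticAt.fun_comp hH (hι _)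
  have hs' : φ' s = G fun _ => φ s := hG'.self_of_nhdsWithin hs.1
  refine ⟨fun z => G fun _ => z, isPosAt_of_analyticAt hG1 ?_, hG'⟩
  have hid : ∀ᶠ z in 𝓝 (φ s), (H fun _ => G fun _ => z) = z := by
    refine eventually_of_comp h.isOpenEmbedding_one h.isOpen ⟨hs.1, hs.2.1⟩ ?_
    filter_upwards [hG', hH'] with x hx hx'
    have h1 : φ x = H fun _ => φ' x := hx'
    have h2 : φ' x = G fun _ => φ x := hx
    rw [← h2, ← h1]
  rw [hs'] at hH1
  have h1 := hH1.differentiableAt.hasDerivAt.comp (φ s) hG1.differentiableAt.hasDerivAt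
  have h2 := h1.unique ((hasDerivAt_id (φ s)).congr_of_eventuallyEq hid)
  exact right_ne_zero_of_mul (h2.symm ▸ one_ne_zero)

end Charts

end MilnorBoundary


/-! ### Charts of the preimage, compared with the coordinate of the curve -/

namespace MilnorBoundary

variable {X : Type*} [TopologicalSpace X] {P : SmoothingGerm X} {Y : Type*} [TopologicalSpace Y]
  {M : Modification P Y} {c : AdaptedChart M} {e : Equiv.Perm (Fin 3)} {D₁ D₂ C : Set Y}
  {m : Set Y → ℕ} {k : ℕ} {q : Y}

namespace IsLocalForm

variable (H : IsLocalForm c e D₁ D₂ C m k q)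
include H

lemma continuousWithinAt_model {y : Y} (hy : y ∈ M.openPart k) (hyU : y ∈ c.U) :
    ContinuousWithinAt (c.model k) (M.openPart k) y := by
  have hc : ∀ i, ContinuousAt (fun y => c.coord y i) y := fun i => by
    obtain ⟨l, rfl⟩ := e.surjective i
    exact (H.monomialForm.continuousOn l).continuousAt (H.monomialForm.isOpen.mem_nhds hyU)
  have h1 : c.coord y (e 1) ≠ 0 := H.monomialForm.h_one_ne hyU hy
  refine ContinuousAt.continuousWithinAt (continuousAt_pi.2 fun i => ?_)
  have h3 : i = e 0 ∨ i = e 1 ∨ i = e 2 := by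
    obtain ⟨l, rfl⟩ := e.surjective i
    fin_cases l <;> simp
  by_cases h : c.IsMinus
  · have h2 : c.coord y (e 2) ≠ 0 := H.monomialForm.h_two_ne
      (mem_support_of_isMinus h) hyU hy
    rcases h3 with rfl | rfl | rfl
    · simpa only [H.model_zero] using hc _
    · simp only [H.model_of_isMinus h _ 1 one_ne_zero]
      exact ((hc _).inv₀ h1).mul (Complex.continuous_ofReal.continuousAt.comp
        ((hc _).norm.rpow_const (Or.inl (norm_ne_zero_iff.2 h1))))
    · simp only [H.model_of_isMinus h _ 2 (show (2 : Fin 3) ≠ 0 by decide)]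
      exact ((hc _).inv₀ h2).mul (Complex.continuous_ofReal.continuousAt.comp
        ((hc _).norm.rpow_const (Or.inl (norm_ne_zero_iff.2 h2))))
  · rcases h3 with rfl | rfl | rfl
    · simpa only [H.model_zero] using hc _
    · simp only [H.model_one_of_not_isMinus h]
      exact ((hc _).inv₀ h1).mul (Complex.continuous_ofReal.continuousAt.comp
        (((hc _).norm.rpow_const (Or.inr (by positivity))).mul
          ((hc _).norm.rpow_const (Or.inr (by positivity)))))
    · simpa only [H.model_two_of_not_isMinus h] using hc _

lemma model_ne_zero (hs : e 2 ∈ c.support) {y : Y} (hy : y ∈ M.openPart k) (hyU : y ∈ c.U)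
    (i : Fin 3) : c.model k y i ≠ 0 := by
  have h0 : c.coord y (e 0) ≠ 0 := H.monomialForm.h_zero_ne hyU hy
  have h1 : c.coord y (e 1) ≠ 0 := H.monomialForm.h_one_ne hyU hy
  have h2 : c.coord y (e 2) ≠ 0 := H.monomialForm.h_two_ne hs hyU hy
  have h3 : i = e 0 ∨ i = e 1 ∨ i = e 2 := by
    obtain ⟨l, rfl⟩ := e.surjective i
    fin_cases l <;> simp
  have hp : ∀ (z : ℂ) (x : ℝ), z ≠ 0 → ‖z‖ ^ x ≠ 0 := fun z x hz =>
    (Real.rpow_pos_of_pos (norm_pos_iff.2 hz) _).ne'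
  by_cases h : c.IsMinus
  · rcases h3 with rfl | rfl | rfl
    · rwa [H.model_zero]
    · rw [H.model_of_isMinus h _ 1 one_ne_zero]
      exact mul_ne_zero (inv_ne_zero h1) (by exact_mod_cast hp _ _ h1)
    · rw [H.model_of_isMinus h _ 2 (show (2 : Fin 3) ≠ 0 by decide)]
      exact mul_ne_zero (inv_ne_zero h2) (by exact_mod_cast hp _ _ h2)
  · rcases h3 with rfl | rfl | rfl
    · rwa [H.model_zero]
    · rw [H.model_one_of_not_isMinus h]
      exact mul_ne_zero (inv_ne_zero h1) (by
        exact_mod_cast mul_ne_zero (hp _ _ h0) (hp _ _ h2))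
    · rwa [H.model_two_of_not_isMinus h]

lemma isDouble_of_mem (hs : e 2 ∈ c.support) : c.IsDouble := by
  by_contra h
  rcases H.perm with rfl | ⟨-, h1⟩ | ⟨-, h1⟩
  · exact h (c.two_mem_support.1 hs)
  · exact h (Or.inr h1)
  · exact h (Or.inl h1.2)

/-- All three coordinates vanish at `q` and at the center of the chart, and they are injective. A
double point on the curve is thus the center of every adapted chart containing it, to which the
uniqueness hypothesis on the cover applies. -/
lemma eq_center (hs : e 2 ∈ c.support) (h2 : c.coord q (e 2) = 0) : q = c.center := by
  have hd := H.isDouble_of_mem hs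
  refine H.monomialForm.eq_of_h_eq H.mem c.center_mem ?_
  have h0 : ∀ i, c.coord c.center i = 0 := by
    intro i
    fin_cases i
    · exact c.coord_zero
    · exact c.coord_one
    · exact c.coord_two hd
  funext i
  show c.coord q (e i) = c.coord c.center (e i)
  rw [h0]
  fin_cases i
  · exact H.zero
  · exact H.one
  · exact h2

/-- The orientation of the charts of the curve of branches. -/
noncomputable def _root_.MilnorBoundary.AdaptedChart.orient (c : AdaptedChart M) (z : ℂ) : ℂ :=
  open Classical in if c.IsMinus then starRingEnd ℂ z else z

omit H in
lemma _root_.MilnorBoundary.AdaptedChart.isTransition_orient {E : Type*} [TopologicalSpace E]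
    {A : Set E} {s : E} {ψ ψ' : E → ℂ} (h : IsTransition A s ψ ψ') (c : AdaptedChart M) :
    IsTransition A s (fun x => c.orient (ψ x)) (fun x => c.orient (ψ' x)) := by
  by_cases hc : c.IsMinus
  · simpa [AdaptedChart.orient, hc] using h.conj
  · simpa [AdaptedChart.orient, hc] using h

/-- Charts of the curve of branches, and their relation to the coordinate of the curve. -/
theorem exists_chart {s₀ : BranchPoint (M.openPart k)} (hs₀ : s₀.pt = q) :
    ∃ (V : Set (BranchPoint (M.openPart k))) (φ : BranchPoint (M.openPart k) → ℂ), s₀ ∈ V ∧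
      IsChartOn (c.modelHol k) (M.curvePreimage k C) V (fun s (_ : Fin 1) => φ s) ∧
      ((e 2 ∈ c.support → c.coord q (e 2) ≠ 0) →
        IsTransition (M.curvePreimage k C) s₀ (fun s => c.coord s.pt (e 2))
            (fun s => c.orient (φ s)) ∧
          IsTransition (M.curvePreimage k C) s₀ (fun s => c.orient (φ s))
            (fun s => c.coord s.pt (e 2))) := by
  subst hs₀
  have hS : ∀ y ∈ M.openPart k, ∀ᶠ y' in 𝓝 y, y' ∈ closure (M.openPart k) → y' ∈ M.openPart k :=
    fun y hy => openPart_eventually hy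
  have hμc : ∀ y ∈ M.openPart k, y ∈ H.monomialForm.U →
      ContinuousWithinAt (c.model k) (M.openPart k) y := fun y hy hyU =>
    H.continuousWithinAt_model hy hyU
  have hmem : s₀ ∈ M.curvePreimage k C := H.mem_curve
  have hvec : ∀ w, c.coord s₀.pt (e 2) = w → H.monomialForm.h s₀.pt = ![0, 0, w] := by
    intro w hw
    ext i
    fin_cases i
    · exact H.zero
    · exact H.one
    · exact hw
  by_cases hs : e 2 ∈ c.support
  · by_cases h2 : c.coord s₀.pt (e 2) = 0
    · have hμ0 : ∀ y ∈ M.openPart k, y ∈ H.monomialForm.U → ∀ i, c.model k y i ≠ 0 :=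
        fun y hy hyU => H.model_ne_zero hs hy hyU
      by_cases hc : c.IsMinus
      · obtain ⟨V, φ, h1, h3⟩ := MonomialForm.exists_chart_double H.fits_exp
          (H.hasModel_of_isMinus hc) hS hμc hμ0 h2 hs rfl H.curve
        exact ⟨V, φ, h1, h3, fun h => absurd h2 (h hs)⟩
      · obtain ⟨V, φ, h1, h3⟩ := MonomialForm.exists_chart_double H.fits_exp
          (H.hasModel_of_not_isMinus hc H.fits_exp) hS hμc hμ0 h2 hs rfl H.curve
        exact ⟨V, φ, h1, h3, fun h => absurd h2 (h hs)⟩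
    · have ht : c.coord s₀.pt (e 2) = Complex.exp (Complex.log (c.coord s₀.pt (e 2))) :=
        (Complex.exp_log h2).symm
      by_cases hc : c.IsMinus
      · obtain ⟨V, φ, h1, h3, h4⟩ := MonomialForm.exists_chart_generic isUniformizer_logAt H.fits_exp
          (H.hasModel_of_isMinus hc) hS hμc H.mem (hvec _ ht) H.curve
        set α : ℝ := c.expF (e 0) / (k * c.expG (e 0) - c.expF (e 0))
        have hα : 0 < α := (H.hasModel_of_isMinus hc).pos
        -- Conjugation of `exp (zmap α (-1) t)` gives `exp (zmap α 1 t)`. Off the center the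
        -- reoriented chart of type `⊖` is therefore a radial map of the third coordinate, which
        -- preserves the orientation.
        have hV : ∀ᶠ s in 𝓝[M.curvePreimage k C] s₀,
            c.orient (φ s) = radial α (c.coord s.pt (e 2)) ∧ c.coord s.pt (e 2) ≠ 0 := by
          filter_upwards [self_mem_nhdsWithin, mem_nhdsWithin_of_mem_nhds (h3.isOpen.mem_nhds h1)]
            with s hsC hsV
          obtain ⟨t, ht, hφ⟩ := h4 s hsV hsC
          have ht' : c.coord s.pt (e 2) = Complex.exp t := ht
          rw [ht', radial_exp]
          refine ⟨?_, Complex.exp_ne_zero _⟩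
          simp only [AdaptedChart.orient, if_pos hc]
          rw [hφ, ← Complex.exp_conj]
          congr 1
          apply Complex.ext <;> simp [zmap]
        refine ⟨V, φ, h1, h3, fun _ => ⟨⟨radial α, isPosAt_radial hα h2, ?_⟩,
          ⟨radial α⁻¹, ?_, ?_⟩⟩⟩
        · filter_upwards [hV] with s hs using hs.1
        · refine isPosAt_radial (inv_pos.2 hα) ?_
          show c.orient (φ s₀) ≠ 0
          rw [(hV.self_of_nhdsWithin hmem).1]
          exact Complex.exp_ne_zero _
        · filter_upwards [hV] with s hs
          rw [Function.comp_apply, hs.1, radial_radial hα hs.2]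
      · obtain ⟨V, φ, h1, h3, h4⟩ := MonomialForm.exists_chart_generic isUniformizer_logAt H.fits_exp
          (H.hasModel_of_not_isMinus hc H.fits_exp) hS hμc H.mem (hvec _ ht) H.curve
        have hV : ∀ᶠ s in 𝓝[M.curvePreimage k C] s₀, c.orient (φ s) = c.coord s.pt (e 2) := by
          filter_upwards [self_mem_nhdsWithin, mem_nhdsWithin_of_mem_nhds (h3.isOpen.mem_nhds h1)]
            with s hsC hsV
          obtain ⟨t, ht, hφ⟩ := h4 s hsV hsC
          have ht' : c.coord s.pt (e 2) = Complex.exp t := ht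
          simp only [AdaptedChart.orient, if_neg hc]
          rw [ht', hφ]
          congr 1
          exact Complex.ext (one_mul _) (one_mul _)
        exact ⟨V, φ, h1, h3, fun _ => ⟨isTransition_of_eventuallyEq (EventuallyEq.symm hV),
          isTransition_of_eventuallyEq hV⟩⟩
  · have hc : ¬ c.IsMinus := fun hc => hs (mem_support_of_isMinus hc)
    obtain ⟨V, φ, h1, h3, h4⟩ := MonomialForm.exists_chart_generic isUniformizer_id (H.fits_id hs)
      (H.hasModel_of_not_isMinus hc (H.fits_id hs)) hS hμc H.mem (hvec _ rfl) H.curve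
    have hV : ∀ᶠ s in 𝓝[M.curvePreimage k C] s₀, c.orient (φ s) = c.coord s.pt (e 2) := by
      filter_upwards [self_mem_nhdsWithin, mem_nhdsWithin_of_mem_nhds (h3.isOpen.mem_nhds h1)]
        with s hsC hsV
      obtain ⟨t, ht, hφ⟩ := h4 s hsV hsC
      have ht' : c.coord s.pt (e 2) = t := ht
      simp only [AdaptedChart.orient, if_neg hc]
      rw [ht', hφ]
      exact Complex.ext (one_mul _) (one_mul _)
    exact ⟨V, φ, h1, h3, fun _ => ⟨isTransition_of_eventuallyEq (EventuallyEq.symm hV),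
      isTransition_of_eventuallyEq hV⟩⟩

/-- Two coordinates of the curve differ by a holomorphic change of coordinate. -/
lemma isTransition_coord {c' : AdaptedChart M} {e' : Equiv.Perm (Fin 3)}
    (H' : IsLocalForm c' e' D₁ D₂ C m k q) {s₀ : BranchPoint (M.openPart k)} (hs₀ : s₀.pt = q) :
    IsTransition (M.curvePreimage k C) s₀ (fun s => c.coord s.pt (e 2))
      (fun s => c'.coord s.pt (e' 2)) := by
  subst hs₀
  have key : ∀ {c : AdaptedChart M} {e : Equiv.Perm (Fin 3)} (H : IsLocalForm c e D₁ D₂ C m k s₀.pt)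
      {c' : AdaptedChart M} {e' : Equiv.Perm (Fin 3)} (H' : IsLocalForm c' e' D₁ D₂ C m k s₀.pt),
      ∃ G : ℂ → ℂ, AnalyticAt ℂ G (c.coord s₀.pt (e 2)) ∧
        ∀ᶠ y in 𝓝 s₀.pt, y ∈ C → c'.coord y (e' 2) = G (c.coord y (e 2)) := by
    intro c e H c' e' H'
    obtain ⟨G, hG, hev⟩ := c.isChartOn.factor s₀.pt ⟨mem_univ _, H.mem⟩ _
      (c'.isChartOn.hol_coord (e' 2) s₀.pt ⟨mem_univ _, H'.mem⟩)
    rw [nhdsWithin_univ] at hev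
    set ι : ℂ → Fin 3 → ℂ := fun w => Pi.single (e 2) w
    have hι : ∀ y, c.coord y (e 0) = 0 → c.coord y (e 1) = 0 → ι (c.coord y (e 2)) = c.coord y := by
      intro y h0 h1
      funext i
      obtain ⟨l, rfl⟩ := e.surjective i
      fin_cases l
      · show (Pi.single (e 2) (c.coord y (e 2)) : Fin 3 → ℂ) (e 0) = _
        rw [Pi.single_eq_of_ne (by simp)]
        exact h0.symm
      · show (Pi.single (e 2) (c.coord y (e 2)) : Fin 3 → ℂ) (e 1) = _
        rw [Pi.single_eq_of_ne (by simp)]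
        exact h1.symm
      · exact Pi.single_eq_same _ _
    have hιa : AnalyticAt ℂ ι (c.coord s₀.pt (e 2)) :=
      (ContinuousLinearMap.single ℂ (fun _ : Fin 3 => ℂ) (e 2)).analyticAt _
    refine ⟨G ∘ ι, AnalyticAt.comp (by rw [hι _ H.zero H.one]; exact hG) hιa, ?_⟩
    filter_upwards [hev, H.curve] with y hy hyC h
    obtain ⟨h0, h1⟩ := hyC.1 h
    rw [hy, Function.comp_apply, Function.comp_apply, hι y h0 h1]
  obtain ⟨G, hG, hGe⟩ := key H H'
  obtain ⟨K, hK, hKe⟩ := key H' H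
  have hpt : Tendsto BranchPoint.pt (𝓝[M.curvePreimage k C] s₀) (𝓝 s₀.pt) :=
    BranchPoint.continuous_pt.continuousAt.mono_left nhdsWithin_le_nhds
  refine ⟨G, isPosAt_of_analyticAt hG ?_, ?_⟩
  swap
  · filter_upwards [hpt.eventually hGe, self_mem_nhdsWithin] with s h1 h2 using h1 h2
  have hid : ∀ᶠ w in 𝓝 (c.coord s₀.pt (e 2)), K (G w) = w := by
    obtain ⟨r, hr, hpoly⟩ := H.monomialForm.exists_polydisc (hGe.and (hKe.and H.curve))
    filter_upwards [Metric.ball_mem_nhds _ hr] with w hw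
    obtain ⟨y, ⟨hyU, h1, h2, h3⟩, hy⟩ := hpoly ![0, 0, w] (by simpa using hr) (by simpa using hr) (by
      show ‖w - c.coord s₀.pt (e 2)‖ < r
      rwa [← dist_eq_norm])
    have hyC : y ∈ C := h3.2 ⟨congrFun hy 0, congrFun hy 1⟩
    have hyw : c.coord y (e 2) = w := congrFun hy 2
    rw [← hyw, ← h1 hyC, ← h2 hyC]
  have hG0 := hGe.self_of_nhds H.mem_curve
  rw [hG0] at hK
  have h1 := hK.differentiableAt.hasDerivAt.comp _ hG.differentiableAt.hasDerivAt
  have h2 := h1.unique ((hasDerivAt_id _).congr_of_eventuallyEq hid)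
  exact right_ne_zero_of_mul (h2.symm ▸ one_ne_zero)

end IsLocalForm

end MilnorBoundary


/-! ### The preimage of a curve as an oriented surface -/

namespace MilnorBoundary

/-- The charted space structure has only two uses: second countability, in the compact case, and
local path-connectedness. -/
lemma nonempty_chartedSpace {E : Type*} [TopologicalSpace E] {A : Set E}
    (h : ∀ s ∈ A, ∃ (V : Set E) (φ : E → ℂ), IsOpen V ∧ s ∈ V ∧
      IsOpenEmbedding ((A ∩ V).domRestrict φ)) : Nonempty (ChartedSpace ℂ A) := by
  have : ∀ s : A, ∃ e : OpenPartialHomeomorph A ℂ, s ∈ e.source := by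
    intro s
    obtain ⟨V, φ, hV, hs, hφ⟩ := h s.1 s.2
    have hloc : IsLocalHomeomorphOn (fun x : A => φ x) ((Subtype.val : A → E) ⁻¹' V) := by
      refine (isLocalHomeomorphOn_iff_isOpenEmbedding_restrict _).2 fun x hx =>
        ⟨_, (hV.preimage continuous_subtype_val).mem_nhds hx, ?_⟩
      let Φ : ((Subtype.val : A → E) ⁻¹' V) ≃ₜ ↥(A ∩ V) :=
        { toFun := fun x => ⟨x.1.1, x.1.2, x.2⟩
          invFun := fun x => ⟨⟨x.1, x.2.1⟩, x.2.2⟩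
          left_inv := fun _ => rfl
          right_inv := fun _ => rfl
          continuous_toFun := by fun_prop
          continuous_invFun := by fun_prop }
      exact hφ.comp Φ.isOpenEmbedding
    obtain ⟨e, he, -⟩ := hloc s hs
    exact ⟨e, he⟩
  choose e he using this
  exact ⟨⟨range e, e, he, fun x => mem_range_self x⟩⟩

variable {X : Type*} [TopologicalSpace X] {P : SmoothingGerm X} {Y : Type*} [TopologicalSpace Y]
  {M : Modification P Y} {D₁ D₂ C : Set Y} {m : Set Y → ℕ} {k : ℕ}

/-- Double points of a chart are double points of any other chart. -/
lemma IsLocalForm.double_iff {c c' : AdaptedChart M} {e e' : Equiv.Perm (Fin 3)} {q : Y}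
    (H : IsLocalForm c e D₁ D₂ C m k q) (H' : IsLocalForm c' e' D₁ D₂ C m k q)
    (h : e 2 ∈ c.support) (h0 : c.coord q (e 2) = 0) :
    e' 2 ∈ c'.support ∧ c'.coord q (e' 2) = 0 := by
  obtain ⟨D₃, ⟨hD, h1, h2, -⟩, hq, -⟩ := H.double h h0
  by_contra! hcon
  exact ((H'.generic hcon).self_of_nhds D₃ hD hq).elim h1 h2

/-- Two charts from the same adapted chart differ by a holomorphic change of coordinate, or by its
conjugate. For different adapted charts both are compared with the holomorphic coordinates of `C`,
which is possible off the double points, and two different charts of the cover never give charts at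
a common double point. -/
theorem isOrientedAnalyticSurface {ι : Type*} [T2Space Y] (𝒰 : AdaptedCover M ι)
    (hLF : ∀ q ∈ C, ∀ c : AdaptedChart M, q ∈ c.U → ∃ e, IsLocalForm c e D₁ D₂ C m k q)
    (hC : C ⊆ M.configuration) [CompactSpace (M.curvePreimage k C)] :
    IsOrientedAnalyticSurface (M.curvePreimage k C) (M.orientedCharts k 𝒰 C) ∧
      LocallyPathConnectedSpace (M.curvePreimage k C) := by
  have hchart : ∀ s ∈ M.curvePreimage k C, ∃ (i : ι) (V : Set (BranchPoint (M.openPart k)))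
      (φ : BranchPoint (M.openPart k) → ℂ), s ∈ V ∧
      IsChartOn ((𝒰.chart i).modelHol k) (M.curvePreimage k C) V (fun s (_ : Fin 1) => φ s) := by
    intro s hs
    obtain ⟨i, hi⟩ := 𝒰.covers s.pt (hC hs)
    obtain ⟨e, H⟩ := hLF s.pt hs _ hi
    obtain ⟨V, φ, hsV, hφ, -⟩ := H.exists_chart (s₀ := s) rfl
    exact ⟨i, V, φ, hsV, hφ⟩
  obtain ⟨hch⟩ := nonempty_chartedSpace (A := M.curvePreimage k C) fun s hs => by
    obtain ⟨i, V, φ, hsV, hφ⟩ := hchart s hs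
    exact ⟨V, φ, hφ.isOpen, hsV, hφ.isOpenEmbedding_one⟩
  refine ⟨⟨inferInstance, ChartedSpace.secondCountable_of_sigmaCompact ℂ _, fun s hs => ?_, ?_, ?_,
    ?_⟩, ChartedSpace.locallyPathConnectedSpace ℂ _⟩
  · obtain ⟨i, V, φ, hsV, hφ⟩ := hchart s hs
    refine ⟨(V, fun s => (𝒰.chart i).orient (φ s)), ⟨i, φ, hφ, ?_⟩, hsV⟩
    by_cases h : (𝒰.chart i).IsMinus
    · exact Or.inr ⟨h, by simp [AdaptedChart.orient, h]⟩
    · exact Or.inl ⟨h, by simp [AdaptedChart.orient, h]⟩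
  · rintro ⟨V, ψ⟩ ⟨i, φ, hφ, -⟩
    exact hφ.isOpen
  · rintro ⟨V, ψ⟩ ⟨i, φ, hφ, ⟨-, h⟩ | ⟨-, h⟩⟩
    · subst h
      exact hφ.isOpenEmbedding_one
    · subst h
      exact Complex.conjCLE.toHomeomorph.isOpenEmbedding.comp hφ.isOpenEmbedding_one
  · have horient : ∀ {V ψ}, (V, ψ) ∈ M.orientedCharts k 𝒰 C → ∃ (i : ι) (φ : BranchPoint (M.openPart k) → ℂ),
        IsChartOn ((𝒰.chart i).modelHol k) (M.curvePreimage k C) V (fun s (_ : Fin 1) => φ s) ∧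
        ψ = fun s => (𝒰.chart i).orient (φ s) := by
      rintro V ψ ⟨i, φ, hφ, ⟨h, h'⟩ | ⟨h, h'⟩⟩
      · exact ⟨i, φ, hφ, by rw [show ψ = φ from h']; simp [AdaptedChart.orient, h]⟩
      · exact ⟨i, φ, hφ, by rw [show ψ = _ from h']; simp [AdaptedChart.orient, h]⟩
    rintro ⟨V, ψ⟩ hψ ⟨V', ψ'⟩ hψ' s ⟨hsA, hsV, hsV'⟩
    obtain ⟨i, φ, hφ, rfl⟩ := horient hψ
    obtain ⟨j, φ', hφ', rfl⟩ := horient hψ'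
    have htrans : IsTransition (M.curvePreimage k C) s (fun s => (𝒰.chart i).orient (φ s))
        (fun s => (𝒰.chart j).orient (φ' s)) := by
      by_cases hij : i = j
      · subst hij
        exact AdaptedChart.isTransition_orient (hφ.isTransition hφ' ⟨hsA, hsV, hsV'⟩) _
      · have hmem : ∀ {i : ι} {V : Set (BranchPoint (M.openPart k))}
            {φ : BranchPoint (M.openPart k) → ℂ}, IsChartOn ((𝒰.chart i).modelHol k) (M.curvePreimage k C) V
            (fun s (_ : Fin 1) => φ s) → s ∈ V → s.pt ∈ (𝒰.chart i).U := by
          intro i V φ h hs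
          obtain ⟨W, -, hsW, hWU, -⟩ := h.hol_coord 0 s ⟨hsA, hs⟩
          exact hWU s hsW
        obtain ⟨e, H⟩ := hLF s.pt hsA _ (hmem hφ hsV)
        obtain ⟨e', H'⟩ := hLF s.pt hsA _ (hmem hφ' hsV')
        -- If `s` lay over a double point, this point would be the center of both adapted charts,
        -- against `i ≠ j`.
        have hgen : e 2 ∈ (𝒰.chart i).support → (𝒰.chart i).coord s.pt (e 2) ≠ 0 := by
          intro h h0
          obtain ⟨h', h0'⟩ := H.double_iff H' h h0
          exact hij (𝒰.double_injective i j (H.isDouble_of_mem h) (H'.isDouble_of_mem h')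
            ((H.eq_center h h0).symm.trans (H'.eq_center h' h0')))
        have hgen' : e' 2 ∈ (𝒰.chart j).support → (𝒰.chart j).coord s.pt (e' 2) ≠ 0 := by
          intro h h0
          obtain ⟨h', h0'⟩ := H'.double_iff H h h0
          exact hgen h' h0'
        obtain ⟨W, χ, hsW, hχ, h⟩ := H.exists_chart (s₀ := s) rfl
        obtain ⟨W', χ', hsW', hχ', h'⟩ := H'.exists_chart (s₀ := s) rfl
        refine (AdaptedChart.isTransition_orient (hφ.isTransition hχ ⟨hsA, hsV, hsW⟩) _).trans hsA
          ((h hgen).2.trans hsA ((H.isTransition_coord H' rfl).trans hsA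
            ((h' hgen').1.trans hsA (AdaptedChart.isTransition_orient
              (hχ'.isTransition hφ' ⟨hsA, hsW', hsV'⟩) _))))
    obtain ⟨T, hT, h⟩ := htrans
    exact ⟨T, hT.1, hT.2, h⟩

end MilnorBoundary


/-! ### The number of branches, and their cyclic order -/

namespace MilnorBoundary

variable {X : Type*} [TopologicalSpace X] {P : SmoothingGerm X} {Y : Type*} [TopologicalSpace Y]
  {M : Modification P Y} {D₁ D₂ C : Set Y} {m : Set Y → ℕ} {k : ℕ}

open Classical in
/-- The number of branches at a point of a curve. -/
noncomputable def branchDegree (M : Modification P Y) (D₁ D₂ C : Set Y) (m : Set Y → ℕ) (q : Y) :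
    ℕ :=
  if h : ∃ D ∈ M.thirdComponents D₁ D₂ C, q ∈ D then ((m D₁).gcd (m D₂)).gcd (m h.choose)
  else (m D₁).gcd (m D₂)

lemma branchDegree_of_generic {q : Y} (h : ∀ D ∈ M.thirdComponents D₁ D₂ C, q ∉ D) :
    branchDegree M D₁ D₂ C m q = (m D₁).gcd (m D₂) :=
  dif_neg fun ⟨D, hD, hq⟩ => h D hD hq

lemma branchDegree_dvd (q : Y) : branchDegree M D₁ D₂ C m q ∣ (m D₁).gcd (m D₂) := by
  unfold branchDegree
  split_ifs
  · exact Nat.gcd_dvd_left _ _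
  · exact dvd_rfl

lemma dvd_branchDegree {l : ℕ} (h₀ : l ∣ (m D₁).gcd (m D₂))
    (h : ∀ D ∈ M.thirdComponents D₁ D₂ C, l ∣ m D) (q : Y) : l ∣ branchDegree M D₁ D₂ C m q := by
  unfold branchDegree
  split_ifs with hq
  · exact Nat.dvd_gcd h₀ (h _ hq.choose_spec.1)
  · exact h₀

/-- A third component through a point of the curve is unique. -/
lemma IsLocalForm.eq_of_mem {c : AdaptedChart M} {e : Equiv.Perm (Fin 3)} {q : Y}
    (H : IsLocalForm c e D₁ D₂ C m k q) {D D' : Set Y} (hD : D ∈ M.thirdComponents D₁ D₂ C)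
    (hD' : D' ∈ M.thirdComponents D₁ D₂ C) (hq : q ∈ D) (hq' : q ∈ D') : D = D' := by
  by_cases h : e 2 ∈ c.support → c.coord q (e 2) ≠ 0
  · exact ((H.generic h).self_of_nhds D hD.1 hq).elim (absurd · hD.2.1) (absurd · hD.2.2.1)
  · push Not at h
    obtain ⟨D₃, -, -, -, h'⟩ := H.double h.1 h.2
    have h'' := h'.self_of_nhds.2
    rcases h'' D hD.1 hq with h | h | h
    · exact absurd h hD.2.1
    · exact absurd h hD.2.2.1
    rcases h'' D' hD'.1 hq' with h1 | h1 | h1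
    · exact absurd h1 hD'.2.1
    · exact absurd h1 hD'.2.2.1
    rw [h, h1]

/-- The points of the third components are isolated. -/
lemma IsLocalForm.eventually_generic {c : AdaptedChart M} {e : Equiv.Perm (Fin 3)} {q : Y}
    (H : IsLocalForm c e D₁ D₂ C m k q) :
    ∀ᶠ y in 𝓝 q, y ∈ C → y ≠ q → ∀ D ∈ M.thirdComponents D₁ D₂ C, y ∉ D := by
  by_cases h : e 2 ∈ c.support → c.coord q (e 2) ≠ 0
  · filter_upwards [H.generic h] with y hy _ _ D hD hyD
    exact (hy D hD.1 hyD).elim (absurd · hD.2.1) (absurd · hD.2.2.1)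
  · push Not at h
    obtain ⟨D₃, -, -, -, h'⟩ := H.double h.1 h.2
    filter_upwards [h', H.curve, c.isChartOn.isOpen.mem_nhds H.mem] with y hy hyC hyU hC hne D hD hyD
    rcases hy.2 D hD.1 hyD with h1 | h1 | h1
    · exact absurd h1 hD.2.1
    · exact absurd h1 hD.2.2.1
    · refine hne (congrArg Subtype.val (H.monomialForm.emb.injective (a₁ := ⟨y, hyU⟩)
        (a₂ := ⟨q, H.mem⟩) (funext fun i => ?_)))
      change c.coord y (e i) = c.coord q (e i)
      have h2 := hyC.1 hC
      have h3 := hy.1.1 (h1 ▸ hyD)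
      fin_cases i
      · exact h2.1.trans H.zero.symm
      · exact h2.2.trans H.one.symm
      · exact h3.trans h.2.symm

lemma branchDegree_of_mem {c : AdaptedChart M} {e : Equiv.Perm (Fin 3)} {q : Y}
    (H : IsLocalForm c e D₁ D₂ C m k q) {D : Set Y} (hD : D ∈ M.thirdComponents D₁ D₂ C)
    (hq : q ∈ D) : branchDegree M D₁ D₂ C m q = ((m D₁).gcd (m D₂)).gcd (m D) := by
  have h : ∃ D ∈ M.thirdComponents D₁ D₂ C, q ∈ D := ⟨D, hD, hq⟩
  rw [branchDegree, dif_pos h, H.eq_of_mem h.choose_spec.1 hD h.choose_spec.2 hq]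

/-- Here the number of branches found in coordinates, a gcd of exponents, becomes a gcd of
multiplicities: the exponents of the hyperplanes through `q` are those of the components `D₁`, `D₂`
and, at a double point, of the third one. -/
lemma IsLocalForm.exists_isRootAt {c : AdaptedChart M} {e : Equiv.Perm (Fin 3)} {q : Y}
    (H : IsLocalForm c e D₁ D₂ C m k q) :
    ∃ φ, IsRootAt (M.openPart k) M.pullF q (branchDegree M D₁ D₂ C m q) φ := by
  by_cases h : e 2 ∈ c.support → c.coord q (e 2) ≠ 0
  · rw [branchDegree_of_generic fun D hD hqD => ((H.generic h).self_of_nhds D hD.1 hqD).elim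
      (absurd · hD.2.1) (absurd · hD.2.2.1), ← H.exp_left, ← H.exp_right, Nat.gcd_comm]
    by_cases hs : e 2 ∈ c.support
    · exact ⟨_, H.monomialForm.isRootAt_generic isUniformizer_logAt H.fits_exp
        (t₁ := Complex.log (c.coord q (e 2))) (Complex.exp_log (h hs)).symm⟩
    · exact ⟨_, H.monomialForm.isRootAt_generic isUniformizer_id (H.fits_id hs)
        (t₁ := c.coord q (e 2)) rfl⟩
  · push Not at h
    obtain ⟨D₃, hD₃, hq, hm, -⟩ := H.double h.1 h.2
    rw [branchDegree_of_mem H hD₃ hq, ← H.exp_left, ← H.exp_right, ← hm,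
      Nat.gcd_comm (c.expF (e 1))]
    exact ⟨_, H.monomialForm.isRootAt_double h.2 h.1⟩

lemma Modification.pullF_pos {y : Y} (hy : y ∈ M.openPart k) : ∃ r : ℝ, 0 < r ∧ M.pullF y = r := by
  obtain ⟨h1, h2⟩ := M.mem_openPart_iff.1 hy
  refine ⟨_, lt_of_le_of_ne (by positivity) fun h => h2 ?_, h1⟩
  rw [h1, ← h]
  simp

/-- The classification of the branches at the points of a curve. -/
theorem exists_branchSystem (hL : ∀ q ∈ C, ∃ (c : AdaptedChart M) (e : _), IsLocalForm c e D₁ D₂ C m k q) :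
    ∃ B : BranchSystem (M.openPart k) C, B.d = branchDegree M D₁ D₂ C m ∧
      ∀ q ∈ C, ∀ (φ : Y → ℂ) (d : ℕ) (h : B.d q ∣ d), IsRootAt (M.openPart k) M.pullF q d φ →
        ∃ c, ∀ᶠ y in 𝓝[M.openPart k] q, B.lab q y = ZMod.castHom h _ (phase d (φ y)) + c := by
  have hφ : ∀ q ∈ C, ∃ φ : Y → ℂ, IsRootAt (M.openPart k) M.pullF q (branchDegree M D₁ D₂ C m q) φ :=
    fun q hq => by
      obtain ⟨c, e, H⟩ := hL q hq
      exact H.exists_isRootAt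
  choose! φ hφ using hφ
  refine ⟨⟨branchDegree M D₁ D₂ C m, fun q y => phase _ (φ q y), fun q hq => (hφ q hq).pos,
    fun q hq => (hφ q hq).isLabel, fun q hq => ?_⟩, rfl, fun q hq φ' d h hφ' =>
      hφ'.compare (fun y hy => M.pullF_pos hy) h (hφ q hq).pow (hφ q hq).cont⟩
  obtain ⟨c, e, H⟩ := hL q hq
  obtain ⟨U, hU, hUo, hqU⟩ := _root_.mem_nhds_iff.1 ((H.eventually_generic.and
    (eventually_eventually_nhds.2 (hφ q hq).pow)).and (eventually_eventually_nhds.2 (hφ q hq).cont))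
  refine ⟨U, hUo, hqU, fun q' ⟨hq'U, hq'⟩ => ?_⟩
  obtain ⟨⟨h1, h2⟩, h3⟩ := hU hq'U
  -- The points of the curve near `q` and distinct from it are generic, so their degree is the gcd
  -- of the two multiplicities, of which the degree at `q` is a divisor.
  have hdd : branchDegree M D₁ D₂ C m q ∣ branchDegree M D₁ D₂ C m q' := by
    by_cases hqq : q' = q
    · rw [hqq]
    · rw [branchDegree_of_generic (h1 hq' hqq)]
      exact branchDegree_dvd q
  exact ⟨hdd, (hφ q' hq').compare (fun y hy => M.pullF_pos hy) hdd h2 h3⟩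

open BranchPoint in
/-- The cyclic order of the branches at a generic point is given by the shift. -/
theorem BranchSystem.shift_eq (hLF : ∀ q ∈ C, ∀ c : AdaptedChart M, q ∈ c.U →
      ∃ e, IsLocalForm c e D₁ D₂ C m k q) {B : BranchSystem (M.openPart k) C}
    (hB : B.d = branchDegree M D₁ D₂ C m)
    (hBφ : ∀ q ∈ C, ∀ (φ : Y → ℂ) (d : ℕ) (h : B.d q ∣ d), IsRootAt (M.openPart k) M.pullF q d φ →
        ∃ c, ∀ᶠ y in 𝓝[M.openPart k] q, B.lab q y = ZMod.castHom h _ (phase d (φ y)) + c)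
    {a : ℤ} {s t : BranchSystem.Space (M.openPart k) C} (h : M.Shift k a s t) :
    t = B.shift a s := by
  obtain ⟨hst, c, j, hc, hsU, hs, ht⟩ := h
  obtain ⟨e, H⟩ := hLF _ s.2 c hsU
  have he : e = 1 := by
    rcases H.perm with h | ⟨-, h⟩ | ⟨-, h⟩
    · exact h
    · exact absurd (Or.inr h) hc
    · exact absurd (Or.inl h.2) hc
  subst he
  have h2 : (1 : Equiv.Perm (Fin 3)) 2 ∉ c.support := fun h => hc (c.two_mem_support.1 h)
  have hm₃ : c.m₃ = 0 := by_contra fun h => hc (Or.inl h)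
  have hn₃ : c.n₃ = 0 := by_contra fun h => hc (Or.inr h)
  have hroot := H.monomialForm.isRootAt_generic isUniformizer_id (H.fits_id h2)
    (t₁ := c.coord s.1.pt 2) rfl
  set φ := H.monomialForm.root (fun _ => id) (c.coord s.1.pt 2)
  have hφ : ∀ y, φ y = c.coord y 0 ^ (c.m₁ / c.m₁.gcd c.m₂) * c.coord y 1 ^ (c.m₂ / c.m₁.gcd c.m₂) := by
    intro y
    change c.coord y 0 ^ (c.m₁ / c.m₁.gcd c.m₂) * c.coord y 1 ^ (c.m₂ / c.m₁.gcd c.m₂) *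
      Complex.exp ((c.m₃ : ℂ) * _ / _) = _
    rw [hm₃]
    simp
  have hd : B.d s.1.pt ∣ c.m₁.gcd c.m₂ := by
    rw [hB, Nat.gcd_comm, show c.m₂ = m D₁ from H.exp_left, show c.m₁ = m D₂ from H.exp_right]
    exact branchDegree_dvd _
  obtain ⟨b, hb⟩ := hBφ _ s.2 φ _ hd hroot
  have hind : ∀ (x : BranchPoint (M.openPart k)) (i : ℤ), x.pt = s.1.pt → c.HasIndex k x i →
      x.HasLabel (B.lab s.1.pt) (i + b) := by
    rintro x i hx ⟨N, hN⟩
    have hle := x.filter_le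
    rw [hx] at hle
    have hN' : x.branch N ∈ x.filter := mem_iInf_of_mem N (mem_principal_self _)
    filter_upwards [hN', hle hb, hle self_mem_nhdsWithin] with y hy hby hyS
    obtain ⟨hyU, hy⟩ := hN y hy
    have h0 : c.coord y 0 ≠ 0 := H.monomialForm.h_zero_ne hyU hyS
    have h1 : c.coord y 1 ≠ 0 := H.monomialForm.h_one_ne hyU hyS
    have hr : 0 < ‖c.coord y 0‖ ^ ((k * c.n₁ : ℝ) / c.m₂) * ‖c.coord y 2‖ ^ ((k * c.n₃ : ℝ) / c.m₂) := by
      rw [hn₃]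
      simpa using Real.rpow_pos_of_pos (norm_pos_iff.2 h0) _
    have hmin : ¬ c.IsMinus := fun h => hc (Or.inl h.2)
    simp only [AdaptedChart.model, if_neg hmin, Matrix.cons_val_zero, Matrix.cons_val_one] at hy
    generalize ‖c.coord y 0‖ ^ ((k * c.n₁ : ℝ) / c.m₂) * ‖c.coord y 2‖ ^ ((k * c.n₃ : ℝ) / c.m₂) = r
      at hr hy
    -- Substituting `y = v⁻¹ r` with `r > 0` in the equation of the component of index `i` gives
    -- `u^(m₁/d) v^(m₂/d)` as a positive multiple of `exp(2πi·i/d)`. The left side is the root of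
    -- `f`, so its phase is the index of the component.
    have hphase : phase (c.m₁.gcd c.m₂) (φ y) = i := by
      rw [← phase_eq (Nat.gcd_pos_of_pos_right _ c.m₂_pos)
        (pow_pos hr (c.m₂ / c.m₁.gcd c.m₂)) i, hφ, hy, mul_pow, inv_pow]
      congr 1
      push_cast
      field_simp
    rw [hby]
    change ZMod.castHom hd _ (phase (c.m₁.gcd c.m₂) (φ y)) + b = _
    rw [hphase, map_intCast]
  refine B.ext hst.symm (B.shift_pt a s) (hind _ _ hst.symm ht) ?_
  have := B.hasLabel_shift a rfl (hind _ _ rfl hs)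
  convert this using 1
  push_cast
  ring

end MilnorBoundary


/-! ### Euler characteristics of the components, and finiteness of double points -/

namespace MilnorBoundary

namespace IsCyclicCover

universe u

variable {E C : Type u} [TopologicalSpace E] [TopologicalSpace C] {π : E → C}
  {T : E ≃ₜ E} {d : C → ℕ} (h : IsCyclicCover π T d)
include h

lemma compactSpace [CompactSpace C] : CompactSpace E := by
  have : IsProperMap π := isProperMap_iff_isClosedMap_and_compact_fibers.2
    ⟨h.continuous, h.isClosedMap, fun q => (h.finite_fiber q).isCompact⟩
  exact ⟨by simpa using this.isCompact_preimage isCompact_univ⟩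

/-- Two points of a fiber with the same label for the base point `π s` differ by a multiple of `d (π
s)`. Where `d` is locally constant this is the period of the nearby fiber, so the projection is
injective on a label set. -/
lemma isLocalHomeomorphOn {U : Set C} (hU : ∀ q ∈ U, ∀ᶠ q' in 𝓝 q, d q' = d q) :
    IsLocalHomeomorphOn π (π ⁻¹' U) := by
  refine (isLocalHomeomorphOn_iff_isOpenEmbedding_restrict _).2 fun s hs => ?_
  obtain ⟨N, hN, hsN, lam, hlam, hT⟩ := h.label (π s)
  obtain ⟨V, hV, hVo, hsV⟩ := _root_.mem_nhds_iff.1 (hU _ hs)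
  have hW : IsOpen (π ⁻¹' V ∩ {t | π t ∈ N ∧ lam t = lam s}) :=
    (hVo.preimage h.continuous).inter (hlam _)
  refine ⟨_, hW.mem_nhds ⟨hsV, hsN, rfl⟩, .of_continuous_injective_isOpenMap
    (h.continuous.comp continuous_subtype_val) ?_ (h.isOpenMap.comp hW.isOpenMap_subtype_val)⟩
  rintro ⟨x, hxV, hxN, hx⟩ ⟨y, hyV, hyN, hy⟩ hxy
  obtain ⟨a, rfl⟩ := h.transitive x y hxy
  have h1 := h.label_zpow hT a hxN
  rw [hy, hx, left_eq_add, ZMod.intCast_zmod_eq_zero_iff_dvd, ← hV hxV] at h1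
  exact Subtype.ext ((h.period x a).2 h1).symm

/-- The Euler characteristic of the components of a cyclic cover. -/
theorem hasEulerCharacteristic_component [T2Space C] [PreconnectedSpace C] [T2Space E]
    [CompactSpace E] [LocallyConnectedSpace E] {n : ℕ} (hn0 : 0 < n)
    (hn : ∀ q, n ∣ d q) (hmk : ∀ (s : E) (a : ℤ),
      ConnectedComponents.mk ((T ^ a) s) = ConnectedComponents.mk s ↔ (n : ℤ) ∣ a) {χ : ℤ}
    (hχ : HasEulerCharacteristic C χ) {B : Finset C} {G : ℕ} (hG : ∀ q ∉ B, d q = G)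
    (κ : ConnectedComponents E) :
    HasEulerCharacteristic {s : E // ConnectedComponents.mk s = κ}
      (χ * (G / n : ℕ) + ∑ b ∈ B, ((d b / n : ℕ) - (G / n : ℕ) : ℤ)) := by
  have hcard : ∀ q, Nat.card ((fun s : {s : E // ConnectedComponents.mk s = κ} => π s) ⁻¹' {q}) =
      d q / n := fun q => by
    rw [← h.card_fiber_component hn0 hn hmk κ q, Nat.mul_div_cancel_left _ hn0]
  have hκ : IsClopen {s : E | ConnectedComponents.mk s = κ} := by
    obtain ⟨t, rfl⟩ := ConnectedComponents.surjective_coe κ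
    have : {s : E | ConnectedComponents.mk s = ConnectedComponents.mk t} = connectedComponent t := by
      ext s
      exact ConnectedComponents.coe_eq_coe'
    rw [this]
    exact ⟨isClosed_connectedComponent, isOpen_connectedComponent⟩
  have : CompactSpace {s : E // ConnectedComponents.mk s = κ} :=
    isCompact_iff_compactSpace.1 hκ.1.isCompact
  have hloc := h.isLocalHomeomorphOn (U := (B : Set C)ᶜ) fun q hq => by
    filter_upwards [B.finite_toSet.isClosed.isOpen_compl.mem_nhds hq] with q' hq'
    rw [hG q hq, hG q' hq']
  -- The restriction of the projection to one component is a ramified cover of degree `G / n`, with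
  -- `d b / n` points over each `b`.
  have := HasEulerCharacteristic.of_ramified (F := {s : E // ConnectedComponents.mk s = κ})
    (ρ := fun s => π s) (B := B) hχ (h.continuous.comp continuous_subtype_val)
    (fun q => Set.Finite.preimage (f := Subtype.val) Subtype.val_injective.injOn (h.finite_fiber q))
    (hloc.comp (hκ.2.isOpenEmbedding_subtypeVal.isLocalHomeomorph.isLocalHomeomorphOn)
      fun s hs => hs)
    (d := G / n) fun q hq => by rw [hcard, hG q hq]
  simpa only [hcard] using this

end IsCyclicCover

variable {X : Type*} [TopologicalSpace X] {P : SmoothingGerm X} {Y : Type*} [TopologicalSpace Y]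
  {M : Modification P Y} {D₁ D₂ C : Set Y} {m : Set Y → ℕ} {k : ℕ}

/-- Each point of the curve has a neighbourhood in which no other point of the curve lies on a third
component. By compactness finitely many such neighbourhoods suffice. -/
lemma finite_doublePoints (hL : ∀ q ∈ C, ∃ (c : AdaptedChart M) (e : _), IsLocalForm c e D₁ D₂ C m k q)
    (hC : IsCompact C) : {q ∈ C | ∃ D ∈ M.thirdComponents D₁ D₂ C, q ∈ D}.Finite := by
  obtain ⟨t, -, ht⟩ := hC.elim_nhds_subcover
    (fun q => {y | y ∈ C → y ≠ q → ∀ D ∈ M.thirdComponents D₁ D₂ C, y ∉ D}) fun q hq => by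
      obtain ⟨c, e, H⟩ := hL q hq
      exact H.eventually_generic
  refine t.finite_toSet.subset fun y ⟨hy, D, hD, hyD⟩ => ?_
  obtain ⟨q, hq, h⟩ := mem_iUnion₂.1 (ht hy)
  by_contra hne
  exact h hy (fun hyq => hne (hyq ▸ hq)) D hD hyD

/-- Every third component passes through a double point, and only one third component passes through
each of them. -/
lemma finite_thirdComponents
    (hL : ∀ q ∈ C, ∃ (c : AdaptedChart M) (e : _), IsLocalForm c e D₁ D₂ C m k q)
    (hC : IsCompact C) : (M.thirdComponents D₁ D₂ C).Finite := by
  refine ((finite_doublePoints hL hC).biUnion (t := fun q => {D ∈ M.thirdComponents D₁ D₂ C | q ∈ D})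
    fun q hq => Set.Subsingleton.finite ?_).subset fun D hD => ?_
  · rintro D ⟨hD, hqD⟩ D' ⟨hD', hqD'⟩
    obtain ⟨c, e, H⟩ := hL q hq.1
    exact H.eq_of_mem hD hD' hqD hqD'
  · obtain ⟨q, hq, hqC⟩ := hD.2.2.2
    exact mem_iUnion₂.2 ⟨q, ⟨hqC, D, hD, hq⟩, hD, hq⟩

end MilnorBoundary


/-! ### The components of the preimage of a compact curve -/

theorem mainTheorem3 {X Y ι : Type*} [TopologicalSpace X] [T2Space X]
    [TopologicalSpace Y] [T2Space Y]
    (P : MilnorBoundary.SmoothingGerm X) (M : MilnorBoundary.AdaptedModification P Y)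
    -- the multiplicities of the pullbacks of `f` and `g`
    (m n : Set Y → ℕ)
    (hm : ∀ D ∈ M.components, M.IsMultiplicity M.pullF D (m D))
    (hn : ∀ D ∈ M.components, M.IsMultiplicity M.pullG D (n D))
    (k : ℕ) (hk : MilnorBoundary.IsAdmissibleExponent M.toModification m n k)
    (𝒰 : MilnorBoundary.AdaptedCover M.toModification ι)
    -- the curve, of genus `g`
    (D₁ D₂ C : Set Y) (hC : M.IsCompactCurve D₁ D₂ C)
    (g : ℕ) (hg : MilnorBoundary.HasEulerCharacteristic C (2 - 2 * g))
    -- loops of generic points of `C` which generate the fundamental group of `C`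
    (p : C) (α : Fin (2 * g) → Path p p)
    (hα : ∀ i t, ∀ D ∈ M.thirdComponents D₁ D₂ C, (α i t : Y) ∉ D)
    (hp : ∀ D ∈ M.thirdComponents D₁ D₂ C, (p : Y) ∉ D)
    (hgen : Subgroup.closure (Set.range fun i =>
      FundamentalGroup.fromPath (Path.Homotopic.Quotient.mk (α i))) = ⊤)
    (δ : Fin (2 * g) → ℤ) (hδ : ∀ i, M.IsSwitch k (α i) (δ i)) :
    -- the third components through points of `C`, and the double points, are finite in number
    ∃ hT : (M.thirdComponents D₁ D₂ C).Finite,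
      (∀ D ∈ hT.toFinset, (D ∩ C).Finite) ∧
      ∃ nC : ℕ, nC = Nat.gcd (Nat.gcd (m D₁) (m D₂))
        (Nat.gcd (hT.toFinset.gcd m) (Finset.univ.gcd fun i => (δ i).natAbs)) ∧
      0 < nC ∧
      -- the preimage is an oriented real analytic surface with `nC` connected components
      MilnorBoundary.IsOrientedAnalyticSurface (M.curvePreimage k C) (M.orientedCharts k 𝒰 C) ∧
      Nat.card (ConnectedComponents (M.curvePreimage k C)) = nC ∧
      -- the components are cyclically ordered, as the branches at generic points of `C` are
      (∃ e : ConnectedComponents (M.curvePreimage k C) ≃ ZMod nC,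
        ∀ s t : M.curvePreimage k C, (∀ D ∈ M.thirdComponents D₁ D₂ C, s.1.pt ∉ D) →
          M.Shift k 1 s t →
            e (ConnectedComponents.mk t) = e (ConnectedComponents.mk s) + 1) ∧
      -- the common Euler characteristic of the components
      ∃ χ : ℤ,
        (∀ κ : ConnectedComponents (M.curvePreimage k C),
          MilnorBoundary.HasEulerCharacteristic
            {s : M.curvePreimage k C // ConnectedComponents.mk s = κ} χ) ∧
        (nC : ℤ) * χ =
          (2 - 2 * (g : ℤ) - ∑ D ∈ hT.toFinset, ((D ∩ C).ncard : ℤ)) * Nat.gcd (m D₁) (m D₂) +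
            ∑ D ∈ hT.toFinset,
              (Nat.gcd (Nat.gcd (m D₁) (m D₂)) (m D) : ℤ) * ((D ∩ C).ncard : ℤ) := by
  open MilnorBoundary in
  classical
  have hCsub : C ⊆ D₁ ∩ D₂ := by
    obtain ⟨-, -, -, p₀, -, h⟩ := hC
    exact h ▸ connectedComponentIn_subset _ _
  have hconf : C ⊆ M.configuration := fun q hq => ⟨D₁, D₂, C, hC, hq⟩
  have hLF : ∀ q ∈ C, ∀ c : AdaptedChart M.toModification, q ∈ c.U →
      ∃ e, IsLocalForm c e D₁ D₂ C m k q := fun q hq c hqc =>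
    exists_isLocalForm hm hn hk hC hq (M.isSNCAt q
      (mem_iUnion₂.2 ⟨D₁, hC.1, mem_iUnion₂.2 ⟨D₂, hC.2.1, hCsub hq⟩⟩)) c hqc
  have hL : ∀ q ∈ C, ∃ (c : AdaptedChart M.toModification) (e : _),
      IsLocalForm c e D₁ D₂ C m k q := fun q hq => by
    obtain ⟨i, hi⟩ := 𝒰.covers q (hconf hq)
    exact ⟨_, hLF q hq _ hi⟩
  have hT := finite_thirdComponents hL hC.2.2.1
  have hDC : ∀ D ∈ hT.toFinset, (D ∩ C).Finite := fun D hD =>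
    (finite_doublePoints hL hC.2.2.1).subset fun q hq => ⟨hq.2, D, hT.mem_toFinset.1 hD, hq.1⟩
  refine ⟨hT, hDC, _, rfl, ?_⟩
  set G := (m D₁).gcd (m D₂) with hG
  set nC := Nat.gcd G (Nat.gcd (hT.toFinset.gcd m) (Finset.univ.gcd fun i => (δ i).natAbs)) with hnC
  obtain ⟨B, hBd, hBφ⟩ := exists_branchSystem hL
  have : CompactSpace C := isCompact_iff_compactSpace.1 hC.2.2.1
  have : PreconnectedSpace C := by
    obtain ⟨-, -, -, p₀, -, h⟩ := hC
    exact Subtype.preconnectedSpace (h ▸ isPreconnected_connectedComponentIn)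
  have hcov := B.isCyclicCover
  have hE : CompactSpace (M.curvePreimage k C) := hcov.compactSpace
  obtain ⟨hsurf, hpath⟩ := isOrientedAnalyticSurface 𝒰 hLF hconf
  have : LocallyPathConnectedSpace (BranchSystem.Space (M.openPart k) C) := hpath
  have : T2Space (BranchSystem.Space (M.openPart k) C) := hsurf.t2Space
  have : CompactSpace (BranchSystem.Space (M.openPart k) C) := hE
  have : Nonempty (BranchSystem.Space (M.openPart k) C) := by
    obtain ⟨s, -⟩ := hcov.surjective p
    exact ⟨s⟩
  have hGpos : 0 < G := by
    obtain ⟨c, e, H⟩ := hL p p.2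
    exact Nat.gcd_pos_of_pos_left _ (H.exp_left ▸ H.exp_pos)
  have hn0 : 0 < nC := Nat.gcd_pos_of_pos_left _ hGpos
  -- The degree of the cyclic cover is `G` off the third components, and `G.gcd (m D)` on `D`. With
  -- these two values `nC` is the greatest common divisor of all degrees and all switches.
  have hdgen : ∀ q, (∀ D ∈ M.thirdComponents D₁ D₂ C, q ∉ D) → B.d q = G := fun q hq => by
    rw [hBd, branchDegree_of_generic hq]
  have hdmem : ∀ q ∈ C, ∀ D ∈ M.thirdComponents D₁ D₂ C, q ∈ D → B.d q = G.gcd (m D) := by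
    intro q hq D hD hqD
    obtain ⟨c, e, H⟩ := hL q hq
    rw [hBd, branchDegree_of_mem H hD hqD]
  have hdvd : ∀ q : C, nC ∣ B.d q := fun q => by
    rw [hBd]
    exact dvd_branchDegree (Nat.gcd_dvd_left _ _) (fun D hD => ((Nat.gcd_dvd_right _ _).trans
      (Nat.gcd_dvd_left _ _)).trans (Finset.gcd_dvd (hT.mem_toFinset.2 hD))) _
  have hmk := hcov.mk_zpow_eq_iff hn0 hdvd (p := p) (α := α) (δ := δ) hgen
    (fun i s hs => by
      obtain ⟨Γ, h0, hΓ, h1⟩ := hδ i s.1 (congrArg Subtype.val hs)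
      refine ⟨⟨fun t => ⟨Γ t, by
        change (Γ t).pt ∈ C
        rw [hΓ t]
        exact (α i t).2⟩, by fun_prop⟩, Subtype.ext h0, fun t => Subtype.ext (hΓ t), ?_⟩
      rw [B.homeo_zpow]
      exact BranchSystem.shift_eq hLF hBd hBφ h1)
    (fun i => Int.natCast_dvd.2 (((Nat.gcd_dvd_right _ _).trans (Nat.gcd_dvd_right _ _)).trans
      (Finset.gcd_dvd (f := fun i => (δ i).natAbs) (Finset.mem_univ i))))
    -- Maximality of `nC`: a common divisor of all degrees divides `G` because the base point is
    -- generic, and divides each `m D` because `D` meets the curve.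
    (fun l hl hlδ => by
      refine Nat.dvd_gcd (hdgen p hp ▸ hl p) (Nat.dvd_gcd (Finset.dvd_gcd fun D hD => ?_)
        (Finset.dvd_gcd fun i _ => Int.natCast_dvd.1 (hlδ i)))
      rw [hT.mem_toFinset] at hD
      obtain ⟨q, hqD, hqC⟩ := hD.2.2.2
      have := hl ⟨q, hqC⟩
      rw [hdmem q hqC D hD hqD] at this
      exact this.trans (Nat.gcd_dvd_right _ _))
  obtain ⟨e, he⟩ := hcov.exists_equiv_zmod hmk
  refine ⟨hn0, hsurf, ?_, ⟨e, fun s t _ hst => ?_⟩, ?_⟩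
  · exact (Nat.card_congr e).trans (Nat.card_zmod _)
  · rw [BranchSystem.shift_eq hLF hBd hBφ hst]
    exact he s
  -- the double points
  let Z : Finset Y := hT.toFinset.attach.biUnion fun D => (hDC D D.2).toFinset
  have hZ : ∀ q, q ∈ Z ↔ ∃ D ∈ M.thirdComponents D₁ D₂ C, q ∈ D ∧ q ∈ C := fun q => by
    simp only [Z, Finset.mem_biUnion, Finset.mem_attach, true_and, Subtype.exists,
      Set.Finite.mem_toFinset, exists_prop, mem_inter_iff]
  refine ⟨_, hcov.hasEulerCharacteristic_component hn0 hdvd hmk hg (B := Z.subtype (· ∈ C)) (G := G)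
    fun q hq => hdgen q fun D hD hqD => hq (by
      rw [Finset.mem_subtype, hZ]
      exact ⟨D, hD, hqD, q.2⟩), ?_⟩
  -- All degrees are multiples of `nC`, so the divisions in the Euler characteristic of a component
  -- are exact and multiplication by `nC` restores the degrees.
  have hnG : nC * (G / nC) = G := Nat.mul_div_cancel' (Nat.gcd_dvd_left _ _)
  have hnd : ∀ q : C, nC * (B.d q / nC) = B.d q := fun q => Nat.mul_div_cancel' (hdvd q)
  have h1 : ∑ b ∈ Z.subtype (· ∈ C), ((nC : ℤ) * ((B.d b / nC : ℕ) - (G / nC : ℕ) : ℤ)) =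
      ∑ b ∈ Z, ((B.d b : ℤ) - G) := by
    rw [← Finset.sum_subtype_of_mem (p := (· ∈ C)) _ fun q hq => ((hZ q).1 hq).elim fun _ h => h.2.2]
    refine Finset.sum_congr rfl fun b _ => ?_
    rw [mul_sub]
    exact_mod_cast congrArg₂ (fun x y : ℕ => (x : ℤ) - y) (hnd b) hnG
  -- The double points are grouped by the third component through them. There is exactly one for
  -- each point, so the groups are disjoint and the degree is constant on each group.
  have h2 : ∑ b ∈ Z, ((B.d b : ℤ) - G) =
      ∑ D ∈ hT.toFinset, ((G.gcd (m D) : ℤ) - G) * ((D ∩ C).ncard : ℤ) := by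
    rw [Finset.sum_biUnion, ← Finset.sum_attach hT.toFinset]
    · refine Finset.sum_congr rfl fun D _ => ?_
      rw [Finset.sum_congr rfl fun b hb => by
        rw [hdmem b ((hDC D D.2).mem_toFinset.1 hb).2 D (hT.mem_toFinset.1 D.2)
          ((hDC D D.2).mem_toFinset.1 hb).1], Finset.sum_const, nsmul_eq_mul, mul_comm,
        Set.ncard_eq_toFinset_card _ (hDC D D.2)]
    · intro D _ D' _ hne
      refine Finset.disjoint_left.2 fun b hb hb' => hne (Subtype.ext ?_)
      rw [Set.Finite.mem_toFinset] at hb hb'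
      obtain ⟨c, e, H⟩ := hL b hb.2
      exact H.eq_of_mem (hT.mem_toFinset.1 D.2) (hT.mem_toFinset.1 D'.2) hb.1 hb'.1
  rw [mul_add, Finset.mul_sum, h1, h2]
  simp only [sub_mul, Finset.sum_sub_distrib, ← Finset.mul_sum]
  have h3 : (nC : ℤ) * (G / nC : ℕ) = G := by exact_mod_cast hnG
  linear_combination (2 - 2 * (g : ℤ)) * h3
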